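/- Let $N>1$ be an integer, and let $b\in\mathbb C$ with $\operatorname{Re} b\neq 0$ be either real or of modulus one (equivalently $c_L=1+6(b+b^{-1})^2>1$). Put $$\varphi_b(x)=\exp\Bigl(\frac14\int_{i0-\infty}^{i0+\infty}\frac{e^{-2ixw}\,dw}{\sinh(wb)\sinh(w/b)\,w}\Bigr),\qquad \bar\varphi_b(x)=\varphi_b(x)^{-1}\quad (x\in\mathbb R),\qquad \zeta=e^{-i\pi(b+b^{-1})^2/12}.$$ On a complex Hilbert space let selfadjoint operators $\mathsf f_j$, $j\in\mathbb Z$, with $\mathsf f_{j+2N}=\mathsf f_j$, satisfy $$[\mathsf f_m,\mathsf f_n]=\begin{cases}(-1)^m(2\pi i)^{-1}, & n\equiv m\pm1 \pmod{2N},\\ 0,&\text{otherwise,}\end{cases}$$ in the integrated (Weyl) sense, that is, there are unitary operators $e^{2\pi i u}$ for all real linear combinations $u=\sum_j u_j\mathsf f_j$ such that $t\mapsto e^{2\pi i tu}$ is strongly continuous and $e^{2\pi i u}e^{2\pi i v}=e^{(2\pi i)^2[u,v]/2}e^{2\pi i(u+v)}$. Let $\mathsf G$ be a bounded invertible operator with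 $\mathsf G\,\mathsf f_j=(-1)^j\,\mathsf f_{j-1}\,\mathsf G$ for all $j$. Functions of selfadjoint operators are taken in the sense of the spectral theorem. Put $$\mathsf g_{j,k}=\sum_{l=j+1}^{k}\mathsf f_l,\qquad \mathsf U_{lc}=\mathsf G\prod_{j=1}^N\varphi_b(\mathsf f_{2j}),\qquad \mathsf W=\prod_{N\ge j>1}\Bigl(\bar\varphi_b(\mathsf f_{2j})\,\varphi_b(\mathsf f_{2j-1})\,\varphi_b(\mathsf g_{2j,2N+1})\Bigr),$$ where products of noncommuting operators are in decreasing order of the index from left to right. Then $\mathsf W$ is invertible, and $\tilde{\mathsf U}_{lc}=\mathsf W^{-1}\mathsf U_{lc}\mathsf W$ satisfies $$\tilde{\mathsf U}_{lc}=(\zeta e^{i\pi/6})^{-N}\Bigl(\prod_{N>k>1}\bar\varphi_b(\mathsf g_{2k-1,2N-1})\Bigr)\bar\varphi_b(\mathsf g_{2,2N-1})\,\varphi_b(\mathsf g_{2N-1,2N+1})\,\bar\varphi_b(\mathsf f_2)\,e^{i\pi\sum_{l=1}^N\mathsf f_{2l}^2}\,\mathsf G,$$ where the product is again in decreasing order from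 left to right, and $$\tilde{\mathsf U}_{lc}^{\,N}=(\zeta e^{i\pi/6})^{1-N^2}\,\varphi_b(\mathsf g_{2,2N+1})\,e^{-i\pi\mathsf f_2^2}\Bigl(e^{i\pi\sum_{l=1}^N\mathsf f_{2l}^2}\,\mathsf G\Bigr)^N.$$ -/

import Mathlib

open Complex MeasureTheory

noncomputable section

namespace Liouville

/-! ### The quantum dilogarithm and the normalisation constant -/

/-- A height `ε > 0` for which the line `ℝ + iε` lies strictly between the origin and all the
other poles `iπnb^{±1}`, `n ≠ 0`, of `1 / (sinh (wb) sinh (w/b) w)` in the upper half plane.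
The line `ℝ + iε` is the contour that runs from `i0 - ∞` to `i0 + ∞`. -/
def contourHeight (b : ℂ) : ℝ := min |b.re| |(b⁻¹).re|

/-- Faddeev's quantum dilogarithm on the real line,
`φ_b(x) = exp (1/4 ∫_{i0-∞}^{i0+∞} e^{-2ixw} / (sinh (wb) sinh (w/b) w) dw)`. -/
def qdilog (b : ℂ) (x : ℝ) : ℂ :=
  exp (1 / 4 * ∫ s : ℝ,
    let w : ℂ := s + I * contourHeight b
    exp (-(2 * I * x * w)) / (sinh (w * b) * sinh (w / b) * w))

/-- `ζ = e^{-iπ(b+b⁻¹)²/12}`. -/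
def zeta (b : ℂ) : ℂ := exp (-(I * Real.pi * (b + b⁻¹) ^ 2 / 12))

/-! ### Functions of a selfadjoint operator

A selfadjoint operator `T` is given by its one-parameter unitary group `U t = e^{2πi t T}`. -/

section FunctionalCalculus

variable {H : Type*} [NormedAddCommGroup H] [InnerProductSpace ℂ H]

/-- `μ` is the spectral measure at the vector `x` of the selfadjoint operator `T` with
`U t = e^{2πi t T}`: the finite measure with `⟨x, e^{2πi t T} x⟩ = ∫ e^{2πi t s} dμ(s)`. -/
def IsSpectralMeasure (U : ℝ → H →L[ℂ] H) (x : H) (μ : Measure ℝ) : Prop :=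
  IsFiniteMeasure μ ∧
    ∀ t : ℝ, inner ℂ x (U t x) = ∫ s : ℝ, exp (2 * Real.pi * I * t * s) ∂μ

/-- The bounded operator `A` is `F(T)`, where `U t = e^{2πi t T}`: for every vector `x`,
`⟨x, F(T) x⟩ = ∫ F dμ_x` with `μ_x` the spectral measure of `T` at `x`. -/
def IsFunctionOf (U : ℝ → H →L[ℂ] H) (F : ℝ → ℂ) (A : H →L[ℂ] H) : Prop :=
  ∀ x : H, ∃ μ : Measure ℝ, IsSpectralMeasure U x μ ∧ inner ℂ x (A x) = ∫ s : ℝ, F s ∂μ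

/-- There is at most one operator `F(T)`. -/
theorem IsFunctionOf.unique {U : ℝ → H →L[ℂ] H} {F : ℝ → ℂ} {A B : H →L[ℂ] H}
    (hA : IsFunctionOf U F A) (hB : IsFunctionOf U F B) : A = B := by
  have key : ∀ x : H, inner ℂ x (A x) = inner ℂ x (B x) := by
    intro x
    obtain ⟨μ, ⟨hμ, hμU⟩, hμF⟩ := hA x
    obtain ⟨ν, ⟨hν, hνU⟩, hνF⟩ := hB x
    have hμν : μ = ν := by
      apply Measure.ext_of_charFun
      funext t
      have h := (hμU (t / (2 * Real.pi))).symm.trans (hνU (t / (2 * Real.pi)))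
      have e : ∀ s : ℝ, 2 * (Real.pi : ℂ) * I * ((t / (2 * Real.pi) : ℝ) : ℂ) * s
          = (t : ℂ) * s * I := by
        intro s
        have hpi : (Real.pi : ℂ) ≠ 0 := by exact_mod_cast Real.pi_ne_zero
        push_cast
        field_simp
      simp only [e] at h
      simpa [charFun_apply_real] using h
    rw [hμF, hνF, hμν]
  have h := (ext_inner_map (A : H →ₗ[ℂ] H) (B : H →ₗ[ℂ] H)).1 (fun x => by
    have := congrArg (starRingEnd ℂ) (key x)
    simpa [inner_conj_symm] using this)
  ext x
  exact LinearMap.congr_fun h x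

open Classical in
/-- The operator `F(T)` of the functional calculus of the selfadjoint operator `T` with
`U t = e^{2πi t T}`. -/
def funCalc (U : ℝ → H →L[ℂ] H) (F : ℝ → ℂ) : H →L[ℂ] H :=
  if h : ∃ A, IsFunctionOf U F A then h.choose else 0

end FunctionalCalculus

/-! ### The algebra of observables -/

/-- The real linear span of the generators `f_j`, `j ∈ ℤ/2N`: the vector `v` stands for the
selfadjoint element `∑_j v_j f_j`. -/
abbrev Lin (N : ℕ) : Type := ZMod (2 * N) → ℝ

/-- The generator `f_j`, `j ∈ ℤ`, which is `2N`-periodic in `j`. -/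
def f (N : ℕ) (j : ℤ) : Lin N := Pi.single (j : ZMod (2 * N)) 1

/-- `g_{j,k} = f_{j+1} + ⋯ + f_k`. -/
def g (N : ℕ) (j k : ℤ) : Lin N := ∑ l ∈ Finset.Ioc j k, f N l

/-- The real number `c` with `[f_m, f_n] = c (2πi)⁻¹`. -/
def comm (N : ℕ) (m n : ZMod (2 * N)) : ℝ :=
  if n = m + 1 ∨ n = m - 1 then (-1) ^ m.val else 0

/-- The real number `c` with `[∑_m u_m f_m, ∑_n v_n f_n] = c (2πi)⁻¹`. -/
def bracket (N : ℕ) (u v : Lin N) : ℝ :=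
  ∑ m ∈ Finset.range (2 * N), ∑ n ∈ Finset.range (2 * N),
    u (m : ZMod (2 * N)) * v (n : ZMod (2 * N)) * comm N m n

/-- A realization of the algebra of observables, and of the operator `G`, in a Hilbert space.
The selfadjoint elements `v = ∑_j v_j f_j` are unbounded, so their linear structure and their
commutation relations are expressed, as usual, through the unitary operators
`weyl v = e^{2πi v}`, which satisfy `e^{2πi u} e^{2πi v} = e^{(2πi)² [u, v] / 2} e^{2πi (u + v)}`,
where `[u, v] = bracket u v / (2πi)`. The element `v` itself is the selfadjoint generator of the
strongly continuous one-parameter unitary group `t ↦ weyl (t v) = e^{2πi t v}`. -/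
structure Realization (N : ℕ) (H : Type*) [NormedAddCommGroup H] [InnerProductSpace ℂ H]
    [CompleteSpace H] where
  /-- `weyl v = e^{2πi v}` -/
  weyl : Lin N → H →L[ℂ] H
  weyl_unitary : ∀ v, weyl v ∈ unitary (H →L[ℂ] H)
  weyl_mul : ∀ u v, weyl u * weyl v = exp (Real.pi * I * bracket N u v) • weyl (u + v)
  weyl_continuous : ∀ (v : Lin N) (x : H), Continuous fun t : ℝ => weyl (t • v) x
  /-- The operator `G`. -/
  G : (H →L[ℂ] H)ˣ
  /-- `G f_j = (-1)^j f_{j-1} G` -/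
  G_mul_weyl : ∀ (j : ℤ) (t : ℝ),
    (G : H →L[ℂ] H) * weyl (t • f N j) = weyl (t • (-1 : ℝ) ^ j • f N (j - 1)) * G

/-- The ordered product `F (n - 1) * ⋯ * F (m + 1) * F m`, with decreasing indices from left to
right. -/
def decProd {A : Type*} [Monoid A] (m n : ℕ) (F : ℕ → A) : A :=
  ((List.Ico m n).reverse.map F).prod

namespace Realization

variable {N : ℕ} {H : Type*} [NormedAddCommGroup H] [InnerProductSpace ℂ H] [CompleteSpace H]

/-- `F(v)` for a selfadjoint element `v = ∑_j v_j f_j`. -/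
def fn (R : Realization N H) (F : ℝ → ℂ) (v : Lin N) : H →L[ℂ] H :=
  funCalc (fun t => R.weyl (t • v)) F

/-- `φ_b(v)` -/
def phi (R : Realization N H) (b : ℂ) (v : Lin N) : H →L[ℂ] H := R.fn (qdilog b) v

/-- `φ̄_b(v)`, where `φ̄_b(x) = (φ_b(x))⁻¹`. -/
def phiBar (R : Realization N H) (b : ℂ) (v : Lin N) : H →L[ℂ] H :=
  R.fn (fun x => (qdilog b x)⁻¹) v

/-- The evolution operator `U_lc = G ∏_{j=1}^N φ_b(f_{2j})`; the factors of the product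
commute. -/
def Ulc (R : Realization N H) (b : ℂ) : H →L[ℂ] H :=
  R.G * decProd 1 (N + 1) fun j => R.phi b (f N (2 * j))

/-- `W = ∏_{N ≥ j > 1} φ̄_b(f_{2j}) φ_b(f_{2j-1}) φ_b(g_{2j,2N+1})`, with decreasing `j` from left
to right. -/
def W (R : Realization N H) (b : ℂ) : H →L[ℂ] H :=
  decProd 2 (N + 1) fun j =>
    R.phiBar b (f N (2 * j)) * R.phi b (f N (2 * j - 1)) * R.phi b (g N (2 * j) (2 * N + 1))

/-- The transformed evolution operator `Ad(W⁻¹) U_lc = W⁻¹ U_lc W`. -/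
def UlcTilde (R : Realization N H) (b : ℂ) : H →L[ℂ] H :=
  Ring.inverse (R.W b) * R.Ulc b * R.W b

/-- `e^{iπ a v²}` for real `a`. -/
def gauss (R : Realization N H) (a : ℝ) (v : Lin N) : H →L[ℂ] H :=
  R.fn (fun x => exp (I * Real.pi * a * x ^ 2)) v

/-- `e^{iπ ∑_{l=1}^N f_{2l}²}`. The operators `f_{2l}` commute with each other, so this is the
product of the commuting operators `e^{iπ f_{2l}²}`. -/
def gaussEven (R : Realization N H) : H →L[ℂ] H :=
  decProd 1 (N + 1) fun l => R.gauss 1 (f N (2 * l))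

end Realization

end Liouville

end

noncomputable section

namespace Liouville

open Filter Topology FourierTransform

set_option linter.unusedSectionVars false
set_option linter.unusedSimpArgs false

/-! ### Bochner's theorem on the line -/

/-! Both formulas follow from a few relations between invertible operators: the pentagon identity
φ(p)φ(q) = φ(q)φ(p+q)φ(p) for [p,q] = (2πi)⁻¹, the inversion relation φ(v)φ(-v) = κ e^{iπv²} with
the scalar κ = (ζe^{iπ/6})⁻¹, the commutation of φ(u) and φ(v) when [u,v] = 0, and the fact that
conjugation by e^{iπp²} or by G acts linearly on the arguments. `DilogSystem` axiomatises these
relations, and the combinatorics takes place in an abstract group.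

Algebra. Conjugation by the factors of W, from j = N down to j = 2, is an induction. The base is
`conj_evolution_top`; the step `conj_conjEvolution_succ` rests on a product of five pentagons,
`conj_relation`, and on one inversion that releases one κ. A final inversion of φ(-f₂) completes κ^N
and the Gaussian. The transformed operator is then κ^N X y with y = e^{iπΣf²}G, and (Xy)^N is the
product of X, yXy⁻¹, ..., y^{N-1}Xy^{1-N}, times y^N. On the partial sums of f_{2l} + f_{2l+1} the
conjugation by y acts as a shift of the index up to a common increment (`evol_chain`), so the
conjugates are explicit (`conjFactor`) and their product telescopes through `partialProd`. The last
step of the telescope returns one κ⁻¹, whence the exponent N² - 1.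

Analysis. What remains is the pentagon for operators. Bochner's theorem supplies spectral measures,
hence a functional calculus for bounded continuous functions. With Q = b + b⁻¹, which is real, φ_b
is holomorphic for |Im z| < Q/2 and satisfies a first order difference equation and the inversion
relation; both are residue computations. The beta integral of φ(x)/φ(x+u) against e^{-2πicx},
divided by its expected value, is ib-periodic in u and bounded, hence constant by Liouville's
theorem; Re u → -∞ shows that the constant is the Fourier transform of φ. A symmetry of the beta
integral shows that this transform is again a dilogarithm up to a Gaussian and a constant. Together
they give `dilogTransform_mul_betaInt`, which is the pentagon written in Weyl operators. As φ_b
itself is not integrable, the argument runs with shifted and damped functions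
(`pentagon_shiftDilog`), and the shift tends to 0 in the strong topology (`pentagon`). -/

lemma integrable_fourier_of_nonneg {k : ℝ → ℂ} (hc : Continuous k) (hk : Integrable k)
    (hpos : ∀ s, ∃ r : ℝ, 0 ≤ r ∧ 𝓕 k s = r) : Integrable (𝓕 k) := by
  have hcont : Continuous (𝓕 k) :=
    VectorFourier.fourierIntegral_continuous Real.continuous_fourierChar
      (L := innerₗ ℝ) continuous_inner hk
  choose r hr0 hr using hpos
  have hbd : ∀ s, ‖𝓕 k s‖ ≤ ∫ t, ‖k t‖ := fun s =>
    VectorFourier.norm_fourierIntegral_le_integral_norm _ _ _ _ _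
  have hg : ∀ c : ℝ, 0 < c → Integrable (fun w : ℝ => cexp (-c⁻¹ * ‖w‖ ^ 2)) := by
    intro c hc
    have := GaussianFourier.integrable_cexp_neg_mul_sq_norm_add (V := ℝ) (b := (c : ℂ)⁻¹)
      (by simpa [← ofReal_inv] using hc) 0 0
    simpa using this
  have hgk : ∀ c : ℝ, 0 < c → Integrable (fun w : ℝ => cexp (-c⁻¹ * ‖w‖ ^ 2) * 𝓕 k w) :=
    fun c hc => (hg c hc).mul_bdd hcont.aestronglyMeasurable (ae_of_all _ hbd)
  -- Moving the Fourier transform onto the Gaussian turns this integral into an average of `k`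
  -- against an approximate identity, so it tends to `k 0`.
  have hlim : Tendsto (fun c : ℝ => ∫ w : ℝ, cexp (-c⁻¹ * ‖w‖ ^ 2) * 𝓕 k w) atTop (𝓝 (k 0)) := by
    have h1 := Real.tendsto_integral_gaussian_smul' hk (v := (0 : ℝ)) hc.continuousAt
    refine h1.congr' ?_
    filter_upwards [Ioi_mem_atTop 0] with c (hc : 0 < c)
    have h2 := VectorFourier.integral_fourierIntegral_smul_eq_flip (L := innerₗ ℝ)
      Real.continuous_fourierChar continuous_inner (hg c hc) hk
    have h3 : (innerₗ ℝ : ℝ →ₗ[ℝ] ℝ →ₗ[ℝ] ℝ).flip = innerₗ ℝ := by ext; simp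
    rw [h3] at h2
    refine Eq.trans ?_ h2
    congr with w
    congr 1
    have h4 := fourier_gaussian_innerProductSpace (V := ℝ) (b := (c : ℂ)⁻¹)
      (by simpa [← ofReal_inv] using hc) w
    have h5 : VectorFourier.fourierIntegral Real.fourierChar volume (innerₗ ℝ)
        (fun w : ℝ => cexp (-((c⁻¹ : ℝ) : ℂ) * ‖w‖ ^ 2)) w
        = 𝓕 (fun v : ℝ => cexp (-(c : ℂ)⁻¹ * ‖v‖ ^ 2)) w := by
      simp only [ofReal_inv]; rfl
    rw [h5, h4]
    simp
    left
    ring_nf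
  have hseq : Tendsto (fun n : ℕ => ∫ w : ℝ, cexp (-(((n + 1 : ℝ)⁻¹ : ℝ) : ℂ) * ‖w‖ ^ 2) * 𝓕 k w)
      atTop (𝓝 (k 0)) := by
    refine (hlim.comp (tendsto_natCast_atTop_atTop.atTop_add
      (tendsto_const_nhds (x := (1 : ℝ))))).congr fun n => ?_
    simp
  refine ⟨hcont.aestronglyMeasurable, ?_⟩
  -- Fatou's lemma. By nonnegativity of the transform the integrals of norms on the right are the
  -- convergent integrals of `hseq`, so the liminf is finite.
  have hF : ∫⁻ w, ‖𝓕 k w‖ₑ ≤ liminf (fun n : ℕ =>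
      ∫⁻ w : ℝ, ‖cexp (-(((n + 1 : ℝ)⁻¹ : ℝ) : ℂ) * ‖w‖ ^ 2) * 𝓕 k w‖ₑ) atTop := by
    refine le_trans (lintegral_mono fun w => ?_) (lintegral_liminf_le fun n => ?_)
    · refine le_of_eq (Tendsto.liminf_eq ?_).symm
      refine (Continuous.tendsto continuous_enorm _).comp ?_
      have : Tendsto (fun n : ℕ => cexp (-(((n + 1 : ℝ)⁻¹ : ℝ) : ℂ) * ‖w‖ ^ 2)) atTop (𝓝 1) := by
        have h0 : Tendsto (fun n : ℕ => (((n : ℝ) + 1)⁻¹ : ℝ)) atTop (𝓝 0) :=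
          tendsto_inv_atTop_zero.comp
            (tendsto_natCast_atTop_atTop.atTop_add (tendsto_const_nhds (x := (1 : ℝ))))
        have h1 : Tendsto (fun n : ℕ => -((((n : ℝ) + 1)⁻¹ : ℝ) : ℂ) * (‖w‖ : ℂ) ^ 2) atTop
            (𝓝 (-((0 : ℝ) : ℂ) * (‖w‖ : ℂ) ^ 2)) :=
          ((continuous_ofReal.tendsto 0).comp h0).neg.mul_const _
        have h2 := (continuous_exp.tendsto _).comp h1
        simpa [Function.comp_def] using h2
      simpa using this.mul_const (𝓕 k w)
    · exact ((Continuous.mul (by fun_prop) hcont).measurable).enorm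
  refine lt_of_le_of_lt hF ?_
  have hval : ∀ n : ℕ, ∫⁻ w : ℝ, ‖cexp (-(((n + 1 : ℝ)⁻¹ : ℝ) : ℂ) * ‖w‖ ^ 2) * 𝓕 k w‖ₑ
      = ENNReal.ofReal (∫ w : ℝ, cexp (-(((n + 1 : ℝ)⁻¹ : ℝ) : ℂ) * ‖w‖ ^ 2) * 𝓕 k w).re := by
    intro n
    have hn : (0 : ℝ) < n + 1 := by positivity
    rw [← ofReal_integral_norm_eq_lintegral_enorm (hgk _ hn)]
    congr 1
    rw [← RCLike.re_eq_complex_re, ← integral_re (hgk _ hn)]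
    congr with w
    have : cexp (-(((n + 1 : ℝ)⁻¹ : ℝ) : ℂ) * ‖w‖ ^ 2) * 𝓕 k w
        = ((Real.exp (-(n + 1 : ℝ)⁻¹ * ‖w‖ ^ 2) * r w : ℝ) : ℂ) := by
      rw [hr]; push_cast; rfl
    rw [this]
    rw [Complex.norm_real, Real.norm_of_nonneg (by have := hr0 w; positivity)]
    rfl
  simp_rw [hval]
  have := (ENNReal.continuous_ofReal.tendsto _).comp ((continuous_re.tendsto _).comp hseq)
  exact (Tendsto.liminf_eq this).trans_lt ENNReal.ofReal_lt_top


/-- Bochner's theorem by regularisation. `F` times a Gaussian is, up to a scaling by 2π, the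
characteristic function of a probability density, by Fourier inversion and F 0 = 1. As the Gaussians
widen these functions converge to the continuous `F`, so the measures are tight, and a limit point
given by Prokhorov's theorem has `F` as its transform. -/
lemma exists_measure_of_fourier_gaussian_nonneg {F : ℝ → ℂ} (hc : Continuous F) (h0 : F 0 = 1)
    (hb : ∀ t, ‖F t‖ ≤ 1)
    (hpos : ∀ a : ℝ, 0 < a → ∀ s, ∃ r : ℝ, 0 ≤ r ∧
      𝓕 (fun t : ℝ => F t * cexp (-a * t ^ 2)) s = r) :
    ∃ μ : Measure ℝ, IsProbabilityMeasure μ ∧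
      ∀ t : ℝ, F t = ∫ s : ℝ, exp (2 * Real.pi * I * t * s) ∂μ := by
  set k : ℕ → ℝ → ℂ := fun n t => F t * cexp (-((n + 1 : ℝ)⁻¹ : ℝ) * t ^ 2) with hk
  have ha : ∀ n : ℕ, (0 : ℝ) < (n + 1 : ℝ)⁻¹ := fun n => by positivity
  have hkc : ∀ n, Continuous (k n) := fun n => by simp only [hk]; fun_prop
  have hki : ∀ n, Integrable (k n) := fun n =>
    (integrable_cexp_neg_mul_sq (b := (((n + 1 : ℝ)⁻¹ : ℝ) : ℂ))
      (by rw [ofReal_re]; exact ha n)).bdd_mul hc.aestronglyMeasurable (ae_of_all _ hb)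
  have hp : ∀ n s, ∃ r : ℝ, 0 ≤ r ∧ 𝓕 (k n) s = r := fun n s => hpos _ (ha n) s
  have hfi : ∀ n, Integrable (𝓕 (k n)) := fun n =>
    integrable_fourier_of_nonneg (hkc n) (hki n) (hp n)
  choose p hp0 hp using hp
  have hpi : ∀ n, Integrable (p n) := fun n => by
    have := (hfi n).re
    refine this.congr (ae_of_all _ fun s => ?_)
    simp [hp]
  have hinv : ∀ n (t : ℝ), ∫ s : ℝ, exp (2 * Real.pi * I * t * s) * p n s = k n t := by
    intro n t
    have h1 := congrFun (Continuous.fourierInv_fourier_eq (hkc n) (hki n) (hfi n)) t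
    rw [Real.fourierInv_eq'] at h1
    rw [← h1]
    congr with s
    rw [hp, smul_eq_mul]
    congr 2
    simp; ring
  -- `charFun` is normalised with e^{its} and `F` with e^{2πits}, hence the division by 2π.
  have hm : ∀ n t, charFun ((volume : Measure ℝ).withDensity fun s => ENNReal.ofReal (p n s)) t
      = k n (t / (2 * Real.pi)) := by
    intro n t
    rw [charFun_apply_real, integral_withDensity_eq_integral_toReal_smul₀
      (hpi n).aestronglyMeasurable.aemeasurable.ennreal_ofReal (by simp), ← hinv]
    congr with s
    rw [ENNReal.toReal_ofReal (hp0 n s), real_smul, mul_comm]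
    congr 2
    push_cast
    field_simp
  have hprob : ∀ n, IsProbabilityMeasure
      ((volume : Measure ℝ).withDensity fun s => ENNReal.ofReal (p n s)) := by
    intro n
    have hfin : IsFiniteMeasure
        ((volume : Measure ℝ).withDensity fun s => ENNReal.ofReal (p n s)) :=
      isFiniteMeasure_withDensity_ofReal (hpi n).2
    have h1 := hm n 0
    rw [charFun_zero] at h1
    constructor
    have h2 : (1 : ℝ) = ((volume : Measure ℝ).withDensity
        fun s => ENNReal.ofReal (p n s)).real Set.univ := by
      simpa [hk, h0] using congrArg Complex.re h1.symm
    rw [measureReal_def] at h2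
    rw [← ENNReal.ofReal_toReal (measure_ne_top _ Set.univ), ← h2]
    simp
  have hlim : ∀ t : ℝ, Tendsto (fun n : ℕ => charFun
      ((volume : Measure ℝ).withDensity fun s => ENNReal.ofReal (p n s)) t) atTop
      (𝓝 (F (t / (2 * Real.pi)))) := by
    intro t
    simp_rw [hm, hk]
    have h0 : Tendsto (fun n : ℕ => (((n : ℝ) + 1)⁻¹ : ℝ)) atTop (𝓝 0) :=
      tendsto_inv_atTop_zero.comp
        (tendsto_natCast_atTop_atTop.atTop_add (tendsto_const_nhds (x := (1 : ℝ))))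
    have h1 : Continuous fun a : ℝ => F (t / (2 * Real.pi)) *
        cexp (-(a : ℂ) * ((t / (2 * Real.pi) : ℝ) : ℂ) ^ 2) := by fun_prop
    have h2 := (h1.tendsto 0).comp h0
    simpa [Function.comp_def] using h2
  let ν : ℕ → ProbabilityMeasure ℝ := fun n => ⟨_, hprob n⟩
  have htight := isTightMeasureSet_of_tendsto_charFun
    (μ := fun n => (volume : Measure ℝ).withDensity fun s => ENNReal.ofReal (p n s))
    (f := fun t => F (t / (2 * Real.pi))) (by fun_prop) hlim
  have hcpt : IsCompact (closure (Set.range ν)) := by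
    apply isCompact_closure_of_isTightMeasureSet
    have hS : {m : Measure ℝ | ∃ μ ∈ Set.range ν, (μ : Measure ℝ) = m} = Set.range
        fun n => (volume : Measure ℝ).withDensity fun s => ENNReal.ofReal (p n s) := by
      refine Set.ext fun m => ⟨?_, ?_⟩
      · rintro ⟨_, ⟨n, rfl⟩, rfl⟩
        exact ⟨n, rfl⟩
      · rintro ⟨n, rfl⟩
        exact ⟨_, ⟨n, rfl⟩, rfl⟩
    exact hS ▸ htight
  obtain ⟨μ, -, φ, hφ, hμ⟩ := hcpt.tendsto_subseq (x := ν)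
    (fun n => subset_closure (Set.mem_range_self n))
  refine ⟨μ, inferInstance, fun t => ?_⟩
  have h1 := ProbabilityMeasure.tendsto_iff_tendsto_charFun.1 hμ (2 * Real.pi * t)
  have h2 := (hlim (2 * Real.pi * t)).comp hφ.tendsto_atTop
  have h3 := tendsto_nhds_unique h1 h2
  rw [mul_div_cancel_left₀ _ (by positivity)] at h3
  rw [← h3, charFun_apply_real]
  congr with s
  push_cast
  congr 1
  ring

/-! ### Spectral measures of one-parameter unitary groups -/

section

variable {H : Type*} [NormedAddCommGroup H] [InnerProductSpace ℂ H] [CompleteSpace H]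

/-- `U` is a strongly continuous one-parameter group of unitary operators. -/
structure IsUnitaryGroup (U : ℝ → H →L[ℂ] H) : Prop where
  zero_eq_one : U 0 = 1
  add_eq_mul : ∀ s t, U (s + t) = U s * U t
  mem_unitary : ∀ t, U t ∈ unitary (H →L[ℂ] H)
  continuous : ∀ x, Continuous fun t => U t x

namespace IsUnitaryGroup

variable {U : ℝ → H →L[ℂ] H}

lemma norm_apply (hU : IsUnitaryGroup U) (t : ℝ) (x : H) : ‖U t x‖ = ‖x‖ :=
  ContinuousLinearMap.norm_map_of_mem_unitary (hU.mem_unitary t) x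

lemma inner_apply_apply (hU : IsUnitaryGroup U) (s t : ℝ) (x y : H) :
    inner ℂ (U s x) (U t y) = inner ℂ x (U (t - s) y) := by
  have h : U t y = U s (U (t - s) y) := by
    rw [← mul_apply_eq_comp, ← hU.add_eq_mul]; congr 2; ring
  rw [h]
  exact ContinuousLinearMap.inner_map_map_of_mem_unitary (hU.mem_unitary s) _ _

/-- The value is a positive multiple of a squared norm. For v = ∫ e^{-2at² - 2πits} U_t x dt, expand
⟨v, v⟩ in t and the time difference w: the identity 2t² + 2(t+w)² = 4(t + w/2)² + w² splits off a
Gaussian integral in t and leaves the Fourier transform in w. -/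
lemma fourier_gaussian_nonneg (hU : IsUnitaryGroup U) (x : H) {a : ℝ} (ha : 0 < a) (s : ℝ) :
    ∃ r : ℝ, 0 ≤ r ∧ 𝓕 (fun t : ℝ => inner ℂ x (U t x) * cexp (-a * t ^ 2)) s = r := by
  set F : ℝ → H := fun t => cexp (-(2 * a : ℝ) * t ^ 2 + ((-2 * Real.pi * t * s : ℝ)) * I) • U t x
  have hFc : Continuous F := by
    have := hU.continuous x
    simp only [F]; fun_prop
  have hnorm : ∀ t : ℝ, ‖F t‖ = Real.exp (-(2 * a) * t ^ 2) * ‖x‖ := by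
    intro t
    simp only [F]
    rw [norm_smul, hU.norm_apply, Complex.norm_exp]
    congr 2
    simp [← ofReal_pow]
  have hg : ∀ c : ℝ, 0 < c → Integrable fun t : ℝ => Real.exp (-c * t ^ 2) :=
    fun c hc => integrable_exp_neg_mul_sq hc
  have hFi : Integrable F := by
    refine ((hg (2 * a) (by positivity)).mul_const ‖x‖).mono' hFc.aestronglyMeasurable ?_
    exact ae_of_all _ fun t => (hnorm t).le
  set C : ℝ := ∫ r : ℝ, Real.exp (-(4 * a) * r ^ 2)
  have hC : 0 < C := by
    simp only [C]; rw [integral_gaussian]; positivity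
  set v : H := ∫ t, F t
  have e1 : inner ℂ v v = ∫ t, ∫ w, inner ℂ (F t) (F (w + t)) := by
    have h1 : inner ℂ v v = ∫ t, inner ℂ v (F t) := (integral_inner hFi v).symm
    have h2 : (starRingEnd ℂ) (inner ℂ v v) = ∫ t, inner ℂ (F t) v := by
      rw [h1, ← integral_conj]; simp
    rw [inner_conj_symm] at h2
    rw [h2]
    congr with t
    rw [← integral_inner hFi (F t)]
    exact (integral_add_right_eq_self (fun w => inner ℂ (F t) (F w)) t).symm
  have e2 : ∀ t w : ℝ, inner ℂ (F t) (F (w + t)) =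
      (cexp ((-2 * Real.pi * w * s : ℝ) * I) * inner ℂ x (U w x)) *
        (Real.exp (-a * w ^ 2) * Real.exp (-(4 * a) * (t + w / 2) ^ 2) : ℝ) := by
    intro t w
    simp only [F]
    have hcj : (starRingEnd ℂ) (-↑(2 * a) * (t : ℂ) ^ 2 + ↑(-2 * Real.pi * t * s) * I)
        = -↑(2 * a) * (t : ℂ) ^ 2 - ↑(-2 * Real.pi * t * s) * I := by
      rw [map_add, map_mul, map_mul, map_neg, map_pow, conj_I, conj_ofReal, conj_ofReal,
        conj_ofReal]
      ring
    rw [inner_smul_left, inner_smul_right, hU.inner_apply_apply, ← exp_conj, hcj]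
    rw [show w + t - t = w by ring]
    push_cast
    rw [← mul_assoc, ← Complex.exp_add, ← Complex.exp_add,
      mul_right_comm (cexp (-2 * Real.pi * w * s * I)), ← Complex.exp_add]
    congr 2
    ring
  have hint : Integrable (Function.uncurry fun t w : ℝ => inner ℂ (F t) (F (w + t))) := by
    have hd : Integrable (fun z : ℝ × ℝ => Real.exp (-(a / 2) * z.1 ^ 2) *
        Real.exp (-(a / 2) * z.2 ^ 2)) := (hg _ (by positivity)).mul_prod (hg _ (by positivity))
    refine (hd.mul_const (‖x‖ * ‖x‖)).mono' ?_ ?_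
    · exact Continuous.aestronglyMeasurable (by fun_prop)
    · refine ae_of_all _ fun z => ?_
      simp only [Function.uncurry_def]
      refine (norm_inner_le_norm _ _).trans ?_
      rw [hnorm, hnorm, mul_mul_mul_comm, ← Real.exp_add, ← Real.exp_add]
      refine mul_le_mul_of_nonneg_right (Real.exp_le_exp.2 ?_) (by positivity)
      -- The difference 2t² + 2(t+w)² - (t² + w²)/2 equals (7t + 4w)²/14 plus a positive multiple of
      -- w².
      nlinarith [mul_nonneg ha.le (sq_nonneg (7 * z.1 + 4 * z.2)),
        mul_nonneg ha.le (sq_nonneg z.2)]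
  have e3 : inner ℂ v v =
      (C : ℂ) * 𝓕 (fun t : ℝ => inner ℂ x (U t x) * cexp (-a * t ^ 2)) s := by
    rw [e1, integral_integral_swap hint, Real.fourier_eq', ← integral_const_mul]
    congr with w
    simp_rw [e2]
    rw [integral_const_mul]
    have h5 : ∫ t : ℝ, ((Real.exp (-a * w ^ 2) * Real.exp (-(4 * a) * (t + w / 2) ^ 2) : ℝ) : ℂ)
        = (Real.exp (-a * w ^ 2) * C : ℝ) := by
      rw [integral_complex_ofReal, integral_const_mul,
        integral_add_right_eq_self (fun t => Real.exp (-(4 * a) * t ^ 2))]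
    rw [h5]
    simp
    ring_nf
  refine ⟨C⁻¹ * ‖v‖ ^ 2, by positivity, ?_⟩
  rw [inner_self_eq_norm_sq_to_K] at e3
  push_cast
  have hC' : (C : ℂ) ≠ 0 := by exact_mod_cast hC.ne'
  rw [inv_mul_eq_div, eq_div_iff hC', mul_comm _ (C : ℂ)]
  exact e3.symm

theorem exists_isSpectralMeasure (hU : IsUnitaryGroup U) (x : H) :
    ∃ μ : Measure ℝ, IsSpectralMeasure U x μ := by
  by_cases hx : x = 0
  · exact ⟨0, inferInstance, fun t => by simp [hx]⟩
  have hn : (0 : ℝ) < ‖x‖ := norm_pos_iff.2 hx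
  -- The measure produced by Bochner's theorem has mass 1, so `x` is normalised and the measure is
  -- scaled back by ‖x‖².
  set y : H := ((‖x‖⁻¹ : ℝ) : ℂ) • x
  have hy : ‖y‖ = 1 := by
    simp only [y]
    rw [norm_smul]
    simp [hn.ne']
  obtain ⟨μ, hμ, h⟩ := exists_measure_of_fourier_gaussian_nonneg
    (F := fun t => inner ℂ y (U t y)) (continuous_const.inner (hU.continuous y))
    (by simp [hU.zero_eq_one, inner_self_eq_norm_sq_to_K, hy])
    (fun t => (norm_inner_le_norm _ _).trans (by rw [hU.norm_apply, hy, mul_one]))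
    (fun a ha s => hU.fourier_gaussian_nonneg y ha s)
  refine ⟨ENNReal.ofReal (‖x‖ ^ 2) • μ, ?_, fun t => ?_⟩
  · exact Measure.smul_finite μ ENNReal.ofReal_ne_top
  · rw [integral_smul_measure, ← h]
    simp only [y, map_smul, inner_smul_left, inner_smul_right, conj_ofReal]
    rw [ENNReal.toReal_ofReal (by positivity), real_smul]
    push_cast
    have : (‖x‖ : ℂ) ≠ 0 := by exact_mod_cast hn.ne'
    field_simp

end IsUnitaryGroup

end


/-! ### Bounded continuous functions as limits of trigonometric polynomials -/

/-- The character `s ↦ e^{2πi t s}`. -/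
def character (t : ℝ) (s : ℝ) : ℂ := exp (2 * Real.pi * I * t * s)

lemma norm_character (t s : ℝ) : ‖character t s‖ = 1 := by
  rw [character, show 2 * (Real.pi : ℂ) * I * t * s = ((2 * Real.pi * t * s : ℝ) : ℂ) * I by
    push_cast; ring, norm_exp_ofReal_mul_I]

lemma continuous_character (t : ℝ) : Continuous (character t) := by
  unfold character; fun_prop

lemma character_mul (s t : ℝ) : character s * character t = character (s + t) := by
  ext x
  simp only [character, Pi.mul_apply, ← Complex.exp_add]
  congr 1; push_cast; ring

/-- `F` is a bounded continuous function. -/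
def IsBddCont (F : ℝ → ℂ) : Prop := Continuous F ∧ ∃ C, ∀ x, ‖F x‖ ≤ C

namespace IsBddCont

variable {F G : ℝ → ℂ}

lemma of_character (t : ℝ) : IsBddCont (character t) :=
  ⟨continuous_character t, 1, fun s => (norm_character t s).le⟩

lemma mul (hF : IsBddCont F) (hG : IsBddCont G) : IsBddCont (F * G) := by
  obtain ⟨hFc, C, hC⟩ := hF
  obtain ⟨hGc, D, hD⟩ := hG
  refine ⟨hFc.mul hGc, C * D, fun x => ?_⟩
  rw [Pi.mul_apply, norm_mul]
  exact mul_le_mul (hC x) (hD x) (norm_nonneg _) ((norm_nonneg _).trans (hC x))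

lemma add (hF : IsBddCont F) (hG : IsBddCont G) : IsBddCont (F + G) := by
  obtain ⟨hFc, C, hC⟩ := hF
  obtain ⟨hGc, D, hD⟩ := hG
  exact ⟨hFc.add hGc, C + D, fun x => (norm_add_le _ _).trans (add_le_add (hC x) (hD x))⟩

lemma const_smul (c : ℂ) (hF : IsBddCont F) : IsBddCont (c • F) := by
  obtain ⟨hFc, C, hC⟩ := hF
  refine ⟨hFc.const_smul c, ‖c‖ * C, fun x => ?_⟩
  rw [Pi.smul_apply, norm_smul]
  exact mul_le_mul_of_nonneg_left (hC x) (norm_nonneg _)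

lemma sub (hF : IsBddCont F) (hG : IsBddCont G) : IsBddCont (F - G) := by
  rw [sub_eq_add_neg, ← neg_one_smul ℂ G]
  exact hF.add (hG.const_smul _)

lemma const (c : ℂ) : IsBddCont fun _ => c := ⟨continuous_const, ‖c‖, fun _ => le_rfl⟩

lemma zero : IsBddCont 0 := const 0

lemma conj (hF : IsBddCont F) : IsBddCont fun x => (starRingEnd ℂ) (F x) := by
  obtain ⟨hFc, C, hC⟩ := hF
  exact ⟨continuous_conj.comp hFc, C, fun x => by rw [RCLike.norm_conj]; exact hC x⟩

lemma comp (hF : IsBddCont F) {u : ℝ → ℝ} (hu : Continuous u) : IsBddCont fun x => F (u x) := by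
  obtain ⟨hFc, C, hC⟩ := hF
  exact ⟨hFc.comp hu, C, fun x => hC _⟩

lemma integrable (hF : IsBddCont F) (μ : Measure ℝ) [IsFiniteMeasure μ] : Integrable F μ := by
  obtain ⟨hFc, C, hC⟩ := hF
  exact Integrable.of_bound hFc.aestronglyMeasurable C (ae_of_all _ hC)

lemma of_mem_span (h : F ∈ Submodule.span ℂ (Set.range character)) : IsBddCont F := by
  induction h using Submodule.span_induction with
  | mem x hx => obtain ⟨t, rfl⟩ := hx; exact of_character t
  | zero => exact zero
  | add x y _ _ hx hy => exact hx.add hy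
  | smul a x _ hx => exact hx.const_smul a

end IsBddCont

/-- A cut-off equal to 1 on [-n, n] and to 0 at ±(n + 1) makes `F` extend continuously to a circle
of circumference 2(n + 1), where trigonometric polynomials are uniformly dense. -/
lemma exists_trig_near {F : ℝ → ℂ} (hF : Continuous F) {C : ℝ} (hC : ∀ x, ‖F x‖ ≤ C) (n : ℕ) :
    ∃ P ∈ Submodule.span ℂ (Set.range character), (∀ s, ‖P s‖ ≤ C + 1) ∧
      ∀ s : ℝ, |s| ≤ n → ‖P s - F s‖ ≤ (n + 1 : ℝ)⁻¹ := by
  set T : ℝ := 2 * (n + 1) with hT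
  have hTpos : Fact (0 < T) := ⟨by positivity⟩
  set G : ℝ → ℂ := fun s => ((max 0 (min 1 (n + 1 - |s|)) : ℝ) : ℂ) * F s with hG
  have hGc : Continuous G := by simp only [hG]; fun_prop
  have hGb : ∀ s, ‖G s‖ ≤ C := by
    intro s
    simp only [hG, norm_mul, Complex.norm_real]
    rw [Real.norm_of_nonneg (le_max_left _ _)]
    calc _ ≤ 1 * ‖F s‖ := by
          gcongr; exact max_le zero_le_one (min_le_left _ _)
      _ ≤ C := by rw [one_mul]; exact hC s
  have hends : G (-(n + 1)) = G (-(n + 1) + T) := by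
    have h1 : |(-((n : ℝ) + 1))| = n + 1 := by rw [abs_neg, abs_of_pos (by positivity)]
    have h2 : |(-((n : ℝ) + 1)) + T| = n + 1 := by
      rw [hT, show -((n : ℝ) + 1) + 2 * (n + 1) = n + 1 by ring, abs_of_pos (by positivity)]
    simp only [hG]
    rw [h1, h2, sub_self, min_eq_right zero_le_one, max_self]
    simp
  have hLc := AddCircle.liftIco_continuous (p := T) hends hGc.continuousOn
  let L : C(AddCircle T, ℂ) := ⟨_, hLc⟩
  have hL : ∀ s : ℝ, s ∈ Set.Ico (-((n : ℝ) + 1)) (-(n + 1) + T) → L (s : AddCircle T) = G s :=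
    fun s hs => AddCircle.liftIco_coe_apply (f := G) hs
  have hLb : ∀ z, ‖L z‖ ≤ C := by
    intro z
    obtain ⟨s, hs, rfl⟩ : ∃ s ∈ Set.Ico (-((n : ℝ) + 1)) (-(n + 1) + T),
        (s : AddCircle T) = z := by
      exact ⟨_, (AddCircle.equivIco T (-((n : ℝ) + 1)) z).2,
        (AddCircle.equivIco T (-((n : ℝ) + 1))).symm_apply_apply z⟩
    rw [hL s hs]; exact hGb s
  have hmem : L ∈ (Submodule.span ℂ (Set.range (@fourier T))).topologicalClosure := by
    rw [span_fourier_closure_eq_top]; trivial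
  have hmem' : L ∈ closure (Submodule.span ℂ (Set.range (@fourier T)) : Set C(AddCircle T, ℂ)) :=
    hmem
  obtain ⟨p, hp, hpL⟩ := Metric.mem_closure_iff.1 hmem' ((n + 1 : ℝ)⁻¹) (by positivity)
  have hle1 : (n + 1 : ℝ)⁻¹ ≤ 1 := inv_le_one_of_one_le₀ (by linarith [n.cast_nonneg (α := ℝ)])
  have hpt : ∀ z, ‖p z - L z‖ ≤ (n + 1 : ℝ)⁻¹ := fun z => by
    rw [← dist_eq_norm, dist_comm]
    exact (ContinuousMap.dist_apply_le_dist z).trans hpL.le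
  refine ⟨fun s => p (s : AddCircle T), ?_, fun s => ?_, fun s hs => ?_⟩
  · clear hpL hpt
    induction hp using Submodule.span_induction with
    | mem x hx =>
      obtain ⟨k, rfl⟩ := hx
      refine Submodule.subset_span ⟨k / T, ?_⟩
      ext s
      rw [fourier_coe_apply, character]
      congr 1
      push_cast; ring
    | zero => exact Submodule.zero_mem _
    | add x y _ _ hx hy => exact Submodule.add_mem _ hx hy
    | smul a x _ hx => exact Submodule.smul_mem _ a hx
  · calc ‖p s‖ = ‖(p s - L s) + L s‖ := by rw [sub_add_cancel]
      _ ≤ ‖p s - L s‖ + ‖L s‖ := norm_add_le _ _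
      _ ≤ C + 1 := by linarith [hpt s, hLb s]
  · have h1 : s ∈ Set.Ico (-((n : ℝ) + 1)) (-(n + 1) + T) := by
      rw [abs_le] at hs
      constructor <;> linarith [hs.1, hs.2]
    have h2 : L (s : AddCircle T) = F s := by
      rw [hL s h1]
      change ((max 0 (min 1 (n + 1 - |s|)) : ℝ) : ℂ) * F s = F s
      rw [min_eq_left (by linarith), max_eq_right zero_le_one]
      simp
    rw [← h2]
    exact hpt s

/-- Pointwise convergence with a common bound is all that dominated convergence against finite
spectral measures requires. -/
lemma IsBddCont.exists_trig {F : ℝ → ℂ} (hF : IsBddCont F) :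
    ∃ (P : ℕ → ℝ → ℂ) (C : ℝ), (∀ n, P n ∈ Submodule.span ℂ (Set.range character)) ∧
      (∀ n s, ‖P n s‖ ≤ C) ∧ ∀ s, Tendsto (fun n => P n s) atTop (𝓝 (F s)) := by
  obtain ⟨hc, C, hC⟩ := hF
  choose P hP hPb hPF using fun n => exists_trig_near hc hC n
  refine ⟨P, C + 1, hP, hPb, fun s => ?_⟩
  rw [tendsto_iff_norm_sub_tendsto_zero]
  have h0 : Tendsto (fun n : ℕ => (((n : ℝ) + 1)⁻¹ : ℝ)) atTop (𝓝 0) :=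
    tendsto_inv_atTop_zero.comp
      (tendsto_natCast_atTop_atTop.atTop_add (tendsto_const_nhds (x := (1 : ℝ))))
  refine squeeze_zero' (Eventually.of_forall fun n => norm_nonneg _) ?_ h0
  filter_upwards [eventually_ge_atTop ⌈|s|⌉₊] with n hn
  exact hPF n s ((Nat.le_ceil _).trans (by exact_mod_cast hn))

/-! ### The functional calculus of a unitary group -/

section

variable {H : Type*} [NormedAddCommGroup H] [InnerProductSpace ℂ H] [CompleteSpace H]
  {U : ℝ → H →L[ℂ] H}

lemma IsSpectralMeasure.unique {x : H} {μ ν : Measure ℝ} (hμ : IsSpectralMeasure U x μ)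
    (hν : IsSpectralMeasure U x ν) : μ = ν := by
  obtain ⟨_, hμ⟩ := hμ
  obtain ⟨_, hν⟩ := hν
  apply Measure.ext_of_charFun
  funext t
  have h := (hμ (t / (2 * Real.pi))).symm.trans (hν (t / (2 * Real.pi)))
  have e : ∀ s : ℝ, 2 * (Real.pi : ℂ) * I * ((t / (2 * Real.pi) : ℝ) : ℂ) * s
      = (t : ℂ) * s * I := by
    intro s
    have hpi : (Real.pi : ℂ) ≠ 0 := by exact_mod_cast Real.pi_ne_zero
    push_cast
    field_simp
  simp only [e] at h
  simpa [charFun_apply_real] using h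

lemma IsSpectralMeasure.integral_one {x : H} {μ : Measure ℝ} (hμ : IsSpectralMeasure U x μ)
    (hU : IsUnitaryGroup U) : μ.real Set.univ = ‖x‖ ^ 2 := by
  have h := hμ.2 0
  simp [hU.zero_eq_one, inner_self_eq_norm_sq_to_K] at h
  exact_mod_cast h.symm

lemma IsFunctionOf.inner_eq {F : ℝ → ℂ} {A : H →L[ℂ] H} (h : IsFunctionOf U F A) {x : H}
    {μ : Measure ℝ} (hμ : IsSpectralMeasure U x μ) : inner ℂ x (A x) = ∫ s, F s ∂μ := by
  obtain ⟨ν, hν, e⟩ := h x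
  rw [hμ.unique hν, e]

lemma IsFunctionOf.funCalc_eq {F : ℝ → ℂ} {A : H →L[ℂ] H} (h : IsFunctionOf U F A) :
    funCalc U F = A := by
  have hex : ∃ A, IsFunctionOf U F A := ⟨A, h⟩
  rw [funCalc, dif_pos hex]
  exact hex.choose_spec.unique h

lemma IsFunctionOf.add {F G : ℝ → ℂ} {A B : H →L[ℂ] H} (hF : IsBddCont F) (hG : IsBddCont G)
    (hA : IsFunctionOf U F A) (hB : IsFunctionOf U G B) : IsFunctionOf U (F + G) (A + B) := by
  intro x
  obtain ⟨μ, hμ, e⟩ := hA x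
  have := hμ.1
  refine ⟨μ, hμ, ?_⟩
  simp only [Pi.add_apply]
  rw [integral_add (hF.integrable μ) (hG.integrable μ), ← e, ← hB.inner_eq hμ]
  simp [inner_add_right]

lemma IsFunctionOf.const_smul {F : ℝ → ℂ} {A : H →L[ℂ] H} (c : ℂ) (hA : IsFunctionOf U F A) :
    IsFunctionOf U (c • F) (c • A) := by
  intro x
  obtain ⟨μ, hμ, e⟩ := hA x
  refine ⟨μ, hμ, ?_⟩
  simp only [Pi.smul_apply]
  rw [integral_smul, ← e]
  simp [inner_smul_right]

lemma IsFunctionOf.sub {F G : ℝ → ℂ} {A B : H →L[ℂ] H} (hF : IsBddCont F) (hG : IsBddCont G)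
    (hA : IsFunctionOf U F A) (hB : IsFunctionOf U G B) : IsFunctionOf U (F - G) (A - B) := by
  rw [sub_eq_add_neg, sub_eq_add_neg, ← neg_one_smul ℂ G, ← neg_one_smul ℂ B]
  exact hA.add hF (hG.const_smul _) (hB.const_smul _)

lemma IsFunctionOf.conj {F : ℝ → ℂ} {A : H →L[ℂ] H} (hA : IsFunctionOf U F A) :
    IsFunctionOf U (fun s => (starRingEnd ℂ) (F s)) (ContinuousLinearMap.adjoint A) := by
  intro x
  obtain ⟨μ, hμ, e⟩ := hA x
  refine ⟨μ, hμ, ?_⟩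
  rw [integral_conj, ← e, ContinuousLinearMap.adjoint_inner_right, inner_conj_symm]

lemma IsUnitaryGroup.isFunctionOf_character (hU : IsUnitaryGroup U) (t : ℝ) :
    IsFunctionOf U (character t) (U t) := fun x => by
  obtain ⟨μ, hμ⟩ := hU.exists_isSpectralMeasure x
  exact ⟨μ, hμ, hμ.2 t⟩

/-- The trigonometric polynomials together with their values at a selfadjoint operator. -/
def trigPairs (U : ℝ → H →L[ℂ] H) : Submodule ℂ ((ℝ → ℂ) × (H →L[ℂ] H)) :=
  Submodule.span ℂ (Set.range fun t => (character t, U t))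

lemma trigPairs.isBddCont {p : (ℝ → ℂ) × (H →L[ℂ] H)} (hp : p ∈ trigPairs U) :
    IsBddCont p.1 := by
  induction hp using Submodule.span_induction with
  | mem x hx => obtain ⟨t, rfl⟩ := hx; exact .of_character t
  | zero => exact .zero
  | add x y _ _ hx hy => exact hx.add hy
  | smul a x _ hx => exact hx.const_smul a

lemma trigPairs.isFunctionOf (hU : IsUnitaryGroup U) {p : (ℝ → ℂ) × (H →L[ℂ] H)}
    (hp : p ∈ trigPairs U) : IsFunctionOf U p.1 p.2 := by
  induction hp using Submodule.span_induction with
  | mem x hx => obtain ⟨t, rfl⟩ := hx; exact hU.isFunctionOf_character t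
  | zero =>
    intro x
    obtain ⟨μ, hμ⟩ := hU.exists_isSpectralMeasure x
    exact ⟨μ, hμ, by simp⟩
  | add x y hx' hy' hx hy => exact hx.add (isBddCont hx') (isBddCont hy') hy
  | smul a x _ hx => exact hx.const_smul a

lemma trigPairs.mul_mem (hU : IsUnitaryGroup U) {p q : (ℝ → ℂ) × (H →L[ℂ] H)}
    (hp : p ∈ trigPairs U) (hq : q ∈ trigPairs U) : p * q ∈ trigPairs U := by
  induction hp using Submodule.span_induction with
  | mem x hx =>
    obtain ⟨t, rfl⟩ := hx
    induction hq using Submodule.span_induction with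
    | mem y hy =>
      obtain ⟨s, rfl⟩ := hy
      refine Submodule.subset_span ⟨t + s, ?_⟩
      simp only [Prod.mk_mul_mk, character_mul, hU.add_eq_mul]
    | zero => rw [mul_zero]; exact Submodule.zero_mem _
    | add x y _ _ hx hy => rw [mul_add]; exact Submodule.add_mem _ hx hy
    | smul a x _ hx => rw [mul_smul_comm]; exact Submodule.smul_mem _ a hx
  | zero => rw [zero_mul]; exact Submodule.zero_mem _
  | add x y _ _ hx hy => rw [add_mul]; exact Submodule.add_mem _ hx hy
  | smul a x _ hx => rw [smul_mul_assoc]; exact Submodule.smul_mem _ a hx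

lemma trigPairs.exists_of_mem_span {P : ℝ → ℂ}
    (hP : P ∈ Submodule.span ℂ (Set.range character)) : ∃ A, (P, A) ∈ trigPairs U := by
  induction hP using Submodule.span_induction with
  | mem x hx => obtain ⟨t, rfl⟩ := hx; exact ⟨U t, Submodule.subset_span ⟨t, rfl⟩⟩
  | zero => exact ⟨0, Submodule.zero_mem _⟩
  | add x y _ _ hx hy =>
    obtain ⟨A, hA⟩ := hx
    obtain ⟨B, hB⟩ := hy
    exact ⟨A + B, Submodule.add_mem _ hA hB⟩
  | smul a x _ hx =>
    obtain ⟨A, hA⟩ := hx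
    exact ⟨a • A, Submodule.smul_mem _ a hA⟩

lemma IsUnitaryGroup.adjoint_eq (hU : IsUnitaryGroup U) (t : ℝ) :
    ContinuousLinearMap.adjoint (U t) = U (-t) := by
  have h1 : star (U t) * U t = 1 := Unitary.star_mul_self_of_mem (hU.mem_unitary t)
  have h2 : U t * U (-t) = 1 := by rw [← hU.add_eq_mul, add_neg_cancel, hU.zero_eq_one]
  exact left_inv_eq_right_inv h1 h2

lemma trigPairs.conj_mem (hU : IsUnitaryGroup U) {p : (ℝ → ℂ) × (H →L[ℂ] H)}
    (hp : p ∈ trigPairs U) : ((fun s => (starRingEnd ℂ) (p.1 s)),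
      ContinuousLinearMap.adjoint p.2) ∈ trigPairs U := by
  induction hp using Submodule.span_induction with
  | mem x hx =>
    obtain ⟨t, rfl⟩ := hx
    refine Submodule.subset_span ⟨-t, ?_⟩
    simp only [hU.adjoint_eq]
    congr 1
    ext s
    rw [character, character, ← exp_conj, map_mul, map_mul, map_mul, map_mul, conj_I, conj_ofReal,
      conj_ofReal, conj_ofReal, map_ofNat]
    congr 1; push_cast; ring
  | zero =>
    have h : ((fun _ => 0, 0) : (ℝ → ℂ) × (H →L[ℂ] H)) ∈ trigPairs U := (trigPairs U).zero_mem
    simpa using h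
  | add x y _ _ hx hy =>
    have := Submodule.add_mem _ hx hy
    simpa [Pi.add_def] using this
  | smul a x _ hx =>
    have h := Submodule.smul_mem _ ((starRingEnd ℂ) a) hx
    have h2 : ContinuousLinearMap.adjoint (a • x.2)
        = (starRingEnd ℂ) a • ContinuousLinearMap.adjoint x.2 := map_smulₛₗ _ _ _
    simpa [Pi.smul_def, h2] using h

/-- Follows from ‖p(T)x‖² = ⟨x, (p̄p)(T)x⟩. This isometry turns bounded pointwise convergence of
functions into strong convergence of operators. -/
lemma trigPairs.norm_sq (hU : IsUnitaryGroup U) {p : (ℝ → ℂ) × (H →L[ℂ] H)}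
    (hp : p ∈ trigPairs U) {x : H} {μ : Measure ℝ} (hμ : IsSpectralMeasure U x μ) :
    ‖p.2 x‖ ^ 2 = ∫ s, ‖p.1 s‖ ^ 2 ∂μ := by
  have h1 := (isFunctionOf hU (mul_mem hU (conj_mem hU hp) hp)).inner_eq hμ
  simp only [Prod.mul_def, Pi.mul_apply, mul_apply_eq_comp,
    ContinuousLinearMap.adjoint_inner_right, conj_mul', inner_self_eq_norm_sq_to_K] at h1
  have h2 : ∫ s, ((‖p.1 s‖ : ℂ)) ^ 2 ∂μ = ((∫ s, ‖p.1 s‖ ^ 2 ∂μ : ℝ) : ℂ) := by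
    rw [← integral_complex_ofReal]; simp
  rw [h2] at h1
  exact Complex.ofReal_injective (by rw [ofReal_pow]; exact h1)

lemma tendsto_integral_norm_sq {F : ℕ → ℝ → ℂ} (hF : ∀ n, Continuous (F n)) {C : ℝ}
    (hC : ∀ n s, ‖F n s‖ ≤ C) (h0 : ∀ s, Tendsto (fun n => F n s) atTop (𝓝 0))
    (μ : Measure ℝ) [IsFiniteMeasure μ] :
    Tendsto (fun n => ∫ s, ‖F n s‖ ^ 2 ∂μ) atTop (𝓝 0) := by
  rw [← integral_zero ℝ ℝ (μ := μ)]
  refine tendsto_integral_of_dominated_convergence (fun _ => C ^ 2)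
    (fun n => ((hF n).norm.pow 2).aestronglyMeasurable) (integrable_const _) ?_ ?_
  · intro n
    refine ae_of_all _ fun s => ?_
    rw [Real.norm_of_nonneg (by positivity)]
    exact pow_le_pow_left₀ (norm_nonneg _) (hC n s) 2
  · refine ae_of_all _ fun s => ?_
    simpa using ((h0 s).norm.pow 2)

/-- Dominated convergence in L²(μ_x) and the isometry `trigPairs.norm_sq` make `A n x` a Cauchy
sequence for each `x`; the uniform boundedness principle makes the limit a bounded operator. -/
lemma IsUnitaryGroup.exists_tendsto (hU : IsUnitaryGroup U) {F : ℝ → ℂ} (hF : IsBddCont F)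
    {P : ℕ → ℝ → ℂ} {A : ℕ → H →L[ℂ] H} {C : ℝ} (hp : ∀ n, (P n, A n) ∈ trigPairs U)
    (hC : ∀ n s, ‖P n s‖ ≤ C) (hlim : ∀ s, Tendsto (fun n => P n s) atTop (𝓝 (F s))) :
    ∃ B : H →L[ℂ] H, IsFunctionOf U F B ∧ ∀ x, Tendsto (fun n => A n x) atTop (𝓝 (B x)) := by
  have hcauchy : ∀ x, CauchySeq fun n => A n x := by
    intro x
    obtain ⟨μ, hμ⟩ := hU.exists_isSpectralMeasure x
    have := hμ.1
    have hd : ∀ m n, ‖A m x - A n x‖ ^ 2 = ∫ s, ‖P m s - P n s‖ ^ 2 ∂μ := fun m n =>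
      trigPairs.norm_sq hU (Submodule.sub_mem _ (hp m) (hp n)) hμ
    have hFC : ∀ s, ‖F s‖ ≤ C := fun s => le_of_tendsto (hlim s).norm
      (Eventually.of_forall fun n => hC n s)
    have hPc : ∀ n, IsBddCont (P n) := fun n => trigPairs.isBddCont (hp n)
    have hb : ∀ n, Integrable (fun s => ‖P n s - F s‖ ^ 2) μ := fun n => by
      refine Integrable.of_bound (((hPc n).1.sub hF.1).norm.pow 2).aestronglyMeasurable
        ((C + C) ^ 2) (ae_of_all _ fun s => ?_)
      rw [Real.norm_of_nonneg (by positivity)]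
      exact pow_le_pow_left₀ (norm_nonneg _) ((norm_sub_le _ _).trans
        (add_le_add (hC n s) (hFC s))) 2
    have hz : Tendsto (fun n => ∫ s, ‖P n s - F s‖ ^ 2 ∂μ) atTop (𝓝 0) := by
      refine tendsto_integral_norm_sq (fun n => (hPc n).1.sub hF.1) (C := C + C)
        (fun n s => (norm_sub_le _ _).trans (add_le_add (hC n s) (hFC s))) (fun s => ?_) μ
      simpa using (hlim s).sub_const (F s)
    have hle : ∀ m n, ‖A m x - A n x‖ ^ 2 ≤
        2 * (∫ s, ‖P m s - F s‖ ^ 2 ∂μ) + 2 * ∫ s, ‖P n s - F s‖ ^ 2 ∂μ := by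
      intro m n
      rw [hd, ← integral_const_mul, ← integral_const_mul,
        ← integral_add ((hb m).const_mul 2) ((hb n).const_mul 2)]
      refine integral_mono_of_nonneg (ae_of_all _ fun s => by positivity)
        (((hb m).const_mul 2).add ((hb n).const_mul 2)) (ae_of_all _ fun s => ?_)
      have h1 : ‖P m s - P n s‖ ≤ ‖P m s - F s‖ + ‖P n s - F s‖ := by
        rw [show P m s - P n s = (P m s - F s) - (P n s - F s) by ring]
        exact norm_sub_le _ _
      have h2 := pow_le_pow_left₀ (norm_nonneg _) h1 2
      have h3 := sq_nonneg (‖P m s - F s‖ - ‖P n s - F s‖)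
      simp only
      nlinarith
    rw [Metric.cauchySeq_iff]
    intro ε hε
    have := (hz.eventually (gt_mem_nhds (show (0 : ℝ) < ε ^ 2 / 4 by positivity)))
    obtain ⟨N, hN⟩ := eventually_atTop.1 this
    refine ⟨N, fun m hm n hn => ?_⟩
    rw [dist_eq_norm]
    refine lt_of_pow_lt_pow_left₀ 2 hε.le ?_
    linarith [hle m n, hN m hm, hN n hn]
  choose f hf using fun x => cauchySeq_tendsto_of_complete (hcauchy x)
  refine ⟨continuousLinearMapOfTendsto A (tendsto_pi_nhds.2 hf), ?_, hf⟩
  intro x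
  obtain ⟨μ, hμ⟩ := hU.exists_isSpectralMeasure x
  have := hμ.1
  refine ⟨μ, hμ, ?_⟩
  have h1 : Tendsto (fun n => inner ℂ x (A n x)) atTop (𝓝 (inner ℂ x (f x))) :=
    tendsto_const_nhds.inner (hf x)
  have h2 : Tendsto (fun n => ∫ s, P n s ∂μ) atTop (𝓝 (∫ s, F s ∂μ)) :=
    tendsto_integral_of_dominated_convergence (fun _ => C)
      (fun n => (trigPairs.isBddCont (hp n)).1.aestronglyMeasurable) (integrable_const _)
      (fun n => ae_of_all _ (hC n)) (ae_of_all _ hlim)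
  have h3 : ∀ n, inner ℂ x (A n x) = ∫ s, P n s ∂μ := fun n =>
    (trigPairs.isFunctionOf hU (hp n)).inner_eq hμ
  simp_rw [h3] at h1
  exact tendsto_nhds_unique h1 h2

namespace IsUnitaryGroup

/-- In particular the default value 0 of `funCalc` plays no role for bounded continuous functions.
-/
theorem isFunctionOf_funCalc (hU : IsUnitaryGroup U) {F : ℝ → ℂ} (hF : IsBddCont F) :
    IsFunctionOf U F (funCalc U F) := by
  obtain ⟨P, C, hP, hC, hlim⟩ := hF.exists_trig
  choose A hA using fun n => trigPairs.exists_of_mem_span (U := U) (hP n)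
  obtain ⟨B, hB, -⟩ := hU.exists_tendsto hF hA hC hlim
  rwa [hB.funCalc_eq]

lemma funCalc_character (hU : IsUnitaryGroup U) (t : ℝ) : funCalc U (character t) = U t :=
  (hU.isFunctionOf_character t).funCalc_eq

/-- On trigonometric polynomials multiplicativity is the group law. The passage to strong limits of
products needs a uniform bound on the left factors, `hAC`, which the isometry provides. -/
theorem funCalc_mul (hU : IsUnitaryGroup U) {F G : ℝ → ℂ} (hF : IsBddCont F)
    (hG : IsBddCont G) : funCalc U (F * G) = funCalc U F * funCalc U G := by
  obtain ⟨P, C, hP, hC, hPlim⟩ := hF.exists_trig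
  obtain ⟨Q, D, hQ, hD, hQlim⟩ := hG.exists_trig
  choose A hA using fun n => trigPairs.exists_of_mem_span (U := U) (hP n)
  choose B hB using fun n => trigPairs.exists_of_mem_span (U := U) (hQ n)
  obtain ⟨A', hA', hAlim⟩ := hU.exists_tendsto hF hA hC hPlim
  obtain ⟨B', hB', hBlim⟩ := hU.exists_tendsto hG hB hD hQlim
  have hPQ : ∀ n s, ‖(P n * Q n) s‖ ≤ C * D := fun n s => by
    rw [Pi.mul_apply, norm_mul]
    exact mul_le_mul (hC n s) (hD n s) (norm_nonneg _) ((norm_nonneg _).trans (hC n s))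
  obtain ⟨E, hE, hElim⟩ := hU.exists_tendsto (hF.mul hG) (A := fun n => A n * B n)
    (P := fun n => P n * Q n)
    (fun n => trigPairs.mul_mem hU (hA n) (hB n)) hPQ (fun s => (hPlim s).mul (hQlim s))
  rw [hA'.funCalc_eq, hB'.funCalc_eq, hE.funCalc_eq]
  ext x
  refine tendsto_nhds_unique (hElim x) ?_
  have hAC : ∀ n y, ‖A n y‖ ≤ C * ‖y‖ := by
    intro n y
    obtain ⟨μ, hμ⟩ := hU.exists_isSpectralMeasure y
    have := hμ.1
    have hC0 : 0 ≤ C := (norm_nonneg _).trans (hC 0 0)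
    refine le_of_sq_le_sq ?_ (by positivity)
    rw [trigPairs.norm_sq hU (hA n) hμ, mul_pow, ← hμ.integral_one hU]
    calc ∫ s, ‖P n s‖ ^ 2 ∂μ ≤ ∫ _, C ^ 2 ∂μ := by
          refine integral_mono_of_nonneg (ae_of_all _ fun s => by positivity)
            (integrable_const _) (ae_of_all _ fun s => ?_)
          exact pow_le_pow_left₀ (norm_nonneg _) (hC n s) 2
      _ = C ^ 2 * μ.real Set.univ := by simp [mul_comm]
  have h1 : Tendsto (fun n => A n (B n x) - A n (B' x)) atTop (𝓝 0) := by
    rw [tendsto_zero_iff_norm_tendsto_zero]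
    have h2 : Tendsto (fun n => C * ‖B n x - B' x‖) atTop (𝓝 0) := by
      simpa using (tendsto_iff_norm_sub_tendsto_zero.1 (hBlim x)).const_mul C
    refine squeeze_zero (fun n => norm_nonneg _) (fun n => ?_) h2
    rw [← map_sub]
    exact hAC n _
  simpa using h1.add (hAlim (B' x))

lemma funCalc_sub (hU : IsUnitaryGroup U) {F G : ℝ → ℂ} (hF : IsBddCont F)
    (hG : IsBddCont G) : funCalc U (F - G) = funCalc U F - funCalc U G :=
  ((hU.isFunctionOf_funCalc hF).sub hF hG (hU.isFunctionOf_funCalc hG)).funCalc_eq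

lemma funCalc_smul (hU : IsUnitaryGroup U) {F : ℝ → ℂ} (c : ℂ) (hF : IsBddCont F) :
    funCalc U (c • F) = c • funCalc U F :=
  ((hU.isFunctionOf_funCalc hF).const_smul c).funCalc_eq

lemma norm_funCalc_sq (hU : IsUnitaryGroup U) {F : ℝ → ℂ} (hF : IsBddCont F) {x : H}
    {μ : Measure ℝ} (hμ : IsSpectralMeasure U x μ) :
    ‖funCalc U F x‖ ^ 2 = ∫ s, ‖F s‖ ^ 2 ∂μ := by
  have h1 := (hU.isFunctionOf_funCalc (hF.conj.mul hF)).inner_eq hμ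
  rw [hU.funCalc_mul hF.conj hF, (hU.isFunctionOf_funCalc hF).conj.funCalc_eq] at h1
  simp only [Pi.mul_apply, mul_apply_eq_comp,
    ContinuousLinearMap.adjoint_inner_right, conj_mul', inner_self_eq_norm_sq_to_K] at h1
  have h2 : ∫ s, ((‖F s‖ : ℂ)) ^ 2 ∂μ = ((∫ s, ‖F s‖ ^ 2 ∂μ : ℝ) : ℂ) := by
    rw [← integral_complex_ofReal]; simp
  rw [h2] at h1
  exact Complex.ofReal_injective (by rw [ofReal_pow]; exact h1)

lemma norm_funCalc_apply_le (hU : IsUnitaryGroup U) {F : ℝ → ℂ} (hF : Continuous F) {C : ℝ}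
    (hC : ∀ s, ‖F s‖ ≤ C) (x : H) : ‖funCalc U F x‖ ≤ C * ‖x‖ := by
  obtain ⟨μ, hμ⟩ := hU.exists_isSpectralMeasure x
  have := hμ.1
  have hC0 : 0 ≤ C := (norm_nonneg _).trans (hC 0)
  refine le_of_sq_le_sq ?_ (by positivity)
  rw [hU.norm_funCalc_sq ⟨hF, C, hC⟩ hμ, mul_pow, ← hμ.integral_one hU]
  calc ∫ s, ‖F s‖ ^ 2 ∂μ ≤ ∫ _, C ^ 2 ∂μ := by
        refine integral_mono_of_nonneg (ae_of_all _ fun s => by positivity)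
          (integrable_const _) (ae_of_all _ fun s => ?_)
        exact pow_le_pow_left₀ (norm_nonneg _) (hC s) 2
    _ = C ^ 2 * μ.real Set.univ := by simp [mul_comm]

/-- Bounded convergence in L²(μ_x). It serves to remove the regularisation from the pentagon
identity. -/
theorem tendsto_funCalc (hU : IsUnitaryGroup U) {F : ℝ → ℂ} {P : ℕ → ℝ → ℂ} (hF : Continuous F)
    (hP : ∀ n, Continuous (P n)) {C : ℝ} (hC : ∀ n s, ‖P n s‖ ≤ C)
    (hlim : ∀ s, Tendsto (fun n => P n s) atTop (𝓝 (F s))) (x : H) :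
    Tendsto (fun n => funCalc U (P n) x) atTop (𝓝 (funCalc U F x)) := by
  have hFC : ∀ s, ‖F s‖ ≤ C := fun s => le_of_tendsto (hlim s).norm
    (Eventually.of_forall fun n => hC n s)
  obtain ⟨μ, hμ⟩ := hU.exists_isSpectralMeasure x
  have := hμ.1
  have h1 : Tendsto (fun n => ∫ s, ‖(P n - F) s‖ ^ 2 ∂μ) atTop (𝓝 0) :=
    tendsto_integral_norm_sq (fun n => (hP n).sub hF) (C := C + C)
      (fun n s => (norm_sub_le _ _).trans (add_le_add (hC n s) (hFC s)))
      (fun s => by simpa using (hlim s).sub_const (F s)) μ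
  have hF' : IsBddCont F := ⟨hF, C, hFC⟩
  have hP' : ∀ n, IsBddCont (P n) := fun n => ⟨hP n, C, hC n⟩
  have h2 : Tendsto (fun n => ‖funCalc U (P n) x - funCalc U F x‖ ^ 2) atTop (𝓝 0) := by
    refine h1.congr fun n => ?_
    rw [← hU.norm_funCalc_sq ((hP' n).sub hF') hμ, hU.funCalc_sub (hP' n) hF']
    rfl
  rw [tendsto_iff_norm_sub_tendsto_zero]
  simpa using h2.sqrt

/-- An operator that intertwines two unitary groups intertwines the functions of their
generators. -/
theorem intertwine (hU : IsUnitaryGroup U) {V : ℝ → H →L[ℂ] H} (hV : IsUnitaryGroup V)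
    {X : H →L[ℂ] H} (hX : ∀ t, X * U t = V t * X) {F : ℝ → ℂ} (hF : IsBddCont F) :
    X * funCalc U F = funCalc V F * X := by
  -- On characters the claim is the hypothesis `hX`; linearity and bounded pointwise limits do the
  -- rest.
  have key : ∀ P ∈ Submodule.span ℂ (Set.range character),
      X * funCalc U P = funCalc V P * X := by
    intro P hP
    induction hP using Submodule.span_induction with
    | mem x hx =>
      obtain ⟨t, rfl⟩ := hx
      rw [hU.funCalc_character, hV.funCalc_character, hX]
    | zero =>
      have h := hU.funCalc_smul 0 .zero
      have h' := hV.funCalc_smul 0 .zero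
      rw [zero_smul, zero_smul] at h h'
      rw [h, h', mul_zero, zero_mul]
    | add x y hx' hy' hx hy =>
      have h1 := IsBddCont.of_mem_span hx'
      have h2 := IsBddCont.of_mem_span hy'
      rw [((hU.isFunctionOf_funCalc h1).add h1 h2 (hU.isFunctionOf_funCalc h2)).funCalc_eq,
        ((hV.isFunctionOf_funCalc h1).add h1 h2 (hV.isFunctionOf_funCalc h2)).funCalc_eq,
        mul_add, add_mul, hx, hy]
    | smul a x hx' hx =>
      have h1 := IsBddCont.of_mem_span hx'
      rw [hU.funCalc_smul a h1, hV.funCalc_smul a h1, mul_smul_comm, smul_mul_assoc, hx]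
  obtain ⟨P, C, hP, hC, hlim⟩ := hF.exists_trig
  have hPc : ∀ n, Continuous (P n) := fun n => (IsBddCont.of_mem_span (hP n)).1
  ext x
  refine tendsto_nhds_unique (f := fun n => X (funCalc U (P n) x)) (l := atTop) ?_ ?_
  · exact (X.continuous.tendsto _).comp (hU.tendsto_funCalc hF.1 hPc hC hlim x)
  · have h := hV.tendsto_funCalc hF.1 hPc hC hlim (X x)
    refine h.congr fun n => ?_
    exact (congrArg (fun T : H →L[ℂ] H => T x) (key _ (hP n))).symm

/-- Rescaling and shifting of the generator. -/
lemma funCalc_affine (hU : IsUnitaryGroup U) {F : ℝ → ℂ} (hF : IsBddCont F) (c a : ℝ) :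
    funCalc (fun t => character t a • U (t * c)) F = funCalc U fun s => F (c * s + a) := by
  refine IsFunctionOf.funCalc_eq fun x => ?_
  obtain ⟨μ, hμ, e⟩ := hU.isFunctionOf_funCalc
    (hF.comp (show Continuous fun s => c * s + a by fun_prop)) x
  have := hμ.1
  have hm : Measurable fun s : ℝ => c * s + a := by fun_prop
  refine ⟨μ.map fun s => c * s + a, ⟨inferInstance, fun t => ?_⟩, ?_⟩
  · rw [integral_map hm.aemeasurable (Continuous.aestronglyMeasurable (by fun_prop))]
    simp only [smul_apply, inner_smul_right]
    rw [hμ.2, ← integral_const_mul]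
    congr with s
    rw [character, ← Complex.exp_add]
    congr 1; push_cast; ring
  · rw [integral_map hm.aemeasurable hF.1.aestronglyMeasurable]
    exact e

/-- A function with integrable Fourier transform is a superposition of characters. -/
lemma funCalc_apply_eq_integral (hU : IsUnitaryGroup U) {F k : ℝ → ℂ} (hk : Integrable k)
    (hF : ∀ s, F s = ∫ t, k t * character t s) (x : H) :
    funCalc U F x = ∫ t, k t • U t x := by
  have hint : ∀ x, Integrable fun t => k t • U t x := fun x => by
    refine (hk.norm.mul_const ‖x‖).mono' (hk.1.smul (hU.continuous x).aestronglyMeasurable)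
      (ae_of_all _ fun t => ?_)
    rw [norm_smul, hU.norm_apply]
  let A : H →L[ℂ] H := LinearMap.mkContinuous
    { toFun := fun x => ∫ t, k t • U t x
      map_add' := fun x y => by
        simp only [_root_.map_add, smul_add]
        exact integral_add (hint x) (hint y)
      map_smul' := fun c x => by
        simp only [map_smul, RingHom.id_apply]
        rw [← integral_smul]
        congr with t
        rw [smul_comm] } (∫ t, ‖k t‖) (fun x => by
      refine (norm_integral_le_integral_norm _).trans (le_of_eq ?_)
      rw [← integral_mul_const]
      congr with t
      rw [norm_smul, hU.norm_apply])
  -- Fubini's theorem for the spectral measure against the superposition of characters.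
  have hA : IsFunctionOf U F A := by
    intro y
    obtain ⟨μ, hμ⟩ := hU.exists_isSpectralMeasure y
    have := hμ.1
    refine ⟨μ, hμ, ?_⟩
    change inner ℂ y (∫ t, k t • U t y) = _
    rw [← integral_inner (hint y)]
    simp only [inner_smul_right, hF]
    rw [integral_integral_swap]
    · congr with t
      rw [integral_const_mul, hμ.2]
      rfl
    · have h1 : Integrable (fun z : ℝ × ℝ => k z.2) (μ.prod volume) := hk.comp_snd μ
      refine h1.mul_bdd (c := 1) ?_ (ae_of_all _ fun z => (norm_character z.2 z.1).le)
      refine Continuous.aestronglyMeasurable ?_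
      unfold character
      fun_prop
  rw [hA.funCalc_eq]
  rfl

end IsUnitaryGroup

end


/-! ### Contour integrals over horizontal lines -/

lemma integrable_exp_neg_mul_abs {δ : ℝ} (hδ : 0 < δ) :
    Integrable fun x : ℝ => Real.exp (-δ * |x|) := by
  rw [← integrableOn_univ, ← Set.Iic_union_Ioi (a := (0 : ℝ))]
  refine IntegrableOn.union ?_ ?_
  · refine (integrableOn_exp_mul_Iic hδ 0).congr_fun (fun x hx => ?_) measurableSet_Iic
    simp only [abs_of_nonpos (Set.mem_Iic.1 hx)]; ring_nf
  · refine (integrableOn_exp_mul_Ioi (neg_lt_zero.2 hδ) 0).congr_fun (fun x hx => ?_)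
      measurableSet_Ioi
    simp only [abs_of_pos (Set.mem_Ioi.1 hx)]

lemma tendsto_exp_neg_mul_abs {δ : ℝ} (hδ : 0 < δ) (C : ℝ) :
    Tendsto (fun x : ℝ => C * Real.exp (-δ * |x|)) (cocompact ℝ) (𝓝 0) := by
  have h1 : Tendsto (fun x : ℝ => δ * |x|) (cocompact ℝ) atTop :=
    (tendsto_norm_cocompact_atTop (E := ℝ)).const_mul_atTop hδ
  have h2 := (Real.tendsto_exp_neg_atTop_nhds_zero.comp h1).const_mul C
  simpa [Function.comp_def] using h2

/-- Horizontal contours may be moved through a strip in which the integrand is holomorphic. -/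
theorem integral_horizontal_eq {f : ℂ → ℂ} {a d : ℝ} (had : a ≤ d)
    (hc : ContinuousOn f {w | w.im ∈ Set.Icc a d})
    (hd : ∀ w : ℂ, w.im ∈ Set.Ioo a d → DifferentiableAt ℂ f w)
    {g : ℝ → ℝ} (hg : Tendsto g (cocompact ℝ) (𝓝 0))
    (hb : ∀ᶠ x : ℝ in cocompact ℝ, ∀ y ∈ Set.Icc a d, ‖f (x + y * I)‖ ≤ g x)
    (ha : Integrable fun x : ℝ => f (x + a * I)) (hd' : Integrable fun x : ℝ => f (x + d * I)) :
    ∫ x : ℝ, f (x + a * I) = ∫ x : ℝ, f (x + d * I) := by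
  -- Cauchy's theorem on a rectangle; the bound `g` makes the vertical sides vanish in the limit.
  have hrect : ∀ R : ℝ, (∫ x : ℝ in -R..R, f (x + a * I)) - (∫ x : ℝ in -R..R, f (x + d * I)) +
      I • (∫ y : ℝ in a..d, f (R + y * I)) - I • (∫ y : ℝ in a..d, f ((-R : ℝ) + y * I)) = 0 := by
    intro R
    have h := integral_boundary_rect_eq_zero_of_continuousOn_of_differentiableOn f
      (((-R : ℝ) : ℂ) + a * I) ((R : ℂ) + d * I) ?_ ?_
    · simpa using h
    · refine hc.mono fun w hw => ?_
      have := hw.2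
      simpa [Set.uIcc_of_le had] using this
    · intro w hw
      have := hw.2
      refine (hd w ?_).differentiableWithinAt
      simpa [min_eq_left had, max_eq_right had] using this
  have hbt := hb.filter_mono atTop_le_cocompact
  have hbb := hb.filter_mono atBot_le_cocompact
  have hgt := hg.mono_left atTop_le_cocompact
  have hgb := hg.mono_left atBot_le_cocompact
  have hv : ∀ (l : Filter ℝ) (r : ℝ → ℝ), Tendsto (fun R => g (r R)) l (𝓝 0) →
      (∀ᶠ R in l, ∀ y ∈ Set.Icc a d, ‖f (r R + y * I)‖ ≤ g (r R)) →
      Tendsto (fun R => ∫ y : ℝ in a..d, f (r R + y * I)) l (𝓝 0) := by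
    intro l r h0 h1
    rw [tendsto_zero_iff_norm_tendsto_zero]
    refine squeeze_zero' (Eventually.of_forall fun _ => norm_nonneg _)
      (g := fun R => g (r R) * |d - a|) ?_ (by simpa using h0.mul_const |d - a|)
    filter_upwards [h1] with R hR
    refine intervalIntegral.norm_integral_le_of_norm_le_const fun y hy => ?_
    rw [Set.uIoc_of_le had] at hy
    exact hR y ⟨hy.1.le, hy.2⟩
  have h1 := hv atTop (fun R => R) hgt hbt
  have h2 := hv atTop (fun R => -R) (hgb.comp tendsto_neg_atTop_atBot)
    (tendsto_neg_atTop_atBot.eventually hbb)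
  have h3 := intervalIntegral_tendsto_integral ha tendsto_neg_atTop_atBot tendsto_id
  have h4 := intervalIntegral_tendsto_integral hd' tendsto_neg_atTop_atBot tendsto_id
  have h5 := ((h3.sub h4).add (h1.const_smul I)).sub (h2.const_smul I)
  simp only [id_eq, hrect] at h5
  have h6 := tendsto_nhds_unique tendsto_const_nhds h5
  simp only [smul_zero, add_zero, sub_zero] at h6
  exact sub_eq_zero.1 h6.symm

lemma normSq_sinh (w : ℂ) :
    ‖sinh w‖ ^ 2 = Real.sinh w.re ^ 2 + Real.sin w.im ^ 2 := by
  have h : sinh w = ((Real.sinh w.re * Real.cos w.im : ℝ) : ℂ) +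
      ((Real.cosh w.re * Real.sin w.im : ℝ) : ℂ) * I := by
    conv_lhs => rw [← re_add_im w, sinh_add, sinh_mul_I, cosh_mul_I]
    push_cast; ring
  rw [h, Complex.sq_norm, normSq_add_mul_I]
  have h1 := Real.cosh_sq w.re
  have h2 := Real.sin_sq_add_cos_sq w.im
  rw [mul_pow, mul_pow, h1]
  linear_combination (Real.sinh w.re ^ 2) * h2

lemma mul_cosh_le_norm_sinh {c : ℝ} {w : ℂ} (hc0 : 0 ≤ c) (hc1 : c ≤ 1)
    (hc : c ≤ |Real.sin w.im|) : c * Real.cosh w.re ≤ ‖sinh w‖ := by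
  refine le_of_sq_le_sq ?_ (norm_nonneg _)
  rw [normSq_sinh, mul_pow, Real.cosh_sq]
  have h1 : c ^ 2 ≤ Real.sin w.im ^ 2 := by rw [← sq_abs (Real.sin _)]; gcongr
  have h2 : c ^ 2 ≤ 1 := pow_le_one₀ hc0 hc1
  nlinarith [sq_nonneg (Real.sinh w.re)]

lemma abs_sinh_le_norm_sinh (w : ℂ) : |Real.sinh w.re| ≤ ‖sinh w‖ := by
  refine le_of_sq_le_sq ?_ (norm_nonneg _)
  rw [normSq_sinh, sq_abs]
  linarith [sq_nonneg (Real.sin w.im)]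

lemma exp_abs_le_two_mul_cosh (x : ℝ) : Real.exp |x| ≤ 2 * Real.cosh x := by
  rw [Real.cosh_eq]; linarith [Real.exp_abs_le x]

/-- The antiderivative arctan ∘ sinh tends to ±π/2. -/
lemma integral_inv_cosh : ∫ x : ℝ, (Real.cosh x)⁻¹ = Real.pi := by
  have hi : Integrable fun x : ℝ => (Real.cosh x)⁻¹ := by
    refine ((integrable_exp_neg_mul_abs one_pos).const_mul 2).mono'
      (Continuous.aestronglyMeasurable (by
        exact Real.continuous_cosh.inv₀ fun x => (Real.cosh_pos x).ne')) (ae_of_all _ fun x => ?_)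
    rw [norm_inv, Real.norm_of_nonneg (Real.cosh_pos x).le, neg_one_mul, Real.exp_neg]
    have h := exp_abs_le_two_mul_cosh x
    have h2 := Real.exp_pos |x|
    rw [inv_le_comm₀ (Real.cosh_pos x) (by positivity), mul_inv, inv_inv]
    linarith
  have hder : ∀ x : ℝ, HasDerivAt (fun x => Real.arctan (Real.sinh x)) (Real.cosh x)⁻¹ x := by
    intro x
    have h := (Real.hasDerivAt_arctan (Real.sinh x)).comp x (Real.hasDerivAt_sinh x)
    have e : (Real.cosh x)⁻¹ = 1 / (1 + Real.sinh x ^ 2) * Real.cosh x := by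
      rw [add_comm, ← Real.cosh_sq]
      have := (Real.cosh_pos x).ne'
      field_simp
    rw [e]
    exact h
  have hst : Tendsto Real.sinh atTop atTop := by
    refine tendsto_atTop_mono' atTop ?_ tendsto_id
    filter_upwards [eventually_ge_atTop 0] with x hx
    exact Real.self_le_sinh_iff.2 hx
  have hsb : Tendsto Real.sinh atBot atBot := by
    refine tendsto_atBot_mono' atBot ?_ tendsto_id
    filter_upwards [eventually_le_atBot 0] with x hx
    exact Real.sinh_le_self_iff.2 hx
  rw [integral_of_hasDerivAt_of_tendsto hder hi
    ((Real.tendsto_arctan_atBot.mono_right nhdsWithin_le_nhds).comp hsb)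
    ((Real.tendsto_arctan_atTop.mono_right nhdsWithin_le_nhds).comp hst)]
  ring

lemma exists_sin_lower_bound {α β : ℝ} (hα : 0 < α) (hβ : β < Real.pi) :
    ∃ c, 0 < c ∧ c ≤ 1 ∧ ∀ θ ∈ Set.Icc α β, c ≤ Real.sin θ := by
  by_cases h : (Set.Icc α β).Nonempty
  · obtain ⟨θ, hθ, hmin⟩ := isCompact_Icc.exists_isMinOn h Real.continuous_sin.continuousOn
    exact ⟨Real.sin θ, Real.sin_pos_of_pos_of_lt_pi (by linarith [hθ.1]) (by linarith [hθ.2]),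
      Real.sin_le_one θ, hmin⟩
  · exact ⟨1, one_pos, le_rfl, fun θ hθ => (h ⟨θ, hθ⟩).elim⟩

lemma norm_inv_sinh_le {c : ℝ} (hc0 : 0 < c) (hc1 : c ≤ 1) {w : ℂ} (hc : c ≤ |Real.sin w.im|) :
    ‖(sinh w)⁻¹‖ ≤ 2 / c * Real.exp (-1 * |w.re|) := by
  have h1 := mul_cosh_le_norm_sinh hc0.le hc1 hc
  have h2 := exp_abs_le_two_mul_cosh w.re
  have h3 := Real.exp_pos |w.re|
  have h4 : c / 2 * Real.exp |w.re| ≤ ‖sinh w‖ := by nlinarith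
  rw [norm_inv, neg_one_mul, Real.exp_neg]
  calc _ ≤ (c / 2 * Real.exp |w.re|)⁻¹ := inv_anti₀ (by positivity) h4
    _ = _ := by rw [mul_inv, inv_div]

lemma integrable_inv_sinh {θ : ℝ} (h0 : Real.sin θ ≠ 0) :
    Integrable fun x : ℝ => (sinh (x + θ * I))⁻¹ := by
  have hs : ∀ x : ℝ, |Real.sin θ| ≤ |Real.sin ((x + θ * I : ℂ)).im| := fun x => by simp
  have hne : ∀ x : ℝ, sinh (x + θ * I) ≠ 0 := by
    intro x h
    have := mul_cosh_le_norm_sinh (abs_nonneg _) (Real.abs_sin_le_one θ) (hs x)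
    rw [h, norm_zero] at this
    have h2 := mul_pos (abs_pos.2 h0) (Real.cosh_pos ((x + θ * I : ℂ)).re)
    linarith
  refine ((integrable_exp_neg_mul_abs one_pos).const_mul (2 / |Real.sin θ|)).mono'
    (Continuous.aestronglyMeasurable (Continuous.inv₀ (by fun_prop) hne))
    (ae_of_all _ fun x => ?_)
  simpa using norm_inv_sinh_le (abs_pos.2 h0) (Real.abs_sin_le_one θ) (hs x)

/-- At height π/2 the integrand is -i / cosh x. Other heights follow by moving the contour, since
sinh has no zero with 0 < Im w < π. -/
lemma integral_inv_sinh {θ : ℝ} (h0 : 0 < θ) (h1 : θ < Real.pi) :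
    ∫ x : ℝ, (sinh (x + θ * I))⁻¹ = -(Real.pi * I) := by
  have hhalf : ∫ x : ℝ, (sinh (x + (Real.pi / 2 : ℝ) * I))⁻¹ = -(Real.pi * I) := by
    have : ∀ x : ℝ, (sinh (x + (Real.pi / 2 : ℝ) * I))⁻¹ = -I * ((Real.cosh x)⁻¹ : ℝ) := by
      intro x
      rw [sinh_add, sinh_mul_I, cosh_mul_I, ← ofReal_cos, ← ofReal_sin, Real.cos_pi_div_two,
        Real.sin_pi_div_two]
      push_cast
      rw [mul_zero, zero_add, one_mul, mul_inv, inv_I]; ring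
    simp_rw [this]
    rw [integral_const_mul, integral_complex_ofReal, integral_inv_cosh]
    ring
  have key : ∀ a d : ℝ, 0 < a → a ≤ d → d < Real.pi →
      ∫ x : ℝ, (sinh (x + a * I))⁻¹ = ∫ x : ℝ, (sinh (x + d * I))⁻¹ := by
    intro a d ha had hd
    obtain ⟨c, hc0, hc1, hc⟩ := exists_sin_lower_bound ha hd
    have hsin : ∀ w : ℂ, w.im ∈ Set.Icc a d → c ≤ |Real.sin w.im| := fun w hw =>
      (hc _ hw).trans (le_abs_self _)
    have hne : ∀ w : ℂ, w.im ∈ Set.Icc a d → sinh w ≠ 0 := by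
      intro w hw h
      have := mul_cosh_le_norm_sinh hc0.le hc1 (hsin w hw)
      rw [h, norm_zero] at this
      have h2 := mul_pos hc0 (Real.cosh_pos w.re)
      linarith
    refine integral_horizontal_eq (f := fun w => (sinh w)⁻¹) had
      (g := fun x => 2 / c * Real.exp (-1 * |x|)) ?_ ?_ (tendsto_exp_neg_mul_abs one_pos _) ?_ ?_ ?_
    · exact continuous_sinh.continuousOn.inv₀ fun w hw => hne w hw
    · exact fun w hw => (differentiable_sinh w).inv (hne w ⟨hw.1.le, hw.2.le⟩)
    · refine Eventually.of_forall fun x y hy => ?_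
      simpa using norm_inv_sinh_le hc0 hc1 (w := x + y * I) (hsin _ (by simpa using hy))
    · exact integrable_inv_sinh (hc0.trans_le (hc a ⟨le_rfl, had⟩)).ne'
    · exact integrable_inv_sinh (hc0.trans_le (hc d ⟨had, le_rfl⟩)).ne'
  rcases le_total θ (Real.pi / 2) with h | h
  · rw [key θ _ h0 h (by linarith), hhalf]
  · rw [← key _ θ (by positivity) h h1, hhalf]

lemma integral_inv_sinh_neg {θ : ℝ} (h0 : 0 < θ) (h1 : θ < Real.pi) :
    ∫ x : ℝ, (sinh (x + (-θ : ℝ) * I))⁻¹ = Real.pi * I := by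
  rw [← integral_neg_eq_self]
  have : ∀ x : ℝ, (sinh (((-x : ℝ) : ℂ) + (-θ : ℝ) * I))⁻¹ = -(sinh (x + θ * I))⁻¹ := by
    intro x
    rw [← inv_neg, ← sinh_neg]
    congr 2; push_cast; ring
  simp_rw [this]
  rw [integral_neg, integral_inv_sinh h0 h1, neg_neg]

/-- The residue theorem for a strip with one simple pole. -/
theorem integral_horizontal_sub_eq {f : ℂ → ℂ} {a d : ℝ} {w₀ ρ : ℂ} (ha : a < w₀.im)
    (hd : w₀.im < d) (hc : ContinuousOn f ({w | w.im ∈ Set.Icc a d} \ {w₀}))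
    (hdf : ∀ w : ℂ, w.im ∈ Set.Ioo a d → w ≠ w₀ → DifferentiableAt ℂ f w)
    (hres : Tendsto (fun w => (w - w₀) * f w) (𝓝[≠] w₀) (𝓝 ρ))
    {g : ℝ → ℝ} (hg : Tendsto g (cocompact ℝ) (𝓝 0))
    (hb : ∀ᶠ x : ℝ in cocompact ℝ, ∀ y ∈ Set.Icc a d, ‖f (x + y * I)‖ ≤ g x)
    (hia : Integrable fun x : ℝ => f (x + a * I)) (hid : Integrable fun x : ℝ => f (x + d * I)) :
    (∫ x : ℝ, f (x + a * I)) - ∫ x : ℝ, f (x + d * I) = 2 * Real.pi * I * ρ := by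
  -- The model function r(w) = 1 / (β sinh((w - w₀)/β)) has residue 1 at w₀, and its integrals over
  -- the two lines are ±πi by `integral_inv_sinh`. Its poles are πβ apart, more than the width β of
  -- the strip, so w₀ is the only one in it.
  set β : ℝ := d - a with hβ
  have hβ0 : 0 < β := by linarith
  have hβ1 : (β : ℂ) ≠ 0 := by exact_mod_cast hβ0.ne'
  have hpi := Real.pi_gt_three
  set r : ℂ → ℂ := fun w => (β : ℂ)⁻¹ * (sinh ((w - w₀) / β))⁻¹ with hr
  have hsne : ∀ w : ℂ, w.im ∈ Set.Icc a d → w ≠ w₀ → sinh ((w - w₀) / β) ≠ 0 := by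
    intro w hw hne h
    have h1 := normSq_sinh ((w - w₀) / β)
    rw [h, norm_zero] at h1
    have h2 : Real.sinh ((w - w₀) / β).re = 0 := by
      nlinarith [sq_nonneg (Real.sinh ((w - w₀) / β).re), sq_nonneg (Real.sin ((w - w₀) / β).im)]
    have h3 : Real.sin ((w - w₀) / β).im = 0 := by
      nlinarith [sq_nonneg (Real.sinh ((w - w₀) / β).re), sq_nonneg (Real.sin ((w - w₀) / β).im)]
    rw [div_ofReal_re, sub_re] at h2
    rw [div_ofReal_im, sub_im] at h3
    have h4 : w.re = w₀.re := by
      have := Real.sinh_eq_zero.1 h2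
      rw [div_eq_zero_iff, or_iff_left hβ0.ne'] at this
      linarith
    have hlt : |(w.im - w₀.im) / β| ≤ 1 := by
      rw [abs_div, abs_of_pos hβ0, div_le_one hβ0, abs_le]
      constructor <;> linarith [hw.1, hw.2]
    rw [abs_le] at hlt
    have h5 := (Real.sin_eq_zero_iff_of_lt_of_lt (by linarith) (by linarith)).1 h3
    rw [div_eq_zero_iff, or_iff_left hβ0.ne'] at h5
    exact hne (Complex.ext h4 (by linarith))
  have hrint : ∀ y : ℝ, (fun x : ℝ => r (x + y * I)) = fun x : ℝ =>
      (β : ℂ)⁻¹ * (fun x : ℝ => (sinh (x + ((y - w₀.im) / β : ℝ) * I))⁻¹) ((x - w₀.re) / β) := by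
    intro y
    ext x
    simp only [hr]
    congr 3
    conv_lhs => rw [← re_add_im w₀]
    push_cast
    field_simp
    ring
  have hrI : ∀ y : ℝ, Real.sin ((y - w₀.im) / β) ≠ 0 →
      Integrable fun x : ℝ => r (x + y * I) := by
    intro y hy
    rw [hrint]
    refine Integrable.const_mul ?_ _
    exact ((integrable_inv_sinh hy).comp_div hβ0.ne').comp_sub_right w₀.re
  have hrV : ∀ y : ℝ, ∫ x : ℝ, r (x + y * I) =
      ∫ x : ℝ, (sinh (x + ((y - w₀.im) / β : ℝ) * I))⁻¹ := by
    intro y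
    have h1 := Measure.integral_comp_div
      (fun x : ℝ => (sinh (x + ((y - w₀.im) / β : ℝ) * I))⁻¹) β
    rw [hrint, integral_const_mul, integral_sub_right_eq_self
      (fun x : ℝ => (fun x : ℝ => (sinh (x + ((y - w₀.im) / β : ℝ) * I))⁻¹) (x / β)),
      h1, abs_of_pos hβ0, real_smul, inv_mul_cancel_left₀ hβ1]
  have hta0 : 0 < (w₀.im - a) / β := div_pos (by linarith) hβ0
  have hta1 : (w₀.im - a) / β < Real.pi := by
    rw [div_lt_iff₀ hβ0]; nlinarith
  have htd0 : 0 < (d - w₀.im) / β := div_pos (by linarith) hβ0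
  have htd1 : (d - w₀.im) / β < Real.pi := by
    rw [div_lt_iff₀ hβ0]; nlinarith
  have hae : (a - w₀.im) / β = -((w₀.im - a) / β) := by ring
  have hra : ∫ x : ℝ, r (x + a * I) = Real.pi * I := by
    rw [hrV, hae, integral_inv_sinh_neg hta0 hta1]
  have hrd : ∫ x : ℝ, r (x + d * I) = -(Real.pi * I) := by
    rw [hrV, integral_inv_sinh htd0 htd1]
  have hrIa : Integrable fun x : ℝ => r (x + a * I) := hrI a (by
    rw [hae, Real.sin_neg]
    exact neg_ne_zero.2 (Real.sin_pos_of_pos_of_lt_pi hta0 hta1).ne')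
  have hrId : Integrable fun x : ℝ => r (x + d * I) := hrI d
    (Real.sin_pos_of_pos_of_lt_pi htd0 htd1).ne'
  have hrres : Tendsto (fun w => (w - w₀) * r w) (𝓝[≠] w₀) (𝓝 1) := by
    have h1 : HasDerivAt (fun w => β * sinh ((w - w₀) / β)) 1 w₀ := by
      have h2 := (((hasDerivAt_id w₀).sub_const w₀).div_const (β : ℂ)).csinh.const_mul (β : ℂ)
      simpa [hβ1] using h2
    have h3 := h1.tendsto_slope.inv₀ one_ne_zero
    rw [inv_one] at h3
    refine h3.congr fun w => ?_
    simp [slope_def_field, hr, mul_comm]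
    ring
  -- The residues cancel, so the singularity at w₀ is removable and both lines give the same
  -- integral.
  set F : ℂ → ℂ := fun w => f w - ρ * r w with hF
  have hFres : Tendsto (fun w => (w - w₀) * F w) (𝓝[≠] w₀) (𝓝 0) := by
    have := hres.sub (hrres.const_mul ρ)
    rw [mul_one, sub_self] at this
    refine this.congr fun w => ?_
    simp only [hF]; ring
  have hFd : ∀ w : ℂ, w.im ∈ Set.Ioo a d → w ≠ w₀ → DifferentiableAt ℂ F w := by
    intro w hw hne
    refine (hdf w hw hne).sub (DifferentiableAt.const_mul ?_ _)
    have h1 : DifferentiableAt ℂ (fun w => sinh ((w - w₀) / β)) w := by fun_prop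
    exact (h1.fun_inv (hsne w ⟨hw.1.le, hw.2.le⟩ hne)).const_mul _
  have hopen : IsOpen {w : ℂ | w.im ∈ Set.Ioo a d} := isOpen_Ioo.preimage continuous_im
  have hw₀ : w₀ ∈ {w : ℂ | w.im ∈ Set.Ioo a d} := ⟨ha, hd⟩
  have hFl : (fun z => F z - F w₀) =o[𝓝[≠] w₀] fun z => (z - w₀)⁻¹ := by
    rw [Asymptotics.isLittleO_iff_tendsto']
    · have h1 : Tendsto (fun w => (w - w₀) * F w₀) (𝓝[≠] w₀) (𝓝 0) := by
        have : Continuous fun w : ℂ => (w - w₀) * F w₀ := by fun_prop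
        simpa using (this.tendsto w₀).mono_left nhdsWithin_le_nhds
      have h2 := hFres.sub h1
      rw [sub_zero] at h2
      refine h2.congr fun w => ?_
      rw [div_inv_eq_mul]; ring
    · filter_upwards [self_mem_nhdsWithin] with w hw h
      exact absurd (inv_eq_zero.1 h) (sub_ne_zero.2 hw)
  set F' := Function.update F w₀ (limUnder (𝓝[≠] w₀) F) with hF'
  have hF'd : DifferentiableOn ℂ F' {w : ℂ | w.im ∈ Set.Ioo a d} :=
    differentiableOn_update_limUnder_of_isLittleO (hopen.mem_nhds hw₀)
      (fun w hw => (hFd w hw.1 hw.2).differentiableWithinAt) hFl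
  have hF'e : ∀ w, w ≠ w₀ → F' w = F w := fun w hw => Function.update_of_ne hw _ _
  have hlines : ∀ (y : ℝ), y ≠ w₀.im → (fun x : ℝ => F' (x + y * I)) =
      fun x : ℝ => f (x + y * I) - ρ * r (x + y * I) := by
    intro y hy
    ext x
    rw [hF'e]
    intro h
    apply hy
    simpa using congrArg Complex.im h
  have hcoc : ∀ᶠ x : ℝ in cocompact ℝ, |w₀.re| + β < |x| :=
    (tendsto_norm_cocompact_atTop (E := ℝ)).eventually_gt_atTop _
  have hrb : ∀ᶠ x : ℝ in cocompact ℝ, ∀ y ∈ Set.Icc a d, ‖r (x + y * I)‖ ≤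
      β⁻¹ * (4 * Real.exp (|w₀.re| / β)) * Real.exp (-β⁻¹ * |x|) := by
    filter_upwards [hcoc] with x hx y hy
    have h1 := abs_sinh_le_norm_sinh ((x + y * I - w₀) / β)
    have hre : ((x + y * I - w₀) / β).re = (x - w₀.re) / β := by
      rw [div_ofReal_re]; simp
    rw [hre] at h1
    set t := |(x - w₀.re) / β| with ht
    have ht1 : 1 ≤ t := by
      rw [ht, abs_div, abs_of_pos hβ0, one_le_div hβ0]
      have := abs_sub_abs_le_abs_sub x w₀.re
      linarith
    have ht2 : |x| / β - |w₀.re| / β ≤ t := by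
      rw [ht, abs_div, abs_of_pos hβ0, ← sub_div]
      gcongr
      exact abs_sub_abs_le_abs_sub x w₀.re
    have hs : Real.exp t / 4 ≤ |Real.sinh ((x - w₀.re) / β)| := by
      rw [Real.abs_sinh, ← ht, Real.sinh_eq]
      have e1 : Real.exp (-t) ≤ 1 := Real.exp_le_one_iff.2 (by linarith)
      have e2 : 2 ≤ Real.exp t := by linarith [Real.add_one_le_exp t]
      linarith
    simp only [hr]
    rw [norm_mul, norm_inv, norm_inv, Complex.norm_real, Real.norm_of_nonneg hβ0.le, mul_assoc]
    gcongr
    calc ‖sinh ((x + y * I - w₀) / β)‖⁻¹ ≤ (Real.exp t / 4)⁻¹ :=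
          inv_anti₀ (by positivity) (hs.trans h1)
      _ = 4 * Real.exp (-t) := by rw [inv_div, Real.exp_neg]; ring
      _ ≤ 4 * (Real.exp (|w₀.re| / β) * Real.exp (-β⁻¹ * |x|)) := by
          rw [← Real.exp_add]
          gcongr
          have : β⁻¹ * |x| = |x| / β := by ring
          rw [neg_mul, this]; linarith
      _ = _ := by ring
  have hmain := integral_horizontal_eq (f := F') (a := a) (d := d) (by linarith) ?_
    (fun w hw => (hF'd w hw).differentiableAt (hopen.mem_nhds hw))
    (g := fun x => g x + ‖ρ‖ * (β⁻¹ * (4 * Real.exp (|w₀.re| / β)) * Real.exp (-β⁻¹ * |x|)))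
    ?_ ?_ ?_ ?_
  · rw [hlines a ha.ne, hlines d hd.ne', integral_sub hia (hrIa.const_mul ρ),
      integral_sub hid (hrId.const_mul ρ), integral_const_mul ρ (fun x : ℝ => r (x + a * I)),
      integral_const_mul ρ (fun x : ℝ => r (x + d * I)), hra, hrd] at hmain
    linear_combination hmain
  · intro w hw
    by_cases hne : w = w₀
    · rw [hne]
      exact ((hF'd w₀ hw₀).differentiableAt (hopen.mem_nhds hw₀)).continuousAt.continuousWithinAt
    · have h1 : ContinuousOn F ({w | w.im ∈ Set.Icc a d} \ {w₀}) := by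
        refine hc.sub (continuousOn_const.mul (continuousOn_const.mul (ContinuousOn.inv₀ ?_ ?_)))
        · fun_prop
        · exact fun z hz => hsne z hz.1 hz.2
      have h2 : ContinuousOn F' ({w | w.im ∈ Set.Icc a d} \ {w₀}) :=
        h1.congr fun z hz => hF'e z hz.2
      have h3 := h2 w ⟨hw, hne⟩
      refine h3.mono_of_mem_nhdsWithin ?_
      exact inter_mem self_mem_nhdsWithin
        (mem_nhdsWithin_of_mem_nhds (isOpen_ne.mem_nhds hne))
  · have := hg.add ((tendsto_exp_neg_mul_abs (inv_pos.2 hβ0)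
      (β⁻¹ * (4 * Real.exp (|w₀.re| / β)))).const_mul ‖ρ‖)
    simpa using this
  · filter_upwards [hb, hrb, hcoc] with x h1 h2 h3 y hy
    rw [hF'e]
    · refine (norm_sub_le _ _).trans (add_le_add (h1 y hy) ?_)
      rw [norm_mul]
      gcongr
      exact h2 y hy
    · intro h
      have h4 : x = w₀.re := by simpa using congrArg Complex.re h
      rw [h4] at h3
      linarith
  · rw [hlines a ha.ne]; exact hia.sub (hrIa.const_mul ρ)
  · rw [hlines d hd.ne']; exact hid.sub (hrId.const_mul ρ)


/-! ### Periodic holomorphic functions on strips; zeros and decay of 1/sinh -/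

lemma eq_add_natCast_mul_of_periodic_strip {f : ℂ → ℂ} {ω : ℂ} {a d : ℝ} (hω : 0 < ω.im)
    (hper : ∀ z : ℂ, a < z.im → (z + ω).im < d → f (z + ω) = f z) (n : ℕ) :
    ∀ z : ℂ, a < z.im → (z + n * ω).im < d → f (z + n * ω) = f z := by
  induction n with
  | zero => intro z _ _; simp
  | succ n ih =>
    intro z hz hz'
    have him : ∀ m : ℕ, (z + m * ω).im = z.im + m * ω.im := fun m => by simp
    have e : z + ((n + 1 : ℕ) : ℂ) * ω = (z + n * ω) + ω := by push_cast; ring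
    have h1 : a < (z + n * ω).im := by rw [him]; nlinarith [mul_nonneg n.cast_nonneg hω.le]
    rw [e] at hz' ⊢
    rw [hper _ h1 hz', ih z hz (by rw [add_im] at hz'; linarith)]

/-- A holomorphic function on a strip that is periodic in a transversal direction and bounded
on a substrip containing a period is constant. -/
theorem exists_eq_const_of_periodic_strip {f : ℂ → ℂ} {ω : ℂ} {a d a' d' : ℝ} (hω : 0 < ω.im)
    (ha : a < a') (hd : d' < d) (hωd : ω.im ≤ d' - a')
    (hf : ∀ z : ℂ, a < z.im → z.im < d → DifferentiableAt ℂ f z)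
    (hper : ∀ z : ℂ, a < z.im → (z + ω).im < d → f (z + ω) = f z)
    {C : ℝ} (hb : ∀ z : ℂ, a' ≤ z.im → z.im ≤ d' → ‖f z‖ ≤ C) :
    ∃ c, ∀ z : ℂ, a < z.im → z.im < d → f z = c := by
  -- Each z is translated by a multiple of ω into the substrip between a' and d', which is at least
  -- Im ω high. By periodicity the resulting `g` does not depend locally on the translate, so it is
  -- entire; it is bounded, and Liouville's theorem applies.
  set κ : ℂ → ℤ := fun z => ⌊(z.im - a') / ω.im⌋ with hκ
  set g : ℂ → ℂ := fun z => f (z - κ z * ω) with hg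
  have him : ∀ (z : ℂ) (k : ℤ), (z - k * ω).im = z.im - k * ω.im := fun z k => by simp
  have h1 : ∀ z, a' ≤ (z - κ z * ω).im := by
    intro z
    have := Int.floor_le ((z.im - a') / ω.im)
    rw [le_div_iff₀ hω] at this
    rw [him]; linarith
  have h2 : ∀ z, (z - κ z * ω).im ≤ d' := by
    intro z
    have := Int.lt_floor_add_one ((z.im - a') / ω.im)
    rw [div_lt_iff₀ hω] at this
    rw [him]; simp only [hκ]; linarith
  have hall : ∀ (z w : ℂ) (k : ℤ), w = z + k * ω → a < z.im → z.im < d → a < w.im → w.im < d →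
      f w = f z := by
    intro z w k hw hz hz' hw1 hw2
    obtain ⟨n, rfl | rfl⟩ := k.eq_nat_or_neg
    · subst hw
      simpa using eq_add_natCast_mul_of_periodic_strip hω hper n z hz (by simpa using hw2)
    · have hzw : z = w + n * ω := by rw [hw]; push_cast; ring
      rw [hzw] at hz' ⊢
      exact (eq_add_natCast_mul_of_periodic_strip hω hper n w hw1 hz').symm
  have hgk : ∀ (z : ℂ) (k : ℤ), a < (z - k * ω).im → (z - k * ω).im < d →
      g z = f (z - k * ω) := by
    intro z k hk1 hk2
    refine hall _ _ (k - κ z) ?_ hk1 hk2 (ha.trans_le (h1 z)) ((h2 z).trans_lt hd)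
    push_cast; ring
  have hgd : Differentiable ℂ g := by
    intro z
    have hopen : IsOpen {w : ℂ | a < (w - κ z * ω).im ∧ (w - κ z * ω).im < d} :=
      isOpen_Ioo.preimage (continuous_im.comp (f := fun w : ℂ => w - κ z * ω) (by fun_prop))
    have hmem := hopen.mem_nhds (x := z) ⟨ha.trans_le (h1 z), (h2 z).trans_lt hd⟩
    have hev : g =ᶠ[𝓝 z] fun w => f (w - κ z * ω) := by
      filter_upwards [hmem] with w hw using hgk w _ hw.1 hw.2
    refine DifferentiableAt.congr_of_eventuallyEq ?_ hev
    exact (hf _ (ha.trans_le (h1 z)) ((h2 z).trans_lt hd)).comp z (by fun_prop)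
  have hgb : Bornology.IsBounded (Set.range g) := by
    rw [isBounded_iff_forall_norm_le]
    refine ⟨C, ?_⟩
    rintro _ ⟨z, rfl⟩
    exact hb _ (h1 z) (h2 z)
  refine ⟨g 0, fun z hz1 hz2 => ?_⟩
  rw [← hgd.apply_eq_apply_of_bounded hgb z 0, hgk z 0 (by simpa) (by simpa)]
  simp

lemma exists_int_of_sinh_mul_eq_zero {β w : ℂ} (hβ : β ≠ 0) (h : sinh (w * β) = 0) :
    ∃ n : ℤ, w = ((n * Real.pi : ℝ) : ℂ) * (I * β⁻¹) := by
  have h2 : sin (w * β * I) = 0 := by rw [sin_mul_I, h, zero_mul]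
  obtain ⟨k, hk⟩ := Complex.sin_eq_zero_iff.1 h2
  refine ⟨-k, ?_⟩
  have h3 : w * β = -(w * β * I) * I := by linear_combination (w * β) * I_mul_I
  have h4 : w = w * β * β⁻¹ := by field_simp
  rw [h4, h3, hk]; push_cast; ring

lemma re_inv_pos {β : ℂ} (hβ : 0 < β.re) : 0 < (β⁻¹).re := by
  have hβ0 : β ≠ 0 := by rintro rfl; simp at hβ
  rw [inv_re]; exact div_pos hβ (normSq_pos.2 hβ0)

lemma im_ofReal_mul_I_mul (r : ℝ) (z : ℂ) : ((r : ℂ) * (I * z)).im = r * z.re := by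
  simp

/-- The zeros of `w ↦ sinh (wβ)` in a strip containing at most the first one. -/
lemma eq_of_sinh_mul_eq_zero {β w : ℂ} (hβ : 0 < β.re) (h0 : 0 < w.im)
    (h1 : w.im < 2 * (Real.pi * (β⁻¹).re)) (h : sinh (w * β) = 0) :
    w = Real.pi * (I * β⁻¹) := by
  have hβ0 : β ≠ 0 := by rintro rfl; simp at hβ
  obtain ⟨n, hn⟩ := exists_int_of_sinh_mul_eq_zero hβ0 h
  have hp : 0 < Real.pi * (β⁻¹).re := mul_pos Real.pi_pos (re_inv_pos hβ)
  have him : w.im = n * (Real.pi * (β⁻¹).re) := by rw [hn, im_ofReal_mul_I_mul]; ring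
  rw [him] at h0 h1
  have hn0 : (0 : ℝ) < n := by
    by_contra hcon
    nlinarith
  have hn1 : (n : ℝ) < 2 := by
    by_contra hcon
    nlinarith
  have a1 : 0 < n := by exact_mod_cast hn0
  have a2 : n < 2 := by exact_mod_cast hn1
  obtain rfl : n = 1 := by omega
  rw [hn]; simp

lemma eq_zero_of_sinh_mul_eq_zero {β w : ℂ} (hβ : 0 < β.re)
    (h1 : |w.im| < Real.pi * (β⁻¹).re) (h : sinh (w * β) = 0) : w = 0 := by
  have hβ0 : β ≠ 0 := by rintro rfl; simp at hβ
  obtain ⟨n, hn⟩ := exists_int_of_sinh_mul_eq_zero hβ0 h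
  have hp : 0 < Real.pi * (β⁻¹).re := mul_pos Real.pi_pos (re_inv_pos hβ)
  have him : w.im = n * (Real.pi * (β⁻¹).re) := by rw [hn, im_ofReal_mul_I_mul]; ring
  rw [him, abs_lt] at h1
  have hn0 : (-1 : ℝ) < n := by
    by_contra hcon
    nlinarith [h1.1]
  have hn1 : (n : ℝ) < 1 := by
    by_contra hcon
    nlinarith [h1.2]
  have a1 : -1 < n := by exact_mod_cast hn0
  have a2 : n < 1 := by exact_mod_cast hn1
  obtain rfl : n = 0 := by omega
  rw [hn]; simp

lemma sinh_mul_ne_zero {β w : ℂ} (hβ : 0 < β.re) (h0 : 0 < w.im)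
    (h1 : w.im < Real.pi * (β⁻¹).re) : sinh (w * β) ≠ 0 := by
  intro h
  have := eq_zero_of_sinh_mul_eq_zero hβ (by rwa [abs_of_pos h0]) h
  simp [this] at h0

/-- Exponential decay of `1 / sinh (wβ)` at the ends of a strip. -/
lemma exists_norm_inv_sinh_mul_le_of_le {β : ℂ} (hβ : 0 < β.re) (a d : ℝ) :
    ∃ M C, 0 < M ∧ 0 < C ∧ ∀ w : ℂ, w.im ∈ Set.Icc a d → M ≤ |w.re| →
      ‖(sinh (w * β))⁻¹‖ ≤ C * Real.exp (-β.re * |w.re|) := by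
  set T : ℝ := (|a| + |d|) * |β.im| with hT
  have hT0 : 0 ≤ T := by positivity
  have him : ∀ w : ℂ, w.im ∈ Set.Icc a d → |w.im * β.im| ≤ T := by
    intro w hw
    rw [abs_mul]
    refine mul_le_mul_of_nonneg_right ?_ (abs_nonneg _)
    rw [abs_le]
    constructor
    · linarith [hw.1, neg_abs_le a, abs_nonneg d]
    · linarith [hw.2, le_abs_self d, abs_nonneg a]
  refine ⟨(T + 1) / β.re, 4 * Real.exp T, by positivity, by positivity, fun w hw hM' => ?_⟩
  have hre : (w * β).re = w.re * β.re - w.im * β.im := mul_re _ _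
  have h1 : β.re * |w.re| - T ≤ |(w * β).re| := by
    rw [hre]
    have := abs_sub_abs_le_abs_sub (w.re * β.re) (w.im * β.im)
    rw [abs_mul w.re, abs_of_pos hβ] at this
    linarith [him w hw]
  have h2 : 1 ≤ |(w * β).re| := by
    have : T + 1 ≤ β.re * |w.re| := by
      rw [div_le_iff₀ hβ] at hM'; linarith
    linarith
  have h3 : Real.exp |(w * β).re| / 4 ≤ ‖sinh (w * β)‖ := by
    refine le_trans ?_ (abs_sinh_le_norm_sinh _)
    rw [Real.abs_sinh, Real.sinh_eq]
    have e1 : Real.exp (-|(w * β).re|) ≤ 1 := Real.exp_le_one_iff.2 (by linarith)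
    have e2 : 2 ≤ Real.exp |(w * β).re| := by linarith [Real.add_one_le_exp |(w * β).re|]
    linarith
  rw [norm_inv]
  calc (‖sinh (w * β)‖)⁻¹ ≤ (Real.exp |(w * β).re| / 4)⁻¹ := inv_anti₀ (by positivity) h3
    _ = 4 * Real.exp (-|(w * β).re|) := by rw [inv_div, Real.exp_neg]; ring
    _ ≤ 4 * Real.exp (T + -β.re * |w.re|) := by
      refine mul_le_mul_of_nonneg_left (Real.exp_le_exp.2 ?_) (by norm_num)
      linarith
    _ = _ := by rw [Real.exp_add]; ring

/-- Exponential decay of `1 / sinh (wβ)` in a closed substrip of the strip of holomorphy. -/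
lemma exists_norm_inv_sinh_mul_le {β : ℂ} (hβ : 0 < β.re) {a d : ℝ}
    (hne : ∀ w : ℂ, w.im ∈ Set.Icc a d → sinh (w * β) ≠ 0) :
    ∃ C, 0 < C ∧ ∀ w : ℂ, w.im ∈ Set.Icc a d →
      ‖(sinh (w * β))⁻¹‖ ≤ C * Real.exp (-β.re * |w.re|) := by
  obtain ⟨M, C, hM0, hC0, hfar⟩ := exists_norm_inv_sinh_mul_le_of_le hβ a d
  have hK : IsCompact (Set.Icc (-M) M ×ℂ Set.Icc a d) := isCompact_Icc.reProdIm isCompact_Icc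
  have hcont : ContinuousOn (fun w : ℂ => (sinh (w * β))⁻¹) (Set.Icc (-M) M ×ℂ Set.Icc a d) :=
    ContinuousOn.inv₀ (by fun_prop) fun w hw => hne w hw.2
  obtain ⟨B, hB⟩ := hK.exists_bound_of_continuousOn hcont
  have hB0 : 0 ≤ |B| := abs_nonneg B
  refine ⟨C + |B| * Real.exp (β.re * M), by positivity, fun w hw => ?_⟩
  have hE := Real.exp_pos (-β.re * |w.re|)
  rw [add_mul]
  rcases le_total M |w.re| with h | h
  · have h1 := hfar w hw h
    have h2 : 0 ≤ |B| * Real.exp (β.re * M) * Real.exp (-β.re * |w.re|) := by positivity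
    linarith
  · have h1 := hB w ⟨Set.mem_Icc.2 (abs_le.1 h), hw⟩
    have h2 : 0 ≤ C * Real.exp (-β.re * |w.re|) := by positivity
    have h3 : 1 ≤ Real.exp (β.re * M) * Real.exp (-β.re * |w.re|) := by
      rw [← Real.exp_add]
      exact Real.one_le_exp (by nlinarith)
    have h4 : |B| ≤ |B| * (Real.exp (β.re * M) * Real.exp (-β.re * |w.re|)) :=
      le_mul_of_one_le_right hB0 h3
    nlinarith [le_abs_self B]

/-! ### Integrals of Laplace type and their holomorphy -/

lemma norm_exp_neg_two_I_mul (z w : ℂ) :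
    ‖exp (-(2 * I * z * w))‖ = Real.exp (2 * (z.im * w.re + z.re * w.im)) := by
  rw [norm_exp]
  congr 1
  simp [mul_re, mul_im]; ring

lemma norm_exp_neg_two_I_mul_le (z w : ℂ) :
    ‖exp (-(2 * I * z * w))‖ ≤ Real.exp (2 * z.re * w.im) * Real.exp (2 * |z.im| * |w.re|) := by
  rw [norm_exp_neg_two_I_mul, ← Real.exp_add]
  refine Real.exp_le_exp.2 ?_
  have := le_abs_self (z.im * w.re)
  rw [abs_mul] at this
  linarith

section Laplace

variable {k : ℝ → ℂ} {C A h : ℝ}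

lemma norm_exp_mul_le (hk : ∀ s, ‖k s‖ ≤ C * Real.exp (-A * |s|)) (z : ℂ) (s : ℝ) :
    ‖exp (-(2 * I * z * (s + I * h))) * k s‖ ≤
      Real.exp (2 * h * z.re) * C * Real.exp (-(A - 2 * |z.im|) * |s|) := by
  rw [norm_mul]
  have h1 := norm_exp_neg_two_I_mul_le z (s + I * h)
  have e1 : (s + I * h : ℂ).re = s := by simp
  have e2 : (s + I * h : ℂ).im = h := by simp
  rw [e1, e2] at h1
  calc _ ≤ (Real.exp (2 * z.re * h) * Real.exp (2 * |z.im| * |s|)) *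
        (C * Real.exp (-A * |s|)) :=
        mul_le_mul h1 (hk s) (norm_nonneg _) (by positivity)
    _ = Real.exp (2 * h * z.re) * C * (Real.exp (2 * |z.im| * |s|) * Real.exp (-A * |s|)) := by
      rw [show 2 * z.re * h = 2 * h * z.re by ring]; ring
    _ = _ := by rw [← Real.exp_add]; ring_nf

lemma integrable_exp_mul (hkc : Continuous k) (hk : ∀ s, ‖k s‖ ≤ C * Real.exp (-A * |s|))
    {z : ℂ} (hz : |z.im| < A / 2) :
    Integrable fun s : ℝ => exp (-(2 * I * z * (s + I * h))) * k s := by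
  refine ((integrable_exp_neg_mul_abs (δ := A - 2 * |z.im|) (by linarith)).const_mul
    (Real.exp (2 * h * z.re) * C)).mono' ?_ (ae_of_all _ (norm_exp_mul_le hk z))
  exact Continuous.aestronglyMeasurable (by fun_prop)

lemma norm_integral_exp_mul_le (hC : 0 ≤ C)
    (hk : ∀ s, ‖k s‖ ≤ C * Real.exp (-A * |s|)) {δ : ℝ} (hδ : 0 < δ)
    {z : ℂ} (hz : |z.im| ≤ A / 2 - δ) :
    ‖∫ s : ℝ, exp (-(2 * I * z * (s + I * h))) * k s‖ ≤
      (C * ∫ s : ℝ, Real.exp (-(2 * δ) * |s|)) * Real.exp (2 * h * z.re) := by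
  calc _ ≤ ∫ s : ℝ, Real.exp (2 * h * z.re) * C * Real.exp (-(2 * δ) * |s|) := by
        refine norm_integral_le_of_norm_le
          ((integrable_exp_neg_mul_abs (by positivity)).const_mul _) (ae_of_all _ fun s => ?_)
        refine (norm_exp_mul_le hk z s).trans ?_
        refine mul_le_mul_of_nonneg_left (Real.exp_le_exp.2 ?_) (by positivity)
        nlinarith [abs_nonneg s]
    _ = _ := by rw [integral_const_mul]; ring

/-- Differentiation under the integral sign. As ε is a quarter of the slack A/2 - |Im z₀|, a decay
of at least e^{-2ε|s|} remains throughout the disc of radius ε; half of it absorbs the factor |s| +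
|h| produced by the derivative. -/
lemma hasDerivAt_integral_exp_mul (hkc : Continuous k) (hC : 0 ≤ C)
    (hk : ∀ s, ‖k s‖ ≤ C * Real.exp (-A * |s|)) {z₀ : ℂ} (hz : |z₀.im| < A / 2) :
    Integrable (fun s : ℝ =>
      (-(2 * I * (s + I * h))) * (exp (-(2 * I * z₀ * (s + I * h))) * k s)) ∧
    HasDerivAt (fun z : ℂ => ∫ s : ℝ, exp (-(2 * I * z * (s + I * h))) * k s)
      (∫ s : ℝ, (-(2 * I * (s + I * h))) * (exp (-(2 * I * z₀ * (s + I * h))) * k s)) z₀ := by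
  set ε : ℝ := (A / 2 - |z₀.im|) / 4 with hε
  have hε0 : 0 < ε := by simp only [hε]; linarith
  set B : ℝ := Real.exp (2 * |h| * (|z₀.re| + ε)) * C with hB
  refine (hasDerivAt_integral_of_dominated_loc_of_deriv_le (μ := volume) (𝕜 := ℂ)
    (s := Metric.ball z₀ ε)
    (bound := fun s => (2 * (1 / ε + |h|) * B) * Real.exp (-ε * |s|))
    (F := fun (z : ℂ) (s : ℝ) => exp (-(2 * I * z * (s + I * h))) * k s)
    (F' := fun (z : ℂ) (s : ℝ) =>
      (-(2 * I * (s + I * h))) * (exp (-(2 * I * z * (s + I * h))) * k s))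
    (Metric.ball_mem_nhds z₀ hε0) ?_ (integrable_exp_mul hkc hk hz) ?_ ?_ ?_ ?_)
  · exact Eventually.of_forall fun z => Continuous.aestronglyMeasurable (by fun_prop)
  · exact Continuous.aestronglyMeasurable (by fun_prop)
  · refine ae_of_all _ fun s z hz' => ?_
    have hzn : ‖z - z₀‖ < ε := by simpa [dist_eq_norm] using hz'
    have him : |z.im| ≤ |z₀.im| + ε := by
      have := (abs_im_le_norm (z - z₀)).trans hzn.le
      rw [sub_im] at this
      linarith [abs_sub_abs_le_abs_sub z.im z₀.im]
    have hre : |z.re| ≤ |z₀.re| + ε := by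
      have := (abs_re_le_norm (z - z₀)).trans hzn.le
      rw [sub_re] at this
      linarith [abs_sub_abs_le_abs_sub z.re z₀.re]
    have h1 : ‖-(2 * I * (s + I * h : ℂ))‖ ≤ 2 * (|s| + |h|) := by
      rw [norm_neg, norm_mul, norm_mul]
      simp only [norm_I, mul_one, Complex.norm_ofNat]
      refine mul_le_mul_of_nonneg_left ((norm_add_le _ _).trans ?_) (by norm_num)
      simp
    have h2 : ‖exp (-(2 * I * z * (s + I * h))) * k s‖ ≤ B * Real.exp (-(2 * ε) * |s|) := by
      refine (norm_exp_mul_le hk z s).trans ?_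
      have e1 : Real.exp (2 * h * z.re) ≤ Real.exp (2 * |h| * (|z₀.re| + ε)) := by
        refine Real.exp_le_exp.2 ?_
        have := le_abs_self (h * z.re)
        rw [abs_mul] at this
        nlinarith [abs_nonneg h]
      refine mul_le_mul (mul_le_mul_of_nonneg_right e1 hC) (Real.exp_le_exp.2 ?_)
        (Real.exp_pos _).le (by positivity)
      have : 2 * ε ≤ A - 2 * |z.im| := by simp only [hε] at him ⊢; linarith
      nlinarith [abs_nonneg s]
    have h3 : |s| + |h| ≤ (1 / ε + |h|) * Real.exp (ε * |s|) := by
      have e1 : ε * |s| ≤ Real.exp (ε * |s|) := by linarith [Real.add_one_le_exp (ε * |s|)]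
      have e2 : 1 ≤ Real.exp (ε * |s|) := Real.one_le_exp (by positivity)
      have e3 : |s| ≤ 1 / ε * Real.exp (ε * |s|) := by
        rw [div_mul_eq_mul_div, one_mul, le_div_iff₀ hε0]; linarith
      nlinarith [abs_nonneg h]
    rw [norm_mul]
    calc _ ≤ (2 * (|s| + |h|)) * (B * Real.exp (-(2 * ε) * |s|)) :=
          mul_le_mul h1 h2 (norm_nonneg _) (by positivity)
      _ ≤ (2 * ((1 / ε + |h|) * Real.exp (ε * |s|))) * (B * Real.exp (-(2 * ε) * |s|)) := by
          refine mul_le_mul_of_nonneg_right ?_ (by positivity)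
          linarith
      _ = 2 * (1 / ε + |h|) * B * (Real.exp (ε * |s|) * Real.exp (-(2 * ε) * |s|)) := by ring
      _ = _ := by rw [← Real.exp_add]; ring_nf
  · exact (integrable_exp_neg_mul_abs hε0).const_mul _
  · refine ae_of_all _ fun s z _ => ?_
    have h1 : HasDerivAt (fun z : ℂ => -(2 * I * z * (s + I * h))) (-(2 * I * (s + I * h))) z := by
      have := ((hasDerivAt_id' z).const_mul (2 * I)).mul_const (s + I * h : ℂ)
      simpa using this.fun_neg
    have h2 := h1.cexp.mul_const (k s)
    exact h2.congr_deriv (by ring)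

end Laplace


/-! ### The quantum dilogarithm in a strip -/

/-- The parameters `b` in the range to which the symmetries `b ↦ -b` and `b ↦ b⁻¹` reduce. -/
structure IsReduced (b : ℂ) : Prop where
  re_pos : 0 < b.re
  re_le : b.re ≤ (b⁻¹).re
  real_or_norm : b.im = 0 ∨ ‖b‖ = 1

/-- `Re b + Re b⁻¹`, which equals `b + b⁻¹` for the parameters in question. -/
def reQ (b : ℂ) : ℝ := b.re + (b⁻¹).re

/-- The kernel `1 / (sinh (wb) sinh (w/b) w)`. -/
def dilogKernel (b w : ℂ) : ℂ := (sinh (w * b) * sinh (w * b⁻¹) * w)⁻¹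

/-- The logarithm of the quantum dilogarithm in the strip `|Im z| < Q / 2`. -/
def logDilog (b z : ℂ) : ℂ :=
  1 / 4 * ∫ s : ℝ, exp (-(2 * I * z * (s + I * b.re))) * dilogKernel b (s + I * b.re)

/-- The quantum dilogarithm in the strip `|Im z| < Q / 2`. -/
def dilog (b z : ℂ) : ℂ := exp (logDilog b z)

lemma dilog_ne_zero (b z : ℂ) : dilog b z ≠ 0 := exp_ne_zero _

namespace IsReduced

variable {b : ℂ} (hb : IsReduced b)
include hb

lemma ne_zero : b ≠ 0 := by rintro rfl; simpa using hb.re_pos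

lemma inv_re_pos : 0 < (b⁻¹).re := re_inv_pos hb.re_pos

lemma reQ_pos : 0 < reQ b := add_pos hb.re_pos hb.inv_re_pos

lemma two_re_le : 2 * b.re ≤ reQ b := by rw [reQ]; linarith [hb.re_le]

/-- Here the assumption that b is real or of modulus one enters: in the second case the inverse is
the conjugate. It makes b + b⁻¹ real, so that the half period iQ/2 is purely imaginary. -/
lemma inv_im : (b⁻¹).im = -b.im := by
  rcases hb.real_or_norm with h | h
  · simp [Complex.inv_im, h]
  · rw [Complex.inv_im, normSq_eq_norm_sq, h]; simp

lemma ofReal_reQ : (reQ b : ℂ) = b + b⁻¹ := by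
  apply Complex.ext <;> simp [reQ, hb.inv_im]

lemma contourHeight_eq : contourHeight b = b.re := by
  rw [contourHeight, abs_of_pos hb.re_pos, abs_of_pos hb.inv_re_pos, min_eq_left hb.re_le]

lemma qdilog_eq (x : ℝ) : qdilog b x = dilog b x := by
  simp only [qdilog, dilog, logDilog, dilogKernel, hb.contourHeight_eq, div_eq_mul_inv]

lemma re_lt_pi_mul_re : b.re < Real.pi * b.re := by
  nlinarith [Real.pi_gt_three, hb.re_pos]

lemma re_lt_pi_mul_inv_re : b.re < Real.pi * (b⁻¹).re := by
  nlinarith [Real.pi_gt_three, hb.re_pos, hb.re_le]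

lemma exists_norm_kernel_le_of_le : ∃ M C, 0 < M ∧ 0 < C ∧ ∀ w : ℂ,
    w.im ∈ Set.Icc (-b.re) b.re → M ≤ |w.re| →
      ‖dilogKernel b w‖ ≤ C * Real.exp (-reQ b * |w.re|) := by
  obtain ⟨M₁, C₁, hM₁, hC₁, h₁⟩ := exists_norm_inv_sinh_mul_le_of_le hb.re_pos (-b.re) b.re
  obtain ⟨M₂, C₂, hM₂, hC₂, h₂⟩ := exists_norm_inv_sinh_mul_le_of_le hb.inv_re_pos (-b.re) b.re
  refine ⟨max 1 (max M₁ M₂), C₁ * C₂, by positivity, by positivity, fun w hw hM => ?_⟩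
  have e1 := h₁ w hw ((le_max_left _ _).trans ((le_max_right _ _).trans hM))
  have e2 := h₂ w hw ((le_max_right _ _).trans ((le_max_right _ _).trans hM))
  have e3 : ‖w⁻¹‖ ≤ 1 := by
    rw [norm_inv]
    exact inv_le_one_of_one_le₀ (((le_max_left _ _).trans hM).trans (abs_re_le_norm w))
  rw [dilogKernel, mul_inv, mul_inv, norm_mul, norm_mul]
  calc _ ≤ (C₁ * Real.exp (-b.re * |w.re|)) * (C₂ * Real.exp (-(b⁻¹).re * |w.re|)) * 1 := by
        gcongr
    _ = C₁ * C₂ * (Real.exp (-b.re * |w.re|) * Real.exp (-(b⁻¹).re * |w.re|)) := by ring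
    _ = _ := by rw [← Real.exp_add, reQ]; ring_nf

lemma sinh_mul_ne_zero_of_im_eq {w : ℂ} (hw : w.im = b.re) : sinh (w * b) ≠ 0 :=
  sinh_mul_ne_zero hb.re_pos (hw ▸ hb.re_pos) (hw ▸ hb.re_lt_pi_mul_inv_re)

lemma sinh_mul_inv_ne_zero_of_im_eq {w : ℂ} (hw : w.im = b.re) : sinh (w * b⁻¹) ≠ 0 :=
  sinh_mul_ne_zero hb.inv_re_pos (hw ▸ hb.re_pos) (by rw [inv_inv, hw]; exact hb.re_lt_pi_mul_re)

lemma ne_zero_of_im_eq {w : ℂ} (hw : w.im = b.re) : w ≠ 0 := by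
  rintro rfl
  exact hb.re_pos.ne hw

omit hb in
lemma im_line (s : ℝ) : (s + I * b.re : ℂ).im = b.re := by simp

omit hb in
lemma re_line (s : ℝ) : (s + I * b.re : ℂ).re = s := by simp

lemma exists_norm_inv_sinh_inv_le : ∃ C, 0 < C ∧ ∀ s : ℝ,
    ‖(sinh ((s + I * b.re) * b⁻¹))⁻¹‖ ≤ C * Real.exp (-(b⁻¹).re * |s|) := by
  obtain ⟨C, hC, h⟩ := exists_norm_inv_sinh_mul_le (a := b.re) (d := b.re) hb.inv_re_pos
    fun w hw => hb.sinh_mul_inv_ne_zero_of_im_eq (le_antisymm hw.2 hw.1)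
  refine ⟨C, hC, fun s => ?_⟩
  have := h (s + I * b.re) (by simp)
  rwa [re_line] at this

lemma exists_norm_kernel_le : ∃ C, 0 < C ∧ ∀ s : ℝ,
    ‖dilogKernel b (s + I * b.re)‖ ≤ C * Real.exp (-reQ b * |s|) := by
  obtain ⟨C₁, hC₁, h₁⟩ := exists_norm_inv_sinh_mul_le (a := b.re) (d := b.re) hb.re_pos
    fun w hw => hb.sinh_mul_ne_zero_of_im_eq (le_antisymm hw.2 hw.1)
  obtain ⟨C₂, hC₂, h₂⟩ := hb.exists_norm_inv_sinh_inv_le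
  have hp := hb.re_pos
  refine ⟨C₁ * C₂ * (b.re)⁻¹, by positivity, fun s => ?_⟩
  have e1 := h₁ (s + I * b.re) (by simp)
  rw [re_line] at e1
  have e3 : ‖(s + I * b.re : ℂ)⁻¹‖ ≤ (b.re)⁻¹ := by
    rw [norm_inv]
    refine inv_anti₀ hp ?_
    have := abs_im_le_norm (s + I * b.re : ℂ)
    rwa [im_line, abs_of_pos hp] at this
  rw [dilogKernel, mul_inv, mul_inv, norm_mul, norm_mul]
  calc _ ≤ (C₁ * Real.exp (-b.re * |s|)) * (C₂ * Real.exp (-(b⁻¹).re * |s|)) * (b.re)⁻¹ := by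
        have := h₂ s
        gcongr
    _ = C₁ * C₂ * (b.re)⁻¹ * (Real.exp (-b.re * |s|) * Real.exp (-(b⁻¹).re * |s|)) := by ring
    _ = _ := by rw [← Real.exp_add, reQ]; ring_nf

lemma continuous_kernel : Continuous fun s : ℝ => dilogKernel b (s + I * b.re) := by
  refine Continuous.inv₀ (by fun_prop) fun s => ?_
  exact mul_ne_zero (mul_ne_zero (hb.sinh_mul_ne_zero_of_im_eq (im_line s))
    (hb.sinh_mul_inv_ne_zero_of_im_eq (im_line s))) (hb.ne_zero_of_im_eq (im_line s))

lemma hasDerivAt_logDilog {z : ℂ} (hz : |z.im| < reQ b / 2) :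
    HasDerivAt (logDilog b) (1 / 4 * ∫ s : ℝ, (-(2 * I * (s + I * b.re))) *
      (exp (-(2 * I * z * (s + I * b.re))) * dilogKernel b (s + I * b.re))) z := by
  obtain ⟨C, hC, h⟩ := hb.exists_norm_kernel_le
  exact (hasDerivAt_integral_exp_mul hb.continuous_kernel hC.le h hz).2.const_mul (1 / 4)

lemma differentiableAt_dilog {z : ℂ} (hz : |z.im| < reQ b / 2) : DifferentiableAt ℂ (dilog b) z :=
  (hb.hasDerivAt_logDilog hz).differentiableAt.cexp

lemma exists_norm_logDilog_le {δ : ℝ} (hδ : 0 < δ) : ∃ C, 0 < C ∧ ∀ z : ℂ,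
    |z.im| ≤ reQ b / 2 - δ → ‖logDilog b z‖ ≤ C * Real.exp (2 * b.re * z.re) := by
  obtain ⟨C, hC, h⟩ := hb.exists_norm_kernel_le
  refine ⟨1 / 4 * (C * ∫ s : ℝ, Real.exp (-(2 * δ) * |s|)) + 1, ?_, fun z hz => ?_⟩
  · have : 0 ≤ ∫ s : ℝ, Real.exp (-(2 * δ) * |s|) := integral_nonneg fun s => (Real.exp_pos _).le
    positivity
  · have := norm_integral_exp_mul_le (h := b.re) hC.le h hδ hz
    rw [logDilog, norm_mul]
    have e : ‖(1 / 4 : ℂ)‖ = 1 / 4 := by norm_num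
    rw [e, add_mul, one_mul, mul_assoc (1 / 4 : ℝ)]
    have := Real.exp_pos (2 * b.re * z.re)
    linarith

/-- Integrals of `e^{-2izw} / sinh (w/b)`. -/
lemma integral_exp_div_sinh {z : ℂ} (hz : |z.im| < (b⁻¹).re / 2) :
    (∫ s : ℝ, exp (-(2 * I * z * (s + I * b.re))) * (sinh ((s + I * b.re) * b⁻¹))⁻¹) *
      (1 + exp (2 * Real.pi * b * z)) = -(2 * Real.pi * I * b * exp (2 * Real.pi * b * z)) := by
  have hb0 := hb.ne_zero
  have hre := hb.re_pos
  have hpi := Real.pi_pos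
  set F : ℂ → ℂ := fun w => exp (-(2 * I * z * w)) * (sinh (w * b⁻¹))⁻¹ with hF
  -- The upper contour is the translate of the lower one by iπb, up to a horizontal shift by π Im b.
  -- This translation changes the sign of sinh(w/b) and multiplies the exponential by e^{2πbz}, and
  -- between the lines lies the single pole w₀ = iπb. Hence the integral times 1 + e^{2πbz} is 2πi
  -- times the residue.
  set d : ℝ := b.re + Real.pi * b.re with hd
  set w₀ : ℂ := Real.pi * (I * b) with hw₀
  have hw₀im : w₀.im = Real.pi * b.re := im_ofReal_mul_I_mul _ _
  have hne : ∀ w : ℂ, w.im ∈ Set.Icc b.re d → w ≠ w₀ → sinh (w * b⁻¹) ≠ 0 := by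
    intro w hw hne h
    refine hne ?_
    have := eq_of_sinh_mul_eq_zero hb.inv_re_pos (hre.trans_le hw.1) ?_ h
    · rwa [inv_inv] at this
    · rw [inv_inv]; linarith [hw.2, hb.re_lt_pi_mul_re]
  obtain ⟨M, C, hM, hC, hfar⟩ := exists_norm_inv_sinh_mul_le_of_le hb.inv_re_pos b.re d
  have hδ : 0 < (b⁻¹).re - 2 * |z.im| := by linarith
  set B : ℝ := Real.exp (2 * |z.re| * d) * C with hB
  have hFC : ∀ w : ℂ, w.im ∈ Set.Icc b.re d → M ≤ |w.re| →
      ‖F w‖ ≤ B * Real.exp (-((b⁻¹).re - 2 * |z.im|) * |w.re|) := by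
    intro w hw hwM
    have h1 := norm_exp_neg_two_I_mul_le z w
    have h2 : Real.exp (2 * z.re * w.im) ≤ Real.exp (2 * |z.re| * d) := by
      refine Real.exp_le_exp.2 ?_
      have := le_abs_self z.re
      nlinarith [hw.1, hw.2, abs_nonneg z.re]
    rw [hF, norm_mul]
    calc _ ≤ (Real.exp (2 * |z.re| * d) * Real.exp (2 * |z.im| * |w.re|)) *
          (C * Real.exp (-(b⁻¹).re * |w.re|)) := by
          refine mul_le_mul (h1.trans ?_) (hfar w hw hwM) (norm_nonneg _) (by positivity)
          gcongr
      _ = B * (Real.exp (2 * |z.im| * |w.re|) * Real.exp (-(b⁻¹).re * |w.re|)) := by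
          rw [hB]; ring
      _ = _ := by rw [← Real.exp_add]; ring_nf
  have hsd : ∀ w : ℂ, HasDerivAt (fun w => sinh (w * b⁻¹)) (cosh (w * b⁻¹) * b⁻¹) w := by
    intro w
    exact (((hasDerivAt_id' w).mul_const b⁻¹).csinh).congr_deriv (by ring)
  have hdF : ∀ w : ℂ, sinh (w * b⁻¹) ≠ 0 → DifferentiableAt ℂ F w := by
    intro w hw
    exact DifferentiableAt.mul (by fun_prop) ((hsd w).differentiableAt.inv hw)
  have hia : Integrable fun x : ℝ => F (x + (b.re : ℝ) * I) := by
    obtain ⟨C', hC', h'⟩ := hb.exists_norm_inv_sinh_inv_le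
    have hc : Continuous fun s : ℝ => (sinh ((s + I * b.re) * b⁻¹))⁻¹ :=
      Continuous.inv₀ (by fun_prop) fun s => hb.sinh_mul_inv_ne_zero_of_im_eq (im_line s)
    have := integrable_exp_mul (h := b.re) hc h' hz
    refine this.congr (ae_of_all _ fun s => ?_)
    simp only [hF, mul_comm I]
  have hshift : ∀ x : ℝ, F (x + (d : ℝ) * I) =
      -exp (2 * Real.pi * b * z) * F ((x + Real.pi * b.im : ℝ) + (b.re : ℝ) * I) := by
    intro x
    have e1 : (x + (d : ℝ) * I : ℂ) = ((x + Real.pi * b.im : ℝ) + (b.re : ℝ) * I) + w₀ := by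
      have eb := (re_add_im b).symm
      rw [hw₀, hd]; push_cast
      linear_combination (-(Real.pi : ℂ) * I) * eb - ((Real.pi : ℂ) * b.im) * I_sq
    rw [e1]
    set w : ℂ := (x + Real.pi * b.im : ℝ) + (b.re : ℝ) * I
    have e2 : (w + w₀) * b⁻¹ = w * b⁻¹ + Real.pi * I := by
      rw [hw₀]; field_simp
    simp only [hF]
    rw [e2, sinh_add, sinh_mul_I, cosh_mul_I, sin_pi, cos_pi]
    have e3 : exp (-(2 * I * z * (w + w₀))) = exp (2 * Real.pi * b * z) * exp (-(2 * I * z * w)) := by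
      rw [← exp_add]; congr 1; rw [hw₀]
      linear_combination (-2 * Real.pi * z * b) * I_sq
    rw [e3]
    simp only [mul_neg, mul_one, zero_mul, mul_zero, add_zero, inv_neg]
    ring
  have hid : Integrable fun x : ℝ => F (x + (d : ℝ) * I) := by
    simp_rw [hshift]
    exact (hia.comp_add_right (Real.pi * b.im)).const_mul _
  have hres : Tendsto (fun w => (w - w₀) * F w) (𝓝[≠] w₀)
      (𝓝 (-(b * exp (2 * Real.pi * b * z)))) := by
    have h1 := (hasDerivAt_iff_tendsto_slope.1 (hsd w₀))
    have e0 : w₀ * b⁻¹ = Real.pi * I := by rw [hw₀]; field_simp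
    rw [e0, cosh_mul_I, cos_pi] at h1
    have h2 := h1.inv₀ (by simpa using hb0)
    have h3 : Tendsto (fun w => exp (-(2 * I * z * w))) (𝓝[≠] w₀)
        (𝓝 (exp (-(2 * I * z * w₀)))) :=
      (Continuous.tendsto (by fun_prop) w₀).mono_left nhdsWithin_le_nhds
    have h4 := h3.mul h2
    have e5 : exp (-(2 * I * z * w₀)) * (-1 * b⁻¹)⁻¹ = -(b * exp (2 * Real.pi * b * z)) := by
      have : -(2 * I * z * w₀) = 2 * Real.pi * b * z := by
        rw [hw₀]; linear_combination (-2 * Real.pi * z * b) * I_sq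
      rw [this, neg_one_mul, inv_neg, inv_inv]; ring
    rw [e5] at h4
    refine h4.congr fun w => ?_
    rw [slope_def_field, e0, sinh_mul_I, sin_pi, zero_mul, sub_zero, inv_div]
    simp only [hF]
    ring
  have key := integral_horizontal_sub_eq (f := F) (a := b.re) (d := d) (w₀ := w₀)
    (ρ := -(b * exp (2 * Real.pi * b * z)))
    (g := fun x => B * Real.exp (-((b⁻¹).re - 2 * |z.im|) * |x|))
    (by rw [hw₀im]; exact hb.re_lt_pi_mul_re) (by rw [hw₀im, hd]; linarith)
    (fun w hw => (hdF w (hne w hw.1 hw.2)).continuousAt.continuousWithinAt)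
    (fun w hw hw' => hdF w (hne w (Set.Ioo_subset_Icc_self hw) hw')) hres
    (tendsto_exp_neg_mul_abs hδ B) ?_ hia hid
  · simp_rw [hshift] at key
    rw [integral_const_mul, integral_add_right_eq_self
      (fun x : ℝ => F ((x : ℝ) + (b.re : ℝ) * I))] at key
    have e : ∀ s : ℝ, exp (-(2 * I * z * (s + I * b.re))) * (sinh ((s + I * b.re) * b⁻¹))⁻¹ =
        F ((s : ℝ) + (b.re : ℝ) * I) := by
      intro s; simp only [hF, mul_comm I]
    simp_rw [e]
    linear_combination key
  · have : ∀ᶠ x : ℝ in cocompact ℝ, M ≤ |x| :=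
      (tendsto_norm_cocompact_atTop (E := ℝ)).eventually_ge_atTop M
    filter_upwards [this] with x hx y hy
    have := hFC (x + y * I) (by simpa using hy) (by simpa using hx)
    simpa using this

omit hb in
lemma isPreconnected_strip (r : ℝ) : IsPreconnected {z : ℂ | |z.im| < r} := by
  have : Convex ℝ {z : ℂ | |z.im| < r} := by
    have h : {z : ℂ | |z.im| < r} = imCLM ⁻¹' Set.Ioo (-r) r := by
      ext z; simp [abs_lt]
    rw [h]
    exact (convex_Ioo _ _).linear_preimage imCLM.toLinearMap
  exact this.isPreconnected

omit hb in
lemma isOpen_strip (r : ℝ) : IsOpen {z : ℂ | |z.im| < r} :=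
  isOpen_lt (by fun_prop) continuous_const

lemma abs_im_sub_lt {z : ℂ} (hz : |z.im| < (b⁻¹).re / 2) :
    |(z - I * b / 2).im| < reQ b / 2 ∧ |(z + I * b / 2).im| < reQ b / 2 := by
  have e1 : (z - I * b / 2).im = z.im - b.re / 2 := by simp
  have e2 : (z + I * b / 2).im = z.im + b.re / 2 := by simp
  rw [e1, e2, reQ]
  have := abs_lt.1 hz
  constructor <;> rw [abs_lt] <;> constructor <;> linarith [hb.re_pos]

/-- The functional equation of the quantum dilogarithm. -/
theorem dilog_sub_eq {z : ℂ} (hz : |z.im| < (b⁻¹).re / 2) :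
    dilog b (z - I * b / 2) = (1 + exp (2 * Real.pi * b * z)) * dilog b (z + I * b / 2) := by
  have hb0 := hb.ne_zero
  -- Differentiation brings down a factor w, and the difference of the two exponentials contains
  -- sinh(wb); they cancel all of the kernel except 1/sinh(w/b). So D' is given by
  -- `integral_exp_div_sinh`.
  set D : ℂ → ℂ := fun z => logDilog b (z - I * b / 2) - logDilog b (z + I * b / 2) with hD
  set S : Set ℂ := {z : ℂ | |z.im| < (b⁻¹).re / 2} with hS
  obtain ⟨C, hC, hker⟩ := hb.exists_norm_kernel_le
  have hder : ∀ z ∈ S, HasDerivAt D (I * ∫ s : ℝ, exp (-(2 * I * z * (s + I * b.re))) *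
      (sinh ((s + I * b.re) * b⁻¹))⁻¹) z := by
    intro z hz
    obtain ⟨h1, h2⟩ := hb.abs_im_sub_lt hz
    have d1 := (hb.hasDerivAt_logDilog h1).comp_sub_const z (I * b / 2)
    have d2 := (hb.hasDerivAt_logDilog h2).comp_add_const z (I * b / 2)
    refine (d1.sub d2).congr_deriv ?_
    rw [← mul_sub, ← integral_sub, ← integral_const_mul, ← integral_const_mul]
    · refine integral_congr_ae (ae_of_all _ fun s => ?_)
      simp only
      set w : ℂ := s + I * b.re with hw
      have him : w.im = b.re := im_line s
      have n1 := hb.sinh_mul_ne_zero_of_im_eq him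
      have n2 := hb.sinh_mul_inv_ne_zero_of_im_eq him
      have n3 := hb.ne_zero_of_im_eq him
      have e1 : exp (-(2 * I * (z - I * b / 2) * w)) - exp (-(2 * I * (z + I * b / 2) * w)) =
          -2 * sinh (w * b) * exp (-(2 * I * z * w)) := by
        have a1 : -(2 * I * (z - I * b / 2) * w) = -(2 * I * z * w) + -(w * b) := by
          linear_combination (b * w) * I_sq
        have a2 : -(2 * I * (z + I * b / 2) * w) = -(2 * I * z * w) + w * b := by
          linear_combination (-b * w) * I_sq
        rw [a1, a2, exp_add, exp_add, sinh]; ring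
      have e2 : dilogKernel b w = (sinh (w * b))⁻¹ * (sinh (w * b⁻¹))⁻¹ * w⁻¹ := by
        rw [dilogKernel, mul_inv, mul_inv]
      rw [← mul_sub, ← sub_mul, e1, e2]
      field_simp
      ring
    · exact (hasDerivAt_integral_exp_mul hb.continuous_kernel hC.le hker h1).1
    · exact (hasDerivAt_integral_exp_mul hb.continuous_kernel hC.le hker h2).1
  set E : ℂ → ℂ := fun z => exp (2 * Real.pi * b * z) with hE
  -- This function has derivative zero and equals its limit 1 at -∞ along the real line.
  set Φ : ℂ → ℂ := fun z => exp (-D z) * (1 + E z) with hΦ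
  have hΦd : ∀ z ∈ S, HasDerivAt Φ 0 z := by
    intro z hz
    have h1 := (hder z hz).fun_neg.cexp
    have h2 : HasDerivAt (fun z => 1 + E z) (E z * (2 * Real.pi * b)) z := by
      have := ((hasDerivAt_id' z).const_mul (2 * Real.pi * b)).cexp.const_add 1
      simpa using this
    refine (h1.mul h2).congr_deriv ?_
    have h3 := hb.integral_exp_div_sinh hz
    simp only [hE]
    linear_combination (-I * exp (-D z)) * h3 +
      (2 * Real.pi * b * exp (2 * Real.pi * b * z) * exp (-D z)) * I_sq
  have hconst : ∀ y ∈ S, Φ y = Φ z := by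
    intro y hy
    refine (isOpen_strip _).is_const_of_deriv_eq_zero (isPreconnected_strip _)
      (fun w hw => (hΦd w hw).differentiableAt.differentiableWithinAt)
      (fun w hw => (hΦd w hw).deriv) hy hz
  have hlim : Tendsto (fun t : ℝ => Φ t) atBot (𝓝 1) := by
    obtain ⟨K, hK, hKb⟩ := hb.exists_norm_logDilog_le (δ := (reQ b - b.re) / 2)
      (by linarith [hb.two_re_le, hb.re_pos])
    have hexp : ∀ c : ℝ, 0 < c → Tendsto (fun t : ℝ => Real.exp (c * t)) atBot (𝓝 0) := fun c hc =>
      Real.tendsto_exp_atBot.comp (tendsto_id.const_mul_atBot hc)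
    have hD0 : Tendsto (fun t : ℝ => D t) atBot (𝓝 0) := by
      refine squeeze_zero_norm' (a := fun t : ℝ =>
        K * Real.exp (2 * b.re * (t + b.im / 2)) + K * Real.exp (2 * b.re * (t - b.im / 2)))
        (Eventually.of_forall fun t => ?_) ?_
      · have e1 : (t - I * b / 2 : ℂ).im = - b.re / 2 := by simp; ring
        have e2 : (t + I * b / 2 : ℂ).im = b.re / 2 := by simp
        have e3 : (t - I * b / 2 : ℂ).re = t + b.im / 2 := by simp; ring
        have e4 : (t + I * b / 2 : ℂ).re = t - b.im / 2 := by simp; ring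
        have hp := hb.re_pos
        have k1 := hKb (t - I * b / 2) (by rw [e1, abs_le]; constructor <;> linarith)
        have k2 := hKb (t + I * b / 2) (by rw [e2, abs_le]; constructor <;> linarith)
        rw [e3] at k1
        rw [e4] at k2
        exact (norm_sub_le _ _).trans (add_le_add k1 k2)
      · have hp : 0 < 2 * b.re := by linarith [hb.re_pos]
        have t1 := (hexp _ hp).comp (tendsto_atBot_add_const_right atBot (b.im / 2) tendsto_id)
        have t2 := (hexp _ hp).comp (tendsto_atBot_add_const_right atBot (-(b.im / 2)) tendsto_id)
        have := (t1.const_mul K).add (t2.const_mul K)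
        simpa [Function.comp_def, sub_eq_add_neg] using this
    have hE0 : Tendsto (fun t : ℝ => E t) atBot (𝓝 0) := by
      rw [tendsto_zero_iff_norm_tendsto_zero]
      have hp : 0 < 2 * Real.pi * b.re := by have := hb.re_pos; positivity
      refine (hexp _ hp).congr fun t => ?_
      simp only [hE]
      rw [norm_exp]; congr 1
      simp [mul_assoc]
    have h3 := (continuous_exp.tendsto _).comp hD0.neg
    have := h3.mul (hE0.const_add 1)
    simpa [hΦ, Function.comp_def] using this
  have hΦ1 : Φ z = 1 := by
    refine tendsto_nhds_unique ?_ hlim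
    refine tendsto_const_nhds.congr fun t => ?_
    exact (hconst t (by simpa [hS] using hb.inv_re_pos)).symm
  simp only [dilog]
  have h4 : exp (D z) = 1 + E z := by
    calc exp (D z) = exp (D z) * Φ z := by rw [hΦ1, mul_one]
      _ = 1 + E z := by simp only [hΦ]; rw [← mul_assoc, ← exp_add, add_neg_cancel, exp_zero, one_mul]
  rw [show (1 + exp (2 * Real.pi * b * z) : ℂ) = 1 + E z from rfl, ← h4, ← exp_add]
  congr 1
  simp only [hD]; ring

end IsReduced


/-! ### Expansion at the triple pole and the inversion relation -/

lemma tendsto_of_norm_sub_le_mul {f : ℂ → ℂ} {l : ℂ} {C : ℝ} {s : Set ℂ} (hs : s ∈ 𝓝[≠] (0 : ℂ))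
    (h : ∀ w ∈ s, ‖f w - l‖ ≤ C * ‖w‖) : Tendsto f (𝓝[≠] 0) (𝓝 l) := by
  rw [tendsto_iff_norm_sub_tendsto_zero]
  have h1 : Tendsto (fun w : ℂ => C * ‖w‖) (𝓝[≠] 0) (𝓝 0) := by
    have : Tendsto (fun w : ℂ => C * ‖w‖) (𝓝 0) (𝓝 (C * ‖(0 : ℂ)‖)) :=
      Continuous.tendsto (by fun_prop) 0
    rw [norm_zero, mul_zero] at this
    exact this.mono_left nhdsWithin_le_nhds
  refine squeeze_zero' (Eventually.of_forall fun _ => norm_nonneg _) ?_ h1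
  filter_upwards [hs] with w hw using h w hw

lemma mem_nhdsNE_mul_le_one (a : ℂ) : {w : ℂ | w ≠ 0 ∧ ‖a * w‖ ≤ 1} ∈ 𝓝[≠] (0 : ℂ) := by
  have h1 : ∀ᶠ w : ℂ in 𝓝 0, ‖a * w‖ < 1 :=
    (Continuous.tendsto (f := fun w : ℂ => ‖a * w‖) (by fun_prop) 0).eventually_lt_const (by simp)
  filter_upwards [self_mem_nhdsWithin, nhdsWithin_le_nhds h1] with w hw hw' using ⟨hw, hw'.le⟩

lemma tendsto_exp_mul_sub_div_sq (a : ℂ) :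
    Tendsto (fun w => (exp (a * w) - 1 - a * w) / w ^ 2) (𝓝[≠] 0) (𝓝 (a ^ 2 / 2)) := by
  refine tendsto_of_norm_sub_le_mul (C := ‖a‖ ^ 3) (mem_nhdsNE_mul_le_one a) fun w hw => ?_
  obtain ⟨h0, h1⟩ := hw
  have h := exp_bound h1 (n := 3) (by norm_num)
  simp only [Finset.sum_range_succ, Finset.sum_range_zero, Nat.factorial] at h
  norm_num at h
  have e : (exp (a * w) - 1 - a * w) / w ^ 2 - a ^ 2 / 2 =
      (exp (a * w) - (1 + a * w + (a * w) ^ 2 / 2)) / w ^ 2 := by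
    field_simp; ring
  have hw0 : 0 < ‖w‖ := norm_pos_iff.2 h0
  rw [e, norm_div, norm_pow, div_le_iff₀ (by positivity)]
  refine h.trans ?_
  have : 0 ≤ (‖a‖ * ‖w‖) ^ 3 := by positivity
  nlinarith

lemma tendsto_sinh_mul_div_sub (a : ℂ) :
    Tendsto (fun w => (sinh (w * a) / w - a) / w ^ 2) (𝓝[≠] 0) (𝓝 (a ^ 3 / 6)) := by
  refine tendsto_of_norm_sub_le_mul (C := ‖a‖ ^ 4) (mem_nhdsNE_mul_le_one a) fun w hw => ?_
  obtain ⟨h0, h1⟩ := hw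
  have h := exp_bound h1 (n := 4) (by norm_num)
  have h' := exp_bound (x := -(a * w)) (by rwa [norm_neg]) (n := 4) (by norm_num)
  simp only [Finset.sum_range_succ, Finset.sum_range_zero, Nat.factorial] at h h'
  norm_num at h h'
  set u := a * w with hu
  have e : (sinh (w * a) / w - a) / w ^ 2 - a ^ 3 / 6 =
      ((exp u - (1 + u + u ^ 2 / 2 + u ^ 3 / 6)) -
        (exp (-u) - (1 + -u + u ^ 2 / 2 + (-u) ^ 3 / 6))) / (2 * w ^ 3) := by
    rw [sinh, show w * a = u by rw [hu]; ring]
    have : a = u / w := by rw [hu]; field_simp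
    rw [this]
    field_simp; ring
  have hw0 : 0 < ‖w‖ := norm_pos_iff.2 h0
  rw [e, norm_div, norm_mul, norm_pow, Complex.norm_ofNat, div_le_iff₀ (by positivity)]
  refine (norm_sub_le _ _).trans ((add_le_add h h').trans ?_)
  have : 0 ≤ (‖a‖ * ‖w‖) ^ 4 := by positivity
  nlinarith

lemma normSq_line (x y : ℝ) : ‖(x + y * I : ℂ)‖ ^ 2 = x ^ 2 + y ^ 2 := by
  rw [Complex.sq_norm, normSq_add_mul_I]

lemma line_ne_zero {y : ℝ} (hy : y ≠ 0) (x : ℝ) : (x + y * I : ℂ) ≠ 0 := by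
  intro h
  have := congrArg Complex.im h
  simp at this
  exact hy this

lemma integrable_inv_line_pow {y : ℝ} (hy : y ≠ 0) (n : ℕ) :
    Integrable fun x : ℝ => ((x + y * I : ℂ) ^ (n + 2))⁻¹ := by
  have hy2 : 0 < y ^ 2 := by positivity
  refine (integrable_inv_one_add_sq.const_mul ((1 + (y ^ 2)⁻¹) * (|y| ^ n)⁻¹)).mono'
    (Continuous.aestronglyMeasurable ?_) (ae_of_all _ fun x => ?_)
  · exact Continuous.inv₀ (by fun_prop) fun x => pow_ne_zero _ (line_ne_zero hy x)
  · rw [norm_inv, norm_pow, pow_add, mul_inv, normSq_line, mul_comm]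
    have h1 : (‖(x + y * I : ℂ)‖ ^ n)⁻¹ ≤ (|y| ^ n)⁻¹ := by
      have := abs_im_le_norm (x + y * I : ℂ)
      simp only [add_im, ofReal_im, mul_im, ofReal_re, I_im, mul_one, I_re, mul_zero, add_zero,
        zero_add] at this
      have hy' := abs_pos.2 hy
      gcongr
    have h2 : (x ^ 2 + y ^ 2)⁻¹ ≤ (1 + (y ^ 2)⁻¹) * (1 + x ^ 2)⁻¹ := by
      rw [← div_eq_mul_inv, le_div_iff₀ (by positivity), inv_mul_le_iff₀ (by positivity)]
      have : y ^ 2 * (y ^ 2)⁻¹ = 1 := mul_inv_cancel₀ hy2.ne'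
      have h3 : 0 ≤ x ^ 2 * (y ^ 2)⁻¹ := by positivity
      nlinarith
    calc _ ≤ ((1 + (y ^ 2)⁻¹) * (1 + x ^ 2)⁻¹) * (|y| ^ n)⁻¹ := by gcongr
      _ = _ := by ring

/-- The antiderivative is a negative power and vanishes at both ends. Hence double and triple poles
may be subtracted from an integrand without changing its integrals over horizontal lines. -/
lemma integral_inv_line_pow {y : ℝ} (hy : y ≠ 0) (n : ℕ) :
    ∫ x : ℝ, ((x + y * I : ℂ) ^ (n + 2))⁻¹ = 0 := by
  have hder : ∀ x : ℝ, HasDerivAt (fun x : ℝ => -(n + 1 : ℂ)⁻¹ * ((x + y * I : ℂ) ^ (n + 1))⁻¹)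
      ((x + y * I : ℂ) ^ (n + 2))⁻¹ x := by
    intro x
    have hx := line_ne_zero hy x
    have h1 : HasDerivAt (fun x : ℝ => (x + y * I : ℂ)) 1 x :=
      (hasDerivAt_id x).ofReal_comp.add_const _
    have h2 := ((h1.fun_pow (n + 1)).fun_inv (pow_ne_zero _ hx)).const_mul (-(n + 1 : ℂ)⁻¹)
    refine h2.congr_deriv ?_
    have hn : (n + 1 : ℂ) ≠ 0 := by exact_mod_cast n.succ_ne_zero
    push_cast
    field_simp
    ring
  have hnorm : Tendsto (fun x : ℝ => ‖(x + y * I : ℂ)‖) (cocompact ℝ) atTop := by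
    refine tendsto_atTop_mono (fun x => ?_) (tendsto_norm_cocompact_atTop (E := ℝ))
    have := abs_re_le_norm (x + y * I : ℂ)
    simpa using this
  have hlim : Tendsto (fun x : ℝ => -(n + 1 : ℂ)⁻¹ * ((x + y * I : ℂ) ^ (n + 1))⁻¹)
      (cocompact ℝ) (𝓝 0) := by
    rw [tendsto_zero_iff_norm_tendsto_zero]
    have h1 := (tendsto_inv_atTop_zero.comp
      ((tendsto_pow_atTop (n := n + 1) (by omega)).comp hnorm)).const_mul ‖-(n + 1 : ℂ)⁻¹‖
    rw [mul_zero] at h1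
    refine h1.congr fun x => ?_
    rw [norm_mul, norm_inv ((_ : ℂ) ^ _), norm_pow]; rfl
  have := integral_of_hasDerivAt_of_tendsto hder (integrable_inv_line_pow hy n)
    (hlim.mono_left (by rw [cocompact_eq_atBot_atTop]; exact le_sup_left))
    (hlim.mono_left (by rw [cocompact_eq_atBot_atTop]; exact le_sup_right))
  simpa using this

lemma differentiableAt_poles (c : ℂ) {w : ℂ} (hw : w ≠ 0) :
    DifferentiableAt ℂ (fun w : ℂ => (w ^ 3)⁻¹ + c * (w ^ 2)⁻¹) w := by
  have h3 : w ^ 3 ≠ 0 := pow_ne_zero _ hw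
  have h2 : w ^ 2 ≠ 0 := pow_ne_zero _ hw
  have d3 : DifferentiableAt ℂ (fun w : ℂ => w ^ 3) w := by fun_prop
  have d2 : DifferentiableAt ℂ (fun w : ℂ => w ^ 2) w := by fun_prop
  exact (d3.fun_inv h3).fun_add ((d2.fun_inv h2).const_mul c)

namespace IsReduced

variable {b : ℂ} (hb : IsReduced b)
include hb

/-- The expansion of the kernel at its triple pole. -/
lemma tendsto_kernel_expansion (c : ℂ) :
    Tendsto (fun w => (w - 0) * (exp (c * w) * dilogKernel b w - ((w ^ 3)⁻¹ + c * (w ^ 2)⁻¹)))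
      (𝓝[≠] 0) (𝓝 (c ^ 2 / 2 - (b ^ 2 + b⁻¹ ^ 2) / 6)) := by
  have hb0 := hb.ne_zero
  -- The kernel is w⁻³ S(w)⁻¹ with S = 1 + (b² + b⁻²)w²/6 + o(w²), so the residue is the coefficient
  -- of w² in e^{cw} S(w)⁻¹.
  set S : ℂ → ℂ := fun w => (sinh (w * b) / w) * (sinh (w * b⁻¹) / w) with hS
  have hid : Tendsto (fun w : ℂ => w) (𝓝[≠] 0) (𝓝 0) := tendsto_id.mono_left nhdsWithin_le_nhds
  have hsq : Tendsto (fun w : ℂ => w ^ 2) (𝓝[≠] 0) (𝓝 0) := by simpa using hid.pow 2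
  have hX := tendsto_sinh_mul_div_sub b
  have hY := tendsto_sinh_mul_div_sub b⁻¹
  set X : ℂ → ℂ := fun w => (sinh (w * b) / w - b) / w ^ 2 with hXd
  set Y : ℂ → ℂ := fun w => (sinh (w * b⁻¹) / w - b⁻¹) / w ^ 2 with hYd
  have hS2 : Tendsto (fun w => (S w - 1) / w ^ 2) (𝓝[≠] 0) (𝓝 ((b ^ 2 + b⁻¹ ^ 2) / 6)) := by
    have h := ((hY.const_mul b).add (hX.mul_const b⁻¹)).add (hsq.mul (hX.mul hY))
    have e : b * (b⁻¹ ^ 3 / 6) + b ^ 3 / 6 * b⁻¹ + 0 * (b ^ 3 / 6 * (b⁻¹ ^ 3 / 6)) =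
        (b ^ 2 + b⁻¹ ^ 2) / 6 := by
      field_simp; ring
    rw [e] at h
    refine h.congr' ?_
    filter_upwards [self_mem_nhdsWithin] with w hw
    have hw : w ≠ 0 := hw
    simp only [hXd, hYd, hS]
    field_simp
    ring
  have hS1 : Tendsto S (𝓝[≠] 0) (𝓝 1) := by
    have h := (hsq.mul hS2).const_add 1
    rw [zero_mul, add_zero] at h
    refine h.congr' ?_
    filter_upwards [self_mem_nhdsWithin] with w hw
    have hw : w ≠ 0 := hw
    field_simp; ring
  have hT1 := hS1.inv₀ one_ne_zero
  rw [inv_one] at hT1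
  have hlim := ((tendsto_exp_mul_sub_div_sq c).mul hT1).sub
    (((hid.const_mul c).const_add 1).mul (hS2.mul hT1))
  have e : c ^ 2 / 2 * 1 - (1 + c * 0) * ((b ^ 2 + b⁻¹ ^ 2) / 6 * 1) =
      c ^ 2 / 2 - (b ^ 2 + b⁻¹ ^ 2) / 6 := by ring
  rw [e] at hlim
  refine hlim.congr' ?_
  have hSne : ∀ᶠ w in 𝓝[≠] (0 : ℂ), S w ≠ 0 := hS1.eventually_ne one_ne_zero
  filter_upwards [self_mem_nhdsWithin, hSne] with w hw hSw
  have hw : w ≠ 0 := hw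
  have hk : dilogKernel b w = (w ^ 3)⁻¹ * (S w)⁻¹ := by
    rw [dilogKernel, ← mul_inv]
    congr 1
    simp only [hS]
    field_simp
  rw [hk]
  field_simp
  ring

set_option maxHeartbeats 800000 in
/-- `log φ(z) + log φ(-z)` is a residue at the origin. -/
lemma logDilog_add_neg {z : ℂ} (hz : |z.im| < reQ b / 2) :
    logDilog b z + logDilog b (-z) =
      I * Real.pi * z ^ 2 + I * Real.pi * (b ^ 2 + b⁻¹ ^ 2) / 12 := by
  have hre := hb.re_pos
  obtain ⟨C, hC, hker⟩ := hb.exists_norm_kernel_le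
  obtain ⟨M, K, hM, hK, hfar⟩ := hb.exists_norm_kernel_le_of_le
  set G : ℂ → ℂ := fun w => exp (-(2 * I * z) * w) * dilogKernel b w with hG
  -- The polar part of order two and three. Its integrals over both lines vanish, so the residue
  -- theorem for a simple pole can be applied to G - P.
  set P : ℂ → ℂ := fun w => (w ^ 3)⁻¹ + -(2 * I * z) * (w ^ 2)⁻¹ with hP
  have hup : ∀ x : ℝ, G (x + (b.re : ℝ) * I) =
      exp (-(2 * I * z * (x + I * b.re))) * dilogKernel b (x + I * b.re) := by
    intro x
    simp only [hG, mul_comm (b.re : ℂ) I]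
    congr 2; ring
  -- The kernel is odd, so w ↦ -w carries the lower line to the upper one and replaces z by -z.
  have hlow : ∀ x : ℝ, G (x + (-b.re : ℝ) * I) =
      -(exp (-(2 * I * -z * ((-x : ℝ) + I * b.re))) * dilogKernel b ((-x : ℝ) + I * b.re)) := by
    intro x
    have e : (x + (-b.re : ℝ) * I : ℂ) = -((-x : ℝ) + I * b.re) := by push_cast; ring
    simp only [hG]
    rw [e]
    set w : ℂ := (-x : ℝ) + I * b.re
    rw [dilogKernel, dilogKernel, neg_mul w, neg_mul w, sinh_neg, sinh_neg, neg_mul_neg,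
      mul_neg, inv_neg, mul_neg]
    congr 3 <;> ring
  have hiU : Integrable fun x : ℝ => G (x + (b.re : ℝ) * I) := by
    simp_rw [hup]
    exact integrable_exp_mul hb.continuous_kernel hker hz
  have hiL : Integrable fun x : ℝ => G (x + (-b.re : ℝ) * I) := by
    simp_rw [hlow]
    exact (integrable_exp_mul hb.continuous_kernel hker (z := -z) (by simpa using hz)).comp_neg.neg
  have hiP : ∀ y : ℝ, y ≠ 0 → Integrable fun x : ℝ => P (x + y * I) := fun y hy =>
    (integrable_inv_line_pow hy 1).add ((integrable_inv_line_pow hy 0).const_mul _)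
  have hPint : ∀ y : ℝ, y ≠ 0 → ∫ x : ℝ, P (x + y * I) = 0 := by
    intro y hy
    simp only [hP]
    rw [integral_add (integrable_inv_line_pow hy 1) ((integrable_inv_line_pow hy 0).const_mul _),
      integral_const_mul, integral_inv_line_pow hy 1, integral_inv_line_pow hy 0]
    simp
  have hIU : ∫ x : ℝ, G (x + (b.re : ℝ) * I) = 4 * logDilog b z := by
    simp_rw [hup, logDilog]; ring
  have hIL : ∫ x : ℝ, G (x + (-b.re : ℝ) * I) = -(4 * logDilog b (-z)) := by
    simp_rw [hlow]
    rw [integral_neg, integral_neg_eq_self (fun x : ℝ =>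
      exp (-(2 * I * -z * ((x : ℝ) + I * b.re))) * dilogKernel b ((x : ℝ) + I * b.re)), logDilog]
    ring
  have hne : ∀ w : ℂ, w.im ∈ Set.Icc (-b.re) b.re → w ≠ 0 →
      sinh (w * b) * sinh (w * b⁻¹) * w ≠ 0 := by
    intro w hw hw0
    have him : |w.im| ≤ b.re := abs_le.2 hw
    refine mul_ne_zero (mul_ne_zero (fun h => hw0 ?_) (fun h => hw0 ?_)) hw0
    · exact eq_zero_of_sinh_mul_eq_zero hb.re_pos (him.trans_lt hb.re_lt_pi_mul_inv_re) h
    · exact eq_zero_of_sinh_mul_eq_zero hb.inv_re_pos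
        (by rw [inv_inv]; exact him.trans_lt hb.re_lt_pi_mul_re) h
  have hd : ∀ w : ℂ, w.im ∈ Set.Icc (-b.re) b.re → w ≠ 0 →
      DifferentiableAt ℂ (fun w => G w - P w) w := by
    intro w hw hw0
    have h1 : DifferentiableAt ℂ (dilogKernel b) w := by
      refine DifferentiableAt.inv ?_ (hne w hw hw0)
      fun_prop
    have h2 : DifferentiableAt ℂ P w := differentiableAt_poles _ hw0
    exact (DifferentiableAt.mul (by fun_prop) h1).sub h2
  set B : ℝ := Real.exp (2 * |z.re| * b.re) * K with hB
  have hδ : 0 < reQ b - 2 * |z.im| := by linarith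
  have key := integral_horizontal_sub_eq (f := fun w => G w - P w) (a := -b.re) (d := b.re)
    (w₀ := 0) (g := fun x => B * Real.exp (-(reQ b - 2 * |z.im|) * |x|) +
      (|x|⁻¹ ^ 3 + ‖2 * I * z‖ * |x|⁻¹ ^ 2)) (by simpa using hre) (by simpa using hre)
    (fun w hw => (hd w hw.1 hw.2).continuousAt.continuousWithinAt)
    (fun w hw hw' => hd w (Set.Ioo_subset_Icc_self hw) hw')
    (hb.tendsto_kernel_expansion (-(2 * I * z))) ?_ ?_
    (hiL.sub (hiP _ (neg_ne_zero.2 hre.ne'))) (hiU.sub (hiP _ hre.ne'))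
  · rw [integral_sub hiL (hiP _ (neg_ne_zero.2 hre.ne')), integral_sub hiU (hiP _ hre.ne'),
      hPint _ hre.ne', hPint _ (neg_ne_zero.2 hre.ne'), hIU, hIL] at key
    linear_combination (-1 / 4 : ℂ) * key + (-Real.pi * I * z ^ 2) * I_sq
  · have h0 : Tendsto (fun x : ℝ => |x|⁻¹) (cocompact ℝ) (𝓝 0) :=
      tendsto_inv_atTop_zero.comp (tendsto_norm_cocompact_atTop (E := ℝ))
    have h1 := (tendsto_exp_neg_mul_abs hδ B).add
      ((h0.pow 3).add ((h0.pow 2).const_mul ‖2 * I * z‖))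
    simpa using h1
  · have : ∀ᶠ x : ℝ in cocompact ℝ, M ≤ |x| :=
      (tendsto_norm_cocompact_atTop (E := ℝ)).eventually_ge_atTop M
    filter_upwards [this] with x hx y hy
    set w : ℂ := x + y * I with hw
    have hwre : w.re = x := by simp [hw]
    have hwim : w.im = y := by simp [hw]
    have hx0 : 0 < |x| := hM.trans_le hx
    have hxw : |x| ≤ ‖w‖ := by rw [← hwre]; exact abs_re_le_norm w
    have k1 := hfar w (by rwa [hwim]) (by rwa [hwre])
    have k2 := norm_exp_neg_two_I_mul_le z w
    rw [hwre] at k1 k2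
    have k3 : Real.exp (2 * z.re * w.im) ≤ Real.exp (2 * |z.re| * b.re) := by
      refine Real.exp_le_exp.2 ?_
      have h1 := le_abs_self (z.re * w.im)
      rw [abs_mul] at h1
      have h2 : |w.im| ≤ b.re := by rw [hwim]; exact abs_le.2 hy
      nlinarith [abs_nonneg z.re]
    have hwi : ‖w‖⁻¹ ≤ |x|⁻¹ := inv_anti₀ hx0 hxw
    refine (norm_sub_le _ _).trans (add_le_add ?_ ?_)
    · simp only [hG]
      rw [norm_mul, neg_mul]
      calc _ ≤ (Real.exp (2 * |z.re| * b.re) * Real.exp (2 * |z.im| * |x|)) *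
            (K * Real.exp (-reQ b * |x|)) := by
            refine mul_le_mul (k2.trans ?_) k1 (norm_nonneg _) (by positivity)
            gcongr
        _ = B * (Real.exp (2 * |z.im| * |x|) * Real.exp (-reQ b * |x|)) := by
            rw [hB]; ring
        _ = _ := by rw [← Real.exp_add]; ring_nf
    · simp only [hP]
      refine (norm_add_le _ _).trans ?_
      rw [norm_mul, norm_neg, norm_inv, norm_inv, norm_pow, norm_pow, ← inv_pow, ← inv_pow]
      gcongr

/-- The constant `κ` of the inversion relation. -/
lemma dilog_mul_neg {z : ℂ} (hz : |z.im| < reQ b / 2) :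
    dilog b z * dilog b (-z) =
      exp (I * Real.pi * (b ^ 2 + b⁻¹ ^ 2) / 12) * exp (I * Real.pi * z ^ 2) := by
  rw [dilog, dilog, ← exp_add, hb.logDilog_add_neg hz, ← exp_add, add_comm]

/-- The modulus of the quantum dilogarithm, up to bounded factors. -/
theorem exists_norm_dilog_bounds {δ : ℝ} (hδ : 0 < δ) :
    ∃ K, 1 ≤ K ∧ ∀ z : ℂ, |z.im| ≤ reQ b / 2 - δ →
      ‖dilog b z‖ ≤ K * Real.exp (-(2 * Real.pi * max z.re 0 * z.im)) ∧
      ‖(dilog b z)⁻¹‖ ≤ K * Real.exp (2 * Real.pi * max z.re 0 * z.im) := by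
  obtain ⟨C, hC, h⟩ := hb.exists_norm_logDilog_le hδ
  have hreb := hb.re_pos
  -- For Re z ≤ 0 the logarithm itself is bounded. For Re z ≥ 0 the inversion relation reduces to -z
  -- at the price of |e^{iπz²}| = e^{-2π Re z Im z}, which is the exponential in the bounds.
  have hleft : ∀ z : ℂ, |z.im| ≤ reQ b / 2 - δ → z.re ≤ 0 →
      ‖dilog b z‖ ≤ Real.exp C ∧ ‖(dilog b z)⁻¹‖ ≤ Real.exp C := by
    intro z hz hz0
    have h1 : ‖logDilog b z‖ ≤ C := by
      refine (h z hz).trans (mul_le_of_le_one_right hC.le (Real.exp_le_one_iff.2 ?_))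
      nlinarith
    have h2 := (abs_re_le_norm _).trans h1
    rw [abs_le] at h2
    rw [dilog, ← exp_neg, norm_exp, norm_exp, neg_re]
    exact ⟨Real.exp_le_exp.2 h2.2, Real.exp_le_exp.2 (by linarith)⟩
  set κ : ℂ := exp (I * Real.pi * (b ^ 2 + b⁻¹ ^ 2) / 12) with hκ
  have hκ0 : 0 < ‖κ‖ := norm_pos_iff.2 (exp_ne_zero _)
  refine ⟨Real.exp C * (1 + ‖κ‖ + ‖κ‖⁻¹), ?_, fun z hz => ?_⟩
  · have := Real.one_le_exp hC.le
    have : 0 < ‖κ‖⁻¹ := by positivity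
    nlinarith
  have hE := Real.exp_pos C
  have hκi : 0 < ‖κ‖⁻¹ := by positivity
  rcases le_total z.re 0 with h0 | h0
  · rw [max_eq_right h0]
    obtain ⟨h1, h2⟩ := hleft z hz h0
    simp only [mul_zero, zero_mul, neg_zero, Real.exp_zero, mul_one]
    constructor <;> nlinarith
  · rw [max_eq_left h0]
    obtain ⟨h1, h2⟩ := hleft (-z) (by simpa using hz) (by simpa using h0)
    have hinv := hb.dilog_mul_neg (z := z) (by linarith)
    have hg : ‖exp (I * Real.pi * z ^ 2)‖ = Real.exp (-(2 * Real.pi * z.re * z.im)) := by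
      rw [norm_exp]; congr 1
      simp [pow_two, mul_re, mul_im]; ring
    have hz1 : dilog b z = κ * exp (I * Real.pi * z ^ 2) * (dilog b (-z))⁻¹ := by
      rw [← hinv]; field_simp [dilog_ne_zero]
    have hz2 : (dilog b z)⁻¹ = κ⁻¹ * (exp (I * Real.pi * z ^ 2))⁻¹ * dilog b (-z) := by
      rw [hz1, mul_inv, mul_inv, inv_inv]
    rw [hz2, hz1, norm_mul, norm_mul, norm_mul, norm_mul, norm_inv κ, norm_inv (exp _), hg,
      ← Real.exp_neg, neg_neg]
    have p1 := Real.exp_pos (-(2 * Real.pi * z.re * z.im))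
    have p2 := Real.exp_pos (2 * Real.pi * z.re * z.im)
    constructor
    · calc _ ≤ ‖κ‖ * Real.exp (-(2 * Real.pi * z.re * z.im)) * Real.exp C := by gcongr
        _ = (Real.exp C * ‖κ‖) * Real.exp (-(2 * Real.pi * z.re * z.im)) := by ring
        _ ≤ _ := by
          refine mul_le_mul_of_nonneg_right ?_ p1.le
          nlinarith
    · calc _ ≤ ‖κ‖⁻¹ * Real.exp (2 * Real.pi * z.re * z.im) * Real.exp C := by gcongr
        _ = (Real.exp C * ‖κ‖⁻¹) * Real.exp (2 * Real.pi * z.re * z.im) := by ring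
        _ ≤ _ := by
          refine mul_le_mul_of_nonneg_right ?_ p2.le
          nlinarith

end IsReduced


/-! ### The beta integral -/

/-- An integral depending on a parameter is holomorphic if the integrand is, and is locally
dominated. -/
lemma differentiableAt_integral_of_dominated {F : ℂ → ℝ → ℂ} {u₀ : ℂ} {r : ℝ} (hr : 0 < r)
    (hm : ∀ u ∈ Metric.ball u₀ (2 * r), AEStronglyMeasurable (F u))
    (hd : ∀ x : ℝ, ∀ u ∈ Metric.ball u₀ (2 * r), DifferentiableAt ℂ (fun u => F u x) u)
    {g : ℝ → ℝ} (hg : Integrable g) (hb : ∀ x : ℝ, ∀ u ∈ Metric.ball u₀ (2 * r), ‖F u x‖ ≤ g x) :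
    DifferentiableAt ℂ (fun u => ∫ x, F u x) u₀ := by
  have h0 : u₀ ∈ Metric.ball u₀ (2 * r) := Metric.mem_ball_self (by linarith)
  have hsub : Metric.ball u₀ r ⊆ Metric.ball u₀ (2 * r) := Metric.ball_subset_ball (by linarith)
  refine (hasDerivAt_integral_of_dominated_loc_of_deriv_le (μ := volume) (𝕜 := ℂ)
    (s := Metric.ball u₀ r) (bound := fun x => g x / (r / 2)) (F := F)
    (F' := fun u x => deriv (fun u => F u x) u) (Metric.ball_mem_nhds u₀ hr)
    ?_ (hg.mono' (hm _ h0) (ae_of_all _ fun x => hb x _ h0)) ?_ ?_ ?_ ?_).2.differentiableAt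
  · filter_upwards [Metric.ball_mem_nhds u₀ hr] with u hu using hm u (hsub hu)
  -- The derivative is measurable in x as a limit of difference quotients along u₀ + r/(n + 1).
  · have hseq : ∀ n : ℕ, u₀ + (r / (n + 1) : ℝ) ∈ Metric.ball u₀ (2 * r) := by
      intro n
      rw [mem_ball_iff_norm, add_sub_cancel_left, norm_real, Real.norm_of_nonneg (by positivity)]
      have : r / (n + 1) ≤ r := div_le_self hr.le (by linarith [n.cast_nonneg (α := ℝ)])
      linarith
    refine aestronglyMeasurable_of_tendsto_ae atTop
      (f := fun (n : ℕ) (x : ℝ) => ((r / (n + 1) : ℝ) : ℂ)⁻¹ *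
        (F (u₀ + (r / (n + 1) : ℝ)) x - F u₀ x)) (fun n => ?_) (ae_of_all _ fun x => ?_)
    · exact ((hm _ (hseq n)).sub (hm _ h0)).const_mul _
    · have h1 := (hd x u₀ h0).hasDerivAt.tendsto_slope_zero
      refine h1.comp (f := fun n : ℕ => ((r / (n + 1) : ℝ) : ℂ)) ?_
      refine tendsto_nhdsWithin_iff.2 ⟨?_, Eventually.of_forall fun n => ?_⟩
      · have := (tendsto_const_div_atTop_nhds_zero_nat r).comp (tendsto_add_atTop_nat 1)
        have h2 := (continuous_ofReal.tendsto 0).comp this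
        simpa [Function.comp_def] using h2
      · have : (r / (n + 1) : ℝ) ≠ 0 := by positivity
        exact ofReal_ne_zero.2 this
  -- Cauchy's estimate on circles of radius r/2 bounds the derivative by g/(r/2).
  · refine ae_of_all _ fun x u hu => ?_
    have hin : Metric.closedBall u (r / 2) ⊆ Metric.ball u₀ (2 * r) := by
      intro w hw
      rw [Metric.mem_closedBall] at hw
      rw [Metric.mem_ball] at hu ⊢
      linarith [dist_triangle w u u₀]
    refine norm_deriv_le_of_forall_mem_sphere_norm_le (by linarith) ?_ fun w hw =>
      hb x w (hin (Metric.sphere_subset_closedBall hw))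
    refine DifferentiableOn.diffContOnCl ?_
    refine fun w hw => (hd x w (hin ?_)).differentiableWithinAt
    exact closure_minimal Metric.ball_subset_closedBall Metric.isClosed_closedBall hw
  · exact hg.div_const _
  · exact ae_of_all _ fun x u hu => (hd x u (hsub hu)).hasDerivAt

/-- `e^{-2πicx}` -/
def planeWave (c x : ℂ) : ℂ := exp (-(2 * Real.pi * I * c * x))

lemma norm_planeWave (c x : ℂ) :
    ‖planeWave c x‖ = Real.exp (2 * Real.pi * (c.im * x.re + c.re * x.im)) := by
  rw [planeWave, norm_exp]; congr 1
  simp [mul_re, mul_im]; ring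

lemma planeWave_add_right (c x y : ℂ) : planeWave c (x + y) = planeWave c x * planeWave c y := by
  rw [planeWave, planeWave, planeWave, ← exp_add]; congr 1; ring

lemma planeWave_add_left (c d x : ℂ) : planeWave (c + d) x = planeWave c x * planeWave d x := by
  rw [planeWave, planeWave, planeWave, ← exp_add]; congr 1; ring

/-- The integrand of the beta integral of the quantum dilogarithm. -/
def betaFun (b u c x : ℂ) : ℂ := dilog b x * (dilog b (x + u))⁻¹ * planeWave c x

/-- The beta integral of the quantum dilogarithm along the line `ℝ + iτ`. -/
def betaInt (b : ℂ) (τ : ℝ) (u c : ℂ) : ℂ := ∫ x : ℝ, betaFun b u c (x + τ * I)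

/-- The Fourier transform of the quantum dilogarithm along the line `ℝ + iτ`. -/
def dilogTransform (b : ℂ) (τ : ℝ) (c : ℂ) : ℂ :=
  ∫ x : ℝ, dilog b (x + τ * I) * planeWave c (x + τ * I)

namespace IsReduced

variable {b : ℂ} (hb : IsReduced b)
include hb

lemma continuous_dilog_comp {X : Type*} [TopologicalSpace X] {g : X → ℂ} (hg : Continuous g)
    (h : ∀ x, |(g x).im| < reQ b / 2) : Continuous fun x => dilog b (g x) :=
  continuous_iff_continuousAt.2 fun x =>
    ContinuousAt.comp (f := g) (hb.differentiableAt_dilog (h x)).continuousAt hg.continuousAt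

lemma exists_norm_betaFun_le {σ : ℝ} (hσ : 0 < σ) : ∃ K, 0 < K ∧ ∀ u c x : ℂ,
    |x.im| ≤ reQ b / 2 - σ → |(x + u).im| ≤ reQ b / 2 - σ →
    ‖betaFun b u c x‖ ≤ K * Real.exp (2 * Real.pi * (-(max x.re 0 * x.im) +
      max (x + u).re 0 * (x + u).im + c.im * x.re + c.re * x.im)) := by
  obtain ⟨K, hK, h⟩ := hb.exists_norm_dilog_bounds hσ
  refine ⟨K * K, by positivity, fun u c x h1 h2 => ?_⟩
  rw [betaFun, norm_mul, norm_mul, norm_planeWave]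
  calc _ ≤ (K * Real.exp (-(2 * Real.pi * max x.re 0 * x.im))) *
        (K * Real.exp (2 * Real.pi * max (x + u).re 0 * (x + u).im)) *
        Real.exp (2 * Real.pi * (c.im * x.re + c.re * x.im)) := by
        have a1 := (h x h1).1
        have a2 := (h _ h2).2
        gcongr
    _ = K * K * (Real.exp (-(2 * Real.pi * max x.re 0 * x.im)) *
        Real.exp (2 * Real.pi * max (x + u).re 0 * (x + u).im) *
        Real.exp (2 * Real.pi * (c.im * x.re + c.re * x.im))) := by ring
    _ = _ := by rw [← Real.exp_add, ← Real.exp_add]; ring_nf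

omit hb in
lemma max_mul_le (x u y : ℝ) : max (x + u) 0 * y ≤ max x 0 * y + |u| * |y| := by
  have h1 : |max (x + u) 0 - max x 0| ≤ |u| := by
    have := abs_max_sub_max_le_abs (x + u) x 0
    simpa using this
  have h2 := le_abs_self ((max (x + u) 0 - max x 0) * y)
  rw [abs_mul] at h2
  nlinarith [abs_nonneg y]

omit hb in
-- The left side has slope η on the negative axis and η - w on the positive one. It is the exponent
-- of the beta integrand along a contour, which therefore decays at both ends.
lemma mul_max_add_mul_le {δ η w : ℝ} (h1 : δ ≤ η) (h2 : δ ≤ w - η) (x : ℝ) :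
    -(w * max x 0) + η * x ≤ -(δ * |x|) := by
  rcases le_total x 0 with h | h
  · rw [max_eq_right h, abs_of_nonpos h]; nlinarith
  · rw [max_eq_left h, abs_of_nonneg h]; nlinarith

/-- Decay to the left is governed by Im c, decay to the right by -Im u - Im c, so the beta integral
converges for 0 < Im c < -Im u; the constant is uniform for bounded Re u. -/
lemma exists_norm_betaFun_le_exp {σ : ℝ} (hσ : 0 < σ) (M : ℝ) (c : ℂ) {δ : ℝ} (hδ : δ ≤ c.im) :
    ∃ K, 0 < K ∧ ∀ u x : ℂ, |u.re| ≤ M → δ ≤ -u.im - c.im → |x.im| ≤ reQ b / 2 - σ →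
      |(x + u).im| ≤ reQ b / 2 - σ →
      ‖betaFun b u c x‖ ≤ K * Real.exp (-(2 * Real.pi * δ) * |x.re|) := by
  obtain ⟨K, hK, h⟩ := hb.exists_norm_betaFun_le hσ
  refine ⟨K * Real.exp (2 * Real.pi * (M * (reQ b / 2) + |c.re| * (reQ b / 2))), by positivity,
    fun u x hu hδ' h1 h2 => (h u c x h1 h2).trans ?_⟩
  rw [mul_assoc K, ← Real.exp_add]
  refine mul_le_mul_of_nonneg_left (Real.exp_le_exp.2 ?_) hK.le
  have hM : 0 ≤ M := (abs_nonneg _).trans hu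
  have e1 := max_mul_le x.re u.re (x + u).im
  have e2 := mul_max_add_mul_le hδ hδ' x.re
  have e3 : |u.re| * |(x + u).im| ≤ M * (reQ b / 2) :=
    mul_le_mul hu (by linarith) (abs_nonneg _) hM
  have e4 : c.re * x.im ≤ |c.re| * (reQ b / 2) := by
    have := le_abs_self (c.re * x.im)
    rw [abs_mul] at this
    exact this.trans (mul_le_mul_of_nonneg_left (by linarith) (abs_nonneg _))
  rw [add_re, add_im] at *
  have : -(max x.re 0 * x.im) + max (x.re + u.re) 0 * (x.im + u.im) + c.im * x.re + c.re * x.im ≤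
      M * (reQ b / 2) + |c.re| * (reQ b / 2) - δ * |x.re| := by
    nlinarith
  have hp := Real.two_pi_pos
  nlinarith

lemma differentiableAt_betaFun {u c x : ℂ} (h1 : |x.im| < reQ b / 2)
    (h2 : |(x + u).im| < reQ b / 2) : DifferentiableAt ℂ (betaFun b u c) x := by
  have d1 := hb.differentiableAt_dilog h1
  have d2 : DifferentiableAt ℂ (fun x => dilog b (x + u)) x :=
    
    DifferentiableAt.comp (g := dilog b) (f := fun x => x + u) x (hb.differentiableAt_dilog h2)
      (by fun_prop)
  have d3 : DifferentiableAt ℂ (planeWave c) x := by unfold planeWave; fun_prop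
  exact (d1.mul (d2.inv (dilog_ne_zero _ _))).mul d3

lemma continuous_betaFun_line {u c : ℂ} {τ : ℝ} (h1 : |τ| < reQ b / 2)
    (h2 : |τ + u.im| < reQ b / 2) : Continuous fun x : ℝ => betaFun b u c (x + τ * I) := by
  refine continuous_iff_continuousAt.2 fun x => ?_
  refine ContinuousAt.comp (f := fun x : ℝ => (x + τ * I : ℂ))
    (hb.differentiableAt_betaFun ?_ ?_).continuousAt (by fun_prop)
  · simpa using h1
  · simpa using h2

lemma exists_norm_betaFun_line_le {u c : ℂ} {τ : ℝ} (h1 : |τ| < reQ b / 2)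
    (h2 : |τ + u.im| < reQ b / 2) (hc : 0 < c.im) (huc : u.im < -c.im) :
    ∃ δ K, 0 < δ ∧ ∀ x : ℝ, ‖betaFun b u c (x + τ * I)‖ ≤ K * Real.exp (-δ * |x|) := by
  set σ := min (reQ b / 2 - |τ|) (reQ b / 2 - |τ + u.im|) with hσ
  set δ := min c.im (-u.im - c.im) with hδ
  have hσ0 : 0 < σ := lt_min (by linarith) (by linarith)
  have hδ0 : 0 < δ := lt_min hc (by linarith)
  obtain ⟨K, hK, h⟩ := hb.exists_norm_betaFun_le_exp hσ0 |u.re| c (min_le_left c.im (-u.im - c.im))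
  refine ⟨2 * Real.pi * δ, K, by positivity, fun x => ?_⟩
  have := h u (x + τ * I) le_rfl (min_le_right _ _) ?_ ?_
  · simpa using this
  · have := min_le_left (reQ b / 2 - |τ|) (reQ b / 2 - |τ + u.im|)
    simp only [add_im, ofReal_im, mul_im, ofReal_re, I_im, I_re, mul_one, mul_zero, zero_add,
      add_zero]
    linarith
  · have := min_le_right (reQ b / 2 - |τ|) (reQ b / 2 - |τ + u.im|)
    simp only [add_im, ofReal_im, mul_im, ofReal_re, I_im, I_re, mul_one, mul_zero, zero_add,
      add_zero]
    linarith

lemma integrable_betaFun {u c : ℂ} {τ : ℝ} (h1 : |τ| < reQ b / 2)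
    (h2 : |τ + u.im| < reQ b / 2) (hc : 0 < c.im) (huc : u.im < -c.im) :
    Integrable fun x : ℝ => betaFun b u c (x + τ * I) := by
  obtain ⟨δ, K, hδ, h⟩ := hb.exists_norm_betaFun_line_le h1 h2 hc huc
  exact ((integrable_exp_neg_mul_abs hδ).const_mul K).mono'
    (hb.continuous_betaFun_line h1 h2).aestronglyMeasurable (ae_of_all _ h)

/-- The beta integral does not depend on the contour. -/
lemma betaInt_eq_of_le {u c : ℂ} {τ₁ τ₂ : ℝ} (h : τ₁ ≤ τ₂) (h1 : |τ₁| < reQ b / 2)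
    (h1' : |τ₁ + u.im| < reQ b / 2) (h2 : |τ₂| < reQ b / 2) (h2' : |τ₂ + u.im| < reQ b / 2)
    (hc : 0 < c.im) (huc : u.im < -c.im) : betaInt b τ₁ u c = betaInt b τ₂ u c := by
  set m := max (max |τ₁| |τ₂|) (max |τ₁ + u.im| |τ₂ + u.im|) with hm
  have hm' : m < reQ b / 2 := max_lt (max_lt h1 h2) (max_lt h1' h2')
  have a1 : |τ₁| ≤ m := (le_max_left _ _).trans (le_max_left _ _)
  have a2 : |τ₂| ≤ m := (le_max_right _ _).trans (le_max_left _ _)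
  have a3 : |τ₁ + u.im| ≤ m := (le_max_left _ _).trans (le_max_right _ _)
  have a4 : |τ₂ + u.im| ≤ m := (le_max_right _ _).trans (le_max_right _ _)
  have hx1 : ∀ y ∈ Set.Icc τ₁ τ₂, |y| ≤ m := fun y hy =>
    abs_le.2 ⟨by linarith [(abs_le.1 a1).1, hy.1], by linarith [(abs_le.1 a2).2, hy.2]⟩
  have hx2 : ∀ y ∈ Set.Icc τ₁ τ₂, |y + u.im| ≤ m := fun y hy =>
    abs_le.2 ⟨by linarith [(abs_le.1 a3).1, hy.1], by linarith [(abs_le.1 a4).2, hy.2]⟩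
  set δ := min c.im (-u.im - c.im) with hδ
  have hδ0 : 0 < δ := lt_min hc (by linarith)
  obtain ⟨K, hK, hbd⟩ := hb.exists_norm_betaFun_le_exp (σ := reQ b / 2 - m) (by linarith) |u.re| c
    (min_le_left c.im (-u.im - c.im))
  have hd : ∀ w : ℂ, w.im ∈ Set.Icc τ₁ τ₂ → DifferentiableAt ℂ (betaFun b u c) w := fun w hw =>
    hb.differentiableAt_betaFun ((hx1 _ hw).trans_lt hm')
      (by rw [add_im]; exact (hx2 _ hw).trans_lt hm')
  refine integral_horizontal_eq (f := betaFun b u c)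
    (g := fun x => K * Real.exp (-(2 * Real.pi * δ) * |x|)) h
    (fun w hw => (hd w hw).continuousAt.continuousWithinAt)
    (fun w hw => hd w (Set.Ioo_subset_Icc_self hw))
    (tendsto_exp_neg_mul_abs (by positivity) K) (Eventually.of_forall fun x y hy => ?_)
    (hb.integrable_betaFun h1 h1' hc huc) (hb.integrable_betaFun h2 h2' hc huc)
  have := hbd u (x + y * I) le_rfl (min_le_right _ _) ?_ ?_
  · simpa using this
  · simpa using hx1 y hy
  · simpa using hx2 y hy

lemma betaInt_eq {u c : ℂ} {τ₁ τ₂ : ℝ} (h1 : |τ₁| < reQ b / 2)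
    (h1' : |τ₁ + u.im| < reQ b / 2) (h2 : |τ₂| < reQ b / 2) (h2' : |τ₂ + u.im| < reQ b / 2)
    (hc : 0 < c.im) (huc : u.im < -c.im) : betaInt b τ₁ u c = betaInt b τ₂ u c := by
  rcases le_total τ₁ τ₂ with h | h
  · exact hb.betaInt_eq_of_le h h1 h1' h2 h2' hc huc
  · exact (hb.betaInt_eq_of_le h h2 h2' h1 h1' hc huc).symm

/-- The functional equation recentred, with e^{2πbx} written as `planeWave (I * b) x` so that it
merges with the plane wave of the beta integral. -/
lemma dilog_sub_I_mul {x : ℂ} (h1 : x.im < reQ b / 2) (h2 : -(reQ b / 2) < x.im - b.re) :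
    dilog b (x - I * b) = (1 + exp (-(I * Real.pi * b ^ 2)) * planeWave (I * b) x) * dilog b x := by
  have h := hb.dilog_sub_eq (z := x - I * b / 2) ?_
  · have e1 : x - I * b / 2 - I * b / 2 = x - I * b := by ring
    have e2 : x - I * b / 2 + I * b / 2 = x := by ring
    rw [e1, e2] at h
    rw [h, planeWave, ← exp_add]
    congr 3
    linear_combination (2 * Real.pi * b * x) * I_sq
  · have e : (x - I * b / 2).im = x.im - b.re / 2 := by simp
    rw [e, abs_lt]
    rw [reQ] at h1 h2
    constructor <;> linarith

lemma dilog_eq_add_I_mul {x : ℂ} (h1 : x.im + b.re < reQ b / 2) (h2 : -(reQ b / 2) < x.im) :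
    dilog b x = (1 + exp (I * Real.pi * b ^ 2) * planeWave (I * b) x) * dilog b (x + I * b) := by
  have h := hb.dilog_sub_I_mul (x := x + I * b) (by simpa using h1) (by simpa using h2)
  rw [add_sub_cancel_right] at h
  have e : exp (-(I * Real.pi * b ^ 2)) * planeWave (I * b) (I * b) =
      exp (I * Real.pi * b ^ 2) := by
    rw [planeWave, ← exp_add]; congr 1
    linear_combination (-2 * Real.pi * I * b ^ 2) * I_sq
  rw [h, planeWave_add_right, mul_comm (planeWave (I * b) x), ← mul_assoc, e]

end IsReduced


/-! ### Difference equations for the beta integral, and its value up to a constant -/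

lemma planeWave_comm (c x : ℂ) : planeWave c x = planeWave x c := by
  rw [planeWave, planeWave]; congr 1; ring

lemma planeWave_mul_neg (c x : ℂ) : planeWave c x * planeWave c (-x) = 1 := by
  rw [← planeWave_add_right, add_neg_cancel, planeWave]; simp

/-- `iQ/2` -/
def halfPeriod (b : ℂ) : ℂ := I * (reQ b / 2 : ℝ)

lemma halfPeriod_im (b : ℂ) : (halfPeriod b).im = reQ b / 2 := by
  rw [halfPeriod, I_mul_im, ofReal_re]

lemma halfPeriod_re (b : ℂ) : (halfPeriod b).re = 0 := by
  rw [halfPeriod, I_mul_re, ofReal_im, neg_zero]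

namespace IsReduced

variable {b : ℂ} (hb : IsReduced b)
include hb

/-- The functional equation acts on the factor 1/φ(x + u); the additional factor e^{2πbx} raises c
by ib. -/
lemma betaInt_add_I_mul {u c : ℂ} {τ : ℝ} (hc : 0 < c.im) (hu : u.im + b.re < -c.im)
    (h0 : 0 < τ) (h1 : τ < reQ b / 2) (h2 : -(reQ b / 2) < τ + u.im) :
    betaInt b τ (u + I * b) c = betaInt b τ u c +
      exp (I * Real.pi * b ^ 2) * planeWave (I * b) u * betaInt b τ u (c + I * b) := by
  have hre := hb.re_pos
  have e1 : |τ| < reQ b / 2 := by rwa [abs_of_pos h0]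
  have e2 : |τ + u.im| < reQ b / 2 := abs_lt.2 ⟨h2, by linarith⟩
  have i1 := hb.integrable_betaFun (u := u) (c := c) e1 e2 hc (by linarith)
  have i2 := hb.integrable_betaFun (u := u) (c := c + I * b) e1 e2
    (by rw [add_im, I_mul_im]; linarith) (by rw [add_im, I_mul_im]; linarith)
  simp only [betaInt]
  rw [← integral_const_mul, ← integral_add i1 (i2.const_mul _)]
  refine integral_congr_ae (ae_of_all _ fun x => ?_)
  beta_reduce
  set w : ℂ := x + τ * I with hw
  have hwim : w.im = τ := by simp [hw]
  have h := hb.dilog_eq_add_I_mul (x := w + u)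
    (by rw [add_im, hwim]; linarith [hb.two_re_le]) (by rw [add_im, hwim]; exact h2)
  simp only [betaFun]
  rw [← add_assoc]
  have n1 := dilog_ne_zero b (w + u)
  have n2 := dilog_ne_zero b (w + u + I * b)
  have h' : (dilog b (w + u + I * b))⁻¹ =
      (1 + exp (I * Real.pi * b ^ 2) * planeWave (I * b) (w + u)) * (dilog b (w + u))⁻¹ := by
    rw [eq_mul_inv_iff_mul_eq₀ n1, h]; field_simp
  rw [h', planeWave_add_right, planeWave_add_left]
  ring

/-- Here the functional equation acts on φ(x), after a translation of the contour by -ib: the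
imaginary part lowers τ by Re b, and the real part Im b is a change of variable. -/
lemma betaInt_sub_add_I_mul {u c : ℂ} {τ : ℝ} (hc : 0 < c.im) (hu : u.im + b.re < -c.im)
    (h0 : 0 < τ) (h1 : τ < reQ b / 2) (h2 : -(reQ b / 2) < τ + u.im) :
    betaInt b (τ - b.re) (u + I * b) c = planeWave c (-(I * b)) * (betaInt b τ u c +
      exp (-(I * Real.pi * b ^ 2)) * betaInt b τ u (c + I * b)) := by
  have hre := hb.re_pos
  have e1 : |τ| < reQ b / 2 := by rwa [abs_of_pos h0]
  have e2 : |τ + u.im| < reQ b / 2 := abs_lt.2 ⟨h2, by linarith⟩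
  have i1 := hb.integrable_betaFun (u := u) (c := c) e1 e2 hc (by linarith)
  have i2 := hb.integrable_betaFun (u := u) (c := c + I * b) e1 e2
    (by rw [add_im, I_mul_im]; linarith) (by rw [add_im, I_mul_im]; linarith)
  simp only [betaInt]
  rw [← integral_const_mul, ← integral_add i1 (i2.const_mul _), ← integral_const_mul,
    ← integral_add_right_eq_self _ b.im]
  refine integral_congr_ae (ae_of_all _ fun x => ?_)
  beta_reduce
  set w : ℂ := x + τ * I with hw
  have hwim : w.im = τ := by simp [hw]
  have ew : ((x + b.im : ℝ) : ℂ) + ((τ - b.re : ℝ) : ℂ) * I = w - I * b := by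
    have eb := (re_add_im b).symm
    rw [hw]; push_cast
    linear_combination I * eb + (b.im : ℂ) * I_sq
  rw [ew]
  clear_value w
  have h := hb.dilog_sub_I_mul (x := w) (by rw [hwim]; exact h1)
    (by rw [hwim]; linarith [hb.two_re_le])
  simp only [betaFun]
  rw [h, sub_eq_add_neg w, planeWave_add_right c w, planeWave_add_left c (I * b) w,
    show w + -(I * b) + (u + I * b) = w + u by ring]
  ring

/-- Since b(b + b⁻¹) = b² + 1, the summand 1 contributes e^{iπ} = -1. -/
lemma planeWave_halfPeriod :
    planeWave (I * b) (halfPeriod b) = -exp (I * Real.pi * b ^ 2) := by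
  have hb0 := hb.ne_zero
  have e : -(2 * Real.pi * I * (I * b) * halfPeriod b) = I * Real.pi * b ^ 2 + Real.pi * I := by
    rw [halfPeriod]; push_cast; rw [hb.ofReal_reQ]
    have : b * (b + b⁻¹) = b ^ 2 + 1 := by field_simp
    linear_combination (-Real.pi * I ^ 3) * this - (Real.pi * I * (b ^ 2 + 1)) * I_sq
  rw [planeWave, e, exp_add, exp_pi_mul_I, mul_neg_one]

lemma dilog_add_halfPeriod {u : ℂ} (h1 : u.im + b.re < 0) (h2 : -reQ b < u.im) :
    dilog b (u + halfPeriod b) =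
      (1 - exp (I * Real.pi * b ^ 2) ^ 2 * planeWave (I * b) u) *
        dilog b (u + I * b + halfPeriod b) := by
  rw [hb.dilog_eq_add_I_mul (by rw [add_im, halfPeriod_im]; linarith)
    (by rw [add_im, halfPeriod_im]; linarith), planeWave_add_right, hb.planeWave_halfPeriod,
    add_right_comm]
  ring

/-- The ratio of the beta integral to its value. -/
lemma betaInt_mul_dilog_periodic {u c : ℂ} {τ : ℝ} (hc : 0 < c.im) (hu : u.im + b.re < -c.im)
    (hu' : -reQ b < u.im) (h0 : 0 < τ) (h1 : τ < reQ b / 2) (h2 : -(reQ b / 2) < τ + u.im) :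
    betaInt b τ (u + I * b) c *
        (dilog b (u + I * b + halfPeriod b) / dilog b (c + (u + I * b) + halfPeriod b)) =
      betaInt b τ u c * (dilog b (u + halfPeriod b) / dilog b (c + u + halfPeriod b)) := by
  have hre := hb.re_pos
  have two := hb.two_re_le
  have hB1 := hb.betaInt_add_I_mul hc hu h0 h1 h2
  have hB2 := hb.betaInt_sub_add_I_mul hc hu h0 h1 h2
  have hu1 : (u + I * b).im = u.im + b.re := by rw [add_im, I_mul_im]
  -- Contour independence identifies the left sides of the two difference equations.
  have hcont := hb.betaInt_eq (u := u + I * b) (c := c) (τ₁ := τ) (τ₂ := τ - b.re)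
    (abs_lt.2 ⟨by linarith, h1⟩) (by rw [hu1]; exact abs_lt.2 ⟨by linarith, by linarith⟩)
    (abs_lt.2 ⟨by linarith, by linarith⟩)
    (by rw [hu1]; exact abs_lt.2 ⟨by linarith, by linarith⟩) hc (by rw [hu1]; exact hu)
  rw [← hcont] at hB2
  have d1 := hb.dilog_add_halfPeriod (u := u) (by linarith) hu'
  have d2 := hb.dilog_add_halfPeriod (u := c + u) (by rw [add_im]; linarith)
    (by rw [add_im]; linarith)
  rw [add_assoc c u] at d2
  have n1 := dilog_ne_zero b (c + u + halfPeriod b)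
  have n2 := dilog_ne_zero b (c + (u + I * b) + halfPeriod b)
  have hZ := planeWave_mul_neg c (I * b)
  rw [planeWave_comm c (I * b)] at hZ
  rw [planeWave_add_right] at d2
  have hq : exp (I * Real.pi * b ^ 2) * exp (-(I * Real.pi * b ^ 2)) = 1 := by
    rw [← exp_add, add_neg_cancel, exp_zero]
  set q := exp (I * Real.pi * b ^ 2)
  set q' := exp (-(I * Real.pi * b ^ 2))
  set Z := planeWave (I * b) c
  set Z' := planeWave c (-(I * b))
  set P := planeWave (I * b) u
  set B := betaInt b τ u c
  set B₁ := betaInt b τ (u + I * b) c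
  set B₂ := betaInt b τ u (c + I * b)
  -- Eliminating B(u, c + ib) leaves a first order equation in u, the one that the quotient of
  -- dilogarithms satisfies inversely.
  have key : (1 - q ^ 2 * (Z * P)) * B₁ = (1 - q ^ 2 * P) * B := by
    linear_combination hB1 - (q ^ 2 * P * Z) * hB2 - (q ^ 2 * P * (B + q' * B₂)) * hZ -
      (q * P * B₂) * hq
  have e1 : c + (u + I * b) + halfPeriod b = c + u + I * b + halfPeriod b := by ring
  have e2 : c + u + halfPeriod b = c + (u + halfPeriod b) := by ring
  rw [e1] at n2 ⊢
  rw [e2] at n1 ⊢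
  rw [mul_div_assoc', mul_div_assoc', div_eq_div_iff n2 n1, d1, d2]
  linear_combination (dilog b (u + I * b + halfPeriod b) *
    dilog b (c + u + I * b + halfPeriod b)) * key

/-- Bound for the beta integral. -/
lemma exists_norm_betaInt_le {c : ℂ} (hc : 0 < c.im) {δ : ℝ} (hδ : 0 < δ) :
    ∃ K, ∀ u : ℂ, 2 * c.im + δ ≤ -u.im → -u.im ≤ reQ b - δ →
      ‖betaInt b (-u.im / 2) u c‖ ≤ K * Real.exp (-(2 * Real.pi * c.im * max u.re 0)) := by
  obtain ⟨K, hK, h⟩ := hb.exists_norm_betaFun_le (σ := δ / 2) (by positivity)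
  set δ' := min c.im (δ / 2) with hδ'
  have hδ'0 : 0 < δ' := lt_min hc (by positivity)
  set A : ℝ := K * Real.exp (2 * Real.pi * (|c.re| * reQ b)) with hA
  refine ⟨A * ∫ x : ℝ, Real.exp (-(2 * Real.pi * δ') * |x|), fun u hu1 hu2 => ?_⟩
  set v := -u.im with hv
  have hQ := hb.reQ_pos
  -- At height -Im u / 2 the points x and x + u have opposite imaginary parts, so both dilogarithm
  -- factors decay to the right. The exponent is largest at -max(Re u, 0), which produces the factor
  -- e^{-2π Im c max(Re u, 0)}.
  have hpt : ∀ x : ℝ, ‖betaFun b u c (x + (v / 2 : ℝ) * I)‖ ≤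
      A * Real.exp (-(2 * Real.pi * c.im * max u.re 0)) *
        Real.exp (-(2 * Real.pi * δ') * |x + max u.re 0|) := by
    intro x
    have a1 : (x + (v / 2 : ℝ) * I : ℂ).im = v / 2 := by simp
    have a2 : (x + (v / 2 : ℝ) * I : ℂ).re = x := by simp
    have a3 : (x + (v / 2 : ℝ) * I + u : ℂ).im = -(v / 2) := by rw [add_im, a1, hv]; ring
    have a4 : (x + (v / 2 : ℝ) * I + u : ℂ).re = x + u.re := by rw [add_re, a2]
    have hv0 : 0 < v / 2 := by linarith
    have hb1 := h u c (x + (v / 2 : ℝ) * I)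
      (by rw [a1, abs_of_pos hv0]; linarith) (by rw [a3, abs_neg, abs_of_pos hv0]; linarith)
    rw [a1, a2, a3, a4] at hb1
    refine hb1.trans ?_
    rw [hA, mul_assoc K, mul_assoc K, ← Real.exp_add, ← Real.exp_add]
    refine mul_le_mul_of_nonneg_left (Real.exp_le_exp.2 ?_) hK.le
    have m1 : δ' ≤ c.im := min_le_left _ _
    have m2 : δ' ≤ v / 2 - c.im := (min_le_right _ _).trans (by linarith)
    have e1 : c.re * (v / 2) ≤ |c.re| * reQ b := by
      have := le_abs_self c.re
      have := abs_nonneg c.re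
      nlinarith
    have e2 : -(max x 0 * (v / 2)) + max (x + u.re) 0 * -(v / 2) + c.im * x ≤
        -(c.im * max u.re 0) - δ' * |x + max u.re 0| := by
      rcases le_total u.re 0 with h0 | h0
      · rw [max_eq_right h0, add_zero]
        have := mul_max_add_mul_le m1 m2 x
        have h3 : 0 ≤ max (x + u.re) 0 := le_max_right _ _
        nlinarith
      · rw [max_eq_left h0]
        have := mul_max_add_mul_le m1 m2 (x + u.re)
        have h3 : 0 ≤ max x 0 := le_max_right _ _
        nlinarith
    have hp := Real.two_pi_pos
    nlinarith
  rw [betaInt]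
  have hint : Integrable fun x : ℝ => Real.exp (-(2 * Real.pi * δ') * |x + max u.re 0|) :=
    (integrable_exp_neg_mul_abs (δ := 2 * Real.pi * δ') (by positivity)).comp_add_right _
  refine (norm_integral_le_of_norm_le (hint.const_mul _) (ae_of_all _ hpt)).trans_eq ?_
  rw [integral_const_mul, integral_add_right_eq_self
    (fun x : ℝ => Real.exp (-(2 * Real.pi * δ') * |x|))]
  ring

/-- The contour moves with u, but near u₀ it can be frozen at height -Im u₀ / 2 by contour
independence; on a fixed contour the integrand is holomorphic in u and dominated. -/
lemma differentiableAt_betaInt {c u₀ : ℂ} (hc : 0 < c.im) (h1 : -reQ b < u₀.im)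
    (h2 : u₀.im < -c.im) :
    DifferentiableAt ℂ (fun u : ℂ => betaInt b (-u.im / 2) u c) u₀ := by
  have hQ := hb.reQ_pos
  set v := -u₀.im with hv
  set r := min ((reQ b - v) / 16) ((v - c.im) / 16) with hr
  have hr0 : 0 < r := lt_min (by linarith) (by linarith)
  have hr1 : r ≤ (reQ b - v) / 16 := min_le_left _ _
  have hr2 : r ≤ (v - c.im) / 16 := min_le_right _ _
  have hball : ∀ u ∈ Metric.ball u₀ (2 * r), |u.im + v| < 2 * r ∧ |u.re - u₀.re| < 2 * r := by
    intro u hu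
    rw [mem_ball_iff_norm] at hu
    have a1 := (abs_im_le_norm (u - u₀)).trans_lt hu
    have a2 := (abs_re_le_norm (u - u₀)).trans_lt hu
    rw [sub_im] at a1
    rw [sub_re] at a2
    exact ⟨by rwa [hv, ← sub_eq_add_neg], a2⟩
  have hτ : |v / 2| < reQ b / 2 := by rw [abs_of_pos (by linarith)]; linarith
  have hτu : ∀ u ∈ Metric.ball u₀ (2 * r), |v / 2 + u.im| ≤ reQ b / 2 - (reQ b - v) / 4 := by
    intro u hu
    have := abs_lt.1 (hball u hu).1
    rw [abs_le]; constructor <;> linarith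
  have hτu' : ∀ u ∈ Metric.ball u₀ (2 * r), |v / 2 + u.im| < reQ b / 2 := fun u hu =>
    (hτu u hu).trans_lt (by linarith)
  have hev : (fun u : ℂ => betaInt b (-u.im / 2) u c) =ᶠ[𝓝 u₀] fun u => betaInt b (v / 2) u c := by
    filter_upwards [Metric.ball_mem_nhds u₀ (by linarith : 0 < 2 * r)] with u hu
    have := abs_lt.1 (hball u hu).1
    refine hb.betaInt_eq ?_ ?_ hτ (hτu' u hu) hc (by linarith)
    · rw [abs_lt]; constructor <;> linarith
    · rw [abs_lt]; constructor <;> linarith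
  refine DifferentiableAt.congr_of_eventuallyEq ?_ hev
  set δ := min c.im ((v - c.im) / 2) with hδ
  have hδ0 : 0 < δ := lt_min hc (by linarith)
  obtain ⟨K, hK, h⟩ := hb.exists_norm_betaFun_le_exp (σ := (reQ b - v) / 4) (by linarith)
    (|u₀.re| + 2 * r) c (min_le_left c.im ((v - c.im) / 2))
  refine differentiableAt_integral_of_dominated (F := fun u x => betaFun b u c (x + (v / 2 : ℝ) * I))
    (g := fun x => K * Real.exp (-(2 * Real.pi * δ) * |x|)) hr0 (fun u hu => ?_)
    (fun x u hu => ?_) ((integrable_exp_neg_mul_abs (by positivity)).const_mul K)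
    (fun x u hu => ?_)
  · exact (hb.continuous_betaFun_line hτ (hτu' u hu)).aestronglyMeasurable
  · have him : (x + (v / 2 : ℝ) * I + u : ℂ).im = v / 2 + u.im := by simp
    have d1 : DifferentiableAt ℂ (fun u : ℂ => dilog b (x + (v / 2 : ℝ) * I + u)) u :=
      DifferentiableAt.comp (g := dilog b) (f := fun u : ℂ => x + (v / 2 : ℝ) * I + u) u
        (hb.differentiableAt_dilog (by rw [him]; exact hτu' u hu)) (by fun_prop)
    exact ((d1.fun_inv (dilog_ne_zero _ _)).const_mul _).mul_const _
  · have b1 := hball u hu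
    have b2 := abs_lt.1 b1.1
    have := h u (x + (v / 2 : ℝ) * I) ?_ ?_ ?_ ?_
    · simpa using this
    · linarith [abs_sub_abs_le_abs_sub u.re u₀.re]
    · refine (min_le_right _ _).trans ?_; linarith
    · have : (x + (v / 2 : ℝ) * I : ℂ).im = v / 2 := by simp
      rw [this, abs_of_pos (by linarith)]; linarith
    · have him : (x + (v / 2 : ℝ) * I + u : ℂ).im = v / 2 + u.im := by simp
      rw [him]; exact hτu u hu

/-- The product is ib-periodic in u (`betaInt_mul_dilog_periodic`) and bounded on a substrip at
least as high as the period, because the exponential rates of its three factors cancel as Re u → +∞.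
-/
lemma exists_betaInt_mul_eq_const {c : ℂ} (hc : 0 < c.im) (hc' : c.im < reQ b / 4) :
    ∃ C, ∀ u : ℂ, -reQ b < u.im → u.im < -c.im →
      betaInt b (-u.im / 2) u c * (dilog b (u + halfPeriod b) / dilog b (c + u + halfPeriod b)) =
        C := by
  have hre := hb.re_pos
  have two := hb.two_re_le
  -- With this δ the strip -Q + δ ≤ Im u ≤ -2 Im c - δ has height 3Q/4 - Im c ≥ Q/2 ≥ Re b, as
  -- periodicity requires.
  set δ := (reQ b / 4 - c.im) / 2 with hδ
  have hδ0 : 0 < δ := by simp only [hδ]; linarith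
  obtain ⟨K₁, h₁⟩ := hb.exists_norm_betaInt_le hc hδ0
  obtain ⟨K₂, hK₂, h₂⟩ := hb.exists_norm_dilog_bounds hδ0
  have him : ∀ u : ℂ, (u + halfPeriod b).im = reQ b / 2 + u.im := fun u => by
    rw [add_im, halfPeriod_im]; ring
  have him' : ∀ u : ℂ, (c + u + halfPeriod b).im = reQ b / 2 + c.im + u.im := fun u => by
    rw [add_im, add_im, halfPeriod_im]; ring
  refine exists_eq_const_of_periodic_strip (ω := I * b) (a' := -reQ b + δ) (d' := -2 * c.im - δ)
    (C := K₁ * (K₂ * (K₂ * Real.exp (2 * Real.pi * (|c.re| * reQ b)))))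
    (by rw [I_mul_im]; exact hre) (by linarith) (by linarith)
    (by rw [I_mul_im]; simp only [hδ]; linarith) (fun u h1 h2 => ?_) (fun u h1 h2 => ?_)
    (fun u h1 h2 => ?_)
  · refine (hb.differentiableAt_betaInt hc h1 h2).mul (DifferentiableAt.div ?_ ?_ (dilog_ne_zero _ _))
    · exact DifferentiableAt.comp (g := dilog b) (f := fun u : ℂ => u + halfPeriod b) u
        (hb.differentiableAt_dilog (by rw [him, abs_lt]; constructor <;> linarith)) (by fun_prop)
    · exact DifferentiableAt.comp (g := dilog b) (f := fun u : ℂ => c + u + halfPeriod b) u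
        (hb.differentiableAt_dilog (by rw [him', abs_lt]; constructor <;> linarith)) (by fun_prop)
  · have e : (u + I * b).im = u.im + b.re := by rw [add_im, I_mul_im]
    rw [e] at h2
    have key := hb.betaInt_mul_dilog_periodic (τ := -u.im / 2) hc h2 h1 (by linarith) (by linarith)
      (by linarith)
    rw [← key]
    congr 1
    refine hb.betaInt_eq ?_ ?_ ?_ ?_ hc (by rw [e]; exact h2)
    all_goals try simp only [e]
    all_goals rw [abs_lt]; constructor <;> linarith
  · have k1 := h₁ u (by linarith) (by linarith)
    have k2 := (h₂ (u + halfPeriod b) (by rw [him, abs_le]; constructor <;> linarith)).1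
    have k3 := (h₂ (c + u + halfPeriod b) (by rw [him', abs_le]; constructor <;> linarith)).2
    rw [him, add_re, halfPeriod_re, add_zero] at k2
    rw [him', add_re, halfPeriod_re, add_zero, add_re] at k3
    rw [norm_mul, div_eq_mul_inv (dilog b (u + halfPeriod b)), norm_mul]
    set m := max u.re 0
    have hm : 0 ≤ m := le_max_right _ _
    have k3' : Real.exp (2 * Real.pi * max (c.re + u.re) 0 * (reQ b / 2 + c.im + u.im)) ≤
        Real.exp (2 * Real.pi * (|c.re| * reQ b)) *
          Real.exp (2 * Real.pi * m * (reQ b / 2 + c.im + u.im)) := by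
      rw [← Real.exp_add]
      refine Real.exp_le_exp.2 ?_
      have := max_mul_le u.re c.re (reQ b / 2 + c.im + u.im)
      rw [add_comm u.re] at this
      have h3 : |reQ b / 2 + c.im + u.im| ≤ reQ b := by rw [abs_le]; constructor <;> linarith
      have h4 := mul_le_mul_of_nonneg_left h3 (abs_nonneg c.re)
      have hp := Real.two_pi_pos
      nlinarith
    have hK1 : 0 ≤ K₁ := by
      have := (norm_nonneg _).trans k1
      by_contra hcon
      nlinarith [Real.exp_pos (-(2 * Real.pi * c.im * m))]
    calc _ ≤ (K₁ * Real.exp (-(2 * Real.pi * c.im * m))) *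
          ((K₂ * Real.exp (-(2 * Real.pi * m * (reQ b / 2 + u.im)))) *
            (K₂ * (Real.exp (2 * Real.pi * (|c.re| * reQ b)) *
              Real.exp (2 * Real.pi * m * (reQ b / 2 + c.im + u.im))))) := by
          have k3'' := k3.trans (mul_le_mul_of_nonneg_left k3' (by linarith))
          gcongr
      _ = K₁ * (K₂ * (K₂ * Real.exp (2 * Real.pi * (|c.re| * reQ b)))) *
          (Real.exp (-(2 * Real.pi * c.im * m)) *
            Real.exp (-(2 * Real.pi * m * (reQ b / 2 + u.im))) *
              Real.exp (2 * Real.pi * m * (reQ b / 2 + c.im + u.im))) := by ring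
      _ = _ := by
          rw [← Real.exp_add, ← Real.exp_add]
          rw [show -(2 * Real.pi * c.im * m) + -(2 * Real.pi * m * (reQ b / 2 + u.im)) +
            2 * Real.pi * m * (reQ b / 2 + c.im + u.im) = 0 by ring, Real.exp_zero, mul_one]

end IsReduced


/-! ### Fourier transforms of regularised quantum dilogarithms -/

/-- Fourier inversion, in terms of characters. -/
lemma fourier_inversion {f k : ℝ → ℂ} (hc : Continuous f) (hf : Integrable f) (hk : Integrable k)
    (h : ∀ t : ℝ, k t = ∫ x : ℝ, f x * planeWave t x) (s : ℝ) :
    f s = ∫ t : ℝ, k t * character t s := by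
  have hF : 𝓕 f = k := by
    funext t
    rw [h, Real.fourier_eq']
    refine integral_congr_ae (ae_of_all _ fun x => ?_)
    simp only [planeWave, smul_eq_mul, RCLike.inner_apply, conj_trivial]
    rw [mul_comm]
    congr 2; push_cast; ring
  have h1 := congrFun (Continuous.fourierInv_fourier_eq hc hf (by rwa [hF])) s
  rw [hF, Real.fourierInv_eq'] at h1
  rw [← h1]
  refine integral_congr_ae (ae_of_all _ fun x => ?_)
  simp only [character, smul_eq_mul, RCLike.inner_apply, conj_trivial]
  rw [mul_comm]
  congr 2; push_cast; ring

/-- `φ(x + iτ) e^{2πηx}` -/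
def shiftDilog (b : ℂ) (τ η : ℝ) (x : ℝ) : ℂ := dilog b (x + τ * I) * exp (2 * Real.pi * η * x)

/-- The Fourier transform of `shiftDilog`. -/
def shiftDilogHat (b : ℂ) (τ η : ℝ) (a : ℝ) : ℂ :=
  exp (-(2 * Real.pi * τ * (a + η * I))) * dilogTransform b τ (a + η * I)

/-- `φ(x + iε) / φ(x - u - iε) e^{2πεx}` -/
def pairDilog (b : ℂ) (ε u : ℝ) (x : ℝ) : ℂ :=
  dilog b (x + ε * I) * (dilog b (x + ε * I + -(u + (2 * ε : ℝ) * I)))⁻¹ *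
    exp (2 * Real.pi * ε * x)

/-- The Fourier transform of `pairDilog`. -/
def pairDilogHat (b : ℂ) (ε u : ℝ) (a : ℝ) : ℂ :=
  exp (-(2 * Real.pi * ε * (a + ε * I))) *
    betaInt b ε (-(u + (2 * ε : ℝ) * I)) (a + ε * I)

lemma planeWave_line (a η x τ : ℝ) : planeWave (a + η * I) (x + τ * I) =
    exp (2 * Real.pi * τ * (a + η * I)) * exp (2 * Real.pi * η * x) * planeWave a x := by
  rw [planeWave, planeWave, ← exp_add, ← exp_add]
  congr 1
  linear_combination (-(2 * Real.pi * η * x) - 2 * Real.pi * τ * (a + η * I)) * I_sq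

namespace IsReduced

variable {b : ℂ} (hb : IsReduced b)
include hb

lemma tendsto_dilog_atBot {z : ℂ} (hz : |z.im| < reQ b / 2) :
    Tendsto (fun t : ℝ => dilog b (t + z)) atBot (𝓝 1) := by
  obtain ⟨C, hC, h⟩ := hb.exists_norm_logDilog_le (δ := reQ b / 2 - |z.im|) (by linarith)
  have h0 : Tendsto (fun t : ℝ => logDilog b (t + z)) atBot (𝓝 0) := by
    refine squeeze_zero_norm (a := fun t : ℝ => C * Real.exp (2 * b.re * (t + z.re)))
      (fun t => ?_) ?_
    · have := h (t + z) (by simp)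
      simpa using this
    · have hp : 0 < 2 * b.re := by linarith [hb.re_pos]
      have h1 : Tendsto (fun t : ℝ => 2 * b.re * (t + z.re)) atBot atBot :=
        (tendsto_atBot_add_const_right atBot z.re tendsto_id).const_mul_atBot hp
      simpa using (Real.tendsto_exp_atBot.comp h1).const_mul C
  have := (continuous_exp.tendsto _).comp h0
  simpa [Function.comp_def, dilog] using this

/-- The limit of the beta integral. -/
lemma tendsto_betaInt {c : ℂ} {τ : ℝ} (hc : 0 < c.im) (h1 : c.im < τ) (h2 : τ < reQ b / 2) :
    Tendsto (fun t : ℝ => betaInt b τ (t - τ * I) c) atBot (𝓝 (dilogTransform b τ c)) := by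
  have hτ : |τ| < reQ b / 2 := by rw [abs_of_pos (by linarith)]; exact h2
  obtain ⟨K, hK, h⟩ := hb.exists_norm_betaFun_le (σ := reQ b / 2 - τ) (by linarith)
  set δ := min c.im (τ - c.im) with hδ
  have hδ0 : 0 < δ := lt_min hc (by linarith)
  refine tendsto_integral_filter_of_dominated_convergence (fun x : ℝ =>
    (K * Real.exp (2 * Real.pi * (c.re * τ))) * Real.exp (-(2 * Real.pi * δ) * |x|))
    (Eventually.of_forall fun t => ?_) (Eventually.of_forall fun t => ae_of_all _ fun x => ?_)
    ((integrable_exp_neg_mul_abs (by positivity)).const_mul _) (ae_of_all _ fun x => ?_)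
  · exact (hb.continuous_betaFun_line hτ (by simpa using hb.reQ_pos)).aestronglyMeasurable
  · have a1 : (x + τ * I : ℂ).im = τ := by simp
    have a2 : (x + τ * I : ℂ).re = x := by simp
    have a3 : (x + τ * I + (t - τ * I) : ℂ).im = 0 := by simp
    have := h (t - τ * I) c (x + τ * I) (by rw [a1, abs_of_pos (by linarith)]; linarith)
      (by rw [a3, abs_zero]; linarith)
    rw [a1, a2, a3] at this
    refine this.trans ?_
    rw [mul_assoc K, ← Real.exp_add]
    refine mul_le_mul_of_nonneg_left (Real.exp_le_exp.2 ?_) hK.le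
    have e := mul_max_add_mul_le (min_le_left c.im (τ - c.im)) (min_le_right _ _) x
    have hp := Real.two_pi_pos
    nlinarith
  · have h3 := (hb.tendsto_dilog_atBot (z := x) (by simpa using hb.reQ_pos)).inv₀ one_ne_zero
    have h4 := (h3.const_mul (dilog b (x + τ * I))).mul_const (planeWave c (x + τ * I))
    rw [inv_one, mul_one] at h4
    refine h4.congr fun t => ?_
    rw [betaFun, show (x + τ * I + (t - τ * I) : ℂ) = t + x by ring]

/-- The evaluation of the beta integral. -/
theorem betaInt_mul_dilog {c u : ℂ} {τ τ' : ℝ} (hc : 0 < c.im) (hc' : c.im < reQ b / 4)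
    (h1 : c.im < τ) (h2 : τ < reQ b / 2) (hu : -reQ b < u.im) (hu' : u.im < -c.im)
    (h3 : |τ'| < reQ b / 2) (h4 : |τ' + u.im| < reQ b / 2) :
    betaInt b τ' u c * dilog b (u + halfPeriod b) =
      dilogTransform b τ c * dilog b (c + u + halfPeriod b) := by
  obtain ⟨C, hC⟩ := hb.exists_betaInt_mul_eq_const hc hc'
  have hCeq : C = dilogTransform b τ c := by
    -- The constant is found along Im u = -τ as Re u → -∞: the denominator φ(x + u) and both
    -- dilogarithms of the quotient tend to 1.
    have l1 := hb.tendsto_betaInt hc h1 h2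
    have l2 := hb.tendsto_dilog_atBot (z := halfPeriod b - τ * I) (by
      have : (halfPeriod b - τ * I).im = reQ b / 2 - τ := by rw [sub_im, halfPeriod_im]; simp
      rw [this, abs_lt]; constructor <;> linarith)
    have l3 := hb.tendsto_dilog_atBot (z := c + halfPeriod b - τ * I) (by
      have : (c + halfPeriod b - τ * I).im = c.im + reQ b / 2 - τ := by
        rw [sub_im, add_im, halfPeriod_im]; simp
      rw [this, abs_lt]; constructor <;> linarith)
    have l4 := l1.mul (l2.div l3 one_ne_zero)
    rw [div_one, mul_one] at l4
    refine tendsto_nhds_unique (tendsto_const_nhds.congr fun t : ℝ => ?_) l4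
    have him : (t - τ * I : ℂ).im = -τ := by simp
    rw [← hC (t - τ * I) (by rw [him]; linarith) (by rw [him]; linarith)]
    congr 1
    · refine hb.betaInt_eq ?_ ?_ ?_ ?_ hc (by rw [him]; linarith)
      all_goals try rw [him]
      all_goals rw [abs_lt]; constructor <;> linarith
    · simp only [Pi.div_apply]
      congr 2 <;> ring
  have h5 := hC u hu hu'
  rw [hCeq, mul_div_assoc', div_eq_iff (dilog_ne_zero _ _)] at h5
  rw [← h5]
  congr 1
  refine hb.betaInt_eq h3 h4 ?_ ?_ hc hu'
  all_goals rw [abs_lt]; constructor <;> linarith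

/-- The symmetry of the beta integral that results from the inversion relation. -/
lemma betaInt_symm {u c : ℂ} {τ : ℝ} (h1 : |τ| < reQ b / 2) (h2 : |τ + u.im| < reQ b / 2) :
    betaInt b τ u c = exp (I * Real.pi * u ^ 2 + 2 * Real.pi * I * u * c) *
      betaInt b (-τ - u.im) u (-u - c) := by
  rw [betaInt, betaInt, ← integral_const_mul, ← integral_neg_eq_self,
    ← integral_add_right_eq_self _ u.re]
  refine integral_congr_ae (ae_of_all _ fun x => ?_)
  beta_reduce
  set y : ℂ := x + (-τ - u.im : ℝ) * I with hy
  have e : (((-(x + u.re) : ℝ) : ℂ) + τ * I) = -(y + u) := by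
    have eb := (re_add_im u).symm
    rw [hy]; push_cast
    linear_combination eb
  rw [e]
  have him : y.im = -τ - u.im := by simp [hy]
  clear_value y
  -- Under x = -(y + u) the inversion relation exchanges the two dilogarithms; the constants κ
  -- cancel and the quadratic terms in y drop out, leaving a plane wave.
  have i1 := hb.dilog_mul_neg (z := y) (by
    rw [him, ← abs_neg]; convert h2 using 2; ring)
  have i2 := hb.dilog_mul_neg (z := y + u) (by rw [add_im, him, ← abs_neg]; convert h1 using 2; ring)
  have n1 := dilog_ne_zero b y
  have n2 := dilog_ne_zero b (y + u)
  have n3 := dilog_ne_zero b (-y)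
  set κ := exp (I * Real.pi * (b ^ 2 + b⁻¹ ^ 2) / 12)
  have e1 : dilog b (-(y + u)) = κ * exp (I * Real.pi * (y + u) ^ 2) * (dilog b (y + u))⁻¹ := by
    rw [← i2]; field_simp
  have e2 : (dilog b (-y))⁻¹ = dilog b y * κ⁻¹ * exp (-(I * Real.pi * y ^ 2)) := by
    rw [exp_neg, mul_assoc, ← mul_inv, ← i1]; field_simp
  have e3 : exp (I * Real.pi * (y + u) ^ 2) * exp (-(I * Real.pi * y ^ 2)) *
      planeWave c (-(y + u)) =
      exp (I * Real.pi * u ^ 2 + 2 * Real.pi * I * u * c) * planeWave (-u - c) y := by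
    rw [planeWave, planeWave, ← exp_add, ← exp_add, ← exp_add]; congr 1; ring
  have hκ : κ ≠ 0 := exp_ne_zero _
  simp only [betaFun]
  rw [show -(y + u) + u = -y by ring, e1, e2]
  calc _ = (κ * κ⁻¹) * (dilog b y * (dilog b (y + u))⁻¹) *
        (exp (I * Real.pi * (y + u) ^ 2) * exp (-(I * Real.pi * y ^ 2)) *
          planeWave c (-(y + u))) := by ring
    _ = _ := by rw [e3, mul_inv_cancel₀ hκ]; ring

/-- The Fourier transform of the quantum dilogarithm is again a quantum dilogarithm. -/
theorem dilogTransform_mul {c d : ℂ} {τ τ' : ℝ} (hc : 0 < c.im) (hc' : c.im < reQ b / 4)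
    (hd : 0 < d.im) (hd' : d.im < reQ b / 4) (h1 : c.im < τ) (h2 : τ < reQ b / 2)
    (h1' : d.im < τ') (h2' : τ' < reQ b / 2) :
    dilogTransform b τ c * dilog b (halfPeriod b - d) =
      exp (I * Real.pi * (d ^ 2 - c ^ 2)) *
        (dilogTransform b τ' d * dilog b (halfPeriod b - c)) := by
  -- For u = -c - d the symmetry of the beta integral exchanges c and d, while the factor φ(u +
  -- iQ/2) is common to both evaluations.
  set u := -c - d with hu
  have hui : u.im = -c.im - d.im := by simp [hu]
  have k1 := hb.betaInt_mul_dilog (u := u) (τ' := -u.im / 2) hc hc' h1 h2 (by rw [hui]; linarith)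
    (by rw [hui]; linarith) (by rw [hui, abs_lt]; constructor <;> linarith)
    (by rw [hui, abs_lt]; constructor <;> linarith)
  have k2 := hb.betaInt_mul_dilog (u := u) (τ' := -u.im / 2) hd hd' h1' h2' (by rw [hui]; linarith)
    (by rw [hui]; linarith) (by rw [hui, abs_lt]; constructor <;> linarith)
    (by rw [hui, abs_lt]; constructor <;> linarith)
  have k3 := hb.betaInt_symm (u := u) (c := c) (τ := -u.im / 2)
    (by rw [hui, abs_lt]; constructor <;> linarith)
    (by rw [hui, abs_lt]; constructor <;> linarith)
  rw [show -(-u.im / 2) - u.im = -u.im / 2 by ring, show -u - c = d by rw [hu]; ring,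
    show I * Real.pi * u ^ 2 + 2 * Real.pi * I * u * c = I * Real.pi * (d ^ 2 - c ^ 2) by
      rw [hu]; ring] at k3
  rw [show halfPeriod b - d = c + u + halfPeriod b by rw [hu]; ring,
    show halfPeriod b - c = d + u + halfPeriod b by rw [hu]; ring, ← k1, ← k2, k3]
  ring

/-- The relation behind the pentagon identity. -/
theorem dilogTransform_mul_betaInt {u c : ℂ} {τ₁ τ₂ τ₃ τ : ℝ} (hc : 0 < c.im)
    (hu : u.im < reQ b / 4) (huc : c.im < u.im)
    (h1 : u.im < τ₁) (h1' : τ₁ < reQ b / 2) (h2 : c.im < τ₂) (h2' : τ₂ < reQ b / 2)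
    (h3 : u.im - c.im < τ₃) (h3' : τ₃ < reQ b / 2)
    (h4 : |τ| < reQ b / 2) (h4' : |τ - u.im| < reQ b / 2) :
    dilogTransform b τ₁ u * betaInt b τ (-u) c =
      exp (I * Real.pi * ((u - c) ^ 2 - u ^ 2)) *
        (dilogTransform b τ₂ c * dilogTransform b τ₃ (u - c)) := by
  have k1 := hb.betaInt_mul_dilog (u := -u) hc (by linarith) h2 h2' (by rw [neg_im]; linarith)
    (by rw [neg_im]; linarith) h4 (by rwa [neg_im, ← sub_eq_add_neg])
  have k2 := hb.dilogTransform_mul (c := u) (d := u - c) (by linarith) hu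
    (by rw [sub_im]; linarith) (by rw [sub_im]; linarith) h1 h1' (by rw [sub_im]; exact h3) h3'
  rw [show c + -u + halfPeriod b = halfPeriod b - (u - c) by ring,
    show -u + halfPeriod b = halfPeriod b - u by ring] at k1
  refine mul_right_cancel₀ (dilog_ne_zero b (halfPeriod b - u)) ?_
  linear_combination dilogTransform b τ₁ u * k1 + dilogTransform b τ₂ c * k2

section Shift

variable {τ η : ℝ}

lemma continuous_shiftDilog (h : |τ| < reQ b / 2) : Continuous (shiftDilog b τ η) :=
  (hb.continuous_dilog_comp (by fun_prop) fun x : ℝ => by simpa using h).mul (by fun_prop)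

lemma integrable_shiftDilog (h0 : 0 < η) (h1 : η < τ) (h2 : τ < reQ b / 2) :
    Integrable (shiftDilog b τ η) := by
  have hτ : |τ| < reQ b / 2 := by rw [abs_of_pos (by linarith)]; exact h2
  obtain ⟨K, hK, h⟩ := hb.exists_norm_dilog_bounds (δ := reQ b / 2 - τ) (by linarith)
  set δ := min η (τ - η) with hδ
  have hδ0 : 0 < δ := lt_min h0 (by linarith)
  refine ((integrable_exp_neg_mul_abs (δ := 2 * Real.pi * δ) (by positivity)).const_mul K).mono'
    (hb.continuous_shiftDilog hτ).aestronglyMeasurable (ae_of_all _ fun x => ?_)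
  have k := (h (x + τ * I) (by simp [abs_of_pos (h0.trans h1)])).1
  have a1 : (x + τ * I : ℂ).im = τ := by simp
  have a2 : (x + τ * I : ℂ).re = x := by simp
  rw [a1, a2] at k
  have e : ‖exp (2 * Real.pi * η * x : ℂ)‖ = Real.exp (2 * Real.pi * η * x) := by
    rw [norm_exp]; congr 1; simp
  rw [shiftDilog, norm_mul, e]
  calc _ ≤ K * Real.exp (-(2 * Real.pi * max x 0 * τ)) * Real.exp (2 * Real.pi * η * x) := by
        gcongr
    _ = K * (Real.exp (-(2 * Real.pi * max x 0 * τ)) * Real.exp (2 * Real.pi * η * x)) := by ring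
    _ ≤ _ := by
      rw [← Real.exp_add]
      refine mul_le_mul_of_nonneg_left (Real.exp_le_exp.2 ?_) (by linarith)
      have := mul_max_add_mul_le (min_le_left η (τ - η)) (min_le_right _ _) x
      have hp := Real.two_pi_pos
      nlinarith

omit hb in
lemma shiftDilogHat_eq (a : ℝ) :
    shiftDilogHat b τ η a = ∫ x : ℝ, shiftDilog b τ η x * planeWave a x := by
  rw [shiftDilogHat, dilogTransform, ← integral_const_mul]
  refine integral_congr_ae (ae_of_all _ fun x => ?_)
  simp only
  rw [planeWave_line, shiftDilog, exp_neg]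
  field_simp [exp_ne_zero]

/-- This is `dilogTransform_mul` against the fixed argument d = iη. Continuity and exponential decay
of the transform can be read off from the explicit form. -/
lemma exists_shiftDilogHat_eq (h0 : 0 < η) (h0' : η < reQ b / 4) (h1 : η < τ)
    (h2 : τ < reQ b / 2) : ∃ C, ∀ a : ℝ, shiftDilogHat b τ η a =
      C * (exp (-(2 * Real.pi * τ * (a + η * I)) - I * Real.pi * (a + η * I) ^ 2) *
        dilog b (halfPeriod b - (a + η * I))) := by
  set d : ℂ := η * I with hd
  have hdi : d.im = η := by simp [hd]
  refine ⟨exp (I * Real.pi * d ^ 2) * dilogTransform b τ d / dilog b (halfPeriod b - d),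
    fun a => ?_⟩
  have him : (a + d : ℂ).im = η := by simp [hd]
  have k := hb.dilogTransform_mul (c := a + d) (d := d) (τ := τ) (τ' := τ) (by rwa [him])
    (by rwa [him]) (by rwa [hdi]) (by rwa [hdi]) (by rwa [him]) h2 (by rwa [hdi]) h2
  have n := dilog_ne_zero b (halfPeriod b - d)
  rw [← eq_div_iff n] at k
  rw [shiftDilogHat, k, exp_sub, mul_sub, exp_sub]
  ring

lemma continuous_shiftDilogHat (h0 : 0 < η) (h0' : η < reQ b / 4) (h1 : η < τ)
    (h2 : τ < reQ b / 2) : Continuous (shiftDilogHat b τ η) := by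
  obtain ⟨C, hC⟩ := hb.exists_shiftDilogHat_eq h0 h0' h1 h2
  rw [funext hC]
  refine continuous_const.mul (Continuous.mul (by fun_prop)
    (hb.continuous_dilog_comp (by fun_prop) fun x => ?_))
  have : (halfPeriod b - (x + η * I)).im = reQ b / 2 - η := by
    rw [sub_im, halfPeriod_im]; simp
  rw [this, abs_lt]; constructor <;> linarith

lemma exists_norm_shiftDilogHat_le (h0 : 0 < η) (h0' : η < reQ b / 4) (h1 : η < τ)
    (h2 : τ < reQ b / 2) :
    ∃ δ K, 0 < δ ∧ ∀ a, ‖shiftDilogHat b τ η a‖ ≤ K * Real.exp (-δ * |a|) := by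
  obtain ⟨C, hC⟩ := hb.exists_shiftDilogHat_eq h0 h0' h1 h2
  obtain ⟨K, hK, h⟩ := hb.exists_norm_dilog_bounds h0
  set δ := min (τ - η) (reQ b / 2 - τ) with hδ
  have hδ0 : 0 < δ := lt_min (by linarith) (by linarith)
  refine ⟨2 * Real.pi * δ, ‖C‖ * K, by positivity, fun a => ?_⟩
  have a1 : (halfPeriod b - (a + η * I)).im = reQ b / 2 - η := by
    rw [sub_im, halfPeriod_im]; simp
  have a2 : (halfPeriod b - (a + η * I)).re = -a := by
    rw [sub_re, halfPeriod_re]; simp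
  have k := (h (halfPeriod b - (a + η * I)) (by
    rw [a1, abs_of_pos (by linarith)])).1
  rw [a1, a2] at k
  have e : ‖exp (-(2 * Real.pi * τ * (a + η * I)) - I * Real.pi * (a + η * I) ^ 2)‖ =
      Real.exp (-(2 * Real.pi * (τ - η) * a)) := by
    rw [norm_exp]; congr 1
    simp [pow_two, mul_re, mul_im]; ring
  rw [hC, norm_mul, norm_mul, e]
  calc _ ≤ ‖C‖ * (Real.exp (-(2 * Real.pi * (τ - η) * a)) *
        (K * Real.exp (-(2 * Real.pi * max (-a) 0 * (reQ b / 2 - η))))) := by gcongr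
    _ = ‖C‖ * K * (Real.exp (-(2 * Real.pi * (τ - η) * a)) *
        Real.exp (-(2 * Real.pi * max (-a) 0 * (reQ b / 2 - η)))) := by ring
    _ ≤ _ := by
      rw [← Real.exp_add]
      refine mul_le_mul_of_nonneg_left (Real.exp_le_exp.2 ?_) (by positivity)
      have m2 : δ ≤ (reQ b / 2 - η) - (τ - η) := (min_le_right _ _).trans (by linarith)
      have := mul_max_add_mul_le (min_le_left (τ - η) (reQ b / 2 - τ)) m2 (-a)
      rw [abs_neg] at this
      have hp := Real.two_pi_pos
      nlinarith

lemma integrable_shiftDilogHat (h0 : 0 < η) (h0' : η < reQ b / 4) (h1 : η < τ)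
    (h2 : τ < reQ b / 2) : Integrable (shiftDilogHat b τ η) := by
  obtain ⟨δ, K, hδ, h⟩ := hb.exists_norm_shiftDilogHat_le h0 h0' h1 h2
  exact ((integrable_exp_neg_mul_abs hδ).const_mul K).mono'
    (hb.continuous_shiftDilogHat h0 h0' h1 h2).aestronglyMeasurable (ae_of_all _ h)

lemma shiftDilog_eq_integral (h0 : 0 < η) (h0' : η < reQ b / 4) (h1 : η < τ)
    (h2 : τ < reQ b / 2) (s : ℝ) :
    shiftDilog b τ η s = ∫ t : ℝ, shiftDilogHat b τ η t * character t s :=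
  fourier_inversion (hb.continuous_shiftDilog (by rwa [abs_of_pos (h0.trans h1)]))
    (hb.integrable_shiftDilog h0 h1 h2) (hb.integrable_shiftDilogHat h0 h0' h1 h2)
    (fun t => shiftDilogHat_eq t) s

/-- A single zero would force the constant of the explicit form to vanish, and then Fourier
inversion would make `shiftDilog` vanish. The result permits a division in
`integrable_pairDilogHat`. -/
lemma shiftDilogHat_ne_zero (h0 : 0 < η) (h0' : η < reQ b / 4) (h1 : η < τ)
    (h2 : τ < reQ b / 2) (a : ℝ) : shiftDilogHat b τ η a ≠ 0 := by
  intro h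
  obtain ⟨C, hC⟩ := hb.exists_shiftDilogHat_eq h0 h0' h1 h2
  have hC0 : C = 0 := by
    rw [hC] at h
    simpa [exp_ne_zero, dilog_ne_zero] using h
  have h3 := hb.shiftDilog_eq_integral h0 h0' h1 h2 0
  simp [hC, hC0, shiftDilog, dilog_ne_zero] at h3

end Shift

section Pair

variable {ε : ℝ}

omit hb in
lemma pairDilog_eq (u x : ℝ) : pairDilog b ε u x =
    exp (-(2 * Real.pi * ε * (ε * I))) *
      betaFun b (-(u + (2 * ε : ℝ) * I)) (ε * I) (x + ε * I) := by
  have h := planeWave_line 0 ε x ε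
  have h' : planeWave (0 : ℝ) x = 1 := by simp [planeWave]
  rw [h', mul_one] at h
  simp only [ofReal_zero, zero_add] at h
  rw [betaFun, h, pairDilog, exp_neg]
  field_simp [exp_ne_zero]

omit hb in
lemma pairDilogHat_eq (u a : ℝ) :
    pairDilogHat b ε u a = ∫ x : ℝ, pairDilog b ε u x * planeWave a x := by
  rw [pairDilogHat, betaInt, ← integral_const_mul]
  refine integral_congr_ae (ae_of_all _ fun x => ?_)
  simp only [betaFun]
  rw [planeWave_line, pairDilog, exp_neg]
  field_simp [exp_ne_zero]

lemma continuous_pairDilog (h : |ε| < reQ b / 2) (u : ℝ) : Continuous (pairDilog b ε u) := by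
  refine ((hb.continuous_dilog_comp (by fun_prop) fun x : ℝ => by simpa using h).mul
    ((hb.continuous_dilog_comp (by fun_prop) fun x : ℝ => ?_).inv₀ fun x => dilog_ne_zero _ _)).mul
    (by fun_prop)
  have : (x + ε * I + -(u + (2 * ε : ℝ) * I) : ℂ).im = -ε := by simp; ring
  rwa [this, abs_neg]

lemma integrable_pairDilog (h0 : 0 < ε) (h : ε < reQ b / 2) (u : ℝ) :
    Integrable (pairDilog b ε u) := by
  have hε : |ε| < reQ b / 2 := by rwa [abs_of_pos h0]
  have hui : (-(u + (2 * ε : ℝ) * I) : ℂ).im = -(2 * ε) := by simp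
  have hi := hb.integrable_betaFun (u := -(u + (2 * ε : ℝ) * I)) (c := ε * I) (τ := ε) hε
    (by rw [hui, show ε + -(2 * ε) = -ε by ring, abs_neg]; exact hε) (by simpa using h0)
    (by rw [hui]; simp; linarith)
  refine (hi.const_mul (exp (-(2 * Real.pi * ε * (ε * I))))).congr (ae_of_all _ fun x => ?_)
  beta_reduce
  rw [pairDilog_eq]

/-- The Fourier transformed form of the pentagon identity. -/
theorem shiftDilogHat_mul_shiftDilogHat (h0 : 0 < ε) (h : ε < reQ b / 8) (u a : ℝ) :
    shiftDilogHat b (2 * ε) ε a * shiftDilogHat b (2 * ε) ε (u - a) *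
        exp (I * Real.pi * (a ^ 2 - 2 * u * a)) =
      exp (3 * Real.pi * I * ε ^ 2) *
        (shiftDilogHat b (3 * ε) (2 * ε) u * pairDilogHat b ε u a) := by
  -- The heights are Im U = 2ε and Im c = Im (U - c) = ε, so the contours at 3ε, 2ε, 2ε are
  -- admissible. The displacement of the arguments into the complex plane leaves the constant
  -- e^{3πiε²}.
  set U : ℂ := u + (2 * ε : ℝ) * I with hU
  set c : ℂ := a + ε * I with hc
  have hUi : U.im = 2 * ε := by simp [hU]
  have hci : c.im = ε := by simp [hc]
  have k := hb.dilogTransform_mul_betaInt (u := U) (c := c) (τ₁ := 3 * ε) (τ₂ := 2 * ε)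
    (τ₃ := 2 * ε) (τ := ε) (by linarith) (by linarith) (by linarith) (by linarith) (by linarith)
    (by linarith) (by linarith) (by linarith) (by linarith) (by rw [abs_of_pos h0]; linarith)
    (by rw [hUi, abs_lt]; constructor <;> linarith)
  have e1 : ((u - a : ℝ) : ℂ) + ε * I = U - c := by rw [hU, hc]; push_cast; ring
  simp only [shiftDilogHat, pairDilogHat]
  rw [e1, ← hU, ← hc]
  set D₁ := dilogTransform b (2 * ε : ℝ) c
  set D₂ := dilogTransform b (2 * ε : ℝ) (U - c)
  set D₃ := dilogTransform b (3 * ε : ℝ) U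
  set B := betaInt b ε (-U) c
  have e2 : exp (-(2 * Real.pi * (2 * ε : ℝ) * c)) * exp (-(2 * Real.pi * (2 * ε : ℝ) * (U - c))) *
      exp (I * Real.pi * (a ^ 2 - 2 * u * a)) =
      exp (3 * Real.pi * I * ε ^ 2) * (exp (-(2 * Real.pi * (3 * ε : ℝ) * U)) *
        exp (-(2 * Real.pi * ε * c)) * exp (I * Real.pi * ((U - c) ^ 2 - U ^ 2))) := by
    simp only [← exp_add]
    congr 1
    rw [hU, hc]; push_cast
    ring_nf
    simp only [I_sq, I_pow_three]
    ring
  calc _ = exp (-(2 * Real.pi * (2 * ε : ℝ) * c)) *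
        exp (-(2 * Real.pi * (2 * ε : ℝ) * (U - c))) *
        exp (I * Real.pi * (a ^ 2 - 2 * u * a)) * (D₁ * D₂) := by ring
    _ = exp (3 * Real.pi * I * ε ^ 2) * (exp (-(2 * Real.pi * (3 * ε : ℝ) * U)) *
        exp (-(2 * Real.pi * ε * c)) *
          (exp (I * Real.pi * ((U - c) ^ 2 - U ^ 2)) * (D₁ * D₂))) := by rw [e2]; ring
    _ = _ := by rw [← k]; ring

/-- Dividing `shiftDilogHat_mul_shiftDilogHat` by the nonzero value at u exhibits the function as an
integrable function times a bounded one, so the beta integral need not be estimated in a. -/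
lemma integrable_pairDilogHat (h0 : 0 < ε) (h : ε < reQ b / 8) (u : ℝ) :
    Integrable (pairDilogHat b ε u) := by
  have a1 : ε < reQ b / 4 := by linarith
  have a2 : ε < 2 * ε := by linarith
  have a3 : 2 * ε < reQ b / 2 := by linarith
  obtain ⟨δ, K, hδ, hK⟩ := hb.exists_norm_shiftDilogHat_le h0 a1 a2 a3
  have hc := hb.continuous_shiftDilogHat h0 a1 a2 a3
  have n := hb.shiftDilogHat_ne_zero (τ := 3 * ε) (η := 2 * ε) (by linarith) (by linarith)
    (by linarith) (by linarith) u
  have hi : Integrable fun a : ℝ => shiftDilogHat b (2 * ε) ε a *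
      (shiftDilogHat b (2 * ε) ε (u - a) * exp (I * Real.pi * (a ^ 2 - 2 * u * a))) := by
    refine (hb.integrable_shiftDilogHat h0 a1 a2 a3).mul_bdd (c := K) ?_ (ae_of_all _ fun a => ?_)
    · exact Continuous.aestronglyMeasurable ((hc.comp (by fun_prop)).mul (by fun_prop))
    · have e : ‖exp (I * Real.pi * (a ^ 2 - 2 * u * a))‖ = 1 := by
        rw [show I * Real.pi * (a ^ 2 - 2 * u * a : ℂ) =
          ((Real.pi * (a ^ 2 - 2 * u * a) : ℝ) : ℂ) * I by push_cast; ring, norm_exp_ofReal_mul_I]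
      rw [norm_mul, e, mul_one]
      refine (hK _).trans (mul_le_of_le_one_right ?_ (Real.exp_le_one_iff.2 ?_))
      · have := (norm_nonneg _).trans (hK 0)
        simpa using this
      · nlinarith [abs_nonneg (u - a)]
  refine (hi.const_mul (exp (3 * Real.pi * I * ε ^ 2) * shiftDilogHat b (3 * ε) (2 * ε) u)⁻¹).congr
    (ae_of_all _ fun a => ?_)
  have k := hb.shiftDilogHat_mul_shiftDilogHat h0 h u a
  beta_reduce
  set S := shiftDilogHat b (3 * ε) (2 * ε) u
  rw [← mul_assoc (shiftDilogHat b (2 * ε) ε a), k]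
  field_simp [exp_ne_zero]

lemma pairDilog_eq_integral (h0 : 0 < ε) (h : ε < reQ b / 8) (u s : ℝ) :
    pairDilog b ε u s = ∫ t : ℝ, pairDilogHat b ε u t * character t s :=
  fourier_inversion (hb.continuous_pairDilog (by rw [abs_of_pos h0]; linarith) u)
    (hb.integrable_pairDilog h0 (by linarith) u) (hb.integrable_pairDilogHat h0 h u)
    (fun t => pairDilogHat_eq u t) s

end Pair

end IsReduced


/-! ### The bracket -/

section Bracket

variable {N : ℕ}

lemma bracket_add_left (u v w : Lin N) : bracket N (u + v) w = bracket N u w + bracket N v w := by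
  simp only [bracket, Pi.add_apply, add_mul, Finset.sum_add_distrib]

lemma bracket_add_right (u v w : Lin N) : bracket N u (v + w) = bracket N u v + bracket N u w := by
  simp only [bracket, Pi.add_apply, mul_add, add_mul, Finset.sum_add_distrib]

lemma bracket_smul_left (c : ℝ) (u v : Lin N) : bracket N (c • u) v = c * bracket N u v := by
  simp only [bracket, Pi.smul_apply, smul_eq_mul, Finset.mul_sum, mul_assoc]

lemma bracket_smul_right (c : ℝ) (u v : Lin N) : bracket N u (c • v) = c * bracket N u v := by
  simp only [bracket, Pi.smul_apply, smul_eq_mul, Finset.mul_sum]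
  refine Finset.sum_congr rfl fun _ _ => Finset.sum_congr rfl fun _ _ => ?_
  ring

lemma neg_one_pow_val_natCast [NeZero N] (k : ℕ) :
    (-1 : ℝ) ^ (k : ZMod (2 * N)).val = (-1) ^ k := by
  rw [ZMod.val_natCast, neg_one_pow_eq_pow_mod_two, Nat.mod_mod_of_dvd _ (dvd_mul_right 2 N),
    ← neg_one_pow_eq_pow_mod_two]

lemma neg_one_pow_val_add_one [NeZero N] (m : ZMod (2 * N)) :
    (-1 : ℝ) ^ (m + 1).val = -(-1) ^ m.val := by
  have h : m + 1 = ((m.val + 1 : ℕ) : ZMod (2 * N)) := by push_cast; rw [ZMod.natCast_zmod_val]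
  rw [h, neg_one_pow_val_natCast, pow_succ, mul_neg_one]

lemma comm_antisymm [NeZero N] (m n : ZMod (2 * N)) : comm N m n = -comm N n m := by
  have h1 : n = m + 1 ↔ m = n - 1 := ⟨fun h => by rw [h]; ring, fun h => by rw [h]; ring⟩
  have h2 : n = m - 1 ↔ m = n + 1 := ⟨fun h => by rw [h]; ring, fun h => by rw [h]; ring⟩
  unfold comm
  by_cases ha : n = m + 1
  · rw [if_pos (Or.inl ha), if_pos (Or.inr (h1.1 ha)), ha, neg_one_pow_val_add_one, neg_neg]
  · by_cases hb : n = m - 1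
    · rw [if_pos (Or.inr hb), if_pos (Or.inl (h2.1 hb)), h2.1 hb, neg_one_pow_val_add_one]
    · rw [if_neg (by tauto), if_neg (by tauto), neg_zero]

lemma bracket_antisymm [NeZero N] (u v : Lin N) : bracket N u v = -bracket N v u := by
  simp only [bracket]
  rw [Finset.sum_comm, ← Finset.sum_neg_distrib]
  refine Finset.sum_congr rfl fun m _ => ?_
  rw [← Finset.sum_neg_distrib]
  refine Finset.sum_congr rfl fun n _ => ?_
  rw [comm_antisymm]; ring

lemma bracket_self [NeZero N] (u : Lin N) : bracket N u u = 0 := by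
  linarith [bracket_antisymm u u]

end Bracket

/-! ### One-parameter unitary groups -/

namespace IsUnitaryGroup

variable {H : Type*} [NormedAddCommGroup H] [InnerProductSpace ℂ H] [CompleteSpace H]
  {U : ℝ → H →L[ℂ] H}

lemma continuous_apply₂ (hU : IsUnitaryGroup U) {X : Type*} [TopologicalSpace X] {g : X → ℝ}
    {y : X → H} (hg : Continuous g) (hy : Continuous y) : Continuous fun z => U (g z) (y z) := by
  refine continuous_iff_continuousAt.2 fun z₀ => ?_
  have h1 : Tendsto (fun z => U (g z) (y z₀)) (𝓝 z₀) (𝓝 (U (g z₀) (y z₀))) :=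
    ((hU.continuous (y z₀)).comp hg).tendsto z₀
  have h2 : Tendsto (fun z => U (g z) (y z - y z₀)) (𝓝 z₀) (𝓝 0) := by
    rw [tendsto_zero_iff_norm_tendsto_zero]
    simp_rw [hU.norm_apply]
    have := (hy.sub (continuous_const (y := y z₀))).norm.tendsto z₀
    simpa using this
  have := h2.add h1
  simpa [ContinuousAt] using this

lemma character_smul (hU : IsUnitaryGroup U) (a : ℝ) :
    IsUnitaryGroup fun t => character t a • U t where
  zero_eq_one := by simp [character, hU.zero_eq_one]
  add_eq_mul s t := by
    rw [hU.add_eq_mul, smul_mul_smul_comm, ← congrFun (character_mul s t) a, Pi.mul_apply]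
  mem_unitary t := by
    have h := Unitary.mem_iff.1 (hU.mem_unitary t)
    have h1 : star (character t a) * character t a = 1 := by
      rw [RCLike.star_def, RCLike.conj_mul, norm_character]; simp
    rw [Unitary.mem_iff, star_smul, smul_mul_smul_comm, smul_mul_smul_comm, h.1, h.2,
      mul_comm (character t a), h1, one_smul]
    exact ⟨rfl, rfl⟩
  continuous x := by
    have : Continuous fun t => character t a := by unfold character; fun_prop
    exact this.smul (hU.continuous x)

end IsUnitaryGroup

/-! ### Functional calculus in a realization of the Weyl relations -/

namespace Realization

variable {N : ℕ} [NeZero N] {H : Type*} [NormedAddCommGroup H] [InnerProductSpace ℂ H]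
  [CompleteSpace H] (R : Realization N H)

lemma weyl_zero : R.weyl 0 = 1 := by
  have h := R.weyl_mul 0 0
  have h1 := Unitary.mem_iff.1 (R.weyl_unitary 0)
  rw [bracket_self, add_zero] at h
  simp only [ofReal_zero, mul_zero, exp_zero, one_smul] at h
  calc R.weyl 0 = (star (R.weyl 0) * R.weyl 0) * R.weyl 0 := by rw [h1.1, one_mul]
    _ = 1 := by rw [mul_assoc, h, h1.1]

lemma isUnitaryGroup (v : Lin N) : IsUnitaryGroup fun t : ℝ => R.weyl (t • v) where
  zero_eq_one := by rw [zero_smul, R.weyl_zero]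
  add_eq_mul s t := by
    rw [R.weyl_mul, bracket_smul_left, bracket_smul_right, bracket_self, add_smul]
    simp
  mem_unitary t := R.weyl_unitary _
  continuous x := R.weyl_continuous v x

lemma weyl_comm (u v : Lin N) :
    R.weyl u * R.weyl v = exp (2 * Real.pi * I * bracket N u v) • (R.weyl v * R.weyl u) := by
  rw [R.weyl_mul, R.weyl_mul v u, smul_smul, ← exp_add, bracket_antisymm v u, add_comm v u]
  congr 2; push_cast; ring

lemma fn_mul {F G : ℝ → ℂ} (hF : IsBddCont F) (hG : IsBddCont G) (v : Lin N) :
    R.fn (F * G) v = R.fn F v * R.fn G v :=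
  (R.isUnitaryGroup v).funCalc_mul hF hG

lemma fn_smul {F : ℝ → ℂ} (c : ℂ) (hF : IsBddCont F) (v : Lin N) :
    R.fn (c • F) v = c • R.fn F v :=
  (R.isUnitaryGroup v).funCalc_smul c hF

lemma fn_one (v : Lin N) : R.fn (fun _ => 1) v = 1 := by
  have h := (R.isUnitaryGroup v).funCalc_character 0
  have e : character 0 = fun _ => 1 := by funext s; simp [character]
  rw [e] at h
  rw [fn, h, zero_smul, R.weyl_zero]

/-- Conjugation by e^{2πiu} multiplies the group of v by a character (`weyl_comm`), which amounts to
a shift of its generator by a real number. -/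
lemma weyl_mul_fn {F : ℝ → ℂ} (hF : IsBddCont F) (u v : Lin N) :
    R.weyl u * R.fn F v = R.fn (fun s => F (s + bracket N u v)) v * R.weyl u := by
  have hU := R.isUnitaryGroup v
  have h1 := hU.funCalc_affine hF 1 (bracket N u v)
  simp only [mul_one, one_mul] at h1
  rw [fn, fn, ← h1]
  refine hU.intertwine (hU.character_smul _) (fun t => ?_) hF
  rw [R.weyl_comm, bracket_smul_right, smul_mul_assoc, character]
  congr 2; push_cast; ring

end Realization

/-! ### The pentagon identity for operators -/

namespace IsReduced

variable {b : ℂ} (hb : IsReduced b)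
include hb

/-- One bound for all shifts, so that the regularisation can be removed by bounded convergence. -/
lemma exists_norm_shiftDilog_le : ∃ K, ∀ τ η : ℝ, 0 ≤ η → η ≤ τ → τ ≤ reQ b / 4 → ∀ x,
    ‖shiftDilog b τ η x‖ ≤ K ∧ ‖(dilog b (x - τ * I))⁻¹‖ ≤ K := by
  have hQ := hb.reQ_pos
  obtain ⟨K, hK, h⟩ := hb.exists_norm_dilog_bounds (δ := reQ b / 4) (by linarith)
  refine ⟨K, fun τ η h0 h1 h2 x => ⟨?_, ?_⟩⟩
  · have a1 : (x + τ * I : ℂ).im = τ := by simp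
    have a2 : (x + τ * I : ℂ).re = x := by simp
    have k := (h (x + τ * I) (by rw [a1, abs_of_nonneg (by linarith)]; linarith)).1
    rw [a1, a2] at k
    have e : ‖exp (2 * Real.pi * η * x : ℂ)‖ = Real.exp (2 * Real.pi * η * x) := by
      rw [norm_exp]; congr 1; simp
    rw [shiftDilog, norm_mul, e]
    calc _ ≤ K * Real.exp (-(2 * Real.pi * max x 0 * τ)) * Real.exp (2 * Real.pi * η * x) := by
          gcongr
      _ ≤ K := by
        rw [mul_assoc, ← Real.exp_add]
        refine mul_le_of_le_one_right (by linarith) (Real.exp_le_one_iff.2 ?_)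
        have e1 := le_max_left x 0
        have e2 := le_max_right x 0
        have hp := Real.two_pi_pos
        have : η * x ≤ max x 0 * τ := by nlinarith
        nlinarith
  · have a1 : (x - τ * I : ℂ).im = -τ := by simp
    have a2 : (x - τ * I : ℂ).re = x := by simp
    have k := (h (x - τ * I) (by rw [a1, abs_neg, abs_of_nonneg (by linarith)]; linarith)).2
    rw [a1, a2] at k
    refine k.trans (mul_le_of_le_one_right (by linarith) (Real.exp_le_one_iff.2 ?_))
    have e2 := le_max_right x 0
    have := mul_nonneg (mul_nonneg Real.two_pi_pos.le e2) (h0.trans h1)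
    linarith

lemma isBddCont_shiftDilog {τ η : ℝ} (h0 : 0 ≤ η) (h1 : η ≤ τ) (h2 : τ ≤ reQ b / 4) :
    IsBddCont (shiftDilog b τ η) := by
  have hQ := hb.reQ_pos
  obtain ⟨K, h⟩ := hb.exists_norm_shiftDilog_le
  exact ⟨hb.continuous_shiftDilog (by rw [abs_of_nonneg (by linarith)]; linarith), K,
    fun x => (h τ η h0 h1 h2 x).1⟩

lemma isBddCont_inv_dilog {ε : ℝ} (h0 : 0 ≤ ε) (h1 : ε ≤ reQ b / 4) :
    IsBddCont fun x : ℝ => (dilog b (x - ε * I))⁻¹ := by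
  have hQ := hb.reQ_pos
  obtain ⟨K, h⟩ := hb.exists_norm_shiftDilog_le
  refine ⟨(hb.continuous_dilog_comp (by fun_prop) fun x => ?_).inv₀ fun x => dilog_ne_zero _ _, K,
    fun x => (h ε ε h0 le_rfl h1 x).2⟩
  have : (x - ε * I : ℂ).im = -ε := by simp
  rw [this, abs_neg, abs_of_nonneg h0]; linarith

lemma shiftDilog_zero : shiftDilog b 0 0 = qdilog b := by
  funext x
  rw [shiftDilog, hb.qdilog_eq]
  simp

lemma isBddCont_qdilog : IsBddCont (qdilog b) := by
  rw [← hb.shiftDilog_zero]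
  exact hb.isBddCont_shiftDilog le_rfl le_rfl (by linarith [hb.reQ_pos])

lemma isBddCont_inv_qdilog : IsBddCont fun x => (qdilog b x)⁻¹ := by
  have := hb.isBddCont_inv_dilog le_rfl (by linarith [hb.reQ_pos])
  simpa [hb.qdilog_eq] using this

variable {N : ℕ} [NeZero N] {H : Type*} [NormedAddCommGroup H] [InnerProductSpace ℂ H]
  [CompleteSpace H] (R : Realization N H)

omit hb in
-- The phase is exactly the Gaussian of `shiftDilogHat_mul_shiftDilogHat`; this is the link between
-- the scalar identity and the pentagon.
lemma weyl_smul_add_mul {p q : Lin N} (hpq : bracket N p q = 1) (a u : ℝ) :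
    R.weyl (a • (p + q)) * R.weyl ((u - a) • p) =
      exp (I * Real.pi * (a ^ 2 - 2 * u * a)) • (R.weyl (u • p) * R.weyl (a • q)) := by
  have e1 : a • (p + q) + (u - a) • p = u • p + a • q := by module
  have e2 : bracket N (a • (p + q)) ((u - a) • p) = -(a * (u - a)) := by
    rw [bracket_smul_left, bracket_smul_right, bracket_add_left, bracket_self,
      bracket_antisymm q p, hpq]; ring
  have e3 : bracket N (u • p) (a • q) = u * a := by
    rw [bracket_smul_left, bracket_smul_right, hpq]; ring
  rw [R.weyl_mul, R.weyl_mul, e1, e2, e3, smul_smul, ← exp_add]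
  congr 2; push_cast; ring

/-- The pentagon identity for the regularised quantum dilogarithms. -/
theorem pentagon_shiftDilog {p q : Lin N} (hpq : bracket N p q = 1) {ε : ℝ} (h0 : 0 < ε)
    (h : ε < reQ b / 16) (y : H) :
    R.fn (shiftDilog b (2 * ε) ε) (p + q) (R.fn (shiftDilog b (2 * ε) ε) p y) =
      exp (3 * Real.pi * I * ε ^ 2) • R.fn (fun x => (dilog b (x - ε * I))⁻¹) q
        (R.fn (shiftDilog b (3 * ε) (2 * ε)) p (R.fn (shiftDilog b ε ε) q y)) := by
  have a1 : ε < reQ b / 4 := by linarith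
  have a2 : ε < 2 * ε := by linarith
  have a3 : 2 * ε < reQ b / 2 := by linarith
  have a4 : ε < reQ b / 8 := by linarith
  set k := shiftDilogHat b (2 * ε) ε with hk
  set k₃ := shiftDilogHat b (3 * ε) (2 * ε) with hk₃
  have hki : Integrable k := hb.integrable_shiftDilogHat h0 a1 a2 a3
  have hkc : Continuous k := hb.continuous_shiftDilogHat h0 a1 a2 a3
  have hF : ∀ (v : Lin N) (z : H), R.fn (shiftDilog b (2 * ε) ε) v z =
      ∫ t, k t • R.weyl (t • v) z := fun v z =>
    (R.isUnitaryGroup v).funCalc_apply_eq_integral hki (hb.shiftDilog_eq_integral h0 a1 a2 a3) z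
  have hF₃ : ∀ (v : Lin N) (z : H), R.fn (shiftDilog b (3 * ε) (2 * ε)) v z =
      ∫ t, k₃ t • R.weyl (t • v) z := fun v z =>
    (R.isUnitaryGroup v).funCalc_apply_eq_integral
      (hb.integrable_shiftDilogHat (by linarith) (by linarith) (by linarith) (by linarith))
      (hb.shiftDilog_eq_integral (by linarith) (by linarith) (by linarith) (by linarith)) z
  have hint : ∀ (v : Lin N) (z : H), Integrable fun t => k t • R.weyl (t • v) z := fun v z => by
    refine (hki.norm.mul_const ‖z‖).mono'
      (hki.1.smul ((R.isUnitaryGroup v).continuous z).aestronglyMeasurable) (ae_of_all _ fun t => ?_)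
    rw [norm_smul, (R.isUnitaryGroup v).norm_apply]
  set ph : ℝ → ℝ → ℂ := fun u a => exp (I * Real.pi * (a ^ 2 - 2 * u * a)) with hph
  have hphn : ∀ u a, ‖ph u a‖ = 1 := fun u a => by
    simp only [hph]
    rw [show I * Real.pi * (a ^ 2 - 2 * u * a : ℂ) =
      ((Real.pi * (a ^ 2 - 2 * u * a) : ℝ) : ℂ) * I by push_cast; ring, norm_exp_ofReal_mul_I]
  set Φ : ℝ → ℝ → H := fun a u =>
    (k a * k (u - a) * ph u a) • R.weyl (u • p) (R.weyl (a • q) y) with hΦ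
  have hΦi : Integrable (Function.uncurry Φ) (volume.prod volume) := by
    have hconv : Integrable (fun z : ℝ × ℝ => k z.2 * k (z.1 - z.2)) (volume.prod volume) :=
      hki.convolution_integrand (ContinuousLinearMap.mul ℂ ℂ) hki
    have hconv' := hconv.swap.norm.mul_const ‖y‖
    refine hconv'.mono' (Continuous.aestronglyMeasurable ?_) (ae_of_all _ fun z => ?_)
    · have c1 : Continuous fun z : ℝ × ℝ => R.weyl (z.1 • q) y :=
        ((R.isUnitaryGroup q).continuous y).comp continuous_fst
      have c2 : Continuous fun z : ℝ × ℝ => R.weyl (z.2 • p) (R.weyl (z.1 • q) y) :=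
        (R.isUnitaryGroup p).continuous_apply₂ continuous_snd c1
      refine Continuous.smul (Continuous.mul ?_ ?_) c2
      · exact (hkc.comp continuous_fst).mul (hkc.comp (by fun_prop))
      · simp only [hph]; fun_prop
    · simp only [Function.uncurry, hΦ]
      rw [norm_smul, norm_mul, hphn, mul_one, (R.isUnitaryGroup p).norm_apply,
        (R.isUnitaryGroup q).norm_apply]
      rfl
  -- Both operators are superpositions of Weyl operators; a is the coefficient of p + q, and u is
  -- the total coefficient of p.
  have step1 : R.fn (shiftDilog b (2 * ε) ε) (p + q) (R.fn (shiftDilog b (2 * ε) ε) p y) =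
      ∫ a, ∫ u, Φ a u := by
    rw [hF]
    refine integral_congr_ae (ae_of_all _ fun a => ?_)
    beta_reduce
    rw [hF, ← ContinuousLinearMap.integral_comp_comm _ (hint p y), ← integral_smul,
      ← integral_sub_right_eq_self _ a]
    refine integral_congr_ae (ae_of_all _ fun u => ?_)
    beta_reduce
    have e := congrArg (fun T : H →L[ℂ] H => T y) (weyl_smul_add_mul R hpq a u)
    simp only [smul_apply, mul_apply_eq_comp] at e
    rw [map_smul, e]
    simp only [hΦ, smul_smul, hph, mul_assoc]
  -- For fixed u the scalar identity turns the integral over a into the function `pairDilog` of q.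
  have step2 : ∀ u, ∫ a, Φ a u = (exp (3 * Real.pi * I * ε ^ 2) * k₃ u) •
      R.fn (fun x => (dilog b (x - ε * I))⁻¹) q (R.weyl (u • p) (R.fn (shiftDilog b ε ε) q y)) := by
    intro u
    have hpi := hb.integrable_pairDilogHat h0 a4 u
    have hpair : R.fn (pairDilog b ε u) q y = ∫ a, pairDilogHat b ε u a • R.weyl (a • q) y :=
      (R.isUnitaryGroup q).funCalc_apply_eq_integral hpi (hb.pairDilog_eq_integral h0 a4 u) y
    have hint' : Integrable fun a => pairDilogHat b ε u a • R.weyl (a • q) y := by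
      refine (hpi.norm.mul_const ‖y‖).mono'
        (hpi.1.smul ((R.isUnitaryGroup q).continuous y).aestronglyMeasurable)
        (ae_of_all _ fun t => ?_)
      rw [norm_smul, (R.isUnitaryGroup q).norm_apply]
    have e1 : ∀ a, Φ a u = (exp (3 * Real.pi * I * ε ^ 2) * k₃ u) •
        R.weyl (u • p) (pairDilogHat b ε u a • R.weyl (a • q) y) := by
      intro a
      simp only [hΦ, hph]
      rw [hb.shiftDilogHat_mul_shiftDilogHat h0 a4 u a, map_smul, smul_smul,
        mul_assoc (exp (3 * Real.pi * I * ε ^ 2))]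
    simp_rw [e1]
    rw [integral_smul, ContinuousLinearMap.integral_comp_comm _ hint', ← hpair]
    congr 1
    have hA := hb.isBddCont_inv_dilog h0.le a1.le
    have hA' : IsBddCont fun x : ℝ => (dilog b ((x - u : ℝ) - ε * I))⁻¹ :=
      hA.comp (u := fun x => x - u) (by fun_prop)
    have hS := hb.isBddCont_shiftDilog h0.le le_rfl a1.le
    -- The factor 1/φ carries an argument shifted by -u. Its passage to the left of e^{2πiup}
    -- removes the shift, because the bracket of up with q is u.
    have e2 : pairDilog b ε u = (fun x : ℝ => (dilog b ((x - u : ℝ) - ε * I))⁻¹) *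
        shiftDilog b ε ε := by
      funext x
      simp only [pairDilog, Pi.mul_apply, shiftDilog]
      rw [show (x + ε * I + -(u + (2 * ε : ℝ) * I) : ℂ) = (x - u : ℝ) - ε * I by push_cast; ring]
      ring
    have e3 := R.weyl_mul_fn hA' (u • p) q
    rw [bracket_smul_left, hpq, mul_one] at e3
    simp only [add_sub_cancel_right] at e3
    rw [e2, R.fn_mul hA' hS]
    exact congrArg (fun T : H →L[ℂ] H => T (R.fn (shiftDilog b ε ε) q y)) e3
  rw [step1, integral_integral_swap hΦi]
  simp_rw [step2]
  set z := R.fn (shiftDilog b ε ε) q y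
  have hint₃ : Integrable fun u => k₃ u • R.weyl (u • p) z := by
    have hk₃i : Integrable k₃ :=
      hb.integrable_shiftDilogHat (by linarith) (by linarith) (by linarith) (by linarith)
    refine (hk₃i.norm.mul_const ‖z‖).mono'
      (hk₃i.1.smul ((R.isUnitaryGroup p).continuous z).aestronglyMeasurable)
      (ae_of_all _ fun t => ?_)
    rw [norm_smul, (R.isUnitaryGroup p).norm_apply]
  rw [hF₃, ← ContinuousLinearMap.integral_comp_comm _ hint₃, ← integral_smul]
  refine integral_congr_ae (ae_of_all _ fun u => ?_)
  beta_reduce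
  rw [map_smul, smul_smul]

omit hb in
lemma tendsto_apply_of_norm_le {T : ℕ → H →L[ℂ] H} {T₀ : H →L[ℂ] H} {K : ℝ}
    (hK : ∀ n x, ‖T n x‖ ≤ K * ‖x‖) (hT : ∀ x, Tendsto (fun n => T n x) atTop (𝓝 (T₀ x)))
    {x : ℕ → H} {x₀ : H} (hx : Tendsto x atTop (𝓝 x₀)) :
    Tendsto (fun n => T n (x n)) atTop (𝓝 (T₀ x₀)) := by
  have h1 : Tendsto (fun n => T n (x n - x₀)) atTop (𝓝 0) := by
    refine squeeze_zero_norm (fun n => hK n _) ?_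
    have := ((hx.sub_const x₀).norm).const_mul K
    simpa using this
  have := h1.add (hT x₀)
  simpa using this

/-- The pentagon identity for the quantum dilogarithm. -/
theorem pentagon {p q : Lin N} (hpq : bracket N p q = 1) :
    R.phi b p * R.phi b q = R.phi b q * R.phi b (p + q) * R.phi b p := by
  have hQ := hb.reQ_pos
  obtain ⟨K, hK⟩ := hb.exists_norm_shiftDilog_le
  -- Regularisation parameters tending to 0 below the threshold Q/16 of `pentagon_shiftDilog`.
  set e : ℕ → ℝ := fun n => reQ b / 32 / (n + 1) with he
  have e0 : ∀ n, 0 < e n := fun n => by simp only [he]; positivity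
  have e1 : ∀ n, e n < reQ b / 16 := fun n => by
    simp only [he]
    have : reQ b / 32 / (n + 1) ≤ reQ b / 32 :=
      div_le_self (by positivity) (by linarith [n.cast_nonneg (α := ℝ)])
    linarith
  have elim : Tendsto e atTop (𝓝 0) := by
    have := (tendsto_const_div_atTop_nhds_zero_nat (reQ b / 32)).comp (tendsto_add_atTop_nat 1)
    simpa [Function.comp_def] using this
  have elimC : ∀ c : ℝ, Tendsto (fun n => ((c * e n : ℝ) : ℂ)) atTop (𝓝 0) := fun c => by
    have := (continuous_ofReal.tendsto (c * 0)).comp (elim.const_mul c)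
    simpa [Function.comp_def] using this
  have hdl : ∀ (c : ℝ) (x : ℝ), Tendsto (fun n => dilog b (x + (c * e n : ℝ) * I)) atTop
      (𝓝 (qdilog b x)) := fun c x => by
    rw [hb.qdilog_eq]
    have h1 : Tendsto (fun n => (x + (c * e n : ℝ) * I : ℂ)) atTop (𝓝 x) := by
      have := ((elimC c).mul_const I).const_add (x : ℂ)
      simpa using this
    exact ((hb.differentiableAt_dilog (z := x) (by simpa using hQ)).continuousAt.tendsto).comp h1
  have hsl : ∀ (c d : ℝ) (x : ℝ), Tendsto (fun n => shiftDilog b (c * e n) (d * e n) x) atTop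
      (𝓝 (qdilog b x)) := fun c d x => by
    have h1 : Tendsto (fun n => exp (2 * Real.pi * (d * e n : ℝ) * x)) atTop (𝓝 1) := by
      have := ((elimC d).const_mul (2 * Real.pi : ℂ)).mul_const (x : ℂ)
      have h2 := (continuous_exp.tendsto _).comp this
      simpa [Function.comp_def] using h2
    have := (hdl c x).mul h1
    simpa [shiftDilog] using this
  have hsb : ∀ c d : ℝ, 0 ≤ d → d ≤ c → c ≤ 4 → ∀ n s,
      ‖shiftDilog b (c * e n) (d * e n) s‖ ≤ K := fun c d h1 h2 h3 n s =>
    (hK _ _ (mul_nonneg h1 (e0 n).le) (mul_le_mul_of_nonneg_right h2 (e0 n).le)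
      (by nlinarith [e0 n, e1 n]) s).1
  have hsc : ∀ c d : ℝ, 0 ≤ d → d ≤ c → c ≤ 4 → ∀ n, Continuous (shiftDilog b (c * e n) (d * e n)) :=
    fun c d h1 h2 h3 n => hb.continuous_shiftDilog (by
      rw [abs_of_nonneg (mul_nonneg (h1.trans h2) (e0 n).le)]; nlinarith [e0 n, e1 n])
  have hsT : ∀ (c d : ℝ), 0 ≤ d → d ≤ c → c ≤ 4 → ∀ (v : Lin N) (x : ℕ → H) (x₀ : H),
      Tendsto x atTop (𝓝 x₀) →
      Tendsto (fun n => R.fn (shiftDilog b (c * e n) (d * e n)) v (x n)) atTop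
        (𝓝 (R.phi b v x₀)) := fun c d h1 h2 h3 v x x₀ hx =>
    tendsto_apply_of_norm_le
      (fun n x => (R.isUnitaryGroup v).norm_funCalc_apply_le (hsc c d h1 h2 h3 n)
        (hsb c d h1 h2 h3 n) x)
      ((R.isUnitaryGroup v).tendsto_funCalc hb.isBddCont_qdilog.1 (hsc c d h1 h2 h3)
        (hsb c d h1 h2 h3) (hsl c d)) hx
  have hinv : ∀ (v : Lin N) (x : ℕ → H) (x₀ : H), Tendsto x atTop (𝓝 x₀) →
      Tendsto (fun n => R.fn (fun x => (dilog b (x - e n * I))⁻¹) v (x n)) atTop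
        (𝓝 (R.phiBar b v x₀)) := fun v x x₀ hx => by
    have hc : ∀ n, Continuous fun x : ℝ => (dilog b (x - e n * I))⁻¹ := fun n =>
      (hb.isBddCont_inv_dilog (e0 n).le (by linarith [e1 n])).1
    have hbd : ∀ n (x : ℝ), ‖(dilog b (x - e n * I))⁻¹‖ ≤ K := fun n x =>
      (hK (e n) (e n) (e0 n).le le_rfl (by linarith [e1 n]) x).2
    refine tendsto_apply_of_norm_le
      (fun n x => (R.isUnitaryGroup v).norm_funCalc_apply_le (hc n) (hbd n) x)
      ((R.isUnitaryGroup v).tendsto_funCalc hb.isBddCont_inv_qdilog.1 hc hbd fun x => ?_) hx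
    have h1 := (hdl (-1) x).inv₀ (by rw [hb.qdilog_eq]; exact dilog_ne_zero _ _)
    refine h1.congr fun n => ?_
    congr 2; push_cast; ring
  -- All factors converge strongly with uniform bounds, so the products in the regularised identity
  -- converge as well.
  have main : ∀ y, R.phi b (p + q) (R.phi b p y) =
      R.phiBar b q (R.phi b p (R.phi b q y)) := by
    intro y
    have l1 := hsT 2 1 (by norm_num) (by norm_num) (by norm_num) (p + q) _ _
      (hsT 2 1 (by norm_num) (by norm_num) (by norm_num) p (fun _ => y) y tendsto_const_nhds)
    have l2 := hinv q _ _ (hsT 3 2 (by norm_num) (by norm_num) (by norm_num) p _ _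
      (hsT 1 1 (by norm_num) le_rfl (by norm_num) q (fun _ => y) y tendsto_const_nhds))
    have l3 : Tendsto (fun n => exp (3 * Real.pi * I * e n ^ 2)) atTop (𝓝 1) := by
      have := ((elimC 1).pow 2).const_mul (3 * Real.pi * I)
      have h2 := (continuous_exp.tendsto _).comp this
      simpa [Function.comp_def] using h2
    have l4 := l3.smul l2
    rw [one_smul] at l4
    refine tendsto_nhds_unique l1 (l4.congr fun n => ?_)
    have k := hb.pentagon_shiftDilog R hpq (e0 n) (e1 n) y
    simp only [one_mul]
    exact k.symm
  have hqq : R.phi b q * R.phiBar b q = 1 := by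
    rw [Realization.phi, Realization.phiBar, ← R.fn_mul hb.isBddCont_qdilog hb.isBddCont_inv_qdilog,
      ← R.fn_one q]
    congr 1
    funext x
    rw [Pi.mul_apply, mul_inv_cancel₀]
    rw [hb.qdilog_eq]; exact dilog_ne_zero _ _
  have main' : R.phi b (p + q) * R.phi b p = R.phiBar b q * (R.phi b p * R.phi b q) := by
    ext y
    exact main y
  rw [mul_assoc, main', ← mul_assoc, hqq, one_mul]

end IsReduced


/-! ### Decreasing products -/

section DecProd

variable {A : Type*} [Monoid A]

lemma decProd_self (m : ℕ) (F : ℕ → A) : decProd m m F = 1 := by simp [decProd]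

lemma decProd_succ {m n : ℕ} (h : m ≤ n) (F : ℕ → A) :
    decProd m (n + 1) F = F n * decProd m n F := by
  simp [decProd, List.Ico.succ_top h]

lemma decProd_eq_mul_left {m n : ℕ} (h : m < n) (F : ℕ → A) :
    decProd m n F = decProd (m + 1) n F * F m := by
  simp [decProd, List.Ico.eq_cons h]

lemma decProd_succ_succ (m n : ℕ) (F : ℕ → A) :
    decProd (m + 1) (n + 1) F = decProd m n fun k => F (k + 1) := by
  rcases le_total m n with h | h
  · induction n, h using Nat.le_induction with
    | base => rw [decProd_self, decProd_self]
    | succ n h ih => rw [decProd_succ (by omega), decProd_succ h, ih]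
  · simp [decProd, List.Ico.eq_nil_of_le h, List.Ico.eq_nil_of_le (Nat.succ_le_succ h)]

lemma decProd_congr {m n : ℕ} {F F' : ℕ → A} (h : ∀ k, m ≤ k → k < n → F k = F' k) :
    decProd m n F = decProd m n F' := by
  unfold decProd
  congr 1
  refine List.map_congr_left fun k hk => ?_
  rw [List.mem_reverse, List.Ico.mem] at hk
  exact h k hk.1 hk.2

lemma map_decProd {B : Type*} [Monoid B] (T : A →* B) (m n : ℕ) (F : ℕ → A) :
    T (decProd m n F) = decProd m n fun k => T (F k) := by
  simp [decProd, map_list_prod, List.map_map, Function.comp_def]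

lemma commute_decProd {m n : ℕ} {F : ℕ → A} {x : A}
    (h : ∀ k, m ≤ k → k < n → Commute x (F k)) : Commute x (decProd m n F) := by
  refine Commute.list_prod_right _ _ fun y hy => ?_
  rw [List.mem_map] at hy
  obtain ⟨k, hk, rfl⟩ := hy
  rw [List.mem_reverse, List.Ico.mem] at hk
  exact h k hk.1 hk.2

end DecProd

/-! ### The abstract dilogarithm system and consequences of the pentagon -/

lemma bracket_sub_left {N : ℕ} (u v w : Lin N) :
    bracket N (u - v) w = bracket N u w - bracket N v w := by
  rw [sub_eq_add_neg, ← neg_one_smul ℝ v, bracket_add_left, bracket_smul_left]; ring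

lemma bracket_sub_right {N : ℕ} (u v w : Lin N) :
    bracket N u (v - w) = bracket N u v - bracket N u w := by
  rw [sub_eq_add_neg, ← neg_one_smul ℝ w, bracket_add_right, bracket_smul_right]; ring

lemma bracket_neg_left {N : ℕ} (u v : Lin N) : bracket N (-u) v = -bracket N u v := by
  rw [← neg_one_smul ℝ u, bracket_smul_left]; ring

lemma bracket_neg_right {N : ℕ} (u v : Lin N) : bracket N u (-v) = -bracket N u v := by
  rw [← neg_one_smul ℝ v, bracket_smul_right]; ring

/-- The group relations satisfied by the quantum dilogarithms `φ v` of the selfadjoint elements `v`,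
the Gaussian exponentials `γ v = e^{iπv²}`, the constant `κ`, and an element `G` that acts on the
selfadjoint elements by `σ`. -/
structure DilogSystem (N : ℕ) (σ : Lin N → Lin N) (A : Type*) [Group A] where
  φ : Lin N → A
  γ : Lin N → A
  κ : A
  G : A
  commute_κ : ∀ x, Commute κ x
  commute_φ : ∀ u v, bracket N u v = 0 → Commute (φ u) (φ v)
  pentagon : ∀ p q, bracket N p q = 1 → φ p * φ q = φ q * φ (p + q) * φ p
  inversion : ∀ v, φ v * φ (-v) = κ * γ v
  γ_mul : ∀ p q, γ p * φ q = φ (q + bracket N p q • p) * γ p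
  G_mul : ∀ v, G * φ v = φ (σ v) * G

namespace DilogSystem

variable {N : ℕ} [NeZero N] {σ : Lin N → Lin N} {A : Type*} [Group A] (D : DilogSystem N σ A)

lemma commute_inv {u v : Lin N} (h : bracket N u v = 0) : Commute (D.φ u)⁻¹ (D.φ v) :=
  (D.commute_φ u v h).inv_left

lemma commute_inv_inv {u v : Lin N} (h : bracket N u v = 0) : Commute (D.φ u)⁻¹ (D.φ v)⁻¹ :=
  (D.commute_φ u v h).inv_inv

lemma commute_inv_right {u v : Lin N} (h : bracket N u v = 0) : Commute (D.φ u) (D.φ v)⁻¹ :=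
  (D.commute_φ u v h).inv_right

lemma γ_eq (v : Lin N) : D.γ v = D.κ⁻¹ * (D.φ v * D.φ (-v)) := by
  rw [D.inversion, inv_mul_cancel_left]

lemma commute_γ {u v : Lin N} (h : bracket N u v = 0) : Commute (D.γ u) (D.φ v) := by
  rw [γ_eq]
  refine ((D.commute_κ _).inv_left).mul_left ((D.commute_φ _ _ h).mul_left (D.commute_φ _ _ ?_))
  rw [bracket_neg_left, h, neg_zero]

lemma commute_γ_γ {u v : Lin N} (h : bracket N u v = 0) : Commute (D.γ u) (D.γ v) := by
  rw [D.γ_eq v]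
  refine ((D.commute_κ _).symm.inv_right).mul_right
    ((D.commute_γ h).mul_right (D.commute_γ ?_))
  rw [bracket_neg_right, h, neg_zero]

/-- `φ̄(q) φ̄(p) = φ̄(p) φ̄(p+q) φ̄(q)` -/
lemma pentagon_inv {p q : Lin N} (h : bracket N p q = 1) :
    (D.φ p)⁻¹ * (D.φ (p + q))⁻¹ * (D.φ q)⁻¹ = (D.φ q)⁻¹ * (D.φ p)⁻¹ := by
  rw [← mul_inv_rev (D.φ p) (D.φ q), D.pentagon p q h]; group

/-- `φ(q) φ̄(p) φ̄(p+q) = φ̄(p) φ(q)` -/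
lemma pentagon_left {p q : Lin N} (h : bracket N p q = 1) :
    D.φ q * (D.φ p)⁻¹ * (D.φ (p + q))⁻¹ = (D.φ p)⁻¹ * D.φ q := by
  rw [eq_inv_mul_iff_mul_eq]
  have e := D.pentagon p q h
  calc D.φ p * (D.φ q * (D.φ p)⁻¹ * (D.φ (p + q))⁻¹) =
      (D.φ p * D.φ q) * (D.φ p)⁻¹ * (D.φ (p + q))⁻¹ := by group
    _ = D.φ q := by rw [e]; group

/-- `φ(p) φ̄(q) = φ̄(p+q) φ̄(q) φ(p)` -/
lemma pentagon_right {p q : Lin N} (h : bracket N p q = 1) :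
    (D.φ (p + q))⁻¹ * (D.φ q)⁻¹ * D.φ p = D.φ p * (D.φ q)⁻¹ := by
  rw [eq_mul_inv_iff_mul_eq]
  have e := D.pentagon p q h
  calc (D.φ (p + q))⁻¹ * (D.φ q)⁻¹ * D.φ p * D.φ q =
      (D.φ (p + q))⁻¹ * (D.φ q)⁻¹ * (D.φ p * D.φ q) := by group
    _ = D.φ p := by rw [e]; group

/-- The relation behind one conjugation step. -/
lemma conj_relation {o e g E : Lin N} (heo : bracket N e o = 1) (heg : bracket N e g = 1)
    (hog : bracket N o g = 0) (hEg : bracket N E g = 1) (hoE : bracket N o E = 0)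
    (heE : bracket N e E = 0) :
    (D.φ g)⁻¹ * D.φ E * (D.φ e)⁻¹ * D.φ o * D.φ g =
      (D.φ e)⁻¹ * D.φ o * D.φ (g + E) * (D.φ (e + g))⁻¹ * (D.φ (o + e + g))⁻¹ * D.φ E := by
  have r1 := D.pentagon_left (p := e + g) (q := o) (by
    rw [bracket_add_left, heo, bracket_antisymm g o, hog]; norm_num)
  have r2 := D.pentagon_left heg
  have r3 := D.pentagon E g hEg
  have hEe : bracket N E e = 0 := by rw [bracket_antisymm, heE, neg_zero]
  have r4 := D.pentagon_right (p := E) (q := e + g) (by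
    rw [bracket_add_right, hEe, hEg, zero_add])
  have r5 := D.pentagon_left (p := e) (q := g + E) (by rw [bracket_add_right, heg, heE, add_zero])
  have c1 := (D.commute_φ o (g + E) (by rw [bracket_add_right, hog, hoE, add_zero])).eq
  have c2 := (D.commute_φ o E hoE).eq
  have c3 := (D.commute_φ o g hog).eq
  have c4 := (D.commute_inv heE).eq
  rw [show e + g + o = o + e + g by abel] at r1
  rw [show E + (e + g) = e + (g + E) by abel] at r4
  rw [show E + g = g + E by abel] at r3
  -- φ(g) travels left until it cancels φ(g)⁻¹, and φ(E) travels to the right end. The factor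
  -- φ(e+g+E)⁻¹ created when E passes e + g is reabsorbed by `r5`.
  calc _ = (D.φ g)⁻¹ * D.φ E * (D.φ e)⁻¹ * (D.φ o * D.φ g) := by group
    _ = (D.φ g)⁻¹ * D.φ E * ((D.φ e)⁻¹ * D.φ g) * D.φ o := by rw [c3]; group
    _ = (D.φ g)⁻¹ * (D.φ E * D.φ g) * ((D.φ e)⁻¹ * (D.φ (e + g))⁻¹) * D.φ o := by
      rw [← r2]; group
    _ = D.φ (g + E) * (D.φ E * (D.φ e)⁻¹) * (D.φ (e + g))⁻¹ * D.φ o := by rw [r3]; group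
    _ = D.φ (g + E) * (D.φ e)⁻¹ * (D.φ E * (D.φ (e + g))⁻¹) * D.φ o := by rw [← c4]; group
    _ = (D.φ (g + E) * (D.φ e)⁻¹ * (D.φ (e + (g + E)))⁻¹) * (D.φ (e + g))⁻¹ * (D.φ E * D.φ o) := by
      rw [← r4]; group
    _ = (D.φ e)⁻¹ * D.φ (g + E) * ((D.φ (e + g))⁻¹ * D.φ o) * D.φ E := by
      rw [r5, ← c2]; group
    _ = (D.φ e)⁻¹ * (D.φ (g + E) * D.φ o) * (D.φ (e + g))⁻¹ * (D.φ (o + e + g))⁻¹ * D.φ E := by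
      rw [← r1]; group
    _ = _ := by rw [← c1]; group

/-- Pulling `φ̄(a)` through a product of `φ̄(b_k)`. -/
lemma comb (a : Lin N) (v : ℕ → Lin N) {m n : ℕ} (hmn : m ≤ n)
    (h1 : ∀ k, m ≤ k → k < n → bracket N a (v k) = 1)
    (h2 : ∀ k l, m ≤ k → k < l → l < n → bracket N (a + v k) (v l) = 0) :
    (D.φ a)⁻¹ * decProd m n (fun k => (D.φ (a + v k))⁻¹) * decProd m n (fun k => (D.φ (v k))⁻¹) =
      decProd m n (fun k => (D.φ (v k))⁻¹) * (D.φ a)⁻¹ := by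
  induction n, hmn using Nat.le_induction with
  | base => simp [decProd_self]
  | succ n hmn ih =>
    have ih := ih (fun k a1 a2 => h1 k a1 (by omega)) (fun k l a1 a2 a3 => h2 k l a1 a2 (by omega))
    rw [decProd_succ hmn, decProd_succ hmn]
    set Q := decProd m n fun k => (D.φ (a + v k))⁻¹
    set P := decProd m n fun k => (D.φ (v k))⁻¹
    -- The new factor φ(v n)⁻¹ passes the older ones to meet φ(a)⁻¹φ(a + v n)⁻¹, where the pentagon
    -- applies.
    have c : Commute (D.φ (v n))⁻¹ Q := commute_decProd fun k a1 a2 => by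
      have := D.commute_inv_inv (h2 k n a1 a2 (by omega))
      exact this.symm
    have r := D.pentagon_inv (h1 n hmn (by omega))
    calc _ = (D.φ a)⁻¹ * (D.φ (a + v n))⁻¹ * (Q * (D.φ (v n))⁻¹) * P := by group
      _ = ((D.φ a)⁻¹ * (D.φ (a + v n))⁻¹ * (D.φ (v n))⁻¹) * Q * P := by rw [← c.eq]; group
      _ = (D.φ (v n))⁻¹ * ((D.φ a)⁻¹ * Q * P) := by rw [r]; group
      _ = _ := by rw [ih]; group

/-! ### The power of the evolution operator -/

/-- The commutation relations of the partial sums `S k` and of `e` on which the computation of the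
power of the evolution operator depends. -/
structure IsChain (N : ℕ) (S : ℕ → Lin N) (e : Lin N) : Prop where
  zero : S 0 = 0
  lt : ∀ j k, 1 ≤ j → j < k → k < N → bracket N (S j) (S k) = -1
  top : ∀ j, j ≤ N → bracket N (S j) (S N) = 0
  e_left : ∀ k, 1 ≤ k → k < N → bracket N e (S k) = 1
  e_top : bracket N e (S N) = 2

section Chain

variable {S : ℕ → Lin N} {e : Lin N}

/-- `S k`, with `S 0` replaced by `e`. -/
def modChain (S : ℕ → Lin N) (e : Lin N) (k : ℕ) : Lin N := if k = 0 then e else S k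

/-- The factors of the product of the conjugates of the first factor of the evolution operator. -/
def partialProd (S : ℕ → Lin N) (e : Lin N) (m : ℕ) : A :=
  decProd 0 m (fun k => (D.φ (S m - modChain S e k))⁻¹) * D.φ (S N - S m) * (D.φ e)⁻¹ *
    (decProd (m + 1) N fun k => (D.φ (S N - S k))⁻¹)⁻¹

/-- The conjugates of the first factor of the evolution operator. -/
def conjFactor (S : ℕ → Lin N) (e : Lin N) (m : ℕ) : A :=
  decProd 0 m (fun k => (D.φ (S m - S k))⁻¹) *
    decProd (m + 2) N (fun k => (D.φ (S m + (S N - S k)))⁻¹) *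
    (D.φ (S m - e))⁻¹ * D.φ (S (m + 1) - S m) * (D.φ (e + (S N - S (m + 1))))⁻¹

/-- The telescoping step. The two families of factors indexed by k are rearranged by `comb`, one
below m and one above m + 1; the remaining isolated triples are single pentagons. -/
lemma partialProd_mul (hS : IsChain N S e) {m : ℕ} (hm : 1 ≤ m) (hmN : m + 1 < N) :
    D.partialProd S e (m + 1) * D.conjFactor S e m = D.partialProd S e m := by
  have anti := fun j k => bracket_antisymm (S j) (S k)
  have antie := fun k => bracket_antisymm e (S k)
  set a : Lin N := S (m + 1) - S m with ha
  set q : Lin N := S N - S (m + 1) with hq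
  set A₁ := decProd 1 m fun k => (D.φ (S m - S k))⁻¹ with hA₁
  set T := decProd (m + 2) N fun k => (D.φ (S N - S k))⁻¹ with hT
  set T' := decProd (m + 2) N fun k => (D.φ (S m + (S N - S k)))⁻¹ with hT'
  set C := decProd 0 m fun k => (D.φ (S (m + 1) - modChain S e k))⁻¹ with hC
  have eC : decProd 0 (m + 1) (fun k => (D.φ (S (m + 1) - modChain S e k))⁻¹) =
      (D.φ a)⁻¹ * C := by
    rw [decProd_succ (Nat.zero_le _), modChain, if_neg (by omega)]
  have eA : decProd 0 m (fun k => (D.φ (S m - S k))⁻¹) = A₁ * (D.φ (S m))⁻¹ := by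
    rw [decProd_eq_mul_left (by omega), hS.zero, sub_zero]
  have eB : decProd 0 m (fun k => (D.φ (S m - modChain S e k))⁻¹) = A₁ * (D.φ (S m - e))⁻¹ := by
    rw [decProd_eq_mul_left (by omega)]
    congr 1
    exact decProd_congr fun k h1 _ => by rw [modChain, if_neg (by omega)]
  have eT : decProd (m + 1) N (fun k => (D.φ (S N - S k))⁻¹) = T * (D.φ q)⁻¹ :=
    decProd_eq_mul_left hmN _
  have bmm1 := hS.lt m (m + 1) hm (by omega) hmN
  have btm := hS.top m (by omega)
  have btm1 := hS.top (m + 1) (by omega)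
  have bem := hS.e_left m hm (by omega)
  have bem1 := hS.e_left (m + 1) (by omega) hmN
  have beN := hS.e_top
  have bse := bracket_self e
  have bss := fun k => bracket_self (S k)
  -- Replaces the differences from S (m+1) by those from S m, while φ(a)⁻¹ moves to the right.
  have comb1 := D.comb a (fun k => S m - modChain S e k) (Nat.zero_le m)
    (fun k _ hk => by
      rw [modChain, ha]
      split_ifs with h0
      · simp only [bracket_sub_left, bracket_sub_right]
        linarith [anti (m + 1) m, antie m, antie (m + 1), bss m]
      · have := hS.lt k m (by omega) hk (by omega)
        have := hS.lt k (m + 1) (by omega) (by omega) (by omega)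
        simp only [bracket_sub_left, bracket_sub_right]
        linarith [anti (m + 1) m, anti (m + 1) k, anti m k, bss m])
    (fun k l _ hk hl => by
      have := hS.lt l m (by omega) hl (by omega)
      have := hS.lt l (m + 1) (by omega) (by omega) (by omega)
      have := hS.e_left l (by omega) (by omega)
      rw [modChain, modChain, if_neg (by omega : l ≠ 0), ha]
      split_ifs with h0
      · simp only [bracket_sub_left, bracket_sub_right, bracket_add_left]
        linarith [anti (m + 1) m, anti (m + 1) l, anti m l, bss m]
      · have := hS.lt k m (by omega) (by omega) (by omega)
        have := hS.lt k l (by omega) hk (by omega)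
        simp only [bracket_sub_left, bracket_sub_right, bracket_add_left]
        linarith [anti (m + 1) m, anti (m + 1) l, anti m l, bss m])
  -- Absorbs `T'`, whose arguments are shifted by S m, when φ(S m)⁻¹ is carried through `T`.
  have comb2 := D.comb (S m) (fun k => S N - S k) (show m + 2 ≤ N by omega)
    (fun k h1 hk => by
      have := hS.lt m k hm (by omega) hk
      rw [bracket_sub_right]; linarith)
    (fun k l h1 hk hl => by
      have := hS.lt m l hm (by omega) hl
      have := hS.lt k l (by omega) hk hl
      have := hS.top l (by omega)
      simp only [bracket_sub_left, bracket_sub_right, bracket_add_left]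
      linarith [anti N l, bss N, hS.top k (by omega)])
  have e1 : (fun k => (D.φ (a + (S m - modChain S e k)))⁻¹) =
      fun k => (D.φ (S (m + 1) - modChain S e k))⁻¹ := by
    funext k; rw [ha]; congr 2; abel
  rw [e1, eB] at comb1
  have cA : ∀ x : Lin N, (∀ k, 1 ≤ k → k < m → bracket N x (S m - S k) = 0) →
      Commute (D.φ x) A₁ := fun x hx =>
    commute_decProd fun k h1 h2 => D.commute_inv_right (hx k h1 h2)
  have cAq : Commute (D.φ q) A₁ := cA _ fun k h1 h2 => by
    have := hS.lt k (m + 1) h1 (by omega) hmN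
    simp only [hq, bracket_sub_left, bracket_sub_right]
    linarith [anti N m, anti N k, hS.top k (by omega), anti (m + 1) m, anti (m + 1) k]
  have cAe : Commute (D.φ e) A₁ := cA _ fun k h1 h2 => by
    have := hS.e_left k h1 (by omega)
    rw [bracket_sub_right]; linarith
  have cAT : Commute T A₁ := by
    refine commute_decProd fun k h1 h2 => (commute_decProd fun l h3 h4 => ?_).symm
    refine D.commute_inv_inv ?_
    have := hS.lt m l hm (by omega) h4
    have := hS.lt k l h1 (by omega) h4
    simp only [bracket_sub_left, bracket_sub_right]
    linarith [hS.top k (by omega)]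
  have cT : ∀ x : Lin N, (∀ k, m + 2 ≤ k → k < N → bracket N x (S N - S k) = 0) →
      Commute (D.φ x) T := fun x hx =>
    commute_decProd fun k h1 h2 => D.commute_inv_right (hx k h1 h2)
  have cT1 : Commute (D.φ (S m - e)) T := cT _ fun k h1 h2 => by
    have := hS.lt m k hm (by omega) h2
    have := hS.e_left k (by omega) h2
    simp only [bracket_sub_left, bracket_sub_right]; linarith
  have cT2 : Commute (D.φ a) T := cT _ fun k h1 h2 => by
    have := hS.lt m k hm (by omega) h2
    have := hS.lt (m + 1) k (by omega) (by omega) h2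
    simp only [ha, bracket_sub_left, bracket_sub_right]; linarith
  have cT3 : Commute (D.φ (e + q)) T := cT _ fun k h1 h2 => by
    have := hS.lt (m + 1) k (by omega) (by omega) h2
    have := hS.e_left k (by omega) h2
    have := hS.top k (by omega)
    simp only [hq, bracket_sub_left, bracket_sub_right, bracket_add_left]
    linarith [anti N k, bss N]
  have cq : Commute (D.φ q) (D.φ (S m - e)) := D.commute_φ _ _ (by
    simp only [hq, bracket_sub_left, bracket_sub_right]
    linarith [anti N m, antie N, antie (m + 1), anti (m + 1) m])
  have cea : Commute (D.φ e) (D.φ a) := D.commute_φ _ _ (by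
    simp only [ha, bracket_sub_right]; linarith)
  have p1 := D.pentagon_inv (p := e) (q := S m - e) (by rw [bracket_sub_right]; linarith)
  have p2 := D.pentagon q a (by
    simp only [hq, ha, bracket_sub_left, bracket_sub_right]
    linarith [anti N m, anti N (m + 1), anti (m + 1) m, bss (m + 1)])
  have p3 := D.pentagon_left (p := e) (q := q) (by simp only [hq, bracket_sub_right]; linarith)
  rw [show e + (S m - e) = S m by abel] at p1
  rw [show q + a = S N - S m by rw [hq, ha]; abel] at p2
  rw [partialProd, partialProd, conjFactor, eC, eA, eB, eT, ← hq, ← ha]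
  rw [← hT, ← hT']
  have comb2' : T⁻¹ * (D.φ (S m))⁻¹ * T' = (D.φ (S m))⁻¹ * T⁻¹ := by
    have : (D.φ (S m))⁻¹ * T' * T = T * (D.φ (S m))⁻¹ := comb2
    calc T⁻¹ * (D.φ (S m))⁻¹ * T' = T⁻¹ * ((D.φ (S m))⁻¹ * T' * T) * T⁻¹ := by group
      _ = _ := by rw [this]; group
  calc _ = (D.φ a)⁻¹ * C * D.φ q * (D.φ e)⁻¹ * (T⁻¹ * A₁) * (D.φ (S m))⁻¹ * T' *
        (D.φ (S m - e))⁻¹ * D.φ a * (D.φ (e + q))⁻¹ := by group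
    _ = (D.φ a)⁻¹ * C * D.φ q * ((D.φ e)⁻¹ * A₁) * (T⁻¹ * (D.φ (S m))⁻¹ * T') *
        (D.φ (S m - e))⁻¹ * D.φ a * (D.φ (e + q))⁻¹ := by rw [cAT.inv_left.eq]; group
    _ = (D.φ a)⁻¹ * C * (D.φ q * A₁) * (D.φ e)⁻¹ * (D.φ (S m))⁻¹ * (T⁻¹ *
        (D.φ (S m - e))⁻¹) * D.φ a * (D.φ (e + q))⁻¹ := by
      rw [cAe.inv_left.eq, comb2']; group
    _ = (D.φ a)⁻¹ * C * A₁ * D.φ q * ((D.φ e)⁻¹ * (D.φ (S m))⁻¹ * (D.φ (S m - e))⁻¹) * (T⁻¹ *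
        D.φ a) * (D.φ (e + q))⁻¹ := by
      rw [cAq.eq, cT1.symm.inv_inv.eq]; group
    _ = (D.φ a)⁻¹ * C * A₁ * (D.φ q * (D.φ (S m - e))⁻¹) * (D.φ e)⁻¹ * D.φ a * (T⁻¹ *
        (D.φ (e + q))⁻¹) := by
      rw [p1, cT2.symm.inv_left.eq]; group
    _ = ((D.φ a)⁻¹ * C * (A₁ * (D.φ (S m - e))⁻¹)) * D.φ q * ((D.φ e)⁻¹ * D.φ a) *
        (D.φ (e + q))⁻¹ * T⁻¹ := by
      rw [cq.inv_right.eq, cT3.symm.inv_inv.eq]; group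
    _ = A₁ * (D.φ (S m - e))⁻¹ * (D.φ a)⁻¹ * (D.φ q * D.φ a) * (D.φ e)⁻¹ *
        (D.φ (e + q))⁻¹ * T⁻¹ := by
      rw [comb1, cea.inv_left.eq]; group
    _ = A₁ * (D.φ (S m - e))⁻¹ * D.φ (S N - S m) * (D.φ q * (D.φ e)⁻¹ *
        (D.φ (e + q))⁻¹) * T⁻¹ := by
      rw [p2]; group
    _ = _ := by rw [p3]; group

/-- The end of the telescope. Here φ(e)⁻¹ meets φ(-e)⁻¹, and the inversion relation turns the pair
into κ⁻¹γ(e)⁻¹: the source of the Gaussian e^{-iπf₂²} and of the deviation from κ^{N²}. -/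
lemma partialProd_one_mul (hS : IsChain N S e) (hN : 1 < N) :
    D.partialProd S e 1 * D.conjFactor S e 0 = D.κ⁻¹ * (D.φ (S N - e) * (D.γ e)⁻¹) := by
  have be1 := hS.e_left 1 le_rfl hN
  have beN := hS.e_top
  have bse := bracket_self e
  have bt := hS.top 1 hN.le
  have b11 := bracket_self (S 1)
  set T := decProd 2 N fun k => (D.φ (S N - S k))⁻¹ with hT
  have eT' : decProd 2 N (fun k => (D.φ (S 0 + (S N - S k)))⁻¹) = T :=
    decProd_congr fun k _ _ => by rw [hS.zero, zero_add]
  have hγ : (D.φ e)⁻¹ * (D.φ (-e))⁻¹ = D.κ⁻¹ * (D.γ e)⁻¹ := by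
    have c : Commute (D.φ e) (D.φ (-e)) := D.commute_φ _ _ (by rw [bracket_neg_right, bse, neg_zero])
    rw [← mul_inv_rev, ← mul_inv_rev, ← c.eq, D.inversion, (D.commute_κ (D.γ e)).eq]
  have hc : ∀ v : Lin N, (D.γ e)⁻¹ * D.φ (v + bracket N e v • e) = D.φ v * (D.γ e)⁻¹ := by
    intro v
    rw [inv_mul_eq_iff_eq_mul, ← mul_assoc, D.γ_mul]; group
  have h1 := hc (S 1 - e)
  rw [bracket_sub_right, be1, bse, sub_zero, one_smul, sub_add_cancel] at h1
  have h2 := D.γ_mul e (S N - S 1)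
  rw [bracket_sub_right, be1, beN, show (2 : ℝ) - 1 = 1 by norm_num, one_smul] at h2
  have h2' : (D.γ e)⁻¹ * (D.φ (e + (S N - S 1)))⁻¹ = (D.φ (S N - S 1))⁻¹ * (D.γ e)⁻¹ := by
    rw [← mul_inv_rev, ← mul_inv_rev, add_comm e, h2]
  have p := D.pentagon (S N - S 1) (S 1 - e) (by
    simp only [bracket_sub_left, bracket_sub_right]
    linarith [bracket_antisymm (S N) (S 1), bracket_antisymm e (S N), bracket_antisymm e (S 1)])
  rw [show S N - S 1 + (S 1 - e) = S N - e by abel] at p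
  rw [partialProd, conjFactor, decProd_self, zero_add, zero_add, eT',
    decProd_succ le_rfl, decProd_self, modChain, if_pos rfl, hS.zero, zero_sub, sub_zero, ← hT]
  calc _ = (D.φ (S 1 - e))⁻¹ * D.φ (S N - S 1) * ((D.φ e)⁻¹ * (D.φ (-e))⁻¹) * D.φ (S 1) *
        (D.φ (e + (S N - S 1)))⁻¹ := by group
    _ = ((D.φ (S 1 - e))⁻¹ * D.φ (S N - S 1) * D.κ⁻¹) * ((D.γ e)⁻¹ * D.φ (S 1)) *
        (D.φ (e + (S N - S 1)))⁻¹ := by rw [hγ]; group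
    _ = D.κ⁻¹ * (D.φ (S 1 - e))⁻¹ * (D.φ (S N - S 1) * D.φ (S 1 - e)) * ((D.γ e)⁻¹ *
        (D.φ (e + (S N - S 1)))⁻¹) := by
      rw [h1, ← ((D.commute_κ ((D.φ (S 1 - e))⁻¹ * D.φ (S N - S 1))).inv_left).eq]; group
    _ = _ := by rw [p, h2']; group

end Chain

end DilogSystem


namespace DilogSystem

variable {N : ℕ} [NeZero N] {σ : Lin N → Lin N} {A : Type*} [Group A] (D : DilogSystem N σ A)
  {S : ℕ → Lin N} {e : Lin N} {y : A} {T : Lin N →ₗ[ℝ] Lin N}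

/-- Conjugation by y lowers each index by one and adds the last increment S N - S (N-1) to every
partial sum and to e; in differences the increment cancels. -/
lemma conj_partialProd (hy : ∀ v, MulAut.conj y (D.φ v) = D.φ (T v)) {n : ℕ} (hn : N = n + 2)
    (hS : ∀ k, k < N → T (S (k + 1)) = S k + (S N - S (N - 1)))
    (he : T e = e + (S N - S (N - 1))) :
    MulAut.conj y (D.partialProd S e (n + 1)) = D.conjFactor S e n := by
  have eN : N - 1 = n + 1 := by omega
  have hSN : T (S N) = S (n + 1) + (S N - S (n + 1)) := by
    have := hS (n + 1) (by omega)
    rwa [eN, show n + 1 + 1 = N by omega] at this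
  rw [eN] at hS he
  have hp : MulAut.conj y (decProd 0 (n + 1) fun k => (D.φ (S (n + 1) - modChain S e k))⁻¹) =
      decProd 0 n (fun k => (D.φ (S n - S k))⁻¹) * (D.φ (S n - e))⁻¹ := by
    rw [decProd_eq_mul_left (by omega), map_mul, decProd_succ_succ,
      ← MulEquiv.coe_toMonoidHom, map_decProd, map_inv]
    congr 1
    · refine decProd_congr fun k _ hk => ?_
      simp only [modChain, if_neg (Nat.succ_ne_zero k), map_inv, MulEquiv.coe_toMonoidHom, hy,
        map_sub]
      rw [hS n (by omega), hS k (by omega)]; congr 2; abel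
    · simp only [modChain, if_pos, MulEquiv.coe_toMonoidHom, hy, map_sub]
      rw [hS n (by omega), he]; congr 2; abel
  rw [partialProd, conjFactor, map_mul, map_mul, map_mul, hp, map_inv, map_inv, hy, hy, map_sub,
    hSN, he, hS n (by omega), add_sub_add_right_eq_sub, show n + 1 + 1 = N by omega,
    decProd_self, decProd_self, map_one, inv_one, mul_one, mul_one]

/-- Since S 0 = 0 acquires no increment, the factor with k = 0 of the first product does not stay
there: it becomes the top factor of the second product at the lower index. -/
lemma conj_conjFactor (hy : ∀ v, MulAut.conj y (D.φ v) = D.φ (T v)) {m : ℕ} (hm : m + 2 < N)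
    (hS : ∀ k, k < N → T (S (k + 1)) = S k + (S N - S (N - 1)))
    (h0 : S 0 = 0) (he : T e = e + (S N - S (N - 1))) :
    MulAut.conj y (D.conjFactor S e (m + 1)) = D.conjFactor S e m := by
  obtain ⟨n, rfl⟩ : ∃ n, N = n + 1 := ⟨N - 1, by omega⟩
  rw [Nat.add_sub_cancel] at hS he
  have hp : MulAut.conj y (decProd 0 (m + 1) fun k => (D.φ (S (m + 1) - S k))⁻¹) =
      decProd 0 m (fun k => (D.φ (S m - S k))⁻¹) * (D.φ (S m + (S (n + 1) - S n)))⁻¹ := by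
    rw [decProd_eq_mul_left (by omega), map_mul, decProd_succ_succ,
      ← MulEquiv.coe_toMonoidHom, map_decProd, map_inv]
    congr 1
    · refine decProd_congr fun k _ hk => ?_
      simp only [map_inv, MulEquiv.coe_toMonoidHom, hy, map_sub]
      rw [hS m (by omega), hS k (by omega)]; congr 2; abel
    · rw [MulEquiv.coe_toMonoidHom, hy, map_sub, h0, map_zero, hS m (by omega), sub_zero]
  have hq : MulAut.conj y (decProd (m + 3) (n + 1) fun k => (D.φ (S (m + 1) + (S (n + 1) - S k)))⁻¹) =
      decProd (m + 2) n (fun k => (D.φ (S m + (S (n + 1) - S k)))⁻¹) := by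
    rw [decProd_succ_succ, ← MulEquiv.coe_toMonoidHom, map_decProd]
    refine decProd_congr fun k _ hk => ?_
    simp only [map_inv, MulEquiv.coe_toMonoidHom, hy, map_sub, map_add]
    rw [hS m (by omega), hS n (by omega), hS k (by omega)]; congr 2; abel
  rw [conjFactor, conjFactor, map_mul, map_mul, map_mul, map_mul, hp, hq, map_inv, map_inv,
    hy, hy, hy, map_sub, map_sub, map_add, map_sub, he, hS m (by omega), hS (m + 1) (by omega),
    hS n (by omega), decProd_succ (show m + 2 ≤ n by omega), ← mul_assoc,
    add_sub_add_right_eq_sub, add_sub_add_right_eq_sub,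
    show e + (S (n + 1) - S n) + (S n + (S (n + 1) - S n) - (S (m + 1) + (S (n + 1) - S n))) =
      e + (S (n + 1) - S (m + 1)) by abel]

/-- The power of the transformed evolution operator. -/
theorem partialProd_mul_pow (hS : IsChain N S e) (hN : 1 < N)
    (hy : ∀ v, MulAut.conj y (D.φ v) = D.φ (T v))
    (hT : ∀ k, k < N → T (S (k + 1)) = S k + (S N - S (N - 1)))
    (he : T e = e + (S N - S (N - 1))) :
    (D.partialProd S e (N - 1) * y) ^ N = D.κ⁻¹ * (D.φ (S N - e) * (D.γ e)⁻¹) * y ^ N := by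
  obtain ⟨n, rfl⟩ : ∃ n, N = n + 2 := ⟨N - 2, by omega⟩
  rw [show n + 2 - 1 = n + 1 by omega]
  -- `conjFactor` of index m is the conjugate of the first factor by y^{n+1-m}.
  have hX : ∀ i m, i + m = n →
      y ^ (i + 1) * D.partialProd S e (n + 1) = D.conjFactor S e m * y ^ (i + 1) := by
    intro i
    induction i with
    | zero =>
      intro m hm
      obtain rfl : m = n := by omega
      rw [zero_add, pow_one, ← D.conj_partialProd hy rfl hT he, MulAut.conj_apply]; group
    | succ i ih =>
      intro m hm
      rw [pow_succ' y (i + 1), mul_assoc, ih (m + 1) (by omega),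
        ← D.conj_conjFactor (m := m) hy (by omega) hT hS.zero he, MulAut.conj_apply]; group
  -- The product of the first i + 1 conjugates telescopes to the `partialProd` of index N - 1 - i.
  have hpow : ∀ i m, i + m = n →
      (D.partialProd S e (n + 1) * y) ^ (i + 1) = D.partialProd S e (m + 1) * y ^ (i + 1) := by
    intro i
    induction i with
    | zero =>
      intro m hm
      obtain rfl : m = n := by omega
      simp
    | succ i ih =>
      intro m hm
      rw [pow_succ, ih (m + 1) (by omega), ← D.partialProd_mul hS (m := m + 1) (by omega) (by omega)]
      have := hX i (m + 1) (by omega)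
      calc _ = D.partialProd S e (m + 1 + 1) * (y ^ (i + 1) * D.partialProd S e (n + 1)) * y := by
            group
        _ = _ := by rw [this, pow_succ y (i + 1)]; group
  have h1 := hX n 0 (by omega)
  rw [pow_succ, hpow n 0 (by omega), zero_add, ← D.partialProd_one_mul hS hN]
  calc _ = D.partialProd S e 1 * (y ^ (n + 1) * D.partialProd S e (n + 1)) * y := by group
    _ = _ := by rw [h1, pow_succ y (n + 1)]; group

end DilogSystem


/-! ### Commutation relations of the generators -/

section Generators

variable {N : ℕ} [NeZero N]

/-- The prefix sums `f_1 + ⋯ + f_k`. -/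
def pre (N k : ℕ) : Lin N := ∑ l ∈ Finset.range k, f N (l + 1 : ℕ)

lemma pre_zero : pre N 0 = 0 := by simp [pre]

lemma pre_succ (k : ℕ) : pre N (k + 1) = pre N k + f N (k + 1 : ℕ) := Finset.sum_range_succ _ _

lemma f_add (j : ℤ) : f N (j + 2 * N) = f N j := by
  unfold f
  congr 1
  push_cast
  have : ((2 * N : ℕ) : ZMod (2 * N)) = 0 := ZMod.natCast_self _
  push_cast at this
  rw [this, add_zero]

lemma f_natCast {k : ℕ} (hk : 1 ≤ k) : f N (k : ℤ) = pre N k - pre N (k - 1) := by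
  obtain ⟨k, rfl⟩ := Nat.exists_eq_add_of_le' hk
  rw [pre_succ, Nat.add_sub_cancel]; abel

lemma g_natCast {j k : ℕ} (h : j ≤ k) : g N j k = pre N k - pre N j := by
  induction k, h using Nat.le_induction with
  | base => simp [g]
  | succ k h ih =>
    have : Finset.Ioc (j : ℤ) ((k + 1 : ℕ) : ℤ) = insert ((k + 1 : ℕ) : ℤ) (Finset.Ioc (j : ℤ) k) := by
      ext x; simp only [Finset.mem_Ioc, Finset.mem_insert]; omega
    rw [g, this, Finset.sum_insert (by simp), pre_succ, ← g, ih]; abel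

lemma pre_top_add_one : pre N (2 * N + 1) = pre N (2 * N) + pre N 1 := by
  rw [pre_succ, pre_succ 0, pre_zero, zero_add]
  congr 1
  have := f_add (N := N) 1
  push_cast
  rw [← this, add_comm]

lemma bracket_f (i j : ℤ) : bracket N (f N i) (f N j) = comm N i j := by
  have key : ∀ F : ZMod (2 * N) → ℝ,
      ∑ m ∈ Finset.range (2 * N), F (m : ZMod (2 * N)) = ∑ m, F m := by
    intro F
    refine Finset.sum_bij (fun m _ => (m : ZMod (2 * N))) (fun _ _ => Finset.mem_univ _) ?_ ?_ ?_
    · intro a ha b hb h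
      rw [ZMod.natCast_eq_natCast_iff', Nat.mod_eq_of_lt (Finset.mem_range.1 ha),
        Nat.mod_eq_of_lt (Finset.mem_range.1 hb)] at h
      exact h
    · intro m _
      exact ⟨m.val, Finset.mem_range.2 m.val_lt, ZMod.natCast_zmod_val m⟩
    · intros; rfl
  have k1 := fun m : ZMod (2 * N) => key fun n => f N i m * f N j n * comm N m n
  unfold bracket
  simp_rw [k1]
  rw [key fun m => ∑ n, f N i m * f N j n * comm N m n, Finset.sum_eq_single (i : ZMod (2 * N)),
    Finset.sum_eq_single (j : ZMod (2 * N))]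
  · simp [f]
  · intro n _ hn
    simp [f, Pi.single_eq_of_ne hn]
  · simp
  · intro m _ hm
    simp [f, Pi.single_eq_of_ne hm]
  · simp

/-- The last term is the bond between 1 and 2N that closes the ring; N > 1 keeps it apart from the
bonds between consecutive indices. -/
lemma bracket_f_natCast {i j : ℕ} (hN : 1 < N) (hi : 1 ≤ i) (hij : i < j) (hj : j ≤ 2 * N) :
    bracket N (f N i) (f N j) =
      (if j = i + 1 then (-1) ^ i else 0) - if i = 1 ∧ j = 2 * N then 1 else 0 := by
  have h1 : ((j : ℤ) : ZMod (2 * N)) = ((i : ℤ) : ZMod (2 * N)) + 1 ↔ j = i + 1 := by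
    rw [show ((i : ℤ) : ZMod (2 * N)) + 1 = ((i + 1 : ℕ) : ZMod (2 * N)) by push_cast; ring,
      Int.cast_natCast, ZMod.natCast_eq_natCast_iff, Nat.ModEq.comm,
      Nat.modEq_iff_dvd' (by omega)]
    refine ⟨fun h => ?_, fun h => by simp [h]⟩
    have := Nat.eq_zero_of_dvd_of_lt h (by omega)
    omega
  have h2 : ((j : ℤ) : ZMod (2 * N)) = ((i : ℤ) : ZMod (2 * N)) - 1 ↔ i = 1 ∧ j = 2 * N := by
    rw [eq_sub_iff_add_eq, show ((j : ℤ) : ZMod (2 * N)) + 1 = ((j + 1 : ℕ) : ZMod (2 * N)) by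
      push_cast; ring, Int.cast_natCast, ZMod.natCast_eq_natCast_iff, Nat.ModEq.comm,
      Nat.modEq_iff_dvd' (by omega)]
    refine ⟨fun h => ?_, fun h => ?_⟩
    · have := Nat.le_of_dvd (by omega) h
      omega
    · rw [h.1, h.2]; simp
  rw [bracket_f, comm]
  simp only [h1, h2]
  rw [Int.cast_natCast, neg_one_pow_val_natCast]
  by_cases a : j = i + 1
  · rw [if_pos (Or.inl a), if_pos a, if_neg (by omega), sub_zero]
  · by_cases c : i = 1 ∧ j = 2 * N
    · rw [if_pos (Or.inr c), if_neg a, if_pos c, c.1]; norm_num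
    · rw [if_neg (by tauto), if_neg a, if_neg c, sub_zero]

lemma bracket_pre_f {j k : ℕ} (hN : 1 < N) (hj : 1 ≤ j) (hjk : j < k) (hk : k ≤ 2 * N) :
    bracket N (pre N j) (f N k) =
      (if k = j + 1 then (-1) ^ j else 0) - if k = 2 * N then 1 else 0 := by
  induction j, hj using Nat.le_induction with
  | base =>
    rw [pre_succ, pre_zero, zero_add]
    rw [bracket_f_natCast hN le_rfl hjk hk]
    simp
  | succ j hj ih =>
    rw [pre_succ, bracket_add_left, ih (by omega), bracket_f_natCast hN (by omega) hjk hk,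
      if_neg (by omega : ¬ k = j + 1), if_neg (by omega : ¬ (j + 1 = 1 ∧ k = 2 * N))]
    ring

/-- Of the terms by which the longer sum exceeds the shorter, only f_{j+1} and, by closure of the
ring, f_{2N} contribute. So the bracket depends on the parity of the smaller index and on whether k
= 2N, and later brackets reduce to these cases. -/
lemma bracket_pre {j k : ℕ} (hN : 1 < N) (hj : 1 ≤ j) (hjk : j < k) (hk : k ≤ 2 * N) :
    bracket N (pre N j) (pre N k) = (-1) ^ j - if k = 2 * N then 1 else 0 := by
  induction k, (show j + 1 ≤ k from hjk) using Nat.le_induction with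
  | base =>
    rw [pre_succ, bracket_add_right, bracket_self, bracket_pre_f hN hj (by omega) hk, if_pos rfl,
      zero_add]
  | succ k h ih =>
    rw [pre_succ, bracket_add_right, ih (by omega) (by omega),
      bracket_pre_f hN hj (by omega) hk, if_neg (by omega : ¬ k = 2 * N),
      if_neg (by omega : ¬ k + 1 = j + 1)]
    ring

lemma bracket_pre_even {j k : ℕ} (hN : 1 < N) (hj : 1 ≤ j) (hjk : j < k) (hk : k < 2 * N)
    (h : j % 2 = 0) : bracket N (pre N j) (pre N k) = 1 := by
  rw [bracket_pre hN hj hjk hk.le, if_neg hk.ne, (Nat.even_iff.2 h).neg_one_pow, sub_zero]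

lemma bracket_pre_odd {j k : ℕ} (hN : 1 < N) (hj : 1 ≤ j) (hjk : j < k) (hk : k < 2 * N)
    (h : j % 2 = 1) : bracket N (pre N j) (pre N k) = -1 := by
  rw [bracket_pre hN hj hjk hk.le, if_neg hk.ne, (Nat.odd_iff.2 h).neg_one_pow, sub_zero]

lemma bracket_pre_even_top {j k : ℕ} (hN : 1 < N) (hj : 1 ≤ j) (hjk : j < k) (hk : k = 2 * N)
    (h : j % 2 = 0) : bracket N (pre N j) (pre N k) = 0 := by
  rw [bracket_pre hN hj hjk hk.le, if_pos hk, (Nat.even_iff.2 h).neg_one_pow, sub_self]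

lemma bracket_pre_odd_top {j k : ℕ} (hN : 1 < N) (hj : 1 ≤ j) (hjk : j < k) (hk : k = 2 * N)
    (h : j % 2 = 1) : bracket N (pre N j) (pre N k) = -2 := by
  rw [bracket_pre hN hj hjk hk.le, if_pos hk, (Nat.odd_iff.2 h).neg_one_pow]; norm_num

lemma bracket_pre_even' {j k : ℕ} (hN : 1 < N) (hj : 1 ≤ j) (hjk : j < k) (hk : k < 2 * N)
    (h : j % 2 = 0) : bracket N (pre N k) (pre N j) = -1 := by
  rw [bracket_antisymm, bracket_pre_even hN hj hjk hk h]

lemma bracket_pre_odd' {j k : ℕ} (hN : 1 < N) (hj : 1 ≤ j) (hjk : j < k) (hk : k < 2 * N)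
    (h : j % 2 = 1) : bracket N (pre N k) (pre N j) = 1 := by
  rw [bracket_antisymm, bracket_pre_odd hN hj hjk hk h, neg_neg]

lemma bracket_pre_even_top' {j k : ℕ} (hN : 1 < N) (hj : 1 ≤ j) (hjk : j < k) (hk : k = 2 * N)
    (h : j % 2 = 0) : bracket N (pre N k) (pre N j) = 0 := by
  rw [bracket_antisymm, bracket_pre_even_top hN hj hjk hk h, neg_zero]

lemma bracket_pre_odd_top' {j k : ℕ} (hN : 1 < N) (hj : 1 ≤ j) (hjk : j < k) (hk : k = 2 * N)
    (h : j % 2 = 1) : bracket N (pre N k) (pre N j) = 2 := by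
  rw [bracket_antisymm, bracket_pre_odd_top hN hj hjk hk h, neg_neg]

lemma bracket_pre_eq {j k : ℕ} (h : j = k) : bracket N (pre N k) (pre N j) = 0 := by
  rw [h, bracket_self]

lemma bracket_pre_zero_left {j : ℕ} (h : j = 0) (v : Lin N) : bracket N (pre N j) v = 0 := by
  rw [h, pre_zero, ← zero_smul ℝ (0 : Lin N), bracket_smul_left, zero_mul]

lemma bracket_pre_zero_right {j : ℕ} (h : j = 0) (v : Lin N) : bracket N v (pre N j) = 0 := by
  rw [bracket_antisymm, bracket_pre_zero_left h, neg_zero]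

/-- Partial sums of the elements `f_{2l} + f_{2l+1}`. -/
def chain (N k : ℕ) : Lin N := pre N (2 * k + 1) - pre N 1

lemma chain_top : chain N N = pre N (2 * N) := by
  rw [chain, pre_top_add_one, add_sub_cancel_right]

/-- Here e is f₂, written as a difference of prefix sums so that the parity rules decide every
bracket. -/
lemma isChain (hN : 1 < N) : DilogSystem.IsChain N (chain N) (pre N 2 - pre N 1) where
  zero := sub_self _
  lt j k hj hjk hk := by
    simp (disch := omega) only [chain, bracket_sub_left, bracket_sub_right,
      bracket_pre_odd, bracket_pre_odd', bracket_pre_eq]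
    norm_num
  top j hj := by
    rw [chain_top]
    rcases hj.eq_or_lt with rfl | hj
    · rw [chain_top, bracket_self]
    rcases Nat.eq_zero_or_pos j with rfl | h0
    · rw [chain, mul_zero, zero_add, sub_self, ← pre_zero, bracket_pre_zero_left rfl]
    · simp (disch := omega) only [chain, bracket_sub_left, bracket_pre_odd_top]
      norm_num
  e_left k hk hkN := by
    simp (disch := omega) only [chain, bracket_sub_left, bracket_sub_right, bracket_pre_even,
      bracket_pre_odd, bracket_pre_odd', bracket_pre_eq]
    norm_num
  e_top := by
    rw [chain_top]
    simp (disch := omega) only [bracket_sub_left, bracket_pre_odd_top, bracket_pre_even_top]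
    norm_num

/-! ### The evolution of the generators -/

/-- The action of `G` on the selfadjoint elements: `f_j ↦ (-1)^j f_{j-1}`. -/
def shift (N : ℕ) : Lin N →ₗ[ℝ] Lin N where
  toFun v m := (-1) ^ (m + 1).val * v (m + 1)
  map_add' u v := by ext m; simp [mul_add]
  map_smul' c v := by ext m; simp [mul_left_comm]

lemma shift_f (j : ℕ) : shift N (f N (j + 1 : ℕ)) = (-1 : ℝ) ^ (j + 1) • f N j := by
  ext m
  simp only [shift, LinearMap.coe_mk, AddHom.coe_mk, Pi.smul_apply, smul_eq_mul, f]
  by_cases h : m = (j : ZMod (2 * N))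
  · subst h
    have := neg_one_pow_val_natCast (N := N) (j + 1)
    push_cast at this ⊢
    simp [this]
  · have h' : m + 1 ≠ ((j + 1 : ℕ) : ZMod (2 * N)) := fun h' => h (by
      push_cast at h'; exact add_right_cancel h')
    have e1 := Pi.single_eq_of_ne (M := fun _ => ℝ) h' 1
    have e2 := Pi.single_eq_of_ne (M := fun _ => ℝ) h 1
    rw [Int.cast_natCast, Int.cast_natCast, e1, e2, mul_zero, mul_zero]

lemma shift_even {m : ℕ} (hm : 1 ≤ m) :
    shift N (f N (2 * m : ℕ)) = f N (2 * m - 1 : ℕ) := by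
  obtain ⟨m, rfl⟩ := Nat.exists_eq_add_of_le' hm
  have := shift_f (N := N) (2 * m + 1)
  rwa [(by rw [Nat.even_iff]; omega : Even (2 * m + 1 + 1)).neg_one_pow, one_smul] at this

lemma shift_odd (m : ℕ) : shift N (f N (2 * m + 1 : ℕ)) = -f N (2 * m : ℕ) := by
  have := shift_f (N := N) (2 * m)
  rwa [(by rw [Nat.odd_iff]; omega : Odd (2 * m + 1)).neg_one_pow, neg_one_smul] at this

/-- The action of `∏_{l ≥ j} e^{iπ f_{2l}²}` on the selfadjoint elements. -/
def shear (N j : ℕ) : Lin N →ₗ[ℝ] Lin N where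
  toFun v := v + ∑ l ∈ Finset.Ico j (N + 1), bracket N (f N (2 * l : ℕ)) v • f N (2 * l : ℕ)
  map_add' u v := by
    simp only [bracket_add_right, add_smul, Finset.sum_add_distrib]; abel
  map_smul' c v := by
    simp only [bracket_smul_right, mul_smul, ← Finset.smul_sum, smul_add, RingHom.id_apply]

lemma bracket_even_even {l m : ℕ} (hN : 1 < N) (hl : 1 ≤ l) (hlN : l ≤ N) (hm : 1 ≤ m)
    (hmN : m ≤ N) : bracket N (f N (2 * l : ℕ)) (f N (2 * m : ℕ)) = 0 := by
  rcases lt_trichotomy l m with h | rfl | h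
  · rw [bracket_f_natCast hN (by omega) (by omega) (by omega), if_neg (by omega),
      if_neg (by omega), sub_zero]
  · rw [bracket_self]
  · rw [bracket_antisymm, bracket_f_natCast hN (by omega) (by omega) (by omega),
      if_neg (by omega), if_neg (by omega), sub_zero, neg_zero]

lemma bracket_even_odd {l m : ℕ} (hN : 1 < N) (hl : 1 ≤ l) (hlN : l ≤ N) (hm : 1 ≤ m)
    (hmN : m ≤ N) : bracket N (f N (2 * l : ℕ)) (f N (2 * m - 1 : ℕ)) =
      (if l = m then 1 else 0) + if l = (if m = 1 then N else m - 1) then 1 else 0 := by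
  rcases lt_or_ge l m with h | h
  · rw [bracket_f_natCast hN (by omega) (by omega) (by omega),
      (by rw [Nat.even_iff]; omega : Even (2 * l)).neg_one_pow]
    split_ifs <;> first | omega | norm_num
  · rw [bracket_antisymm, bracket_f_natCast hN (by omega) (by omega) (by omega),
      (by rw [Nat.odd_iff]; omega : Odd (2 * m - 1)).neg_one_pow]
    split_ifs <;> first | omega | norm_num

lemma bracket_odd_odd {l m : ℕ} (hN : 1 < N) (hl : 1 ≤ l) (hlN : l ≤ N) (hm : 1 ≤ m)
    (hmN : m ≤ N) : bracket N (f N (2 * l - 1 : ℕ)) (f N (2 * m - 1 : ℕ)) = 0 := by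
  rcases lt_trichotomy l m with h | rfl | h
  · rw [bracket_f_natCast hN (by omega) (by omega) (by omega), if_neg (by omega),
      if_neg (by omega), sub_zero]
  · rw [bracket_self]
  · rw [bracket_antisymm, bracket_f_natCast hN (by omega) (by omega) (by omega),
      if_neg (by omega), if_neg (by omega), sub_zero, neg_zero]

lemma shear_even (hN : 1 < N) {j m : ℕ} (hj : 1 ≤ j) (hm : 1 ≤ m) (hmN : m ≤ N) :
    shear N j (f N (2 * m : ℕ)) = f N (2 * m : ℕ) := by
  simp only [shear, LinearMap.coe_mk, AddHom.coe_mk]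
  rw [Finset.sum_eq_zero, add_zero]
  intro l hl
  rw [Finset.mem_Ico] at hl
  rw [bracket_even_even hN (by omega) (by omega) hm hmN, zero_smul]

lemma shear_odd (hN : 1 < N) {j m : ℕ} (hj : 1 ≤ j) (hm : 1 ≤ m) (hmN : m ≤ N) :
    shear N j (f N (2 * m - 1 : ℕ)) = f N (2 * m - 1 : ℕ) + ((if j ≤ m then f N (2 * m : ℕ) else 0) +
      if j ≤ (if m = 1 then N else m - 1) then f N (2 * (if m = 1 then N else m - 1) : ℕ) else 0) := by
  simp only [shear, LinearMap.coe_mk, AddHom.coe_mk]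
  congr 1
  set m' := if m = 1 then N else m - 1 with hm'
  have h : m' ≤ N := by rw [hm']; split_ifs <;> omega
  rw [Finset.sum_congr rfl (g := fun l => (if l = m then f N (2 * l : ℕ) else 0) +
    if l = m' then f N (2 * l : ℕ) else 0)]
  · rw [Finset.sum_add_distrib, Finset.sum_ite_eq', Finset.sum_ite_eq']
    simp only [Finset.mem_Ico]
    congr 1
    · exact if_congr (by omega) rfl rfl
    · exact if_congr (by omega) rfl rfl
  · intro l hl
    rw [Finset.mem_Ico] at hl
    rw [bracket_even_odd hN (by omega) (by omega) hm hmN, add_smul, ite_smul, ite_smul, one_smul,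
      zero_smul]

/-- The action of `(∏_{l ≥ j} e^{iπ f_{2l}²}) G` on the selfadjoint elements. -/
def evol (N j : ℕ) : Lin N →ₗ[ℝ] Lin N := shear N j ∘ₗ shift N

lemma evol_apply (j : ℕ) (v : Lin N) : evol N j v = shear N j (shift N v) := rfl

lemma evol_odd (hN : 1 < N) {j m : ℕ} (hj : 1 ≤ j) (hm : 1 ≤ m) (hmN : m ≤ N) :
    evol N j (f N (2 * m + 1 : ℕ)) = -f N (2 * m : ℕ) := by
  rw [evol_apply, shift_odd, map_neg, shear_even hN hj hm hmN]

lemma evol_even (hN : 1 < N) {j m : ℕ} (hj : 1 ≤ j) (hm : 1 ≤ m) (hmN : m ≤ N) :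
    evol N j (f N (2 * m : ℕ)) = f N (2 * m - 1 : ℕ) + ((if j ≤ m then f N (2 * m : ℕ) else 0) +
      if j ≤ (if m = 1 then N else m - 1) then f N (2 * (if m = 1 then N else m - 1) : ℕ) else 0) := by
  rw [evol_apply, shift_even hm, shear_odd hN hj hm hmN]

lemma evol_even_succ (hN : 1 < N) {j m : ℕ} (hj : 1 ≤ j) (hm : 1 ≤ m) (hmN : m < N) :
    evol N j (f N (2 * (m + 1) : ℕ)) = f N (2 * m + 1 : ℕ) +
      ((if j ≤ m + 1 then f N (2 * (m + 1) : ℕ) else 0) + if j ≤ m then f N (2 * m : ℕ) else 0) := by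
  have := evol_even hN hj (show 1 ≤ m + 1 by omega) hmN
  rwa [if_neg (show m + 1 ≠ 1 by omega), Nat.add_sub_cancel] at this

lemma chain_succ (k : ℕ) :
    chain N (k + 1) = chain N k + (f N (2 * (k + 1) : ℕ) + f N (2 * (k + 1) + 1 : ℕ)) := by
  rw [chain, chain, pre_succ, show 2 * (k + 1) = 2 * k + 1 + 1 by ring, pre_succ]; abel

lemma f_top_add_one : f N (2 * N + 1 : ℕ) = f N (1 : ℕ) := by
  rw [← f_add ((1 : ℕ) : ℤ)]; congr 1; push_cast; ring

lemma chain_top_sub (hN : 1 < N) : chain N N - chain N (N - 1) = f N (1 : ℕ) + f N (2 * N : ℕ) := by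
  have := chain_succ (N := N) (N - 1)
  rw [Nat.sub_add_cancel hN.le, f_top_add_one] at this
  rw [this]; abel

/-- From f_{2m} ↦ f_{2m-2} + f_{2m-1} + f_{2m} and f_{2m+1} ↦ -f_{2m} the sum telescopes. At the
lower boundary f₁ and f₀ = f_{2N} survive, and together they are the last increment of the chain. -/
lemma evol_chain (hN : 1 < N) {k : ℕ} (hk : k < N) :
    evol N 1 (chain N (k + 1)) = chain N k + (chain N N - chain N (N - 1)) := by
  induction k with
  | zero =>
    rw [chain_succ, map_add, map_add, evol_even hN le_rfl le_rfl hN.le, evol_odd hN le_rfl le_rfl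
      hN.le, chain_top_sub hN, chain, sub_self, map_zero]
    simp only [zero_add, le_refl, if_true, hN.le]
    abel
  | succ k ih =>
    rw [chain_succ (k + 1), map_add, ih (by omega), map_add, evol_even_succ hN le_rfl (by omega) hk,
      evol_odd hN le_rfl (by omega) hk, if_pos (by omega), if_pos (by omega), chain_succ k]
    abel

lemma evol_two (hN : 1 < N) :
    evol N 1 (f N (2 : ℕ)) = f N (2 : ℕ) + (chain N N - chain N (N - 1)) := by
  have := evol_even hN (le_refl 1) (le_refl 1) hN.le
  rw [if_pos le_rfl, if_pos rfl, if_pos hN.le] at this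
  rw [chain_top_sub hN, this]; abel

/-- The truncated shear supplies no f_{2j} at the lower boundary, so only f_{2j+1} survives there.
This is the form used while W is being conjugated through. -/
lemma evol_chain_sub (hN : 1 < N) {j k : ℕ} (hj : 1 ≤ j) (hjk : j ≤ k) (hk : k < N) :
    evol N (j + 1) (chain N (k + 1) - chain N j) =
      f N (2 * j + 1 : ℕ) + (chain N k - chain N j) := by
  induction k, hjk using Nat.le_induction with
  | base =>
    rw [chain_succ, add_sub_cancel_left, map_add, evol_even_succ hN (by omega) hj hk,
      evol_odd hN (by omega) (by omega) hk, if_pos le_rfl, if_neg (by omega)]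
    abel
  | succ k h ih =>
    rw [chain_succ (k + 1), add_sub_right_comm, map_add, ih (by omega), map_add,
      evol_even_succ hN (by omega) (by omega) hk,
      evol_odd hN (by omega) (by omega) hk, if_pos (by omega), if_pos (by omega), chain_succ k]
    abel

end Generators


/-! ### Conjugation of the evolution operator by W -/

namespace DilogSystem

section

variable {N : ℕ} [NeZero N] {σ : Lin N → Lin N} {A : Type*} [Group A] (D : DilogSystem N σ A)

lemma φ_neg (v : Lin N) : D.φ (-v) = D.κ * ((D.φ v)⁻¹ * D.γ v) := by
  rw [← mul_assoc, ((D.commute_κ _)).eq, mul_assoc, ← D.inversion, inv_mul_cancel_left]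

lemma γ_mul_sub {p q : Lin N} (h : bracket N p q = 1) :
    D.γ p * D.φ (q - p) = D.φ q * D.γ p := by
  rw [D.γ_mul, bracket_sub_right, h, bracket_self, sub_zero, one_smul, sub_add_cancel]

/-- The first conjugation of the evolution operator. -/
lemma conj_mul_of_bracket_top {a o f₁ f' : Lin N} {M y : A} (haf : bracket N a f₁ = 1)
    (hof : bracket N o f₁ = 0) (hf' : bracket N a f' = 0) (hMo : Commute (D.φ o) M)
    (hMf : Commute (D.φ f₁) M) (hMa : Commute (D.φ (-a)) M) (hMγ : Commute (D.γ a) M)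
    (hya : y * D.φ a = D.φ o * y) (hyo : y * D.φ o = D.φ (-f') * y)
    (hyf : y * D.φ f₁ = D.φ (-a) * y) :
    ((D.φ a)⁻¹ * D.φ o * D.φ f₁)⁻¹ * (D.φ o * M * D.φ f₁ * y) * ((D.φ a)⁻¹ * D.φ o * D.φ f₁) =
      D.κ * ((D.φ o)⁻¹ * D.φ (a + f₁) * M * D.φ (-f') * (D.γ a * y)) := by
  have hyw : y * ((D.φ a)⁻¹ * D.φ o * D.φ f₁) = (D.φ o)⁻¹ * D.φ (-f') * D.φ (-a) * y := by
    have : y * (D.φ a)⁻¹ = (D.φ o)⁻¹ * y := by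
      rw [mul_inv_eq_iff_eq_mul, mul_assoc, hya, inv_mul_cancel_left]
    calc _ = (y * (D.φ a)⁻¹) * D.φ o * D.φ f₁ := by group
      _ = (D.φ o)⁻¹ * (y * D.φ o) * D.φ f₁ := by rw [this]; group
      _ = (D.φ o)⁻¹ * D.φ (-f') * (y * D.φ f₁) := by rw [hyo]; group
      _ = _ := by rw [hyf]; group
  have c1 := (D.commute_φ (-f') (-a) (by
    rw [bracket_neg_left, bracket_neg_right, bracket_antisymm, hf']; simp)).eq
  have c2 := (D.commute_φ _ _ hof).eq
  have c3 : Commute (D.γ a) (D.φ (-f')) := D.commute_γ (by rw [bracket_neg_right, hf', neg_zero])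
  have p := D.pentagon _ _ haf
  -- φ(f₁) is carried left through φ(a) by a pentagon and cancels φ(f₁)⁻¹; φ(-a) is carried left to
  -- meet φ(a), which gives κγ(a).
  calc _ = (D.φ f₁)⁻¹ * (D.φ o)⁻¹ * D.φ a * (D.φ o * M) * D.φ f₁ *
        (y * ((D.φ a)⁻¹ * D.φ o * D.φ f₁)) := by group
    _ = (D.φ f₁)⁻¹ * (D.φ o)⁻¹ * D.φ a * M * (D.φ o * D.φ f₁) * (D.φ o)⁻¹ *
        (D.φ (-f') * D.φ (-a)) * y := by rw [hyw, hMo.eq]; group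
    _ = (D.φ f₁)⁻¹ * (D.φ o)⁻¹ * D.φ a * (M * D.φ f₁) * (D.φ (-a) * D.φ (-f')) * y := by
      rw [c2, c1]; group
    _ = (D.φ f₁)⁻¹ * (D.φ o)⁻¹ * (D.φ a * D.φ f₁) * (M * D.φ (-a)) * D.φ (-f') * y := by
      rw [← hMf.eq]; group
    _ = ((D.φ f₁)⁻¹ * (D.φ o)⁻¹) * D.φ f₁ * D.φ (a + f₁) * D.φ a * D.φ (-a) * M * D.φ (-f') *
        y := by
      rw [← hMa.eq, p]; group
    _ = (D.φ o)⁻¹ * D.φ (a + f₁) * (D.φ a * D.φ (-a)) * M * D.φ (-f') * y := by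
      rw [← mul_inv_rev, c2]; group
    _ = ((D.φ o)⁻¹ * D.φ (a + f₁) * D.κ) * (D.γ a * M) * D.φ (-f') * y := by
      rw [D.inversion]; group
    _ = D.κ * (D.φ o)⁻¹ * D.φ (a + f₁) * M * (D.γ a * D.φ (-f')) * y := by
      rw [hMγ.eq, ← (D.commute_κ ((D.φ o)⁻¹ * D.φ (a + f₁))).eq]; group
    _ = _ := by rw [c3.eq]; group

/-- The inductive step of the conjugation of the evolution operator. -/
lemma conj_mul_of_bracket {o e g E f' : Lin N} {H M y : A} (heo : bracket N e o = 1)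
    (heg : bracket N e g = 1) (hog : bracket N o g = 0) (hEg : bracket N E g = 1)
    (hoE : bracket N o E = 0) (heE : bracket N e E = 0) (hef : bracket N e f' = 0)
    (hgf : bracket N g f' = 0) (hMo : Commute (D.φ o) M) (hMe : Commute (D.φ (-e)) M)
    (hMγ : Commute (D.γ e) M) (hMg : Commute (D.φ (g - e)) M) (hHo : Commute (D.φ o) H)
    (hHe : Commute (D.φ e) H) (hHg : Commute (D.φ (g + E)) H)
    (hye : y * D.φ e = D.φ o * y) (hyo : y * D.φ o = D.φ (-f') * y)
    (hyg : y * D.φ (g + E) = D.φ (g - e) * y) :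
    ((D.φ e)⁻¹ * D.φ o * D.φ (g + E))⁻¹ *
        (H * (D.φ g)⁻¹ * D.φ E * (D.φ o * M) * D.φ (-e) * y) *
        ((D.φ e)⁻¹ * D.φ o * D.φ (g + E)) =
      D.κ * (H * (D.φ (e + g))⁻¹ * (D.φ (o + e + g))⁻¹ * D.φ E * M * D.φ (-f') * (D.γ e * y)) := by
  have hyw : y * ((D.φ e)⁻¹ * D.φ o * D.φ (g + E)) =
      (D.φ o)⁻¹ * D.φ (-f') * D.φ (g - e) * y := by
    have : y * (D.φ e)⁻¹ = (D.φ o)⁻¹ * y := by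
      rw [mul_inv_eq_iff_eq_mul, mul_assoc, hye, inv_mul_cancel_left]
    calc _ = (y * (D.φ e)⁻¹) * D.φ o * D.φ (g + E) := by group
      _ = (D.φ o)⁻¹ * (y * D.φ o) * D.φ (g + E) := by rw [this]; group
      _ = (D.φ o)⁻¹ * D.φ (-f') * (y * D.φ (g + E)) := by rw [hyo]; group
      _ = _ := by rw [hyg]; group
  have c1 := (D.commute_φ (-f') (g - e) (by
    rw [bracket_neg_left, bracket_antisymm, bracket_sub_left, hgf, hef]; simp)).eq
  have c2 : Commute (D.γ e) (D.φ (-f')) := D.commute_γ (by rw [bracket_neg_right, hef, neg_zero])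
  have p := D.pentagon o (-e) (by rw [bracket_neg_right, bracket_antisymm, heo, neg_neg])
  rw [← sub_eq_add_neg] at p
  have r := D.conj_relation heo heg hog hEg hoE heE
  set P := (D.φ (g + E))⁻¹ * (D.φ o)⁻¹ * D.φ e * H * (D.φ g)⁻¹ * D.φ E with hP
  have hz : Commute (D.φ e * H * (D.φ e)⁻¹ * D.φ o * D.φ (g + E)) D.κ := (D.commute_κ _).symm
  -- φ(-e) is rewritten as κφ(e)⁻¹γ(e). Moving γ(e) to the right undoes the shifts in o - e and g -
  -- e, after which the middle part is the left side of `conj_relation`.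
  calc _ = P * (D.φ o * M) * D.φ (-e) * (y * ((D.φ e)⁻¹ * D.φ o * D.φ (g + E))) := by
        rw [hP]; group
    _ = P * D.φ o * (M * D.φ (-e)) * (D.φ o)⁻¹ * (D.φ (-f') * D.φ (g - e)) * y := by
      rw [hyw]; group
    _ = P * D.φ o * D.φ (-e) * (M * (D.φ o)⁻¹) * D.φ (g - e) * D.φ (-f') * y := by
      rw [← hMe.eq, c1]; group
    _ = P * (D.φ o * D.φ (-e)) * (D.φ o)⁻¹ * (M * D.φ (g - e)) * D.φ (-f') * y := by
      rw [← hMo.inv_left.eq]; group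
    _ = P * D.φ (-e) * D.φ (o - e) * D.φ (g - e) * M * D.φ (-f') * y := by
      rw [← hMg.eq, p]; group
    _ = P * D.κ * (D.φ e)⁻¹ * (D.γ e * D.φ (o - e)) * D.φ (g - e) * M * D.φ (-f') * y := by
      rw [D.φ_neg e]; group
    _ = P * D.κ * (D.φ e)⁻¹ * D.φ o * (D.γ e * D.φ (g - e)) * M * D.φ (-f') * y := by
      rw [D.γ_mul_sub heo]; group
    _ = P * D.κ * (D.φ e)⁻¹ * D.φ o * D.φ g * (D.γ e * M) * D.φ (-f') * y := by
      rw [D.γ_mul_sub heg]; group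
    _ = (P * D.κ) * (D.φ e)⁻¹ * D.φ o * D.φ g * M * (D.γ e * D.φ (-f')) * y := by
      rw [hMγ.eq]; group
    _ = D.κ * (D.φ (g + E))⁻¹ * (D.φ o)⁻¹ * D.φ e * H *
        ((D.φ g)⁻¹ * D.φ E * (D.φ e)⁻¹ * D.φ o * D.φ g) * M * D.φ (-f') * D.γ e * y := by
      rw [c2.eq, ← (D.commute_κ P).eq, hP]; group
    _ = D.κ * (D.φ (g + E))⁻¹ * (D.φ o)⁻¹ * D.φ e * (H * (D.φ e)⁻¹) * D.φ o * D.φ (g + E) *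
        (D.φ (e + g))⁻¹ * (D.φ (o + e + g))⁻¹ * D.φ E * M * D.φ (-f') * D.γ e * y := by
      rw [r]; group
    _ = D.κ * (D.φ (g + E))⁻¹ * (D.φ o)⁻¹ * (H * D.φ o) * D.φ (g + E) *
        (D.φ (e + g))⁻¹ * (D.φ (o + e + g))⁻¹ * D.φ E * M * D.φ (-f') * D.γ e * y := by
      rw [← hHe.inv_left.eq]; group
    _ = D.κ * (D.φ (g + E))⁻¹ * (H * D.φ (g + E)) *
        (D.φ (e + g))⁻¹ * (D.φ (o + e + g))⁻¹ * D.φ E * M * D.φ (-f') * D.γ e * y := by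
      rw [← hHo.eq]; group
    _ = _ := by rw [← hHg.eq]; group

end

variable {N : ℕ} [NeZero N] {A : Type*} [Group A] (D : DilogSystem N (shift N) A)

/-- `∏_{l ≥ j} e^{iπ f_{2l}²}` -/
def gaussTail (j : ℕ) : A := decProd j (N + 1) fun l => D.γ (f N (2 * l : ℕ))

lemma gaussTail_top : D.gaussTail N = D.γ (f N (2 * N : ℕ)) := by
  rw [gaussTail, decProd_succ le_rfl, decProd_self, mul_one]

lemma gaussTail_eq (hN : 1 < N) {j : ℕ} (hj : 1 ≤ j) (hjN : j ≤ N) :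
    D.gaussTail j = D.γ (f N (2 * j : ℕ)) * D.gaussTail (j + 1) := by
  have : Commute (D.γ (f N (2 * j : ℕ))) (D.gaussTail (j + 1)) := commute_decProd fun l h1 h2 =>
    D.commute_γ_γ (bracket_even_even hN hj hjN (by omega) (by omega))
  rw [this.eq, gaussTail, decProd_eq_mul_left (by omega)]; rfl

lemma gaussTail_mul (hN : 1 < N) {j : ℕ} (hj : 1 ≤ j) (hjN : j ≤ N + 1) (v : Lin N) :
    D.gaussTail j * D.φ v = D.φ (shear N j v) * D.gaussTail j := by
  obtain ⟨d, hd⟩ := Nat.exists_eq_add_of_le hjN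
  induction d generalizing j v with
  | zero =>
    obtain rfl : j = N + 1 := by omega
    simp [gaussTail, decProd_self, shear]
  | succ d ih =>
    have e : shear N (j + 1) (v + bracket N (f N (2 * j : ℕ)) v • f N (2 * j : ℕ)) =
        shear N j v := by
      rw [map_add, map_smul, shear_even hN (by omega) hj (by omega)]
      simp only [shear, LinearMap.coe_mk, AddHom.coe_mk]
      rw [Finset.sum_eq_sum_Ico_succ_bot (show j < N + 1 by omega)]
      abel
    have h : D.gaussTail j = D.gaussTail (j + 1) * D.γ (f N (2 * j : ℕ)) := by
      rw [gaussTail, decProd_eq_mul_left (by omega)]; rfl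
    rw [h, mul_assoc, D.γ_mul, ← mul_assoc, ih (by omega) (by omega) _ (by omega), e, mul_assoc]

lemma gaussTail_mul_G_mul (hN : 1 < N) {j : ℕ} (hj : 1 ≤ j) (hjN : j ≤ N + 1) (v : Lin N) :
    D.gaussTail j * D.G * D.φ v = D.φ (evol N j v) * (D.gaussTail j * D.G) := by
  rw [mul_assoc, D.G_mul, ← mul_assoc, D.gaussTail_mul hN hj hjN, ← mul_assoc]; rfl

/-- The factors of `W`. -/
def wFactor (j : ℕ) : A :=
  (D.φ (f N (2 * j : ℕ)))⁻¹ * D.φ (f N (2 * j - 1 : ℕ)) * D.φ (pre N (2 * N + 1) - pre N (2 * j))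

/-- The evolution operator. -/
def evolution : A := D.G * decProd 1 (N + 1) fun j => D.φ (f N (2 * j : ℕ))

/-- Moving G to the right end turns each f_{2j} into f_{2j-1}. The factors j = N and j = 1 are split
off because they do not commute with the last factor of W. -/
lemma evolution_eq (hN : 1 < N) : D.evolution = D.φ (f N (2 * N - 1 : ℕ)) *
    (decProd 2 N fun k => D.φ (f N (2 * k - 1 : ℕ))) * D.φ (f N (1 : ℕ)) * D.G := by
  have : ∀ F : ℕ → A, (∀ k, 1 ≤ k → D.G * F k = D.φ (f N (2 * k - 1 : ℕ)) * D.G) → ∀ n,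
      D.G * decProd 1 (n + 1) F = (decProd 1 (n + 1) fun k => D.φ (f N (2 * k - 1 : ℕ))) * D.G := by
    intro F hF n
    induction n with
    | zero => simp [decProd_self]
    | succ n ih =>
      rw [decProd_succ (by omega), ← mul_assoc, hF _ (by omega), mul_assoc, ih,
        decProd_succ (show 1 ≤ n + 1 by omega), mul_assoc]
  rw [evolution, this _ (fun k hk => by rw [D.G_mul, shift_even hk]), decProd_succ hN.le,
    decProd_eq_mul_left hN, ← mul_assoc]

/-- The evolution operator, conjugated by the factors of `W` with index at least `j`. -/
def conjEvolution (j : ℕ) : A :=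
  (decProd j N fun k => (D.φ (pre N (2 * N - 1) - pre N (2 * k - 1)))⁻¹) *
    (D.φ (pre N (2 * N - 1) - pre N (2 * j - 2)))⁻¹ *
    D.φ (pre N (2 * N + 1) - pre N (2 * N - 1)) *
    (decProd 2 j fun k => D.φ (f N (2 * k - 1 : ℕ))) * D.φ (-f N (2 * j - 2 : ℕ)) *
    (D.gaussTail j * D.G)

/-- The base of the induction: by periodicity g_{2N,2N+1} is f₁, which makes this factor of W
special. -/
lemma conj_evolution_top (hN : 1 < N) :
    (D.wFactor N)⁻¹ * D.evolution * D.wFactor N = D.κ * D.conjEvolution N := by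
  have b1 := f_natCast (N := N) (k := 1) le_rfl
  have bo := f_natCast (N := N) (k := 2 * N - 1) (by omega)
  have be := f_natCast (N := N) (k := 2 * N) (by omega)
  have e1 : pre N (2 * N + 1) - pre N (2 * N) = f N (1 : ℕ) := by
    rw [pre_top_add_one, b1, pre_zero]; abel
  have e2 : pre N (2 * N + 1) - pre N (2 * N - 1) = f N (2 * N : ℕ) + f N (1 : ℕ) := by
    rw [be, b1, pre_zero, pre_top_add_one]; abel
  have hM : ∀ v, (∀ k, 2 ≤ k → k < N → bracket N v (f N (2 * k - 1 : ℕ)) = 0) →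
      Commute (D.φ v) (decProd 2 N fun k => D.φ (f N (2 * k - 1 : ℕ))) := fun v hv =>
    commute_decProd fun k h1 h2 => D.commute_φ _ _ (hv k h1 h2)
  have ha : ∀ k, 2 ≤ k → k < N → bracket N (f N (2 * N : ℕ)) (f N (2 * k - 1 : ℕ)) = 0 :=
    fun k h1 h2 => by
      rw [bracket_even_odd hN (by omega) le_rfl (by omega) (by omega), if_neg (by omega),
        if_neg (by split_ifs <;> omega), zero_add]
  have haf : bracket N (f N (2 * N : ℕ)) (f N (1 : ℕ)) = 1 := by
    have := bracket_even_odd hN (show 1 ≤ N by omega) le_rfl (le_refl 1) hN.le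
    rw [if_neg (by omega), if_pos rfl, if_pos rfl, zero_add] at this
    exact this
  have hof : ∀ k, 1 ≤ k → k ≤ N → bracket N (f N (1 : ℕ)) (f N (2 * k - 1 : ℕ)) = 0 :=
    fun k h1 h2 => bracket_odd_odd (l := 1) hN le_rfl hN.le h1 h2
  have haf' : bracket N (f N (2 * N : ℕ)) (f N (2 * N - 2 : ℕ)) = 0 := by
    rw [show 2 * N - 2 = 2 * (N - 1) by omega]
    exact bracket_even_even hN hN.le le_rfl (by omega) (by omega)
  have hyo : D.G * D.φ (f N (2 * N - 1 : ℕ)) = D.φ (-f N (2 * N - 2 : ℕ)) * D.G := by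
    have := shift_odd (N := N) (N - 1)
    rw [show 2 * (N - 1) + 1 = 2 * N - 1 by omega, show 2 * (N - 1) = 2 * N - 2 by omega] at this
    rw [D.G_mul, this]
  have hyf : D.G * D.φ (f N (1 : ℕ)) = D.φ (-f N (2 * N : ℕ)) * D.G := by
    have := shift_odd (N := N) N
    rw [f_top_add_one] at this
    rw [D.G_mul, this]
  have h := D.conj_mul_of_bracket_top haf
    (by rw [bracket_antisymm, hof N hN.le le_rfl, neg_zero]) haf'
    (hM _ fun k h1 h2 => bracket_odd_odd hN hN.le le_rfl (by omega) h2.le)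
    (hM _ fun k h1 h2 => hof k (by omega) h2.le)
    (hM _ fun k h1 h2 => by rw [bracket_neg_left, ha k h1 h2, neg_zero])
    (commute_decProd fun k h1 h2 => D.commute_γ (ha k h1 h2))
    (by rw [D.G_mul, shift_even hN.le]) hyo hyf
  rw [wFactor, e1, D.evolution_eq hN, h, conjEvolution, decProd_self, D.gaussTail_top, one_mul, e2,
    bo, show 2 * N - 1 - 1 = 2 * N - 2 by omega]

lemma conj_conjEvolution_succ (hN : 1 < N) {j : ℕ} (hj : 2 ≤ j) (hjN : j < N) :
    (D.wFactor j)⁻¹ * D.conjEvolution (j + 1) * D.wFactor j = D.κ * D.conjEvolution j := by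
  have bo := f_natCast (N := N) (k := 2 * j - 1) (by omega)
  have be := f_natCast (N := N) (k := 2 * j) (by omega)
  have bf := f_natCast (N := N) (k := 2 * j - 2) (by omega)
  rw [show 2 * j - 1 - 1 = 2 * j - 2 by omega] at bo
  set o := f N (2 * j - 1 : ℕ) with ho
  set e := f N (2 * j : ℕ) with he
  set f' := f N (2 * j - 2 : ℕ) with hf
  -- In the notation of `conj_mul_of_bracket`, g = g_{2j,2N-1} and E = f_{2N} + f₁, so that g + E is
  -- the argument g_{2j,2N+1} in the factor of W.
  set g := pre N (2 * N - 1) - pre N (2 * j) with hg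
  set E := pre N (2 * N) + pre N 1 - pre N (2 * N - 1) with hE
  set M := decProd 2 j fun k => D.φ (f N (2 * k - 1 : ℕ)) with hMdef
  set H := decProd (j + 1) N fun k => (D.φ (pre N (2 * N - 1) - pre N (2 * k - 1)))⁻¹ with hHdef
  have hM : ∀ v, (∀ k, 2 ≤ k → k < j → bracket N v (f N (2 * k - 1 : ℕ)) = 0) →
      Commute (D.φ v) M := fun v hv =>
    commute_decProd fun k h1 h2 => D.commute_φ _ _ (hv k h1 h2)
  have hH : ∀ v, (∀ k, j < k → k < N →
      bracket N v (pre N (2 * N - 1) - pre N (2 * k - 1)) = 0) → Commute (D.φ v) H := fun v hv =>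
    commute_decProd fun k h1 h2 => (D.commute_φ _ _ (hv k h1 h2)).inv_right
  have hem : ∀ k, 2 ≤ k → k < j → bracket N e (f N (2 * k - 1 : ℕ)) = 0 := fun k h1 h2 => by
    rw [bracket_even_odd hN (by omega) hjN.le (by omega) (by omega), if_neg (by omega),
      if_neg (by split_ifs <;> omega), zero_add]
  -- All brackets below are evaluated by the parity rules for prefix sums.
  have heo : bracket N e o = 1 := by
    rw [be, bo]
    simp (disch := omega) only [hg, hE, bracket_sub_left, bracket_sub_right, bracket_add_left,
      bracket_add_right, bracket_neg_left, bracket_neg_right, bracket_pre_eq,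
      bracket_pre_even_top, bracket_pre_odd_top, bracket_pre_even_top', bracket_pre_odd_top',
      bracket_pre_even, bracket_pre_odd, bracket_pre_even', bracket_pre_odd']
    norm_num
  have heg : bracket N e g = 1 := by
    rw [be]
    simp (disch := omega) only [hg, hE, bracket_sub_left, bracket_sub_right, bracket_add_left,
      bracket_add_right, bracket_neg_left, bracket_neg_right, bracket_pre_eq,
      bracket_pre_even_top, bracket_pre_odd_top, bracket_pre_even_top', bracket_pre_odd_top',
      bracket_pre_even, bracket_pre_odd, bracket_pre_even', bracket_pre_odd']
    norm_num
  have hog : bracket N o g = 0 := by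
    rw [bo]
    simp (disch := omega) only [hg, hE, bracket_sub_left, bracket_sub_right, bracket_add_left,
      bracket_add_right, bracket_neg_left, bracket_neg_right, bracket_pre_eq,
      bracket_pre_even_top, bracket_pre_odd_top, bracket_pre_even_top', bracket_pre_odd_top',
      bracket_pre_even, bracket_pre_odd, bracket_pre_even', bracket_pre_odd']
    norm_num
  have hEg : bracket N E g = 1 := by
    simp (disch := omega) only [hg, hE, bracket_sub_left, bracket_sub_right, bracket_add_left,
      bracket_add_right, bracket_neg_left, bracket_neg_right, bracket_pre_eq,
      bracket_pre_even_top, bracket_pre_odd_top, bracket_pre_even_top', bracket_pre_odd_top',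
      bracket_pre_even, bracket_pre_odd, bracket_pre_even', bracket_pre_odd']
    norm_num
  have hoE : bracket N o E = 0 := by
    rw [bo]
    simp (disch := omega) only [hg, hE, bracket_sub_left, bracket_sub_right, bracket_add_left,
      bracket_add_right, bracket_neg_left, bracket_neg_right, bracket_pre_eq,
      bracket_pre_even_top, bracket_pre_odd_top, bracket_pre_even_top', bracket_pre_odd_top',
      bracket_pre_even, bracket_pre_odd, bracket_pre_even', bracket_pre_odd']
    norm_num
  have heE : bracket N e E = 0 := by
    rw [be]
    simp (disch := omega) only [hg, hE, bracket_sub_left, bracket_sub_right, bracket_add_left,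
      bracket_add_right, bracket_neg_left, bracket_neg_right, bracket_pre_eq,
      bracket_pre_even_top, bracket_pre_odd_top, bracket_pre_even_top', bracket_pre_odd_top',
      bracket_pre_even, bracket_pre_odd, bracket_pre_even', bracket_pre_odd']
    norm_num
  have hef : bracket N e f' = 0 := by
    rw [be, bf]
    simp (disch := omega) only [hg, hE, bracket_sub_left, bracket_sub_right, bracket_add_left,
      bracket_add_right, bracket_neg_left, bracket_neg_right, bracket_pre_eq,
      bracket_pre_even_top, bracket_pre_odd_top, bracket_pre_even_top', bracket_pre_odd_top',
      bracket_pre_even, bracket_pre_odd, bracket_pre_even', bracket_pre_odd']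
    norm_num
  have hgf : bracket N g f' = 0 := by
    rw [bf]
    simp (disch := omega) only [hg, hE, bracket_sub_left, bracket_sub_right, bracket_add_left,
      bracket_add_right, bracket_neg_left, bracket_neg_right, bracket_pre_eq,
      bracket_pre_even_top, bracket_pre_odd_top, bracket_pre_even_top', bracket_pre_odd_top',
      bracket_pre_even, bracket_pre_odd, bracket_pre_even', bracket_pre_odd']
    norm_num
  have hMg : ∀ k, 2 ≤ k → k < j → bracket N (g - e) (f N (2 * k - 1 : ℕ)) = 0 := fun k h1 h2 => by
    rw [be, f_natCast (k := 2 * k - 1) (by omega)]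
    simp (disch := omega) only [hg, hE, bracket_sub_left, bracket_sub_right, bracket_add_left,
      bracket_add_right, bracket_neg_left, bracket_neg_right, bracket_pre_eq,
      bracket_pre_even_top, bracket_pre_odd_top, bracket_pre_even_top', bracket_pre_odd_top',
      bracket_pre_even, bracket_pre_odd, bracket_pre_even', bracket_pre_odd']
    norm_num
  have hHo : ∀ k, j < k → k < N →
      bracket N o (pre N (2 * N - 1) - pre N (2 * k - 1)) = 0 := fun k h1 h2 => by
    rw [bo]
    simp (disch := omega) only [hg, hE, bracket_sub_left, bracket_sub_right, bracket_add_left,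
      bracket_add_right, bracket_neg_left, bracket_neg_right, bracket_pre_eq,
      bracket_pre_even_top, bracket_pre_odd_top, bracket_pre_even_top', bracket_pre_odd_top',
      bracket_pre_even, bracket_pre_odd, bracket_pre_even', bracket_pre_odd']
    norm_num
  have hHe : ∀ k, j < k → k < N →
      bracket N e (pre N (2 * N - 1) - pre N (2 * k - 1)) = 0 := fun k h1 h2 => by
    rw [be]
    simp (disch := omega) only [hg, hE, bracket_sub_left, bracket_sub_right, bracket_add_left,
      bracket_add_right, bracket_neg_left, bracket_neg_right, bracket_pre_eq,
      bracket_pre_even_top, bracket_pre_odd_top, bracket_pre_even_top', bracket_pre_odd_top',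
      bracket_pre_even, bracket_pre_odd, bracket_pre_even', bracket_pre_odd']
    norm_num
  have hHg : ∀ k, j < k → k < N →
      bracket N (g + E) (pre N (2 * N - 1) - pre N (2 * k - 1)) = 0 := fun k h1 h2 => by
    simp (disch := omega) only [hg, hE, bracket_sub_left, bracket_sub_right, bracket_add_left,
      bracket_add_right, bracket_neg_left, bracket_neg_right, bracket_pre_eq,
      bracket_pre_even_top, bracket_pre_odd_top, bracket_pre_even_top', bracket_pre_odd_top',
      bracket_pre_even, bracket_pre_odd, bracket_pre_even', bracket_pre_odd']
    norm_num
  have hye : D.gaussTail (j + 1) * D.G * D.φ e = D.φ o * (D.gaussTail (j + 1) * D.G) := by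
    rw [D.gaussTail_mul_G_mul hN (by omega) (by omega), evol_even hN (by omega) (by omega) hjN.le,
      if_neg (by omega), if_neg (by split_ifs <;> omega), add_zero, add_zero]
  have hyo : D.gaussTail (j + 1) * D.G * D.φ o = D.φ (-f') * (D.gaussTail (j + 1) * D.G) := by
    have := evol_odd hN (j := j + 1) (m := j - 1) (by omega) (by omega) (by omega)
    rw [show 2 * (j - 1) + 1 = 2 * j - 1 by omega, show 2 * (j - 1) = 2 * j - 2 by omega] at this
    rw [D.gaussTail_mul_G_mul hN (by omega) (by omega), this]
  -- The part of g + E beyond f_{2j+1} is a difference of chain elements, handled by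
  -- `evol_chain_sub`; the term -e is the image of f_{2j+1}.
  have hyg : D.gaussTail (j + 1) * D.G * D.φ (g + E) =
      D.φ (g - e) * (D.gaussTail (j + 1) * D.G) := by
    have h1 := evol_chain_sub hN (j := j) (k := N - 1) (by omega) (by omega) (by omega)
    have h2 := evol_odd hN (j := j + 1) (m := j) (by omega) (by omega) hjN.le
    rw [Nat.sub_add_cancel hN.le, chain_top, chain, chain,
      show 2 * (N - 1) + 1 = 2 * N - 1 by omega] at h1
    have e1 : g + E = (pre N (2 * N) - (pre N (2 * j + 1) - pre N 1)) +
        f N (2 * j + 1 : ℕ) := by rw [hg, hE, pre_succ (2 * j)]; abel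
    have e2 : f N (2 * j + 1 : ℕ) + (pre N (2 * N - 1) - pre N 1 -
        (pre N (2 * j + 1) - pre N 1)) + -e = g - e := by rw [hg, pre_succ (2 * j)]; abel
    rw [D.gaussTail_mul_G_mul hN (by omega) (by omega), e1, map_add, h1, h2, e2]
  have h := D.conj_mul_of_bracket (H := H) heo heg hog hEg hoE heE hef hgf
    (hM _ fun k h1 h2 => bracket_odd_odd hN (by omega) hjN.le (by omega) (by omega))
    (hM _ fun k h1 h2 => by rw [bracket_neg_left, hem k h1 h2, neg_zero])
    (commute_decProd fun k h1 h2 => D.commute_γ (hem k h1 h2)) (hM _ hMg) (hH _ hHo) (hH _ hHe)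
    (hH _ hHg) hye hyo hyg
  have hG : D.gaussTail j * D.G = D.γ e * (D.gaussTail (j + 1) * D.G) := by
    rw [D.gaussTail_eq hN (by omega) hjN.le, mul_assoc]
  have e1 : e + g = pre N (2 * N - 1) - pre N (2 * j - 1) := by rw [be, hg]; abel
  have e2 : o + e + g = pre N (2 * N - 1) - pre N (2 * j - 2) := by rw [be, bo, hg]; abel
  have e3 : pre N (2 * N + 1) - pre N (2 * j) = g + E := by
    rw [pre_top_add_one, hg, hE]; abel
  rw [conjEvolution, conjEvolution, wFactor, e3, pre_top_add_one, ← hE,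
    decProd_succ (show 2 ≤ j by omega), ← ho, ← hMdef, decProd_eq_mul_left (show j < N by omega),
    ← hHdef, ← e1, ← e2, hG, show 2 * (j + 1) - 2 = 2 * j by omega, h]

/-- Each factor of W contributes one central κ. -/
lemma conj_evolution (hN : 1 < N) {j : ℕ} (hj : 2 ≤ j) (hjN : j ≤ N) :
    (decProd j (N + 1) D.wFactor)⁻¹ * D.evolution * decProd j (N + 1) D.wFactor =
      D.κ ^ (N + 1 - j) * D.conjEvolution j := by
  obtain ⟨d, hd⟩ := Nat.exists_eq_add_of_le hjN
  induction d generalizing j with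
  | zero =>
    obtain rfl : j = N := by omega
    rw [decProd_succ le_rfl, decProd_self, mul_one, D.conj_evolution_top hN,
      show j + 1 - j = 1 by omega, pow_one]
  | succ d ih =>
    have ih := ih (j := j + 1) (by omega) (by omega) (by omega)
    rw [decProd_eq_mul_left (show j < N + 1 by omega), show N + 1 - j = N + 1 - (j + 1) + 1 by omega,
      pow_succ, mul_assoc (D.κ ^ _) D.κ, ← D.conj_conjEvolution_succ hN hj (by omega)]
    set W := decProd (j + 1) (N + 1) D.wFactor
    have hK := (D.commute_κ (D.wFactor j)⁻¹).pow_left (N + 1 - (j + 1))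
    calc _ = (D.wFactor j)⁻¹ * (W⁻¹ * D.evolution * W) * D.wFactor j := by group
      _ = ((D.wFactor j)⁻¹ * D.κ ^ (N + 1 - (j + 1))) * D.conjEvolution (j + 1) * D.wFactor j := by
        rw [ih]; simp only [mul_assoc]
      _ = _ := by rw [← hK.eq]; simp only [mul_assoc]

/-- The transformed evolution operator. -/
theorem conj_evolution_two (hN : 1 < N) :
    (decProd 2 (N + 1) D.wFactor)⁻¹ * D.evolution * decProd 2 (N + 1) D.wFactor =
      D.κ ^ N * ((decProd 2 N fun k => (D.φ (pre N (2 * N - 1) - pre N (2 * k - 1)))⁻¹) *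
        (D.φ (pre N (2 * N - 1) - pre N 2))⁻¹ *
        D.φ (pre N (2 * N + 1) - pre N (2 * N - 1)) * (D.φ (f N (2 : ℕ)))⁻¹ *
        (D.gaussTail 1 * D.G)) := by
  rw [D.conj_evolution hN le_rfl hN, conjEvolution, decProd_self, D.gaussTail_eq hN le_rfl hN.le]
  set P := (decProd 2 N fun k => (D.φ (pre N (2 * N - 1) - pre N (2 * k - 1)))⁻¹) *
    (D.φ (pre N (2 * N - 1) - pre N 2))⁻¹ * D.φ (pre N (2 * N + 1) - pre N (2 * N - 1))
  have hP := D.commute_κ P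
  -- Inversion of the remaining φ(-f₂) supplies the N-th κ and the factor γ(f₂) still absent from
  -- the Gaussian.
  have e := D.φ_neg (f N (2 : ℕ))
  change D.κ ^ (N + 1 - 2) * (P * 1 * D.φ (-f N (2 : ℕ)) * (D.gaussTail 2 * D.G)) =
    D.κ ^ N * (P * (D.φ (f N (2 : ℕ)))⁻¹ * (D.γ (f N (2 : ℕ)) * D.gaussTail 2 * D.G))
  rw [e, show D.κ ^ N = D.κ ^ (N + 1 - 2) * D.κ by rw [← pow_succ]; congr 1; omega]
  calc _ = D.κ ^ (N + 1 - 2) * (P * D.κ) * (D.φ (f N (2 : ℕ)))⁻¹ * D.γ (f N (2 : ℕ)) *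
        D.gaussTail 2 * D.G := by simp only [mul_assoc, one_mul]
    _ = _ := by rw [← hP.eq]; simp only [mul_assoc]

/-- The bridge between the two halves: the dilogarithm part of the transformed operator is the top
`partialProd` of the chain, so its power telescopes. -/
lemma partialProd_chain (hN : 1 < N) :
    D.partialProd (chain N) (pre N 2 - pre N 1) (N - 1) =
      (decProd 2 N fun k => (D.φ (pre N (2 * N - 1) - pre N (2 * k - 1)))⁻¹) *
        (D.φ (pre N (2 * N - 1) - pre N 2))⁻¹ *
        D.φ (pre N (2 * N + 1) - pre N (2 * N - 1)) * (D.φ (f N (2 : ℕ)))⁻¹ := by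
  have e1 : chain N (N - 1) = pre N (2 * N - 1) - pre N 1 := by
    rw [chain, show 2 * (N - 1) + 1 = 2 * N - 1 by omega]
  have e2 : f N (2 : ℕ) = pre N 2 - pre N 1 := f_natCast (k := 2) (by omega)
  have e3 : (decProd 2 N fun k => (D.φ (pre N (2 * N - 1) - pre N (2 * k - 1)))⁻¹) =
      decProd 1 (N - 1) fun k => (D.φ (pre N (2 * N - 1) - pre N (2 * k + 1)))⁻¹ := by
    have := decProd_succ_succ 1 (N - 1) fun k => (D.φ (pre N (2 * N - 1) - pre N (2 * k - 1)))⁻¹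
    rwa [Nat.sub_add_cancel hN.le] at this
  rw [partialProd, Nat.sub_add_cancel hN.le, decProd_self, inv_one, mul_one, e3, e1, e2,
    decProd_eq_mul_left (show 0 < N - 1 by omega), chain_top, pre_top_add_one, modChain, if_pos rfl,
    sub_sub_sub_cancel_right, sub_sub_eq_add_sub]
  congr 3
  refine decProd_congr fun k h1 _ => ?_
  rw [modChain, if_neg (by omega), chain, sub_sub_sub_cancel_right]

/-- The `N`-th power of the transformed evolution operator. -/
theorem conj_evolution_pow (hN : 1 < N) :
    ((decProd 2 (N + 1) D.wFactor)⁻¹ * D.evolution * decProd 2 (N + 1) D.wFactor) ^ N =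
      D.κ ^ (N * N - 1) * (D.φ (pre N (2 * N + 1) - pre N 2) * (D.γ (f N (2 : ℕ)))⁻¹ *
        (D.gaussTail 1 * D.G) ^ N) := by
  have e2 : f N (2 : ℕ) = pre N 2 - pre N 1 := f_natCast (k := 2) (by omega)
  have hy : ∀ v, MulAut.conj (D.gaussTail 1 * D.G) (D.φ v) = D.φ (evol N 1 v) := fun v => by
    rw [MulAut.conj_apply, D.gaussTail_mul_G_mul hN le_rfl (by omega), mul_inv_cancel_right]
  have he := evol_two hN
  rw [e2] at he
  have h := D.partialProd_mul_pow (isChain hN) hN hy (fun k hk => evol_chain hN hk) he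
  -- The central factors give κ^{N·N}, and the telescope returns one κ⁻¹.
  rw [D.conj_evolution_two hN, ← D.partialProd_chain hN,
    ((D.commute_κ _).pow_left N).mul_pow, h, ← pow_mul, e2,
    show D.κ ^ (N * N) = D.κ ^ (N * N - 1) * D.κ by
      rw [← pow_succ, Nat.sub_add_cancel (by nlinarith)], chain_top,
    show pre N (2 * N) - (pre N 2 - pre N 1) = pre N (2 * N + 1) - pre N 2 by
      rw [pre_top_add_one]; abel]
  group

end DilogSystem


/-! ### Reduction of the parameter -/

lemma contourHeight_neg (b : ℂ) : contourHeight (-b) = contourHeight b := by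
  simp [contourHeight, inv_neg]

lemma contourHeight_inv (b : ℂ) : contourHeight b⁻¹ = contourHeight b := by
  rw [contourHeight, contourHeight, inv_inv, min_comm]

lemma qdilog_neg (b : ℂ) : qdilog (-b) = qdilog b := by
  funext x
  simp only [qdilog, contourHeight_neg, mul_neg, div_neg, sinh_neg, neg_mul, neg_neg]

lemma qdilog_inv (b : ℂ) : qdilog b⁻¹ = qdilog b := by
  funext x
  simp only [qdilog, contourHeight_inv, div_inv_eq_mul, ← div_eq_mul_inv]
  simp only [mul_comm (sinh _) (sinh _)]

lemma zeta_neg (b : ℂ) : zeta (-b) = zeta b := by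
  rw [zeta, zeta, inv_neg, ← neg_add, neg_sq]

lemma zeta_inv (b : ℂ) : zeta b⁻¹ = zeta b := by
  rw [zeta, zeta, inv_inv, add_comm]

/-- The symmetries b ↦ -b and b ↦ b⁻¹ preserve `qdilog` and `zeta`. They achieve 0 < Re b ≤ Re b⁻¹,
whereby the contour height becomes Re b. -/
lemma exists_isReduced {b : ℂ} (hb : b.re ≠ 0) (hb' : b.im = 0 ∨ ‖b‖ = 1) :
    ∃ c, IsReduced c ∧ qdilog c = qdilog b ∧ zeta c = zeta b := by
  have key : ∀ {c : ℂ}, 0 < c.re → (c.im = 0 ∨ ‖c‖ = 1) →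
      ∃ d, IsReduced d ∧ qdilog d = qdilog c ∧ zeta d = zeta c := by
    intro c h1 h2
    have h0 : c ≠ 0 := fun h => by simp [h] at h1
    rcases le_total c.re (c⁻¹).re with h | h
    · exact ⟨c, ⟨h1, h, h2⟩, rfl, rfl⟩
    · refine ⟨c⁻¹, ⟨?_, by rwa [inv_inv], ?_⟩, qdilog_inv c, zeta_inv c⟩
      · rw [inv_re]; exact div_pos h1 (normSq_pos.2 h0)
      · refine h2.imp (fun h => ?_) fun h => ?_
        · rw [inv_im, h]; simp
        · rw [norm_inv, h, inv_one]
  rcases hb.lt_or_gt with h | h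
  · obtain ⟨d, h1, h2, h3⟩ := key (c := -b) (by simpa using h) (by simpa using hb')
    exact ⟨d, h1, h2.trans (qdilog_neg b), h3.trans (zeta_neg b)⟩
  · exact key h hb'

/-! ### The operators -/

lemma lin_induction {N : ℕ} [NeZero N] {P : Lin N → Prop} (h0 : P 0)
    (hadd : ∀ u v, P u → P v → P (u + v)) (hf : ∀ (a : ℝ) (k : ℕ), P (a • f N (k + 1 : ℕ)))
    (v : Lin N) : P v := by
  rw [← Finset.univ_sum_single v]
  refine Finset.sum_induction _ P hadd h0 fun m _ => ?_
  have h := hf (v m) (m - 1).val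
  have e : ((((m - 1).val + 1 : ℕ) : ℤ) : ZMod (2 * N)) = m := by
    push_cast
    rw [ZMod.natCast_zmod_val, sub_add_cancel]
  rw [f, e, ← Pi.single_smul, smul_eq_mul, mul_one] at h
  exact h

lemma comm_add_one {N : ℕ} [NeZero N] (k l : ℕ) :
    (-1) ^ (k + 1) * (-1) ^ (l + 1) * comm N k l = comm N (k + 1) (l + 1) := by
  have h1 : (l + 1 : ZMod (2 * N)) = k + 1 + 1 ↔ (l : ZMod (2 * N)) = k + 1 :=
    add_left_inj 1
  have h2 : (l + 1 : ZMod (2 * N)) = k + 1 - 1 ↔ (l : ZMod (2 * N)) = k - 1 := by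
    rw [add_sub_cancel_right, eq_sub_iff_add_eq]
  simp only [comm, h1, h2]
  rw [neg_one_pow_val_add_one, neg_one_pow_val_natCast]
  split_ifs with h
  · have e : (-1 : ℝ) ^ l = -(-1) ^ k := by
      rw [← neg_one_pow_val_natCast (N := N) l, ← neg_one_pow_val_natCast (N := N) k]
      rcases h with h | h
      · rw [h, neg_one_pow_val_add_one]
      · rw [eq_sub_iff_add_eq] at h
        rw [← h, neg_one_pow_val_add_one, neg_neg]
    have e2 : ((-1 : ℝ) ^ k) * (-1) ^ k = 1 := by rw [← mul_pow]; norm_num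
    rw [pow_succ, pow_succ, e]
    linear_combination (-(-1 : ℝ) ^ k) * e2
  · rw [mul_zero]

/-- The signs (-1)^j picked up by two neighbouring generators multiply to -1, which offsets the
change of the alternating sign of the commutator under the shift by one place. -/
lemma bracket_shift {N : ℕ} [NeZero N] (u v : Lin N) :
    bracket N (shift N u) (shift N v) = bracket N u v := by
  have z1 : ∀ w : Lin N, bracket N 0 w = 0 := fun w => by
    rw [← pre_zero, bracket_pre_zero_left rfl]
  have z2 : ∀ w : Lin N, bracket N w 0 = 0 := fun w => by
    rw [← pre_zero, bracket_pre_zero_right rfl]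
  refine lin_induction (P := fun u => bracket N (shift N u) (shift N v) = bracket N u v)
    (by rw [map_zero, z1, z1]) (fun u u' h h' => by
      rw [map_add, bracket_add_left, bracket_add_left, h, h']) (fun a k => ?_) u
  refine lin_induction (P := fun v => bracket N (shift N (a • f N (k + 1 : ℕ))) (shift N v) =
    bracket N (a • f N (k + 1 : ℕ)) v)
    (by rw [map_zero, z2, z2]) (fun u u' h h' => by
      rw [map_add, bracket_add_right, bracket_add_right, h, h']) (fun c l => ?_) v
  have := comm_add_one (N := N) k l
  rw [map_smul, map_smul, shift_f, shift_f]
  simp only [bracket_smul_left, bracket_smul_right, bracket_f]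
  push_cast
  rw [← this]; ring

lemma isBddCont_gauss (a : ℝ) : IsBddCont fun x : ℝ => exp (I * Real.pi * a * x ^ 2) := by
  refine ⟨by fun_prop, 1, fun x => ?_⟩
  beta_reduce
  rw [show I * Real.pi * a * x ^ 2 = ((Real.pi * a * x ^ 2 : ℝ) : ℂ) * I by push_cast; ring,
    norm_exp_ofReal_mul_I]

namespace Realization

variable {N : ℕ} [NeZero N] {H : Type*} [NormedAddCommGroup H] [InnerProductSpace ℂ H]
  [CompleteSpace H] (R : Realization N H)

lemma weyl_add (u v : Lin N) :
    R.weyl (u + v) = exp (-(Real.pi * I * bracket N u v)) • (R.weyl u * R.weyl v) := by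
  rw [R.weyl_mul, smul_smul, ← exp_add, neg_add_cancel, exp_zero, one_smul]

lemma fn_neg {F : ℝ → ℂ} (hF : IsBddCont F) (v : Lin N) :
    R.fn F (-v) = R.fn (fun s => F (-s)) v := by
  have h := (R.isUnitaryGroup v).funCalc_affine hF (-1) 0
  simp only [character, ofReal_zero, mul_zero, exp_zero, one_smul, add_zero, neg_mul,
    one_mul, mul_neg, mul_one, neg_smul] at h
  rw [fn, fn, ← h]
  simp only [smul_neg]

lemma commute_fn {F G : ℝ → ℂ} (hF : IsBddCont F) (hG : IsBddCont G) {u v : Lin N}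
    (h : bracket N u v = 0) : Commute (R.fn F u) (R.fn G v) := by
  refine (R.isUnitaryGroup v).intertwine (R.isUnitaryGroup v) (fun t => ?_) hG
  have := R.weyl_mul_fn hF (t • v) u
  rw [bracket_smul_left, bracket_antisymm, h] at this
  simpa using this.symm

/-- Completing the square: a shift of x by tc in e^{iπx²} produces the character e^{2πitcx} and a
constant, and the constant cancels against the phase from recombining the Weyl operators. -/
lemma gauss_mul_weyl (p q : Lin N) (t : ℝ) :
    R.gauss 1 p * R.weyl (t • q) = R.weyl (t • (q + bracket N p q • p)) * R.gauss 1 p := by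
  set c := bracket N p q with hc
  have hg := isBddCont_gauss 1
  have h := R.weyl_mul_fn (hg.comp (u := fun s => s + t * c) (by fun_prop)) (t • q) p
  have e1 : bracket N (t • q) p = -(t * c) := by
    rw [bracket_smul_left, bracket_antisymm, ← hc]; ring
  have e2 : (fun s : ℝ => exp (I * Real.pi * (1 : ℝ) * ((s + t * c : ℝ) : ℂ) ^ 2)) =
      exp (Real.pi * I * (t * c) ^ 2) •
        (character (t * c) * fun x : ℝ => exp (I * Real.pi * (1 : ℝ) * x ^ 2)) := by
    funext s
    simp only [Pi.smul_apply, Pi.mul_apply, smul_eq_mul, character, ← exp_add]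
    congr 1; push_cast; ring
  have e3 : R.fn (character (t * c)) p = R.weyl ((t * c) • p) :=
    (R.isUnitaryGroup p).funCalc_character (t * c)
  have e4 : bracket N (t • q) ((t * c) • p) = -(t * c) ^ 2 := by
    rw [bracket_smul_right, e1]; ring
  simp only [e1, neg_add_cancel_right] at h
  rw [gauss, ← h]
  rw [e2, R.fn_smul _ ((IsBddCont.of_character _).mul hg), R.fn_mul (IsBddCont.of_character _) hg,
    e3, mul_smul_comm, ← mul_assoc, R.weyl_mul, e4, smul_mul_assoc, smul_smul, ← exp_add,
    smul_add, smul_smul]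
  rw [show (Real.pi * I * (t * c) ^ 2 + Real.pi * I * ((-(t * c) ^ 2 : ℝ) : ℂ) : ℂ) = 0 by
    push_cast; ring, exp_zero, one_smul]

/-- Given on multiples of generators, the relation extends to sums because `shift` preserves the
bracket and with it the phases of the Weyl relations. -/
lemma G_mul_weyl_smul (v : Lin N) (t : ℝ) :
    (R.G : H →L[ℂ] H) * R.weyl (t • v) = R.weyl (t • shift N v) * R.G := by
  revert t
  refine lin_induction (P := fun v => ∀ t : ℝ,
    (R.G : H →L[ℂ] H) * R.weyl (t • v) = R.weyl (t • shift N v) * R.G) (fun t => ?_)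
    (fun u v hu hv t => ?_) (fun a k t => ?_) v
  · rw [map_zero, smul_zero, R.weyl_zero, mul_one, one_mul]
  · rw [smul_add, map_add, smul_add, R.weyl_add, R.weyl_add, mul_smul_comm, ← mul_assoc, hu,
      mul_assoc _ (R.G : H →L[ℂ] H), hv, smul_mul_assoc]
    simp only [bracket_smul_left, bracket_smul_right, bracket_shift, mul_assoc]
  · have := R.G_mul_weyl (k + 1 : ℕ) (t * a)
    rw [zpow_natCast, show ((k + 1 : ℕ) : ℤ) - 1 = k by push_cast; ring] at this
    rw [smul_smul, this, map_smul, shift_f, smul_smul, smul_smul, smul_smul, mul_assoc]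

end Realization

/-! ### Passage from the abstract group to the operators -/

namespace IsReduced

variable {b : ℂ} (hb : IsReduced b) {N : ℕ} [NeZero N] {H : Type*} [NormedAddCommGroup H]
  [InnerProductSpace ℂ H] [CompleteSpace H] (R : Realization N H)
include hb

lemma qdilog_ne_zero (x : ℝ) : qdilog b x ≠ 0 := by
  rw [hb.qdilog_eq]; exact dilog_ne_zero _ _

/-- The constant agrees with that of `dilog_mul_neg` because (b + b⁻¹)² = b² + b⁻² + 2, where the 2
is compensated by e^{iπ/6}. -/
lemma qdilog_mul_neg (x : ℝ) : qdilog b x * qdilog b (-x) =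
    (zeta b * exp (I * Real.pi / 6))⁻¹ * exp (I * Real.pi * (1 : ℝ) * x ^ 2) := by
  have hQ := hb.reQ_pos
  have h0 : b ≠ 0 := fun h => by simpa [h] using hb.re_pos
  rw [hb.qdilog_eq, hb.qdilog_eq, ofReal_neg, hb.dilog_mul_neg (by simpa using hQ), zeta,
    ← exp_add, ← exp_add, ← exp_neg, ← exp_add]
  congr 1
  push_cast
  field_simp
  ring

/-- `φ_b(v)` as a unit. -/
def phiUnit (v : Lin N) : (H →L[ℂ] H)ˣ where
  val := R.phi b v
  inv := R.phiBar b v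
  val_inv := by
    rw [Realization.phi, Realization.phiBar,
      ← R.fn_mul hb.isBddCont_qdilog hb.isBddCont_inv_qdilog, ← R.fn_one v]
    congr 1; funext x; exact mul_inv_cancel₀ (hb.qdilog_ne_zero x)
  inv_val := by
    rw [Realization.phi, Realization.phiBar,
      ← R.fn_mul hb.isBddCont_inv_qdilog hb.isBddCont_qdilog, ← R.fn_one v]
    congr 1; funext x; exact inv_mul_cancel₀ (hb.qdilog_ne_zero x)

omit hb in
lemma gauss_mul_gauss_neg (a : ℝ) (v : Lin N) : R.gauss a v * R.gauss (-a) v = 1 := by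
  rw [Realization.gauss, Realization.gauss, ← R.fn_mul (isBddCont_gauss _) (isBddCont_gauss _),
    ← R.fn_one v]
  congr 1; funext x
  rw [Pi.mul_apply, ← exp_add, ← exp_zero]
  congr 1; push_cast; ring

omit hb in
/-- `e^{iπv²}` as a unit. -/
def gaussUnit (v : Lin N) : (H →L[ℂ] H)ˣ where
  val := R.gauss 1 v
  inv := R.gauss (-1) v
  val_inv := gauss_mul_gauss_neg R 1 v
  inv_val := by simpa using gauss_mul_gauss_neg R (-1) v

omit hb in
/-- The constant of the inversion relation as an invertible operator. -/
def constUnit (b : ℂ) (H : Type*) [NormedAddCommGroup H] [InnerProductSpace ℂ H] :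
    (H →L[ℂ] H)ˣ :=
  Units.map (algebraMap ℂ (H →L[ℂ] H) : ℂ →* (H →L[ℂ] H))
    (Units.mk0 (zeta b * exp (I * Real.pi / 6))⁻¹
      (inv_ne_zero (mul_ne_zero (exp_ne_zero _) (exp_ne_zero _))))

omit hb in
lemma constUnit_pow_mul (n : ℕ) (x : H →L[ℂ] H) :
    ((constUnit b H ^ n : (H →L[ℂ] H)ˣ) : H →L[ℂ] H) * x =
      (zeta b * exp (I * Real.pi / 6)) ^ (-(n : ℤ)) • x := by
  rw [constUnit, ← map_pow, Units.coe_map, zpow_neg, zpow_natCast, Algebra.smul_def,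
    Units.val_pow_eq_pow_val, Units.val_mk0, inv_pow]
  rfl

/-- The dilogarithm system of a realization. -/
def dilogSystem : DilogSystem N (shift N) (H →L[ℂ] H)ˣ where
  φ := hb.phiUnit R
  γ := gaussUnit R
  κ := constUnit b H
  G := R.G
  commute_κ x := Units.ext (Algebra.commutes _ _)
  commute_φ u v h := Units.ext (R.commute_fn hb.isBddCont_qdilog hb.isBddCont_qdilog h).eq
  pentagon p q h := Units.ext (hb.pentagon R h)
  inversion v := Units.ext (by
    have h := constUnit_pow_mul (b := b) 1 (R.gauss 1 v)
    rw [pow_one] at h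
    have hq := hb.isBddCont_qdilog
    change R.fn _ v * R.fn _ (-v) = (constUnit b H : H →L[ℂ] H) * R.gauss 1 v
    rw [h, R.fn_neg hq, ← R.fn_mul hq (hq.comp (u := fun s => -s) continuous_neg),
      Realization.gauss, ← R.fn_smul _ (isBddCont_gauss 1)]
    congr 1; funext x
    rw [Pi.mul_apply, hb.qdilog_mul_neg]
    simp)
  γ_mul p q := Units.ext ((R.isUnitaryGroup q).intertwine (R.isUnitaryGroup _)
    (R.gauss_mul_weyl p q) hb.isBddCont_qdilog)
  G_mul v := Units.ext ((R.isUnitaryGroup v).intertwine (R.isUnitaryGroup _)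
    (R.G_mul_weyl_smul v) hb.isBddCont_qdilog)

lemma val_evolution :
    ((hb.dilogSystem R).evolution : H →L[ℂ] H) = R.Ulc b := by
  rw [DilogSystem.evolution, Units.val_mul, ← Units.coeHom_apply (decProd _ _ _), map_decProd]
  refine congrArg _ (decProd_congr fun k _ _ => ?_)
  change R.phi b (f N (2 * k : ℕ)) = _
  push_cast; rfl

lemma val_decProd_wFactor :
    ((decProd 2 (N + 1) (hb.dilogSystem R).wFactor : (H →L[ℂ] H)ˣ) : H →L[ℂ] H) = R.W b := by
  rw [← Units.coeHom_apply (decProd _ _ _), map_decProd]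
  refine decProd_congr fun k h1 h2 => ?_
  change R.phiBar b (f N (2 * k : ℕ)) * R.phi b (f N (2 * k - 1 : ℕ)) *
    R.phi b (pre N (2 * N + 1) - pre N (2 * k)) = _
  rw [← g_natCast (by omega)]
  push_cast [Nat.cast_sub (show 1 ≤ 2 * k by omega)]; rfl

lemma val_gaussTail : ((hb.dilogSystem R).gaussTail 1 : H →L[ℂ] H) = R.gaussEven := by
  rw [DilogSystem.gaussTail, ← Units.coeHom_apply (decProd _ _ _), map_decProd]
  refine decProd_congr fun k _ _ => ?_
  change R.gauss 1 (f N (2 * k : ℕ)) = _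
  push_cast; rfl

lemma val_conj :
    (((decProd 2 (N + 1) (hb.dilogSystem R).wFactor)⁻¹ * (hb.dilogSystem R).evolution *
      decProd 2 (N + 1) (hb.dilogSystem R).wFactor : (H →L[ℂ] H)ˣ) : H →L[ℂ] H) =
      R.UlcTilde b := by
  rw [Units.val_mul, Units.val_mul, hb.val_evolution R, ← Ring.inverse_unit,
    hb.val_decProd_wFactor R]
  rfl

theorem isUnit_W : IsUnit (R.W b) := ⟨_, hb.val_decProd_wFactor R⟩

theorem UlcTilde_eq (hN : 1 < N) : R.UlcTilde b =
    (zeta b * exp (I * Real.pi / 6)) ^ (-(N : ℤ)) •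
      ((decProd 2 N fun k => R.phiBar b (g N (2 * k - 1) (2 * N - 1))) *
        R.phiBar b (g N 2 (2 * N - 1)) * R.phi b (g N (2 * N - 1) (2 * N + 1)) *
        R.phiBar b (f N 2) * R.gaussEven * (R.G : H →L[ℂ] H)) := by
  have c1 : ((2 * N - 1 : ℕ) : ℤ) = 2 * N - 1 := by
    push_cast [Nat.cast_sub (show 1 ≤ 2 * N by omega)]; rfl
  have e1 : R.phiBar b (g N 2 (2 * N - 1)) = R.phiBar b (pre N (2 * N - 1) - pre N 2) := by
    rw [← g_natCast (by omega), c1]; rfl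
  have e2 : R.phi b (g N (2 * N - 1) (2 * N + 1)) =
      R.phi b (pre N (2 * N + 1) - pre N (2 * N - 1)) := by
    rw [← g_natCast (by omega), c1]; push_cast; rfl
  have e3 : (decProd 2 N fun k => R.phiBar b (g N (2 * k - 1) (2 * N - 1))) =
      ((decProd 2 N fun k => ((hb.dilogSystem R).φ (pre N (2 * N - 1) - pre N (2 * k - 1)))⁻¹ :
        (H →L[ℂ] H)ˣ) : H →L[ℂ] H) := by
    rw [← Units.coeHom_apply (decProd _ _ _), map_decProd]
    refine decProd_congr fun k h1 h2 => ?_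
    change _ = R.phiBar b (pre N (2 * N - 1) - pre N (2 * k - 1))
    rw [← g_natCast (by omega), c1]
    push_cast [Nat.cast_sub (show 1 ≤ 2 * k by omega)]; rfl
  rw [e1, e2, e3, ← hb.val_conj R, DilogSystem.conj_evolution_two _ hN, Units.val_mul,
    ← hb.val_gaussTail R, ← constUnit_pow_mul]
  refine congrArg _ ?_
  simp only [Units.val_mul, ← mul_assoc]
  rfl

theorem UlcTilde_pow (hN : 1 < N) : R.UlcTilde b ^ N =
    (zeta b * exp (I * Real.pi / 6)) ^ (1 - (N : ℤ) ^ 2) •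
      (R.phi b (g N 2 (2 * N + 1)) * R.gauss (-1) (f N 2) *
        (R.gaussEven * (R.G : H →L[ℂ] H)) ^ N) := by
  have e1 : R.phi b (g N 2 (2 * N + 1)) = R.phi b (pre N (2 * N + 1) - pre N 2) := by
    rw [← g_natCast (by omega)]; push_cast; rfl
  have e2 : (1 - (N : ℤ) ^ 2) = -((N * N - 1 : ℕ) : ℤ) := by
    rw [Nat.cast_sub (by nlinarith)]; push_cast; ring
  rw [e1, e2, ← hb.val_conj R, ← Units.val_pow_eq_pow_val, DilogSystem.conj_evolution_pow _ hN,
    Units.val_mul, ← hb.val_gaussTail R, ← constUnit_pow_mul]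
  refine congrArg _ ?_
  rw [Units.val_mul, Units.val_mul, Units.val_pow_eq_pow_val, Units.val_mul]
  rfl

end IsReduced


end Liouville

end

theorem mainTheorem3 {H : Type*} [NormedAddCommGroup H] [InnerProductSpace ℂ H] [CompleteSpace H]
    (N : ℕ) (hN : 1 < N) (b : ℂ) (hb : b.re ≠ 0) (hb' : b.im = 0 ∨ ‖b‖ = 1)
    (R : Liouville.Realization N H) :
    IsUnit (R.W b) ∧
    R.UlcTilde b =
      (Liouville.zeta b * Complex.exp (Complex.I * Real.pi / 6)) ^ (-(N : ℤ)) •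
        ((Liouville.decProd 2 N fun k =>
            R.phiBar b (Liouville.g N (2 * k - 1) (2 * N - 1))) *
          R.phiBar b (Liouville.g N 2 (2 * N - 1)) *
          R.phi b (Liouville.g N (2 * N - 1) (2 * N + 1)) *
          R.phiBar b (Liouville.f N 2) *
          R.gaussEven * (R.G : H →L[ℂ] H)) ∧
    R.UlcTilde b ^ N =
      (Liouville.zeta b * Complex.exp (Complex.I * Real.pi / 6)) ^ (1 - (N : ℤ) ^ 2) •
        (R.phi b (Liouville.g N 2 (2 * N + 1)) *
          R.gauss (-1) (Liouville.f N 2) *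
          (R.gaussEven * (R.G : H →L[ℂ] H)) ^ N) := by
  have : NeZero N := ⟨by omega⟩
  -- The operators depend on b only through `qdilog b` and the scalar only through `zeta b`, so b
  -- may be replaced by a reduced parameter.
  obtain ⟨c, hc, hq, hz⟩ := Liouville.exists_isReduced hb hb'
  have h1 : ∀ v, R.phi b v = R.phi c v := fun v => by
    rw [Liouville.Realization.phi, Liouville.Realization.phi, hq]
  have h2 : ∀ v, R.phiBar b v = R.phiBar c v := fun v => by
    rw [Liouville.Realization.phiBar, Liouville.Realization.phiBar, hq]
  have h3 : R.W b = R.W c := by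
    simp only [Liouville.Realization.W, h1, h2]
  have h4 : R.UlcTilde b = R.UlcTilde c := by
    simp only [Liouville.Realization.UlcTilde, Liouville.Realization.Ulc, h3, h1]
  simp only [h1, h2, h3, h4, ← hz]
  exact ⟨hc.isUnit_W R, hc.UlcTilde_eq R hN, hc.UlcTilde_pow R hN⟩
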